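/- **Higher regularity in time of peridynamic evolutions.** Let $d\in\{2,3\}$ and let $D\subset\mathbb R^d$ be a bounded open set with $C^1$ boundary. Let $W=H^2(D;\mathbb R^d)\cap H^1_0(D;\mathbb R^d)$ with the $H^2$ norm $\|\cdot\|_2$; elements of $W$ are extended by $0$ outside $D$. For $0<\epsilon<1$ let $H_\epsilon(x)$ be the ball of radius $\epsilon$ around $x$, let $\omega_d$ be the volume of the unit ball of $\mathbb R^d$, and define $$S(y,x;u)=\frac{u(y)-u(x)}{|y-x|}\cdot\frac{y-x}{|y-x|},\qquad W^\epsilon(S,y-x)=\omega(x)\omega(y)\frac{J(|y-x|/\epsilon)}{\epsilon|y-x|}f(|y-x|S^2),$$ $$-\nabla PD^\epsilon(u)(x)=\frac{2}{\epsilon^d\omega_d}\int_{H_\epsilon(x)}\partial_SW^\epsilon(S(y,x;u),y-x)\frac{y-x}{|y-x|}\,dy .$$ Here: * $J$ is measurable, $0\le J\le M$ on $[0,1)$ for some $M<\infty$, and $J=0$ on $[1,\infty)$; * $f:[0,\infty)\to\mathbb R$ is smooth and concave, $f>0$ on $(0,\infty)$, $f(r)/r\to f'(0)$ as $r\to0^+$,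 $f$ has a finite limit at infinity, and the derivatives of order $1,2,3,4$ of $r\mapsto f(r^2)$ are bounded on $\mathbb R$; * $\omega:\mathbb R^d\to[0,1]$ is continuous, $\omega=0$ on $\partial D$, $\omega=1$ at the points of $D$ whose distance from $\partial D$ is at least $\epsilon$, and for every $|\xi|<1$ the function $\bar\omega_\xi(x)=\omega(x)\omega(x+\epsilon\xi)$ is $C^2$ in $D$ with $|\nabla\bar\omega_\xi|\le C_{\omega_1}$ and $|\nabla^2\bar\omega_\xi|\le C_{\omega_2}$ in $D$. Then there is a constant $C>0$, depending only on $d$, $D$, $J$, $f$, $C_{\omega_1}$ and $C_{\omega_2}$, such that the following holds for all $\epsilon\in(0,1)$, all such $\omega$, all $T>0$ and $I_0=(-T,T)$. Let $u_0,v_0\in W$, let $b:I_0\to W$ be continuous with $\sup_{t\in I_0}\|b(t)\|_2<\infty$, and suppose further that $\dot b(t)$ exists in $W$ and is continuous in $t\in I_0$, with $\sup_{t\in I_0}\|\dot b(t)\|_2<\infty$. Let $u$ be the solution of the peridynamic equation with these data, that is, $(u,v)\in C^1(I_0;W\times W)$ and $$\dot u(t)=v(t),\quad \dot v(t)=-\nabla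 PD^\epsilon(u(t))+b(t)\quad(t\in I_0),\qquad u(0)=u_0,\ v(0)=v_0 .$$ Then $u\in C^3(I_0;W)$, the suprema below are finite, and for all $t\in I_0$ $$\|\partial^3_{ttt}u(t)\|_2\le\frac{C\bigl(1+\sup_{s\in I_0}\|u(s)\|_2+\sup_{s\in I_0}\|u(s)\|_2^2\bigr)}{\epsilon^3}\,\sup_{s\in I_0}\|\partial_tu(s)\|_2+\|\dot b(t)\|_2 .$$ -/

import Mathlib

open MeasureTheory Set Filter Topology

noncomputable section

namespace Peridynamics

/-- Euclidean `d`-space. -/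
abbrev E (d : ℕ) : Type := EuclideanSpace ℝ (Fin d)

/-! ### Domains with `C¹` boundary -/

/-- Near each boundary point, `D` is the positivity set of a `C¹` function whose derivative does
not vanish at that point. -/
def HasC1Boundary {d : ℕ} (D : Set (E d)) : Prop :=
  ∀ p ∈ frontier D, ∃ U : Set (E d), IsOpen U ∧ p ∈ U ∧ ∃ φ : E d → ℝ,
    ContDiffOn ℝ 1 φ U ∧ φ p = 0 ∧ fderiv ℝ φ p ≠ 0 ∧ ∀ x ∈ U, (x ∈ D ↔ 0 < φ x)

/-! ### The space `W = H²(D; ℝᵈ) ∩ H¹₀(D; ℝᵈ)` -/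

/-- Smooth functions whose support is a compact subset of `D`. -/
def IsTest {d : ℕ} {F : Type*} [NormedAddCommGroup F] [NormedSpace ℝ F]
    (D : Set (E d)) (φ : E d → F) : Prop :=
  ContDiff ℝ ((⊤ : ℕ∞) : WithTop ℕ∞) φ ∧ HasCompactSupport φ ∧ tsupport φ ⊆ D

/-- The partial derivative `∂ⱼ φ`. -/
def partialDeriv {d : ℕ} {F : Type*} [NormedAddCommGroup F] [NormedSpace ℝ F]
    (j : Fin d) (φ : E d → F) (x : E d) : F :=
  fderiv ℝ φ x (EuclideanSpace.single j 1)

/-- `L²(D; ℝ^ι)`, where `ℝ^ι` carries the Euclidean norm. -/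
abbrev L2 {d : ℕ} (D : Set (E d)) (ι : Type) [Fintype ι] : Type :=
  Lp (EuclideanSpace ℝ ι) 2 (volume.restrict D)

/-- `g` is the weak partial derivative `∂ⱼ u` in `D`. -/
def HasWeakPartial {d : ℕ} (D : Set (E d)) (j : Fin d) (u g : E d → ℝ) : Prop :=
  ∀ φ : E d → ℝ, IsTest D φ →
    ∫ x in D, u x * partialDeriv j φ x = -∫ x in D, g x * φ x

/-- The subspace `H¹₀(D; ℝᵈ)`, given by the pairs `(u, ∇u)`, where `(∇u)_{ij} = ∂ⱼ uᵢ`: the closure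
in the `H¹` norm of the space of test functions. -/
def H10 {d : ℕ} (D : Set (E d)) : Submodule ℝ (L2 D (Fin d) × L2 D (Fin d × Fin d)) :=
  (Submodule.span ℝ {p : L2 D (Fin d) × L2 D (Fin d × Fin d) | ∃ Φ : E d → E d, IsTest D Φ ∧
    (∀ᵐ x ∂(volume.restrict D), p.1 x = Φ x) ∧
    (∀ᵐ x ∂(volume.restrict D), ∀ i j, p.2 x (i, j) = partialDeriv j Φ x i)}).topologicalClosure

/-- Triples `(u, G, H)` of square integrable fields of vectors, matrices and 3-tensors, with norm
`(‖u‖² + ‖G‖² + ‖H‖²)^{1/2}`. -/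
abbrev Triples {d : ℕ} (D : Set (E d)) : Type :=
  WithLp 2 (L2 D (Fin d) × WithLp 2 (L2 D (Fin d × Fin d) × L2 D (Fin d × Fin d × Fin d)))

theorem integrable_component_mul {d : ℕ} {D : Set (E d)} {ι : Type} [Fintype ι] (g : L2 D ι)
    (i : ι) {ψ : E d → ℝ} (hψ : Continuous ψ) (hc : HasCompactSupport ψ) :
    Integrable (fun x => g x i * ψ x) (volume.restrict D) := by
  have h1 : MemLp (fun x => g x i) 2 (volume.restrict D) :=
    (EuclideanSpace.proj (𝕜 := ℝ) i).comp_memLp' (Lp.memLp g)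
  have h2 : MemLp ψ 2 (volume.restrict D) := hψ.memLp_of_hasCompactSupport hc
  exact h1.integrable_mul h2

theorem IsTest.continuous_partialDeriv {d : ℕ} {D : Set (E d)} {φ : E d → ℝ} (h : IsTest D φ)
    (j : Fin d) : Continuous (partialDeriv j φ) :=
  (h.1.continuous_fderiv (by simp)).clm_apply continuous_const

theorem IsTest.hasCompactSupport_partialDeriv {d : ℕ} {D : Set (E d)} {φ : E d → ℝ}
    (h : IsTest D φ) (j : Fin d) : HasCompactSupport (partialDeriv j φ) :=
  (h.2.1.fderiv (𝕜 := ℝ)).comp_left (g := fun L : E d →L[ℝ] ℝ => L (EuclideanSpace.single j 1))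
    (by simp)

theorem HasWeakPartial.zero_L2 {d : ℕ} {D : Set (E d)} {ι κ : Type} [Fintype ι] [Fintype κ]
    (j : Fin d) (i : ι) (k : κ) :
    HasWeakPartial D j (fun x => (0 : L2 D ι) x i) (fun x => (0 : L2 D κ) x k) := by
  intro φ _
  rw [integral_eq_zero_of_ae, integral_eq_zero_of_ae, neg_zero]
  · filter_upwards [Lp.coeFn_zero (EuclideanSpace ℝ κ) 2 (volume.restrict D)] with x hx
    rw [hx, Pi.zero_apply, PiLp.zero_apply, zero_mul, Pi.zero_apply]
  · filter_upwards [Lp.coeFn_zero (EuclideanSpace ℝ ι) 2 (volume.restrict D)] with x hx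
    rw [hx, Pi.zero_apply, PiLp.zero_apply, zero_mul, Pi.zero_apply]

theorem HasWeakPartial.add_L2 {d : ℕ} {D : Set (E d)} {ι κ : Type} [Fintype ι] [Fintype κ]
    {j : Fin d} {i : ι} {k : κ} {u u' : L2 D ι} {g g' : L2 D κ}
    (h : HasWeakPartial D j (fun x => u x i) (fun x => g x k))
    (h' : HasWeakPartial D j (fun x => u' x i) (fun x => g' x k)) :
    HasWeakPartial D j (fun x => (u + u') x i) (fun x => (g + g') x k) := by
  intro φ hφ
  have e1 : ∫ x in D, (u + u') x i * partialDeriv j φ x =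
      ∫ x in D, (u x i * partialDeriv j φ x + u' x i * partialDeriv j φ x) := by
    apply integral_congr_ae
    filter_upwards [Lp.coeFn_add u u'] with x hx
    rw [hx, Pi.add_apply, PiLp.add_apply, add_mul]
  have e2 : ∫ x in D, (g + g') x k * φ x = ∫ x in D, (g x k * φ x + g' x k * φ x) := by
    apply integral_congr_ae
    filter_upwards [Lp.coeFn_add g g'] with x hx
    rw [hx, Pi.add_apply, PiLp.add_apply, add_mul]
  have c := hφ.continuous_partialDeriv j
  have s := hφ.hasCompactSupport_partialDeriv j
  rw [e1, e2, integral_add (integrable_component_mul u i c s) (integrable_component_mul u' i c s),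
    integral_add (integrable_component_mul g k hφ.1.continuous hφ.2.1)
      (integrable_component_mul g' k hφ.1.continuous hφ.2.1), h φ hφ, h' φ hφ]
  ring

theorem HasWeakPartial.smul_L2 {d : ℕ} {D : Set (E d)} {ι κ : Type} [Fintype ι] [Fintype κ]
    {j : Fin d} {i : ι} {k : κ} {u : L2 D ι} {g : L2 D κ} (c : ℝ)
    (h : HasWeakPartial D j (fun x => u x i) (fun x => g x k)) :
    HasWeakPartial D j (fun x => (c • u) x i) (fun x => (c • g) x k) := by
  intro φ hφ
  have e1 : ∫ x in D, (c • u) x i * partialDeriv j φ x =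
      ∫ x in D, c * (u x i * partialDeriv j φ x) := by
    apply integral_congr_ae
    filter_upwards [Lp.coeFn_smul c u] with x hx
    rw [hx, Pi.smul_apply, PiLp.smul_apply, smul_eq_mul, mul_assoc]
  have e2 : ∫ x in D, (c • g) x k * φ x = ∫ x in D, c * (g x k * φ x) := by
    apply integral_congr_ae
    filter_upwards [Lp.coeFn_smul c g] with x hx
    rw [hx, Pi.smul_apply, PiLp.smul_apply, smul_eq_mul, mul_assoc]
  rw [e1, e2, integral_const_mul, integral_const_mul, h φ hφ]
  ring

/-- The space `W = H²(D; ℝᵈ) ∩ H¹₀(D; ℝᵈ)` with the `H²` norm. An element is the triple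
`(u, ∇u, ∇²u)` of a function and its weak derivatives of first and second order,
`(∇u)_{ij} = ∂ⱼ uᵢ` and `(∇²u)_{ijk} = ∂ₖ ∂ⱼ uᵢ`; it is determined by `u`. -/
def W {d : ℕ} (D : Set (E d)) : Submodule ℝ (Triples D) where
  carrier := {w |
    (∀ i j, HasWeakPartial D j (fun x => w.fst x i) (fun x => w.snd.fst x (i, j))) ∧
    (∀ i j k, HasWeakPartial D k (fun x => w.snd.fst x (i, j)) (fun x => w.snd.snd x (i, j, k))) ∧
    (w.fst, w.snd.fst) ∈ H10 D}
  zero_mem' := ⟨fun _ j => HasWeakPartial.zero_L2 j _ _, fun _ _ k => HasWeakPartial.zero_L2 k _ _,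
    (H10 D).zero_mem⟩
  add_mem' := fun h h' => ⟨fun i j => (h.1 i j).add_L2 (h'.1 i j),
    fun i j k => (h.2.1 i j k).add_L2 (h'.2.1 i j k), (H10 D).add_mem h.2.2 h'.2.2⟩
  smul_mem' := fun c _ h => ⟨fun i j => (h.1 i j).smul_L2 c, fun i j k => (h.2.1 i j k).smul_L2 c,
    (H10 D).smul_mem c h.2.2⟩

/-- The function `u : D → ℝᵈ` underlying an element of `W`, extended by `0` outside `D`. -/
def W.toFun {d : ℕ} {D : Set (E d)} (w : W D) : E d → E d :=
  D.indicator fun x => (w : Triples D).fst x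

/-! ### The peridynamic force -/

/-- The linearized strain `S(y, x; u)`. -/
def strain {d : ℕ} (u : E d → E d) (y x : E d) : ℝ :=
  inner ℝ (‖y - x‖⁻¹ • (u y - u x)) (‖y - x‖⁻¹ • (y - x))

/-- The two point potential `W^ε(S, y - x) = ω(x) ω(y) J(|y - x|/ε) / (ε |y - x|) f(|y - x| S²)`. -/
def pairPotential {d : ℕ} (ε : ℝ) (J f : ℝ → ℝ) (ω : E d → ℝ) (x y : E d) (S : ℝ) : ℝ :=
  ω x * ω y * (J (‖y - x‖ / ε) / (ε * ‖y - x‖)) * f (‖y - x‖ * S ^ 2)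

/-- The peridynamic force
`-∇PD^ε(u)(x) = 2 / (ε^d ω_d) ∫_{H_ε(x)} ∂_S W^ε(S(y, x; u), y - x) (y - x)/|y - x| dy`,
where `ω_d` is the volume of the unit ball. -/
def force {d : ℕ} (ε : ℝ) (J f : ℝ → ℝ) (ω : E d → ℝ) (u : E d → E d) (x : E d) : E d :=
  (2 / (ε ^ d * volume.real (Metric.ball (0 : E d) 1))) •
    ∫ y in Metric.ball x ε,
      deriv (pairPotential ε J f ω x y) (strain u y x) • (‖y - x‖⁻¹ • (y - x))

/-- Assumptions on `J`: it is measurable and bounded, nonnegative on `[0, 1)` and zero on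
`[1, ∞)`. -/
structure IsInfluenceFunction (J : ℝ → ℝ) : Prop where
  measurable : Measurable J
  bounded : ∃ M : ℝ, ∀ r, 0 ≤ r → r < 1 → 0 ≤ J r ∧ J r ≤ M
  eq_zero : ∀ r, 1 ≤ r → J r = 0

/-- Assumptions on `f : [0, ∞) → ℝ`: it is smooth, positive and concave, with
`f(r)/r → f'(0)` as `r → 0+` (so that `f(0) = 0`) and a finite limit at infinity, and the
derivatives of order one to four of `r ↦ f(r²)` are bounded. -/
structure IsBondFunction (f : ℝ → ℝ) : Prop where
  smooth : ContDiffOn ℝ ((⊤ : ℕ∞) : WithTop ℕ∞) f (Ici 0)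
  pos : ∀ r, 0 < r → 0 < f r
  concave : ConcaveOn ℝ (Ici 0) f
  tendsto_zero : Tendsto (fun r => f r / r) (𝓝[>] 0) (𝓝 (derivWithin f (Ici 0) 0))
  tendsto_infty : ∃ f_infty : ℝ, Tendsto f atTop (𝓝 f_infty)
  bounded_derivs : ∀ k : ℕ, 1 ≤ k → k ≤ 4 →
    ∃ K : ℝ, ∀ r : ℝ, |iteratedDeriv k (fun s => f (s ^ 2)) r| ≤ K

/-- Assumptions on the boundary function `ω`: it is continuous with values in `[0, 1]`, equal to
`1` at the points of `D` of distance at least `ε` from `∂D` and to `0` on `∂D`, and the functions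
`x ↦ ω(x) ω(x + ε ξ)`, `|ξ| < 1`, are twice continuously differentiable in `D`, with first and
second derivatives bounded by `C₁` and `C₂`. The values of `ω` outside the closure of `D` are not
prescribed; in particular `ω` may vanish there. -/
structure IsBoundaryFunction {d : ℕ} (D : Set (E d)) (ε C₁ C₂ : ℝ) (ω : E d → ℝ) : Prop where
  continuous : Continuous ω
  nonneg : ∀ x, 0 ≤ ω x
  le_one : ∀ x, ω x ≤ 1
  eq_one : ∀ x ∈ D, ε ≤ Metric.infDist x (frontier D) → ω x = 1
  eq_zero : ∀ x ∈ frontier D, ω x = 0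
  contDiffOn : ∀ ξ : E d, ‖ξ‖ < 1 → ContDiffOn ℝ 2 (fun x => ω x * ω (x + ε • ξ)) D
  bound_one : ∀ ξ : E d, ‖ξ‖ < 1 → ∀ x ∈ D, ‖fderiv ℝ (fun x => ω x * ω (x + ε • ξ)) x‖ ≤ C₁
  bound_two : ∀ ξ : E d, ‖ξ‖ < 1 → ∀ x ∈ D,
    ‖iteratedFDeriv ℝ 2 (fun x => ω x * ω (x + ε • ξ)) x‖ ≤ C₂

/-! ### The evolution -/

/-- `y = (u, v) ∈ C¹(I₀; W × W)`, `I₀ = (-T, T)`, solves `u' = v`, `v' = -∇PD^ε(u) + b(t)` with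
`u(0) = u₀`, `v(0) = v₀`. Derivatives in time are those of `W`-valued functions, and the second
equation holds as an equality of functions almost everywhere in `D`, for each `t`. -/
structure IsSolution {d : ℕ} (D : Set (E d)) (ε : ℝ) (J f : ℝ → ℝ) (ω : E d → ℝ) (T : ℝ)
    (b : ℝ → W D) (u₀ v₀ : W D) (u v : ℝ → W D) : Prop where
  contDiffOn : ContDiffOn ℝ 1 (fun t => (u t, v t)) (Ioo (-T) T)
  deriv_u : ∀ t ∈ Ioo (-T) T, deriv u t = v t
  deriv_v : ∀ t ∈ Ioo (-T) T, ∀ᵐ x ∂(volume.restrict D),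
    W.toFun (deriv v t) x = force ε J f ω (W.toFun (u t)) x + W.toFun (b t) x
  init_u : u 0 = u₀
  init_v : v 0 = v₀

end Peridynamics

end

/-! The force at `w` is an integral over bonds ξ in the unit ball. Write h = εξ, r = |h|, e = ξ/|ξ|
and let G be the derivative of s ↦ f(s²). Up to a coefficient of size r^{-1/2}/ε, a bond contributes
the function β(x) G(r^{-1/2} a(x)), where a(x) = e·(w(x+h) − w(x)) and β(x) = ω(x) ω(x+h).
Everything rests on estimating this function in H²(D) for one bond at a time, with bounds that are
integrable in ξ.

Elements of W are bounded, have gradients in L⁴ and are Hölder continuous with exponent 1/4.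
Boundedness comes from Kato's inequality tested with a regularized fundamental solution, which is
square integrable because d ≤ 3 (`W.exists_sup_bound`). Integrating ∫ |∂ⱼu|⁴ by parts gives ‖∂ⱼu‖₄²
≤ 3 ‖u‖_∞ ‖∂ⱼ²u‖₂ (`W.lpBd_four_c1`), and Morrey's inequality gives the Hölder bound
(`W.exists_holder_bound`). The quadratic gradient term in the second derivatives of G(r^{-1/2} a) is
therefore in L². Since w is extended by zero, ∇a may jump where x + h crosses ∂D; the weight β
vanishes there, so the product still has weak second derivatives in D
(`WeakD.weight_mul_of_frontier`, `weakD_jet1`).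

For two elements of W, up to three derivatives of s ↦ G(r^{-1/2} s) cost r^{-3/2} and the Hölder
bound for the difference of the increments regains r^{1/4}, which leaves r^{-5/4}
(`exists_slice_lipschitz`). Together with the coefficient the singularity is ε^{-1} r^{-7/4} ≤
ε^{-3} |ξ|^{-7/4}, which is integrable for d ≥ 2. Summation over bonds yields the Lipschitz estimate
for the force with factor C(1 + M + M²)/ε³ on the ball of radius M (`exists_force_lipschitz`).

That the force lies in W is not deduced from these estimates: along a solution it equals v̇ − b. Its
weak derivatives are identified with the superposition of those of the bonds by testing
(`isBondIntegral_compJet`), and norms are bounded by duality (`norm_le_of_isBondIntegral`).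

In time, the contributions of bonds longer than a fixed length are strictly differentiable along u,
uniformly in the bond, while the difference quotients of short bonds obey the Lipschitz bound and
carry little mass. Hence the difference quotients of the force are Cauchy in the complete space W,
and the force is strictly differentiable along u (`exists_hasStrictDerivAt_force`), which also makes
its derivative continuous. So u is C³, the third derivative is that of the force plus ḃ, and the
Lipschitz constant times ‖u̇‖ bounds the former.

The suprema are finite because G is bounded: the force is bounded in L∞ independently of u, so two
integrations bound u in L∞ on I₀. Under such a bound the interpolation inequality makes the force
grow only linearly in ‖u‖₂ (`exists_force_growth`), and Gronwall's inequality applies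
(`exists_norm_le_of_force`). -/

noncomputable section

open scoped ENNReal NNReal

namespace Peridynamics

/-! ### Quantitative `Lᵖ` bounds -/

/-- `f` is measurable with `‖f‖_p ≤ c`. -/
def LpBd {α : Type*} [MeasurableSpace α] (μ : Measure α) (p : ℝ≥0∞) (f : α → ℝ) (c : ℝ) : Prop :=
  AEStronglyMeasurable f μ ∧ eLpNorm f p μ ≤ ENNReal.ofReal c

section LpBd

variable {α : Type*} [MeasurableSpace α] {μ : Measure α} {p q r : ℝ≥0∞} {f g : α → ℝ} {c c' : ℝ}

theorem LpBd.memLp (h : LpBd μ p f c) : MemLp f p μ := ⟨h.1, h.2.trans_lt ENNReal.ofReal_lt_top⟩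

theorem LpBd.mono (h : LpBd μ p f c) (hc : c ≤ c') : LpBd μ p f c' :=
  ⟨h.1, h.2.trans (ENNReal.ofReal_le_ofReal hc)⟩

theorem LpBd.congr (h : LpBd μ p f c) (hfg : f =ᵐ[μ] g) : LpBd μ p g c :=
  ⟨h.1.congr hfg, (eLpNorm_congr_ae hfg).symm.trans_le h.2⟩

theorem LpBd.zero : LpBd μ p (fun _ => 0) c :=
  ⟨aestronglyMeasurable_const, by simp⟩

theorem LpBd.add (hp : 1 ≤ p) (hc : 0 ≤ c) (hc' : 0 ≤ c') (hf : LpBd μ p f c)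
    (hg : LpBd μ p g c') : LpBd μ p (fun x => f x + g x) (c + c') :=
  ⟨hf.1.add hg.1, (eLpNorm_add_le hf.1 hg.1 hp).trans
    ((add_le_add hf.2 hg.2).trans (ENNReal.ofReal_add hc hc').ge)⟩

theorem LpBd.neg (hf : LpBd μ p f c) : LpBd μ p (fun x => -f x) c :=
  ⟨hf.1.neg, (eLpNorm_neg f p μ).trans_le hf.2⟩

theorem LpBd.sub (hp : 1 ≤ p) (hc : 0 ≤ c) (hc' : 0 ≤ c') (hf : LpBd μ p f c)
    (hg : LpBd μ p g c') : LpBd μ p (fun x => f x - g x) (c + c') := by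
  simpa only [sub_eq_add_neg] using hf.add hp hc hc' hg.neg

theorem LpBd.const_mul (k : ℝ) (hf : LpBd μ p f c) : LpBd μ p (fun x => k * f x) (|k| * c) := by
  refine ⟨hf.1.const_mul k, ?_⟩
  have := eLpNorm_const_smul_le (c := k) (f := f) (p := p) (μ := μ)
  rw [ENNReal.ofReal_mul (abs_nonneg k)]
  refine this.trans ?_
  rw [Real.enorm_eq_ofReal_abs]
  gcongr
  exact hf.2

theorem LpBd.mul [hpqr : p.HolderTriple q r] (hc : 0 ≤ c) (hf : LpBd μ p f c)
    (hg : LpBd μ q g c') : LpBd μ r (fun x => f x * g x) (c * c') := by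
  refine ⟨hf.1.mul hg.1, ?_⟩
  have := eLpNorm_smul_le_mul_eLpNorm (p := p) (q := q) (r := r) hg.1 hf.1
  rw [ENNReal.ofReal_mul hc]
  exact this.trans (mul_le_mul' hf.2 hg.2)

theorem LpBd.of_abs_le (hf : AEStronglyMeasurable f μ) (hg : LpBd μ p g c)
    (h : ∀ᵐ x ∂μ, |f x| ≤ |g x|) : LpBd μ p f c :=
  ⟨hf, (eLpNorm_mono_ae h).trans hg.2⟩

theorem LpBd.of_ae_bound (hf : AEStronglyMeasurable f μ) (h : ∀ᵐ x ∂μ, |f x| ≤ c) :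
    LpBd μ ⊤ f c :=
  ⟨hf, eLpNormEssSup_le_of_ae_bound h⟩

theorem LpBd.ae_le (hc : 0 ≤ c) (h : LpBd μ ⊤ f c) : ∀ᵐ x ∂μ, |f x| ≤ c := by
  have h2 := h.2
  rw [eLpNorm_exponent_top] at h2
  filter_upwards [enorm_ae_le_eLpNormEssSup f μ] with x hx
  have := hx.trans h2
  rwa [Real.enorm_eq_ofReal_abs, ENNReal.ofReal_le_ofReal_iff hc] at this

theorem LpBd.restrict (h : LpBd μ p f c) (s : Set α) : LpBd (μ.restrict s) p f c :=
  ⟨h.1.restrict, (eLpNorm_restrict_le f p μ s).trans h.2⟩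

theorem MemLp.lpBd (h : MemLp f p μ) : LpBd μ p f (eLpNorm f p μ).toReal :=
  ⟨h.1, (ENNReal.ofReal_toReal h.2.ne).ge⟩

theorem LpBd.nonneg_sum {ι : Type*} (s : Finset ι) {F : ι → α → ℝ} {C : ι → ℝ} (hp : 1 ≤ p)
    (hC : ∀ i, 0 ≤ C i) (h : ∀ i, LpBd μ p (F i) (C i)) :
    LpBd μ p (fun x => ∑ i ∈ s, F i x) (∑ i ∈ s, C i) := by
  classical
  induction s using Finset.induction_on with
  | empty => simpa using LpBd.zero
  | insert a s ha ih =>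
    simp only [Finset.sum_insert ha]
    exact (h a).add hp (hC a) (Finset.sum_nonneg fun i _ => hC i) ih

/-- This is what places products of two first derivatives, known in L⁴, in L². -/
instance : ENNReal.HolderTriple 4 4 2 where
  inv_add_inv_eq_inv := by
    have h2 : (2 : ℝ≥0∞)⁻¹ = ENNReal.ofReal (1 / 2) := by
      rw [ENNReal.ofReal_div_of_pos two_pos]; simp
    have h4 : (4 : ℝ≥0∞)⁻¹ = ENNReal.ofReal (1 / 4) := by
      rw [ENNReal.ofReal_div_of_pos (by norm_num)]; simp
    rw [h2, h4, ← ENNReal.ofReal_add (by norm_num) (by norm_num)]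
    norm_num

theorem LpBd.pairing (hc : 0 ≤ c) (hc' : 0 ≤ c') (hf : LpBd μ 2 f c) (hg : LpBd μ 2 g c') :
    Integrable (fun x => f x * g x) μ ∧ ∫ x, |f x * g x| ∂μ ≤ c * c' ∧
      |∫ x, f x * g x ∂μ| ≤ c * c' := by
  have h : LpBd μ 1 (fun x => f x * g x) (c * c') := hf.mul (hpqr := inferInstance) hc hg
  have hi : Integrable (fun x => f x * g x) μ := memLp_one_iff_integrable.1 h.memLp
  have h1 : ∫ x, |f x * g x| ∂μ ≤ c * c' := by
    have h2 := h.2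
    rw [eLpNorm_one_eq_lintegral_enorm, ← ofReal_integral_norm_eq_lintegral_enorm hi,
      ENNReal.ofReal_le_ofReal_iff (by positivity)] at h2
    exact h2
  exact ⟨hi, h1, (abs_integral_le_integral_abs).trans h1⟩

theorem lpBd_two_iff (hc : 0 ≤ c) (hf : AEStronglyMeasurable f μ) :
    LpBd μ 2 f c ↔ Integrable (fun x => f x ^ 2) μ ∧ ∫ x, f x ^ 2 ∂μ ≤ c ^ 2 := by
  constructor
  · intro h
    have := h.pairing hc hc h
    simp only [← sq] at this
    exact ⟨this.1, (le_abs_self _).trans this.2.2⟩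
  · rintro ⟨h1, h2⟩
    refine ⟨hf, ?_⟩
    have hm : MemLp f 2 μ := (memLp_two_iff_integrable_sq hf).2 h1
    rw [hm.eLpNorm_eq_integral_rpow_norm (by simp) (by simp)]
    apply ENNReal.ofReal_le_ofReal
    have : ∫ x, ‖f x‖ ^ (2 : ℝ≥0∞).toReal ∂μ = ∫ x, f x ^ 2 ∂μ := by
      congr 1; ext x; simp
    rw [this]
    calc _ = √(∫ x, f x ^ 2 ∂μ) := by simp [Real.sqrt_eq_rpow]
      _ ≤ √(c ^ 2) := Real.sqrt_le_sqrt h2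
      _ = c := Real.sqrt_sq hc

end LpBd

/-! ### Pairs of functions with a bound on their size and on their difference -/

/-- `‖f‖_p, ‖g‖_p ≤ B` and `‖f - g‖_p ≤ A`. -/
structure PairBd {α : Type*} [MeasurableSpace α] (μ : Measure α) (p : ℝ≥0∞) (f g : α → ℝ)
    (B A : ℝ) : Prop where
  size_nonneg : 0 ≤ B
  diff_nonneg : 0 ≤ A
  left : LpBd μ p f B
  right : LpBd μ p g B
  diff : LpBd μ p (fun x => f x - g x) A

section PairBd

variable {α : Type*} [MeasurableSpace α] {μ : Measure α} {p q r : ℝ≥0∞} {f g f' g' : α → ℝ}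
  {B A B' A' : ℝ}

theorem PairBd.mono (h : PairBd μ p f g B A) (hB : B ≤ B') (hA : A ≤ A') :
    PairBd μ p f g B' A' :=
  ⟨h.1.trans hB, h.2.trans hA, h.3.mono hB, h.4.mono hB, h.5.mono hA⟩

theorem PairBd.const (h : LpBd μ p f B) (hB : 0 ≤ B) : PairBd μ p f f B 0 :=
  ⟨hB, le_rfl, h, h, by simpa using LpBd.zero⟩

theorem PairBd.add (hp : 1 ≤ p) (h : PairBd μ p f g B A) (h' : PairBd μ p f' g' B' A') :
    PairBd μ p (fun x => f x + f' x) (fun x => g x + g' x) (B + B') (A + A') :=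
  ⟨add_nonneg h.1 h'.1, add_nonneg h.2 h'.2, h.3.add hp h.1 h'.1 h'.3, h.4.add hp h.1 h'.1 h'.4,
    (h.5.add hp h.2 h'.2 h'.5).congr (.of_forall fun x => by ring)⟩

theorem PairBd.mul [hpqr : p.HolderTriple q r] (hr : 1 ≤ r) (h : PairBd μ p f g B A)
    (h' : PairBd μ q f' g' B' A') :
    PairBd μ r (fun x => f x * f' x) (fun x => g x * g' x) (B * B') (A * B' + B * A') :=
  ⟨mul_nonneg h.1 h'.1, add_nonneg (mul_nonneg h.2 h'.1) (mul_nonneg h.1 h'.2),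
    h.3.mul (hpqr := hpqr) h.1 h'.3, h.4.mul (hpqr := hpqr) h.1 h'.4,
    ((h.5.mul (hpqr := hpqr) h.2 h'.3).add hr (mul_nonneg h.2 h'.1) (mul_nonneg h.1 h'.2)
      (h.4.mul (hpqr := hpqr) h.1 h'.5)).congr (.of_forall fun x => by ring)⟩

theorem PairBd.comp {φ : ℝ → ℝ} {K L : ℝ} (hφ : Continuous φ) (hK : ∀ s, |φ s| ≤ K) (hL : 0 ≤ L)
    (hlip : ∀ s s', |φ s - φ s'| ≤ L * |s - s'|) (h : PairBd μ ⊤ f g B A) :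
    PairBd μ ⊤ (fun x => φ (f x)) (fun x => φ (g x)) K (L * A) := by
  refine ⟨(abs_nonneg _).trans (hK 0), mul_nonneg hL h.2,
    LpBd.of_ae_bound (hφ.comp_aestronglyMeasurable h.3.1) (.of_forall fun x => hK _),
    LpBd.of_ae_bound (hφ.comp_aestronglyMeasurable h.4.1) (.of_forall fun x => hK _),
    LpBd.of_ae_bound ((hφ.comp_aestronglyMeasurable h.3.1).sub
      (hφ.comp_aestronglyMeasurable h.4.1)) ?_⟩
  filter_upwards [h.5.ae_le h.2] with x hx
  exact (hlip _ _).trans (mul_le_mul_of_nonneg_left hx hL)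

end PairBd

/-! ### Families of curves, strictly differentiable uniformly in the parameter -/

/-- The curves `t ↦ f t i` in `Lᵖ` are strictly differentiable at `t₀` with derivatives `f' i`,
uniformly in `i`, and `f t₀ i`, `f' i` are bounded uniformly in `i`. -/
structure UnifStrictDeriv {ι α : Type*} [MeasurableSpace α] (μ : Measure α) (p : ℝ≥0∞)
    (f : ℝ → ι → α → ℝ) (f' : ι → α → ℝ) (t₀ : ℝ) : Prop where
  bounded : ∃ R, 0 ≤ R ∧ ∀ i, LpBd μ p (f t₀ i) R ∧ LpBd μ p (f' i) R
  strict : ∀ η > 0, ∃ δ > 0, ∀ t t', |t - t₀| < δ → |t' - t₀| < δ → ∀ i,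
    LpBd μ p (fun x => f t i x - f t' i x - (t - t') * f' i x) (η * |t - t'|)

section UnifStrictDeriv

variable {ι α : Type*} [MeasurableSpace α] {μ : Measure α} {p q r : ℝ≥0∞}
  {f g : ℝ → ι → α → ℝ} {f' g' : ι → α → ℝ} {t₀ : ℝ}

theorem UnifStrictDeriv.const {w : ι → α → ℝ} {R : ℝ} (hR : 0 ≤ R) (h : ∀ i, LpBd μ p (w i) R) :
    UnifStrictDeriv μ p (fun _ => w) (fun _ _ => 0) t₀ :=
  ⟨⟨R, hR, fun i => ⟨h i, LpBd.zero⟩⟩, fun η hη => ⟨1, one_pos, fun t t' _ _ i => by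
    simpa using LpBd.zero⟩⟩

theorem UnifStrictDeriv.add (hp : 1 ≤ p) (hf : UnifStrictDeriv μ p f f' t₀)
    (hg : UnifStrictDeriv μ p g g' t₀) :
    UnifStrictDeriv μ p (fun t i x => f t i x + g t i x) (fun i x => f' i x + g' i x) t₀ := by
  obtain ⟨R, hR, h⟩ := hf.1
  obtain ⟨R', hR', h'⟩ := hg.1
  refine ⟨⟨R + R', by positivity, fun i => ⟨(h i).1.add hp hR hR' (h' i).1,
    (h i).2.add hp hR hR' (h' i).2⟩⟩, fun η hη => ?_⟩
  obtain ⟨δ, hδ, H⟩ := hf.2 (η / 2) (by positivity)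
  obtain ⟨δ', hδ', H'⟩ := hg.2 (η / 2) (by positivity)
  refine ⟨min δ δ', by positivity, fun t t' ht ht' i => ?_⟩
  have h1 := H t t' (ht.trans_le (min_le_left _ _)) (ht'.trans_le (min_le_left _ _)) i
  have h2 := H' t t' (ht.trans_le (min_le_right _ _)) (ht'.trans_le (min_le_right _ _)) i
  exact ((h1.add hp (by positivity) (by positivity) h2).congr
    (.of_forall fun x => by ring)).mono (by linarith)

/-- Bounds near `t₀` that follow from strict differentiability. -/
theorem UnifStrictDeriv.lipschitz (hp : 1 ≤ p) (hf : UnifStrictDeriv μ p f f' t₀) :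
    ∃ R δ, 0 ≤ R ∧ 0 < δ ∧ δ ≤ 1 ∧ (∀ i, LpBd μ p (f' i) R) ∧
      (∀ t, |t - t₀| < δ → ∀ i, LpBd μ p (f t i) R) ∧
      ∀ t t', |t - t₀| < δ → |t' - t₀| < δ → ∀ i,
        LpBd μ p (fun x => f t i x - f t' i x) (R * |t - t'|) := by
  obtain ⟨R, hR, h⟩ := hf.1
  obtain ⟨δ, hδ, H⟩ := hf.2 1 one_pos
  have key : ∀ t t', |t - t₀| < δ → |t' - t₀| < δ → ∀ i,
        LpBd μ p (fun x => f t i x - f t' i x) ((1 + R) * |t - t'|) := fun t t' ht ht' i =>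
    (((H t t' ht ht' i).add hp (by positivity) (by positivity)
      ((h i).2.const_mul (t - t'))).congr (.of_forall fun x => by ring)).mono
        (le_of_eq (by ring))
  refine ⟨1 + R + R, min δ 1, by positivity, by positivity, min_le_right _ _,
    fun i => (h i).2.mono (by linarith), fun t ht i => ?_, fun t t' ht ht' i =>
    (key t t' (ht.trans_le (min_le_left _ _)) (ht'.trans_le (min_le_left _ _)) i).mono ?_⟩
  · have h1 := key t t₀ (ht.trans_le (min_le_left _ _)) (by simpa using hδ) i
    refine ((h1.add hp (by positivity) hR (h i).1).congr (.of_forall fun x => by ring)).mono ?_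
    have := ht.le.trans (min_le_right _ _)
    nlinarith
  · have := abs_nonneg (t - t')
    nlinarith

/-- The remainder splits as (remainder of f) g(t) + f(t') (remainder of g) + (t − t') [f' (g(t) −
g(t₀)) + (f(t') − f(t₀)) g'], and each of the four terms is small uniformly in the index. -/
theorem UnifStrictDeriv.mul [hpqr : p.HolderTriple q r] (hp : 1 ≤ p) (hq : 1 ≤ q) (hr : 1 ≤ r)
    (hf : UnifStrictDeriv μ p f f' t₀) (hg : UnifStrictDeriv μ q g g' t₀) :
    UnifStrictDeriv μ r (fun t i x => f t i x * g t i x)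
      (fun i x => f' i x * g t₀ i x + f t₀ i x * g' i x) t₀ := by
  obtain ⟨R, δ, hR, hδ, hδ1, hf', hfb, hfl⟩ := hf.lipschitz hp
  obtain ⟨S, ρ, hS, hρ, hρ1, hg', hgb, hgl⟩ := hg.lipschitz hq
  have hf0 := hfb t₀ (by simpa using hδ)
  have hg0 := hgb t₀ (by simpa using hρ)
  refine ⟨⟨R * S + R * S, by positivity, fun i => ⟨((hf0 i).mul (hpqr := hpqr) hR (hg0 i)).mono
    (by nlinarith [mul_nonneg hR hS]), ((hf' i).mul (hpqr := hpqr) hR (hg0 i)).add hr (by positivity)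
      (by positivity) ((hf0 i).mul (hpqr := hpqr) hR (hg' i))⟩⟩, fun η hη => ?_⟩
  -- The four errors are τS, Rτ, RSτ and RSτ, each times |t − t'|.
  set τ := η / (R + S + 2 * R * S + 1) with hτ
  have hτ0 : 0 < τ := by positivity
  obtain ⟨δ₂, hδ₂, H⟩ := hf.2 τ hτ0
  obtain ⟨ρ₂, hρ₂, H'⟩ := hg.2 τ hτ0
  refine ⟨min (min δ ρ) (min (min δ₂ ρ₂) τ), by positivity, fun t t' ht ht' i => ?_⟩
  simp only [lt_min_iff] at ht ht'
  have a1 := (H t t' ht.2.1.1 ht'.2.1.1 i).mul (hpqr := hpqr) (by positivity) (hgb t ht.1.2 i)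
  have a2 := (hf' i).mul (hpqr := hpqr) hR (hgl t t₀ ht.1.2 (by simpa using hρ) i)
  have a3 := (hfb t' ht'.1.1 i).mul (hpqr := hpqr) hR (H' t t' ht.2.1.2 ht'.2.1.2 i)
  have a4 := (hfl t' t₀ ht'.1.1 (by simpa using hδ) i).mul (hpqr := hpqr) (by positivity) (hg' i)
  have e := ((a1.add hr (by positivity) (by positivity) a3).add hr (by positivity) (by positivity)
    ((a2.add hr (by positivity) (by positivity) a4).const_mul (t - t')))
  refine (e.congr (.of_forall fun x => by ring)).mono ?_
  have h1 : |t - t₀| ≤ τ := ht.2.2.le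
  have h2 : |t' - t₀| ≤ τ := ht'.2.2.le
  have : η = τ * (R + S + 2 * R * S + 1) := by rw [hτ]; field_simp
  rw [this]
  have hT := abs_nonneg (t - t')
  have e1 : R * (S * |t - t₀|) ≤ R * S * τ := by
    rw [← mul_assoc]; exact mul_le_mul_of_nonneg_left h1 (by positivity)
  have e2 : R * |t' - t₀| * S ≤ R * S * τ := by
    rw [mul_right_comm]; exact mul_le_mul_of_nonneg_left h2 (by positivity)
  calc _ = (τ * S + R * τ + (R * (S * |t - t₀|) + R * |t' - t₀| * S)) * |t - t'| := by ring
    _ ≤ (τ * S + R * τ + (R * S * τ + R * S * τ)) * |t - t'| := by gcongr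
    _ ≤ _ := by
      gcongr
      nlinarith

/-- Taylor's formula is applied pointwise, which is why the curves are taken in L∞. Bounds on `φ''`
are needed only on compact sets since the values of the curves stay in a fixed interval; for the
profiles used later `φ''` can be the fifth derivative of s ↦ f(s²), on which no global bound is
assumed. -/
theorem UnifStrictDeriv.comp {φ φ' φ'' : ι → ℝ → ℝ} {K : ℝ}
    (hφ : ∀ i s, HasDerivAt (φ i) (φ' i s) s) (hφ' : ∀ i s, HasDerivAt (φ' i) (φ'' i s) s)
    (hK : ∀ i s, |φ i s| ≤ K) (hK' : ∀ i s, |φ' i s| ≤ K)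
    (hL : ∀ R, ∃ L, ∀ i s, |s| ≤ R → |φ'' i s| ≤ L)
    (hf : UnifStrictDeriv μ ⊤ f f' t₀) :
    UnifStrictDeriv μ ⊤ (fun t i x => φ i (f t i x)) (fun i x => φ' i (f t₀ i x) * f' i x) t₀ := by
  obtain ⟨R, δ, hR, hδ, hδ1, hf', hfb, hfl⟩ := hf.lipschitz le_top
  have hf0 := hfb t₀ (by simpa using hδ)
  have cφ : ∀ i, Continuous (φ i) := fun i =>
    continuous_iff_continuousAt.2 fun s => (hφ i s).continuousAt
  have cφ' : ∀ i, Continuous (φ' i) := fun i =>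
    continuous_iff_continuousAt.2 fun s => (hφ' i s).continuousAt
  have m' : ∀ i, AEStronglyMeasurable (fun x => φ' i (f t₀ i x) * f' i x) μ := fun i =>
    ((cφ' i).comp_aestronglyMeasurable (hf0 i).1).mul (hf' i).1
  rcases isEmpty_or_nonempty ι with hι | ⟨⟨i₀⟩⟩
  · exact ⟨⟨0, le_rfl, fun i => hι.elim i⟩, fun η _ => ⟨1, one_pos, fun _ _ _ _ i => hι.elim i⟩⟩
  have hK0 : 0 ≤ K := (abs_nonneg _).trans (hK i₀ 0)
  refine ⟨⟨K + K * R, by positivity, fun i => ⟨?_, ?_⟩⟩, fun η hη => ?_⟩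
  · exact (LpBd.of_ae_bound ((cφ i).comp_aestronglyMeasurable (hf0 i).1)
      (.of_forall fun x => hK i _)).mono (by nlinarith)
  · refine (LpBd.of_ae_bound (c := K * R) (m' i) ?_).mono (by nlinarith)
    filter_upwards [(hf' i).ae_le hR] with x hx
    rw [abs_mul]
    exact mul_le_mul (hK' i _) hx (abs_nonneg _) hK0
  obtain ⟨L, hL⟩ := hL R
  have hL0 : 0 ≤ L := (abs_nonneg _).trans (hL i₀ 0 (by simpa using hR))
  set τ := η / (K + L * R * R + 1) with hτ
  have hτ0 : 0 < τ := by positivity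
  obtain ⟨δ₂, hδ₂, H⟩ := hf.2 τ hτ0
  refine ⟨min δ (min δ₂ τ), by positivity, fun t t' ht ht' i => ?_⟩
  simp only [lt_min_iff] at ht ht'
  have d0 : |t₀ - t₀| < δ := by simpa using hδ
  refine LpBd.of_ae_bound ((((cφ i).comp_aestronglyMeasurable (hfb t ht.1 i).1).sub
    ((cφ i).comp_aestronglyMeasurable (hfb t' ht'.1 i).1)).sub ((m' i).const_mul _)) ?_
  filter_upwards [(hfb t ht.1 i).ae_le hR, (hfb t' ht'.1 i).ae_le hR, (hf0 i).ae_le hR,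
    (hfl t t₀ ht.1 d0 i).ae_le (by positivity), (hfl t' t₀ ht'.1 d0 i).ae_le (by positivity),
    (hfl t t' ht.1 ht'.1 i).ae_le (by positivity),
    (H t t' ht.2.1 ht'.2.1 i).ae_le (by positivity)] with x b1 b2 b0 l1 l2 l3 hs
  set a := f t i x
  set b := f t' i x
  set z := f t₀ i x
  have lip : ∀ s, |s| ≤ R → |s - z| ≤ R * τ → |φ' i s - φ' i z| ≤ L * (R * τ) := by
    intro s hs hsz
    have := Convex.norm_image_sub_le_of_norm_hasDerivWithin_le (f := φ' i) (f' := φ'' i)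
      (s := Icc (-R) R) (C := L) (fun y _ => (hφ' i y).hasDerivWithinAt)
      (fun y hy => hL i y (abs_le.2 hy)) (convex_Icc _ _) (abs_le.1 b0) (abs_le.1 hs)
    exact this.trans (mul_le_mul_of_nonneg_left hsz hL0)
  have l1' : |a - z| ≤ R * τ := l1.trans (mul_le_mul_of_nonneg_left ht.2.2.le hR)
  have l2' : |b - z| ≤ R * τ := l2.trans (mul_le_mul_of_nonneg_left ht'.2.2.le hR)
  -- Mean value inequality for s ↦ φ(s) − φ'(z) s, whose derivative is small near z, on the convex
  -- set of values that are both bounded by R and close to z.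
  have main : |φ i a - φ i b - φ' i z * (a - b)| ≤ L * (R * τ) * |a - b| := by
    have := Convex.norm_image_sub_le_of_norm_hasDerivWithin_le (f := fun s => φ i s - φ' i z * s)
      (f' := fun s => φ' i s - φ' i z * 1) (s := Icc (-R) R ∩ Icc (z - R * τ) (z + R * τ))
      (C := L * (R * τ))
      (fun y _ => ((hφ i y).sub ((hasDerivAt_id y).const_mul _)).hasDerivWithinAt)
      (fun y hy => by
        rw [mul_one]
        exact lip y (abs_le.2 hy.1) (abs_le.2 ⟨by linarith [hy.2.1], by linarith [hy.2.2]⟩))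
      ((convex_Icc _ _).inter (convex_Icc _ _)) (x := b) (y := a)
      ⟨abs_le.1 b2, by constructor <;> linarith [(abs_le.1 l2').1, (abs_le.1 l2').2]⟩
      ⟨abs_le.1 b1, by constructor <;> linarith [(abs_le.1 l1').1, (abs_le.1 l1').2]⟩
    rw [Real.norm_eq_abs, Real.norm_eq_abs] at this
    convert this using 2
    ring
  have e : φ i a - φ i b - (t - t') * (φ' i z * f' i x) =
      (φ i a - φ i b - φ' i z * (a - b)) + φ' i z * (a - b - (t - t') * f' i x) := by ring
  rw [e]
  refine (abs_add_le _ _).trans ?_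
  rw [abs_mul]
  have k1 : |φ' i z| * |a - b - (t - t') * f' i x| ≤ K * (τ * |t - t'|) :=
    mul_le_mul (hK' i _) hs (abs_nonneg _) hK0
  have k2 : L * (R * τ) * |a - b| ≤ L * (R * τ) * (R * |t - t'|) :=
    mul_le_mul_of_nonneg_left l3 (by positivity)
  have : η = τ * (K + L * R * R + 1) := by rw [hτ]; field_simp
  rw [this]
  nlinarith [abs_nonneg (t - t'), mul_nonneg hτ0.le (abs_nonneg (t - t'))]

end UnifStrictDeriv

end Peridynamics

end

/-! ### The space W: components, approximation by test functions, completeness -/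

noncomputable section

open scoped ENNReal NNReal

namespace Peridynamics

/-! ### Components of elements of `W`, extended by zero -/

variable {d : ℕ} {D : Set (E d)}

/-- The components `uᵢ`, extended by `0`. -/
def comp0 (w : W D) (i : Fin d) : E d → ℝ := D.indicator fun x => (w : Triples D).fst x i

/-- The components `∂ⱼ uᵢ`, extended by `0`. -/
def comp1 (w : W D) (i j : Fin d) : E d → ℝ :=
  D.indicator fun x => (w : Triples D).snd.fst x (i, j)

/-- The components `∂ₖ ∂ⱼ uᵢ`, extended by `0`. -/
def comp2 (w : W D) (i j k : Fin d) : E d → ℝ :=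
  D.indicator fun x => (w : Triples D).snd.snd x (i, j, k)

theorem W.toFun_apply (w : W D) (x : E d) (i : Fin d) : W.toFun w x i = comp0 w i x := by
  by_cases hx : x ∈ D <;> simp [W.toFun, comp0, hx]

theorem stronglyMeasurable_component {ι : Type} [Fintype ι] (hD : MeasurableSet D) (g : L2 D ι)
    (i : ι) : StronglyMeasurable (D.indicator fun x => g x i) := by
  refine StronglyMeasurable.indicator ?_ hD
  exact (EuclideanSpace.proj (𝕜 := ℝ) i).continuous.comp_stronglyMeasurable
    (Lp.stronglyMeasurable g)

theorem lpBd_component {ι : Type} [Fintype ι] (hD : MeasurableSet D) (g : L2 D ι) (i : ι) {B : ℝ}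
    (hB : ‖g‖ ≤ B) : LpBd volume 2 (D.indicator fun x => g x i) B := by
  refine ⟨(stronglyMeasurable_component hD g i).aestronglyMeasurable, ?_⟩
  rw [eLpNorm_indicator_eq_eLpNorm_restrict hD]
  refine le_trans (eLpNorm_mono (g := g) fun x => PiLp.norm_apply_le (g x) i) ?_
  rw [← ENNReal.ofReal_toReal (Lp.eLpNorm_ne_top g), ← Lp.norm_def]
  exact ENNReal.ofReal_le_ofReal hB

theorem W.stronglyMeasurable_c0 (hD : IsOpen D) (w : W D) (i : Fin d) :
    StronglyMeasurable (comp0 w i) := stronglyMeasurable_component hD.measurableSet _ _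

theorem W.norm_fst_le (w : W D) : ‖(w : Triples D).fst‖ ≤ ‖w‖ := WithLp.norm_fst_le _ _

theorem W.norm_snd_fst_le (w : W D) : ‖(w : Triples D).snd.fst‖ ≤ ‖w‖ :=
  (WithLp.norm_fst_le _ _).trans (WithLp.norm_snd_le _ _)

theorem W.norm_snd_snd_le (w : W D) : ‖(w : Triples D).snd.snd‖ ≤ ‖w‖ :=
  (WithLp.norm_snd_le _ _).trans (WithLp.norm_snd_le _ _)

theorem W.lpBd_c0 (hD : IsOpen D) (w : W D) (i : Fin d) : LpBd volume 2 (comp0 w i) ‖w‖ :=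
  lpBd_component hD.measurableSet _ _ (W.norm_fst_le w)

theorem W.lpBd_c1 (hD : IsOpen D) (w : W D) (i j : Fin d) : LpBd volume 2 (comp1 w i j) ‖w‖ :=
  lpBd_component hD.measurableSet _ _ (W.norm_snd_fst_le w)

theorem W.lpBd_c2 (hD : IsOpen D) (w : W D) (i j k : Fin d) : LpBd volume 2 (comp2 w i j k) ‖w‖ :=
  lpBd_component hD.measurableSet _ _ (W.norm_snd_snd_le w)

theorem component_sub {ι : Type} [Fintype ι] (hD : MeasurableSet D) (g g' : L2 D ι) (i : ι) :
    (D.indicator fun x => (g - g') x i) =ᵐ[volume]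
      fun x => D.indicator (fun x => g x i) x - D.indicator (fun x => g' x i) x := by
  filter_upwards [(ae_restrict_iff' hD).1 (Lp.coeFn_sub g g')] with x hx
  by_cases h : x ∈ D
  · simp only [indicator_of_mem h, hx h, Pi.sub_apply, PiLp.sub_apply]
  · simp [h]

theorem component_smul {ι : Type} [Fintype ι] (hD : MeasurableSet D) (c : ℝ) (g : L2 D ι) (i : ι) :
    (D.indicator fun x => (c • g) x i) =ᵐ[volume] fun x => c * D.indicator (fun x => g x i) x := by
  filter_upwards [(ae_restrict_iff' hD).1 (Lp.coeFn_smul c g)] with x hx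
  by_cases h : x ∈ D
  · simp only [indicator_of_mem h, hx h, Pi.smul_apply, PiLp.smul_apply, smul_eq_mul]
  · simp [h]

theorem W.c0_sub (hD : IsOpen D) (w w' : W D) (i : Fin d) :
    comp0 (w - w') i =ᵐ[volume] fun x => comp0 w i x - comp0 w' i x :=
  component_sub hD.measurableSet _ _ _

theorem W.c1_sub (hD : IsOpen D) (w w' : W D) (i j : Fin d) :
    comp1 (w - w') i j =ᵐ[volume] fun x => comp1 w i j x - comp1 w' i j x :=
  component_sub hD.measurableSet _ _ _

theorem W.c2_sub (hD : IsOpen D) (w w' : W D) (i j k : Fin d) :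
    comp2 (w - w') i j k =ᵐ[volume] fun x => comp2 w i j k x - comp2 w' i j k x :=
  component_sub hD.measurableSet _ _ _

theorem W.c0_smul (hD : IsOpen D) (c : ℝ) (w : W D) (i : Fin d) :
    comp0 (c • w) i =ᵐ[volume] fun x => c * comp0 w i x :=
  component_smul hD.measurableSet _ _ _

theorem W.c1_smul (hD : IsOpen D) (c : ℝ) (w : W D) (i j : Fin d) :
    comp1 (c • w) i j =ᵐ[volume] fun x => c * comp1 w i j x :=
  component_smul hD.measurableSet _ _ _

theorem W.c2_smul (hD : IsOpen D) (c : ℝ) (w : W D) (i j k : Fin d) :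
    comp2 (c • w) i j k =ᵐ[volume] fun x => c * comp2 w i j k x :=
  component_smul hD.measurableSet _ _ _

theorem norm_L2_le {ι : Type} [Fintype ι] (hD : MeasurableSet D) (g : L2 D ι) {B : ℝ}
    (hB : 0 ≤ B) (h : ∀ i, LpBd volume 2 (D.indicator fun x => g x i) B) :
    ‖g‖ ≤ Fintype.card ι * B := by
  have h1 : ∀ i, LpBd (volume.restrict D) 2 (fun x => |g x i|) B := fun i => by
    refine LpBd.of_abs_le ?_ (((h i).restrict D).congr
      ((indicator_ae_eq_restrict hD))) (by simp)
    exact ((EuclideanSpace.proj (𝕜 := ℝ) i).continuous.comp_aestronglyMeasurable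
      (Lp.aestronglyMeasurable g)).norm
  have h2 := LpBd.nonneg_sum Finset.univ (by norm_num) (fun _ => hB) h1
  have h3 : eLpNorm g 2 (volume.restrict D) ≤ ENNReal.ofReal (∑ i : ι, B) := by
    refine le_trans (eLpNorm_mono (g := fun x => ∑ i, |g x i|) fun x => ?_) h2.2
    rw [Real.norm_of_nonneg (Finset.sum_nonneg fun i _ => abs_nonneg _), EuclideanSpace.norm_eq]
    refine (Real.sqrt_le_left (Finset.sum_nonneg fun i _ => abs_nonneg _)).2 ?_
    exact Finset.sum_sq_le_sq_sum_of_nonneg fun i _ => norm_nonneg (g x i)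
  rw [Lp.norm_def]
  refine (ENNReal.toReal_mono ENNReal.ofReal_ne_top h3).trans ?_
  rw [ENNReal.toReal_ofReal (Finset.sum_nonneg fun _ _ => hB)]
  simp

theorem W.norm_le (hD : IsOpen D) (w : W D) {B : ℝ} (hB : 0 ≤ B)
    (h0 : ∀ i, LpBd volume 2 (comp0 w i) B) (h1 : ∀ i j, LpBd volume 2 (comp1 w i j) B)
    (h2 : ∀ i j k, LpBd volume 2 (comp2 w i j k) B) : ‖w‖ ≤ ((d : ℝ) + d ^ 2 + d ^ 3) * B := by
  have e0 := norm_L2_le hD.measurableSet (w : Triples D).fst hB h0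
  have e1 := norm_L2_le hD.measurableSet (w : Triples D).snd.fst hB fun i => h1 i.1 i.2
  have e2 := norm_L2_le hD.measurableSet (w : Triples D).snd.snd hB fun i => h2 i.1 i.2.1 i.2.2
  simp only [Fintype.card_prod, Fintype.card_fin, Nat.cast_mul] at e0 e1 e2
  have key : ∀ {α β : Type} [NormedAddCommGroup α] [NormedAddCommGroup β] (x : WithLp 2 (α × β)),
      ‖x‖ ≤ ‖x.fst‖ + ‖x.snd‖ := fun x => by
    rw [WithLp.prod_norm_eq_of_L2]
    exact (Real.sqrt_le_left (by positivity)).2 (by nlinarith [norm_nonneg x.fst, norm_nonneg x.snd])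
  have k1 := key (w : Triples D)
  have k2 := key (w : Triples D).snd
  change ‖(w : Triples D)‖ ≤ _
  nlinarith

/-! ### Weak derivatives -/

/-- `g` is the weak partial derivative `∂ⱼ u` in `O`, for functions on the whole space. -/
def WeakD (O : Set (E d)) (j : Fin d) (u g : E d → ℝ) : Prop :=
  ∀ φ : E d → ℝ, IsTest O φ → ∫ x, u x * partialDeriv j φ x = -∫ x, g x * φ x

/-- Continuously differentiable functions whose support is a compact subset of `O`. -/
def IsC1Test (O : Set (E d)) (ψ : E d → ℝ) : Prop :=
  ContDiff ℝ 1 ψ ∧ HasCompactSupport ψ ∧ tsupport ψ ⊆ O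

theorem IsTest.isC1Test {O : Set (E d)} {φ : E d → ℝ} (h : IsTest O φ) : IsC1Test O φ :=
  ⟨h.1.of_le (by exact_mod_cast le_top), h.2⟩

theorem IsC1Test.continuous_partialDeriv {O : Set (E d)} {φ : E d → ℝ} (h : IsC1Test O φ)
    (j : Fin d) : Continuous (partialDeriv j φ) :=
  (h.1.continuous_fderiv (by simp)).clm_apply continuous_const

theorem IsC1Test.hasCompactSupport_partialDeriv {O : Set (E d)} {φ : E d → ℝ}
    (h : IsC1Test O φ) (j : Fin d) : HasCompactSupport (partialDeriv j φ) :=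
  (h.2.1.fderiv (𝕜 := ℝ)).comp_left (g := fun L : E d →L[ℝ] ℝ => L (EuclideanSpace.single j 1))
    (by simp)

theorem tsupport_partialDeriv_subset (φ : E d → ℝ) (j : Fin d) :
    tsupport (partialDeriv j φ) ⊆ tsupport φ := by
  refine (closure_mono fun x hx => ?_).trans (tsupport_fderiv_subset ℝ)
  intro h
  exact hx (by simp [partialDeriv, h])

theorem IsTest.partialDeriv {O : Set (E d)} {φ : E d → ℝ} (h : IsTest O φ) (j : Fin d) :
    IsTest O (partialDeriv j φ) :=
  ⟨(h.1.fderiv_right (m := ((⊤ : ℕ∞) : WithTop ℕ∞)) (by simp)).clm_apply contDiff_const,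
    h.hasCompactSupport_partialDeriv j, (tsupport_partialDeriv_subset φ j).trans h.2.2⟩

theorem weakD_of_hasWeakPartial {j : Fin d} {u g : E d → ℝ} (hD : MeasurableSet D)
    (h : HasWeakPartial D j u g) : WeakD D j (D.indicator u) (D.indicator g) := by
  intro φ hφ
  have := h φ hφ
  have e : ∀ a b : E d → ℝ, ∫ x in D, a x * b x = ∫ x, D.indicator a x * b x := fun a b => by
    rw [← integral_indicator hD]
    refine integral_congr_ae (.of_forall fun x => ?_)
    by_cases hx : x ∈ D <;> simp [hx]
  rwa [e, e] at this

theorem W.weakD_c0 (hD : IsOpen D) (w : W D) (i j : Fin d) : WeakD D j (comp0 w i) (comp1 w i j) :=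
  weakD_of_hasWeakPartial hD.measurableSet (w.2.1 i j)

theorem W.weakD_c1 (hD : IsOpen D) (w : W D) (i j k : Fin d) :
    WeakD D k (comp1 w i j) (comp2 w i j k) :=
  weakD_of_hasWeakPartial hD.measurableSet (w.2.2.1 i j k)

/-- Test functions are dense in `H¹₀`. -/
theorem H10.exists_near (p : L2 D (Fin d) × L2 D (Fin d × Fin d)) (hp : p ∈ H10 D) {η : ℝ}
    (hη : 0 < η) : ∃ q : L2 D (Fin d) × L2 D (Fin d × Fin d), ‖p - q‖ < η ∧
      ∃ Φ : E d → E d, IsTest D Φ ∧ (∀ᵐ x ∂(volume.restrict D), q.1 x = Φ x) ∧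
      (∀ᵐ x ∂(volume.restrict D), ∀ i j, q.2 x (i, j) = partialDeriv j Φ x i) := by
  have hp' : p ∈ closure (Submodule.span ℝ {p : L2 D (Fin d) × L2 D (Fin d × Fin d) |
    ∃ Φ : E d → E d, IsTest D Φ ∧
    (∀ᵐ x ∂(volume.restrict D), p.1 x = Φ x) ∧
    (∀ᵐ x ∂(volume.restrict D), ∀ i j, p.2 x (i, j) = partialDeriv j Φ x i)} : Set _) := hp
  obtain ⟨q, hq, hpq⟩ := Metric.mem_closure_iff.1 hp' η hη
  refine ⟨q, by rwa [← dist_eq_norm], ?_⟩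
  -- The generators already form a linear subspace, so every element of their span is represented by
  -- a single test function.
  refine Submodule.span_induction (p := fun q _ => ∃ Φ : E d → E d, IsTest D Φ ∧
      (∀ᵐ x ∂(volume.restrict D), q.1 x = Φ x) ∧
      (∀ᵐ x ∂(volume.restrict D), ∀ i j, q.2 x (i, j) = partialDeriv j Φ x i))
      (fun x hx => hx) ?_ ?_ ?_ hq
  · refine ⟨fun _ => 0, ⟨contDiff_const, HasCompactSupport.zero, by simp [tsupport]⟩, ?_, ?_⟩
    · filter_upwards [Lp.coeFn_zero (EuclideanSpace ℝ (Fin d)) 2 (volume.restrict D)] with x hx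
      simpa using hx
    · filter_upwards [Lp.coeFn_zero (EuclideanSpace ℝ (Fin d × Fin d)) 2 (volume.restrict D)]
        with x hx i j
      simp only [Prod.snd_zero, hx]
      simp [partialDeriv]
  · rintro x y _ _ ⟨Φ, hΦ, h1, h2⟩ ⟨Ψ, hΨ, h1', h2'⟩
    refine ⟨fun x => Φ x + Ψ x, ⟨hΦ.1.add hΨ.1, hΦ.2.1.add hΨ.2.1,
      (tsupport_add _ _).trans (union_subset hΦ.2.2 hΨ.2.2)⟩, ?_, ?_⟩
    · filter_upwards [Lp.coeFn_add x.1 y.1, h1, h1'] with z a b c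
      rw [Prod.fst_add, a, Pi.add_apply, b, c]
    · filter_upwards [Lp.coeFn_add x.2 y.2, h2, h2'] with z a b c i j
      have : partialDeriv j (fun x => Φ x + Ψ x) z = partialDeriv j Φ z + partialDeriv j Ψ z := by
        simp only [partialDeriv]
        rw [fderiv_fun_add (hΦ.1.differentiable (by simp) z) (hΨ.1.differentiable (by simp) z)]
        rfl
      rw [Prod.snd_add, a, Pi.add_apply, this, PiLp.add_apply, PiLp.add_apply, b, c]
  · rintro c x _ ⟨Φ, hΦ, h1, h2⟩
    refine ⟨fun x => c • Φ x, ⟨hΦ.1.const_smul c, hΦ.2.1.smul_left (f := fun _ => c),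
      (tsupport_smul_subset_right (fun _ => c) Φ).trans hΦ.2.2⟩, ?_, ?_⟩
    · filter_upwards [Lp.coeFn_smul c x.1, h1] with z a b
      rw [Prod.smul_fst, a, Pi.smul_apply, b]
    · filter_upwards [Lp.coeFn_smul c x.2, h2] with z a b i j
      have : partialDeriv j (fun x => c • Φ x) z = c • partialDeriv j Φ z := by
        simp only [partialDeriv]
        rw [fderiv_fun_const_smul (hΦ.1.differentiable (by simp) z)]
        rfl
      rw [Prod.smul_snd, a, Pi.smul_apply, this, PiLp.smul_apply, PiLp.smul_apply, b]

theorem partialDeriv_component {Φ : E d → E d} (hΦ : Differentiable ℝ Φ) (i j : Fin d) (x : E d) :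
    partialDeriv j (fun x => Φ x i) x = partialDeriv j Φ x i := by
  have := ((EuclideanSpace.proj (𝕜 := ℝ) i).hasFDerivAt.comp x (hΦ x).hasFDerivAt).fderiv
  simp only [partialDeriv]
  change fderiv ℝ ((EuclideanSpace.proj (𝕜 := ℝ) i : E d → ℝ) ∘ Φ) x _ = _
  rw [this]
  rfl

/-- The zero boundary values enter the estimates through this approximation only. It controls the
function and its gradient but not the second derivatives, so in each later integration by parts the
second derivatives must stay on the element of W itself. -/
theorem W.exists_test_near (hD : IsOpen D) (w : W D) {η : ℝ} (hη : 0 < η) :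
    ∃ Φ : Fin d → E d → ℝ, (∀ i, IsTest D (Φ i)) ∧
      (∀ i, LpBd volume 2 (fun x => comp0 w i x - Φ i x) η) ∧
      ∀ i j, LpBd volume 2 (fun x => comp1 w i j x - partialDeriv j (Φ i) x) η := by
  obtain ⟨q, hq, Φ, hΦ, h1, h2⟩ := H10.exists_near _ w.2.2.2 hη
  have hdiff : Differentiable ℝ Φ := hΦ.1.differentiable (by simp)
  have hT : ∀ i, IsTest D (fun x => Φ x i) := fun i => by
    refine ⟨(EuclideanSpace.proj (𝕜 := ℝ) i).contDiff.comp hΦ.1,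
      hΦ.2.1.comp_left (g := fun v : E d => v i) (by simp), ?_⟩
    exact (tsupport_comp_subset (g := fun v : E d => v i) (by simp) Φ).trans hΦ.2.2
  refine ⟨fun i x => Φ x i, hT, fun i => ?_, fun i j => ?_⟩
  · refine (lpBd_component hD.measurableSet _ i ((_root_.norm_fst_le _).trans hq.le)).congr ?_
    filter_upwards [component_sub hD.measurableSet (w : Triples D).fst q.1 i,
      (ae_restrict_iff' hD.measurableSet).1 h1] with x hx hx'
    simp only [Prod.fst_sub]
    rw [hx, comp0]
    congr 1
    by_cases h : x ∈ D
    · simp [h, hx' h]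
    · rw [indicator_of_notMem h]
      exact (image_eq_zero_of_notMem_tsupport fun h' => h ((hT i).2.2 h')).symm
  · refine (lpBd_component hD.measurableSet _ (i, j) ((_root_.norm_snd_le _).trans hq.le)).congr ?_
    filter_upwards [component_sub hD.measurableSet (w : Triples D).snd.fst q.2 (i, j),
      (ae_restrict_iff' hD.measurableSet).1 h2] with x hx hx'
    simp only [Prod.snd_sub]
    rw [hx, comp1]
    congr 1
    by_cases h : x ∈ D
    · simp [h, hx' h i j, partialDeriv_component hdiff]
    · rw [indicator_of_notMem h]
      exact (image_eq_zero_of_notMem_tsupport fun h' => h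
        (((hT i).partialDeriv j).2.2 h')).symm

/-! ### Completeness of `W` -/

/-- For a fixed test function both sides of the defining identity are inner products with fixed
elements of L², hence continuous. -/
theorem isClosed_hasWeakPartial {X ι κ : Type} [TopologicalSpace X] [Fintype ι] [Fintype κ]
    (j : Fin d) (i : ι) (k : κ) {F : X → L2 D ι} {G : X → L2 D κ} (hF : Continuous F)
    (hG : Continuous G) :
    IsClosed {x | HasWeakPartial D j (fun y => F x y i) (fun y => G x y k)} := by
  have key : ∀ (ι : Type) [Fintype ι] (i : ι) (ψ : E d → ℝ), Continuous ψ → HasCompactSupport ψ →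
      Continuous fun g : L2 D ι => ∫ x in D, g x i * ψ x := by
    intro ι _ i ψ hψ hc
    classical
    let Ψ : E d → EuclideanSpace ℝ ι := fun x => ψ x • EuclideanSpace.single i 1
    have hΨ : MemLp Ψ 2 (volume.restrict D) :=
      (hψ.smul continuous_const).memLp_of_hasCompactSupport
        (hc.smul_right (f' := fun _ => EuclideanSpace.single i (1 : ℝ)))
    have : (fun g : L2 D ι => ∫ x in D, g x i * ψ x) =
        fun g : L2 D ι => inner ℝ hΨ.toLp g := by
      ext g
      rw [L2.inner_def]
      apply integral_congr_ae
      filter_upwards [hΨ.coeFn_toLp] with x hx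
      rw [hx]
      simp [Ψ, inner_smul_left, EuclideanSpace.inner_single_left, mul_comm]
    rw [this]
    fun_prop
  have : {x | HasWeakPartial D j (fun y => F x y i) (fun y => G x y k)} =
      ⋂ φ : {φ : E d → ℝ // IsTest D φ}, {x | ∫ y in D, F x y i * partialDeriv j φ.1 y =
        -∫ y in D, G x y k * φ.1 y} := by
    ext x
    simp [HasWeakPartial]
  rw [this]
  refine isClosed_iInter fun φ => isClosed_eq ?_ ?_
  · exact (key ι i _ (φ.2.continuous_partialDeriv j)
      (φ.2.hasCompactSupport_partialDeriv j)).comp hF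
  · exact ((key κ k _ φ.2.1.continuous φ.2.2.1).comp hG).neg

theorem W.isClosed : IsClosed (W D : Set (Triples D)) := by
  have : (W D : Set (Triples D)) =
      (⋂ i, ⋂ j, {w : Triples D | HasWeakPartial D j (fun x => w.fst x i)
        (fun x => w.snd.fst x (i, j))}) ∩ ((⋂ i, ⋂ j, ⋂ k, {w : Triples D | HasWeakPartial D k
        (fun x => w.snd.fst x (i, j)) (fun x => w.snd.snd x (i, j, k))}) ∩
        {w | (w.fst, w.snd.fst) ∈ H10 D}) := by
    ext w
    simp only [mem_inter_iff, mem_iInter, mem_ofPred_eq]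
    rfl
  have f1 : Continuous fun w : Triples D => w.fst := by fun_prop
  have f2 : Continuous fun w : Triples D => w.snd.fst := by fun_prop
  have f3 : Continuous fun w : Triples D => w.snd.snd := by fun_prop
  rw [this]
  refine IsClosed.inter (isClosed_iInter fun i => isClosed_iInter fun j =>
    isClosed_hasWeakPartial _ _ _ f1 f2) (IsClosed.inter (isClosed_iInter fun i =>
      isClosed_iInter fun j => isClosed_iInter fun k => isClosed_hasWeakPartial _ _ _ f2 f3) ?_)
  exact (Submodule.isClosed_topologicalClosure _).preimage (f1.prodMk f2)

/-- Completeness provides the limit of the difference quotients of the force. -/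
instance : CompleteSpace (W D) := W.isClosed.isComplete.completeSpace_coe

end Peridynamics

end

/-! ### Smoothing by convolution -/

noncomputable section

open scoped ENNReal NNReal

namespace Peridynamics

/-! ### Mollification -/

variable {d : ℕ} {D : Set (E d)}

open ContinuousLinearMap (lsmul)

/-- The convolution of `u` with a normalized bump function. -/
def mollify (φ : ContDiffBump (0 : E d)) (u : E d → ℝ) : E d → ℝ :=
  convolution (φ.normed volume) u (lsmul ℝ ℝ) volume

theorem mollify_eq (φ : ContDiffBump (0 : E d)) (u : E d → ℝ) (x : E d) :
    mollify φ u x = ∫ t, φ.normed volume (x - t) * u t := by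
  rw [mollify, convolution_eq_swap]
  rfl

theorem mollify_eq' (φ : ContDiffBump (0 : E d)) (u : E d → ℝ) (x : E d) :
    mollify φ u x = ∫ t, φ.normed volume t * u (x - t) := rfl

theorem contDiff_mollify (φ : ContDiffBump (0 : E d)) {u : E d → ℝ}
    (hu : LocallyIntegrable u volume) : ContDiff ℝ ((⊤ : ℕ∞) : WithTop ℕ∞) (mollify φ u) :=
  φ.hasCompactSupport_normed.contDiff_convolution_left _ φ.contDiff_normed hu

theorem mollify_integrable (φ : ContDiffBump (0 : E d)) {u : E d → ℝ}
    (hu : LocallyIntegrable u volume) (x : E d) :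
    Integrable (fun t => φ.normed volume t * u (x - t)) :=
  (φ.hasCompactSupport_normed (μ := volume)).convolutionExists_left (lsmul ℝ ℝ)
    φ.continuous_normed hu x

theorem mollify_sub (φ : ContDiffBump (0 : E d)) {u v : E d → ℝ}
    (hu : LocallyIntegrable u volume) (hv : LocallyIntegrable v volume) (x : E d) :
    mollify φ (fun y => u y - v y) x = mollify φ u x - mollify φ v x := by
  rw [mollify_eq', mollify_eq', mollify_eq',
    ← integral_sub (mollify_integrable φ hu x) (mollify_integrable φ hv x)]
  simp only [mul_sub]

theorem mollify_support_subset (φ : ContDiffBump (0 : E d)) (u : E d → ℝ) :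
    tsupport (mollify φ u) ⊆ Metric.cthickening φ.rOut (tsupport u) := by
  refine closure_minimal ?_ (Metric.isClosed_cthickening)
  refine (support_convolution_subset _).trans ?_
  rw [φ.support_normed_eq]
  rintro _ ⟨a, ha, b, hb, rfl⟩
  refine Metric.mem_cthickening_of_dist_le _ b _ _ (subset_tsupport _ hb) ?_
  simpa [dist_eq_norm] using (mem_ball_zero_iff.1 ha).le

theorem dist_mollify_le (φ : ContDiffBump (0 : E d)) {u : E d → ℝ} (hu : Continuous u) {η : ℝ}
    (x : E d) (h : ∀ y, dist y x < φ.rOut → |u y - u x| ≤ η) : |mollify φ u x - u x| ≤ η :=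
  φ.dist_normed_convolution_le hu.aestronglyMeasurable fun y hy => h y hy

/-- Integration by parts against a compactly supported function. -/
theorem integral_mul_partialDeriv {O : Set (E d)} {F ψ : E d → ℝ} (hF : ContDiff ℝ 1 F)
    (hψ : IsC1Test O ψ) (j : Fin d) :
    ∫ x, F x * partialDeriv j ψ x = -∫ x, partialDeriv j F x * ψ x := by
  have c1 : Continuous (partialDeriv j F) :=
    (hF.continuous_fderiv (by simp)).clm_apply continuous_const
  refine integral_mul_fderiv_eq_neg_fderiv_mul_of_integrable ?_ ?_ ?_
    (fun x _ => hF.differentiable (by simp) x) (fun x _ => hψ.1.differentiable (by simp) x)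
  · exact (c1.mul hψ.1.continuous).integrable_of_hasCompactSupport hψ.2.1.mul_left
  · exact (hF.continuous.mul (hψ.continuous_partialDeriv j)).integrable_of_hasCompactSupport
      (hψ.hasCompactSupport_partialDeriv j).mul_left
  · exact (hF.continuous.mul hψ.1.continuous).integrable_of_hasCompactSupport hψ.2.1.mul_left

theorem partialDeriv_mollify (φ : ContDiffBump (0 : E d)) {u : E d → ℝ}
    (hu : LocallyIntegrable u volume) (j : Fin d) (x : E d) :
    partialDeriv j (mollify φ u) x = ∫ t, partialDeriv j (φ.normed volume) (x - t) * u t := by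
  have h := φ.hasCompactSupport_normed.hasFDerivAt_convolution_left (lsmul ℝ ℝ)
    (φ.contDiff_normed (n := 1) (μ := volume)) hu x
  have e := h.fderiv
  rw [partialDeriv, mollify, e, convolution_eq_swap, ContinuousLinearMap.integral_apply]
  · rfl
  · have := (φ.hasCompactSupport_normed (μ := volume)).fderiv (𝕜 := ℝ)
      |>.convolutionExists_left ((lsmul ℝ ℝ).precompL (E d))
      ((φ.contDiff_normed (n := 1) (μ := volume)).continuous_fderiv (by simp)) hu x
    exact this.integrable_swap

/-- Mollification commutes with weak derivatives away from the boundary. -/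
theorem partialDeriv_mollify_eq {O : Set (E d)} (φ : ContDiffBump (0 : E d)) {u g : E d → ℝ}
    (hu : LocallyIntegrable u volume) {j : Fin d} (h : WeakD O j u g) {x : E d}
    (hx : Metric.closedBall x φ.rOut ⊆ O) :
    partialDeriv j (mollify φ u) x = mollify φ g x := by
  set ρ := φ.normed (volume : Measure (E d)) with hρ
  have hd : Differentiable ℝ ρ := (φ.contDiff_normed (n := 1)).differentiable (by simp)
  have ht : IsTest O fun t => ρ (x - t) := by
    refine ⟨φ.contDiff_normed.comp (contDiff_const.sub contDiff_id), ?_⟩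
    have hs : tsupport (fun t => ρ (x - t)) ⊆ Metric.closedBall x φ.rOut := by
      refine closure_minimal (fun t h => ?_) Metric.isClosed_closedBall
      have : x - t ∈ Function.support ρ := h
      rw [hρ, φ.support_normed_eq, mem_ball_zero_iff] at this
      rw [mem_closedBall_iff_norm']
      exact this.le
    exact ⟨HasCompactSupport.of_support_subset_isCompact (isCompact_closedBall x φ.rOut)
      ((subset_tsupport _).trans hs), hs.trans hx⟩
  have hp : ∀ t, partialDeriv j (fun t => ρ (x - t)) t = -partialDeriv j ρ (x - t) := fun t => by
    have := ((hd (x - t)).hasFDerivAt.comp t ((hasFDerivAt_id t).const_sub x)).fderiv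
    simp only [partialDeriv]
    change fderiv ℝ (ρ ∘ HSub.hSub x) t _ = _
    rw [this]
    simp
  have e := h _ ht
  simp only [hp, mul_neg, integral_neg, neg_inj] at e
  rw [partialDeriv_mollify φ hu, mollify_eq]
  simp only [mul_comm _ (u _), mul_comm _ (g _)]
  exact e

/-- Approximation of compactly supported `C¹` functions by smooth ones. -/
theorem IsC1Test.exists_test_near {O : Set (E d)} (hO : IsOpen O) {ψ : E d → ℝ}
    (hψ : IsC1Test O ψ) : ∃ K : Set (E d), IsCompact K ∧ ∀ η > 0, ∃ φ, IsTest O φ ∧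
      (∀ x, |φ x - ψ x| ≤ K.indicator (fun _ => η) x) ∧
      ∀ j x, |partialDeriv j φ x - partialDeriv j ψ x| ≤ K.indicator (fun _ => η) x := by
  obtain ⟨r, hr, hrO⟩ := (HasCompactSupport.isCompact hψ.2.1).exists_cthickening_subset_open
    hO hψ.2.2
  -- The compact set is fixed before η, so that the errors can be integrated against functions that
  -- are only locally integrable.
  refine ⟨Metric.cthickening r (tsupport ψ), (HasCompactSupport.isCompact hψ.2.1).cthickening,
    fun η hη => ?_⟩
  have uc : ∀ f : E d → ℝ, Continuous f → HasCompactSupport f → ∃ δ > 0, ∀ x y,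
      dist y x < δ → |f y - f x| ≤ η := fun f hf hc => by
    obtain ⟨δ, hδ, h⟩ := Metric.uniformContinuous_iff.1
      (hf.uniformContinuous_of_tendsto_cocompact hc.is_zero_at_infty) η hη
    exact ⟨δ, hδ, fun x y hxy => (h hxy).le⟩
  obtain ⟨δ, hδ, h0⟩ := uc ψ hψ.1.continuous hψ.2.1
  choose δ' hδ' h1 using fun j => uc (partialDeriv j ψ) (hψ.continuous_partialDeriv j)
    (hψ.hasCompactSupport_partialDeriv j)
  obtain ⟨τ, hτ, hτr, hτδ, hτδ'⟩ : ∃ τ > 0, τ ≤ r ∧ τ ≤ δ ∧ ∀ j, τ ≤ δ' j := by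
    have : ∀ᶠ τ in 𝓝[>] (0 : ℝ), 0 < τ ∧ τ ≤ r ∧ τ ≤ δ ∧ ∀ j, τ ≤ δ' j := by
      have key : ∀ c : ℝ, 0 < c → ∀ᶠ τ in 𝓝[>] (0 : ℝ), τ ≤ c := fun c hc =>
        nhdsWithin_le_nhds (Iic_mem_nhds hc)
      filter_upwards [self_mem_nhdsWithin, key r hr, key δ hδ,
        eventually_all.2 fun j => key (δ' j) (hδ' j)] with τ a b c e
      exact ⟨a, b, c, e⟩
    obtain ⟨τ, h⟩ := this.exists
    exact ⟨τ, h⟩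
  let φ : ContDiffBump (0 : E d) := ⟨τ / 2, τ, by positivity, by linarith⟩
  have hsup : tsupport (mollify φ ψ) ⊆ Metric.cthickening r (tsupport ψ) :=
    (mollify_support_subset φ ψ).trans (Metric.cthickening_mono hτr _)
  have hli := hψ.1.continuous.locallyIntegrable (μ := (volume : Measure (E d)))
  have hw : ∀ j, WeakD univ j ψ (partialDeriv j ψ) := fun j χ hχ =>
    integral_mul_partialDeriv hψ.1 hχ.isC1Test j
  have hpd : ∀ j x, partialDeriv j (mollify φ ψ) x = mollify φ (partialDeriv j ψ) x :=
    fun j x => partialDeriv_mollify_eq φ hli (hw j) (subset_univ _)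
  have hself := Metric.self_subset_cthickening (δ := r) (tsupport ψ)
  refine ⟨mollify φ ψ, ⟨contDiff_mollify φ hli, HasCompactSupport.of_support_subset_isCompact
    (HasCompactSupport.isCompact hψ.2.1).cthickening ((subset_tsupport _).trans hsup),
    hsup.trans hrO⟩, fun x => ?_, fun j x => ?_⟩
  · by_cases hx : x ∈ Metric.cthickening r (tsupport ψ)
    · rw [indicator_of_mem hx]
      exact dist_mollify_le φ hψ.1.continuous x fun y hy => h0 x y (hy.trans_le hτδ)
    · rw [indicator_of_notMem hx, image_eq_zero_of_notMem_tsupport fun h => hx (hsup h),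
        image_eq_zero_of_notMem_tsupport fun h => hx (hself h)]
      simp
  · by_cases hx : x ∈ Metric.cthickening r (tsupport ψ)
    · rw [indicator_of_mem hx, hpd]
      exact dist_mollify_le φ (hψ.continuous_partialDeriv j) x fun y hy =>
        h1 j x y (hy.trans_le (hτδ' j))
    · rw [indicator_of_notMem hx, image_eq_zero_of_notMem_tsupport fun h => hx (hsup
          (tsupport_partialDeriv_subset _ _ h)),
        image_eq_zero_of_notMem_tsupport fun h => hx (hself (tsupport_partialDeriv_subset _ _ h))]
      simp

theorem abs_integral_mul_le_of_le_indicator {u f : E d → ℝ} {K : Set (E d)} {η : ℝ}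
    (hu : LocallyIntegrable u volume) (hK : IsCompact K)
    (hfK : ∀ x, |f x| ≤ K.indicator (fun _ => η) x) :
    |∫ x, u x * f x| ≤ η * ∫ x in K, |u x| := by
  have hi : IntegrableOn u K := hu.integrableOn_isCompact hK
  rw [← Real.norm_eq_abs, ← integral_const_mul, ← integral_indicator hK.measurableSet]
  refine norm_integral_le_of_norm_le ((integrable_indicator_iff hK.measurableSet).2
    (hi.abs.const_mul η)) (.of_forall fun x => ?_)
  rw [norm_mul, Real.norm_eq_abs, Real.norm_eq_abs]
  have h := hfK x
  by_cases hx : x ∈ K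
  · rw [indicator_of_mem hx] at h ⊢
    rw [mul_comm]
    exact mul_le_mul_of_nonneg_right h (abs_nonneg _)
  · rw [indicator_of_notMem hx] at h ⊢
    rw [le_antisymm h (abs_nonneg _), mul_zero]

/-- A weak derivative may be tested with `C¹` functions. -/
theorem WeakD.apply_c1 {O : Set (E d)} (hO : IsOpen O) {j : Fin d} {u g : E d → ℝ}
    (hu : LocallyIntegrable u volume) (hg : LocallyIntegrable g volume) (h : WeakD O j u g)
    {ψ : E d → ℝ} (hψ : IsC1Test O ψ) :
    ∫ x, u x * partialDeriv j ψ x = -∫ x, g x * ψ x := by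
  obtain ⟨K, hK, H⟩ := hψ.exists_test_near hO
  have int : ∀ {u f : E d → ℝ}, LocallyIntegrable u volume → Continuous f → HasCompactSupport f →
      Integrable fun x => u x * f x := fun hu hf hc => by
    simpa [mul_comm] using hu.integrable_smul_left_of_hasCompactSupport hf hc
  rw [← sub_eq_zero, sub_neg_eq_add, ← abs_eq_zero]
  refine le_antisymm (le_of_forall_pos_le_add fun c hc => ?_) (abs_nonneg _)
  set A := (∫ x in K, |u x|) + ∫ x in K, |g x|
  have hA : 0 ≤ A := add_nonneg (integral_nonneg fun _ => abs_nonneg _)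
    (integral_nonneg fun _ => abs_nonneg _)
  obtain ⟨φ, hφ, h0, h1⟩ := H (c / (A + 1)) (by positivity)
  have e := h φ hφ
  have a1 := abs_integral_mul_le_of_le_indicator hu hK (h1 j)
  have a2 := abs_integral_mul_le_of_le_indicator hg hK h0
  simp only [mul_sub] at a1 a2
  rw [integral_sub (int hu (hφ.continuous_partialDeriv j) (hφ.hasCompactSupport_partialDeriv j))
    (int hu (hψ.continuous_partialDeriv j) (hψ.hasCompactSupport_partialDeriv j))] at a1
  rw [integral_sub (int hg hφ.1.continuous hφ.2.1) (int hg hψ.1.continuous hψ.2.1)] at a2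
  have b : |(∫ x, u x * partialDeriv j ψ x) + ∫ x, g x * ψ x| ≤ c / (A + 1) * A := by
    rw [abs_le] at a1 a2 ⊢
    rw [show c / (A + 1) * A = c / (A + 1) * (∫ x in K, |u x|) + c / (A + 1) * ∫ x in K, |g x| by
      simp only [A]; ring]
    constructor <;> linarith [a1.1, a1.2, a2.1, a2.2]
  refine b.trans ?_
  rw [zero_add, div_mul_eq_mul_div, div_le_iff₀ (by positivity)]
  nlinarith

/-! ### Mollification in `Lᵖ` -/

/-- Jensen's inequality for the probability measure with the bump as density, in the form L¹ ≤ Lᵖ,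
followed by Tonelli and translation invariance. -/
theorem lpBd_mollify (φ : ContDiffBump (0 : E d)) {u : E d → ℝ} {p : ℝ≥0∞} {c : ℝ} (hp : 1 ≤ p)
    (hp' : p ≠ ⊤) (hu : LpBd volume p u c) : LpBd volume p (mollify φ u) c := by
  have hli : LocallyIntegrable u volume := hu.memLp.locallyIntegrable hp
  have hp0 : p ≠ 0 := (zero_lt_one.trans_le hp).ne'
  have hpr : 0 < p.toReal := ENNReal.toReal_pos hp0 hp'
  refine ⟨(contDiff_mollify φ hli).continuous.aestronglyMeasurable, le_trans ?_ hu.2⟩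
  set ρ := φ.normed (volume : Measure (E d))
  have hρm : Measurable fun t => ENNReal.ofReal (ρ t) :=
    φ.continuous_normed.measurable.ennreal_ofReal
  have hρ1 : ∫⁻ t, ENNReal.ofReal (ρ t) = 1 := by
    rw [← ofReal_integral_eq_lintegral_ofReal φ.integrable_normed
      (.of_forall fun t => φ.nonneg_normed t), φ.integral_normed]
    simp
  set ν := (volume : Measure (E d)).withDensity fun t => ENNReal.ofReal (ρ t) with hν
  have : IsProbabilityMeasure ν := ⟨by rw [hν, withDensity_apply _ MeasurableSet.univ]; simpa⟩
  have hum : ∀ x, AEStronglyMeasurable (fun t => u (x - t)) volume := fun x =>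
    hu.1.comp_quasiMeasurePreserving
      (Measure.measurePreserving_sub_left volume x).quasiMeasurePreserving
  have hpt : ∀ x, ‖mollify φ u x‖ₑ ^ p.toReal ≤
      ∫⁻ t, ENNReal.ofReal (ρ t) * ‖u (x - t)‖ₑ ^ p.toReal := fun x => by
    have hac : AEStronglyMeasurable (fun t => u (x - t)) ν :=
      (hum x).mono_ac (withDensity_absolutelyContinuous _ _)
    have h1 : ‖mollify φ u x‖ₑ ≤ eLpNorm (fun t => u (x - t)) 1 ν := by
      rw [mollify_eq', eLpNorm_one_eq_lintegral_enorm, hν,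
        lintegral_withDensity_eq_lintegral_mul₀ hρm.aemeasurable (hum x).enorm]
      refine (enorm_integral_le_lintegral_enorm _).trans (lintegral_mono fun t => ?_)
      rw [Pi.mul_apply, enorm_mul, Real.enorm_eq_ofReal_abs, abs_of_nonneg (φ.nonneg_normed t)]
    have h2 := h1.trans (eLpNorm_le_eLpNorm_of_exponent_le hp hac)
    rw [eLpNorm_eq_lintegral_rpow_enorm_toReal hp0 hp', one_div,
      ENNReal.le_rpow_inv_iff hpr, hν, lintegral_withDensity_eq_lintegral_mul₀ hρm.aemeasurable
      ((hum x).enorm.pow_const _)] at h2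
    exact h2
  rw [eLpNorm_eq_lintegral_rpow_enorm_toReal hp0 hp', eLpNorm_eq_lintegral_rpow_enorm_toReal hp0 hp']
  refine ENNReal.rpow_le_rpow ((lintegral_mono hpt).trans ?_) (by positivity)
  have hjm : AEMeasurable (Function.uncurry fun x t =>
      ENNReal.ofReal (ρ t) * ‖u (x - t)‖ₑ ^ p.toReal)
      ((volume : Measure (E d)).prod (volume : Measure (E d))) := by
    refine AEMeasurable.mul (hρm.comp measurable_snd).aemeasurable (AEMeasurable.pow_const ?_ _)
    exact (hu.1.comp_quasiMeasurePreserving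
      (quasiMeasurePreserving_sub volume volume)).enorm
  rw [lintegral_lintegral_swap hjm]
  calc _ = ∫⁻ t, ENNReal.ofReal (ρ t) * ∫⁻ x, ‖u x‖ₑ ^ p.toReal := by
        refine lintegral_congr fun t => ?_
        rw [lintegral_const_mul' _ _ ENNReal.ofReal_ne_top,
          lintegral_sub_right_eq_self (fun x => ‖u x‖ₑ ^ p.toReal) t]
    _ = _ := by rw [lintegral_mul_const _ hρm, hρ1, one_mul]
    _ ≤ _ := le_rfl

/-- Bump functions shrinking to the origin. -/
def shrinkingBump (d n : ℕ) : ContDiffBump (0 : E d) :=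
  ⟨1 / (n + 1 : ℝ) / 2, 1 / (n + 1 : ℝ), by positivity, half_lt_self (by positivity)⟩

theorem tendsto_shrinkingBump : Tendsto (fun n => (shrinkingBump d n).rOut) atTop (𝓝 0) :=
  tendsto_one_div_add_atTop_nhds_zero_nat

theorem ae_tendsto_mollify {u : E d → ℝ} (hu : LocallyIntegrable u volume) :
    ∀ᵐ x, Tendsto (fun n => mollify (shrinkingBump d n) u x) atTop (𝓝 (u x)) :=
  ContDiffBump.ae_convolution_tendsto_right_of_locallyIntegrable (K := 2) tendsto_shrinkingBump
    (.of_forall fun n => by simp only [shrinkingBump]; linarith) hu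

/-- Mollification contracts L¹, so it is enough to treat a continuous compactly supported
approximation, for which the convergence is uniform with supports in a fixed compact set. -/
theorem tendsto_mollify_L1 {u : E d → ℝ} (hu : Integrable u) :
    Tendsto (fun n => ∫ x, |mollify (shrinkingBump d n) u x - u x|) atTop (𝓝 0) := by
  have lp1 : ∀ {f : E d → ℝ} {c : ℝ}, 0 ≤ c → Integrable f → ∫ x, |f x| ≤ c → LpBd volume 1 f c := by
    intro f c hc hf h
    refine ⟨hf.1, ?_⟩
    rw [eLpNorm_one_eq_lintegral_enorm, ← ofReal_integral_norm_eq_lintegral_enorm hf]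
    exact ENNReal.ofReal_le_ofReal h
  have lp1' : ∀ {f : E d → ℝ} {c : ℝ}, 0 ≤ c → LpBd volume 1 f c →
      Integrable f ∧ ∫ x, |f x| ≤ c := by
    intro f c hc h
    have hf := memLp_one_iff_integrable.1 h.memLp
    have h2 := h.2
    rw [eLpNorm_one_eq_lintegral_enorm, ← ofReal_integral_norm_eq_lintegral_enorm hf,
      ENNReal.ofReal_le_ofReal_iff hc] at h2
    exact ⟨hf, h2⟩
  rw [Metric.tendsto_atTop]
  intro η hη
  obtain ⟨g, hgc, hg, hgcont, hgi⟩ := hu.exists_hasCompactSupport_integral_sub_le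
    (ε := η / 4) (by positivity)
  set K := Metric.cthickening 1 (tsupport g)
  have hK : IsCompact K := (HasCompactSupport.isCompact hgc).cthickening
  set V := volume.real K
  have hV : 0 ≤ V := measureReal_nonneg
  obtain ⟨δ, hδ, huc⟩ := Metric.uniformContinuous_iff.1
    (hgcont.uniformContinuous_of_tendsto_cocompact hgc.is_zero_at_infty) (η / 4 / (V + 1))
      (by positivity)
  obtain ⟨N, hN⟩ := Metric.tendsto_atTop.1 (tendsto_shrinkingBump (d := d)) (min δ 1)
    (by positivity)
  refine ⟨N, fun n hn => ?_⟩
  set φ := shrinkingBump d n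
  have hr : φ.rOut < min δ 1 := by
    have := hN n hn
    rw [Real.dist_eq, sub_zero] at this
    exact (le_abs_self _).trans_lt this
  have b1 : LpBd volume 1 (fun x => u x - g x) (η / 4) := lp1 (by positivity) (hu.sub hgi) hg
  have b2 := lpBd_mollify φ le_rfl ENNReal.one_ne_top b1
  have hpt : ∀ x, |mollify φ g x - g x| ≤ K.indicator (fun _ => η / 4 / (V + 1)) x := fun x => by
    by_cases hx : x ∈ K
    · rw [indicator_of_mem hx]
      exact dist_mollify_le φ hgcont x fun y hy =>
        (huc (hy.trans (hr.trans_le (min_le_left _ _)))).le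
    · have h1 := (mollify_support_subset φ g).trans
        (Metric.cthickening_mono (hr.le.trans (min_le_right _ _)) _)
      rw [indicator_of_notMem hx, image_eq_zero_of_notMem_tsupport fun h => hx (h1 h),
        image_eq_zero_of_notMem_tsupport fun h => hx
          (Metric.self_subset_cthickening (δ := 1) (tsupport g) h)]
      simp
  have hind : Integrable (K.indicator fun _ => η / 4 / (V + 1) : E d → ℝ) :=
    (integrable_indicator_iff hK.measurableSet).2
      (integrableOn_const (hK.measure_lt_top.ne))
  have hgl := hgcont.locallyIntegrable (μ := (volume : Measure (E d)))
  have hmeas : AEStronglyMeasurable (fun x => mollify φ g x - g x) volume :=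
    ((contDiff_mollify φ hgl).continuous.sub hgcont).aestronglyMeasurable
  have b3i : Integrable fun x => mollify φ g x - g x := hind.mono' hmeas (.of_forall hpt)
  have b3 : LpBd volume 1 (fun x => mollify φ g x - g x) (η / 4) := by
    refine lp1 (by positivity) b3i ?_
    refine (integral_mono b3i.abs hind hpt).trans ?_
    rw [integral_indicator hK.measurableSet, setIntegral_const, smul_eq_mul]
    change V * _ ≤ _
    rw [mul_div_assoc', div_le_iff₀ (by positivity)]
    nlinarith
  have b4 := (b2.add le_rfl (by positivity) (by positivity) b3).sub le_rfl (by positivity)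
    (by positivity) b1
  have b5 : LpBd volume 1 (fun x => mollify φ u x - u x) (η / 4 + η / 4 + η / 4) := by
    refine b4.congr (.of_forall fun x => ?_)
    simp only [mollify_sub φ hu.locallyIntegrable hgl]
    ring
  rw [Real.dist_eq, sub_zero, abs_of_nonneg (integral_nonneg fun _ => abs_nonneg _)]
  exact (lp1' (by positivity) b5).2.trans_lt (by linarith)

end Peridynamics

end

/-! ### Nonlinear functions of weakly differentiable functions and L⁴ interpolation -/

noncomputable section

open scoped ENNReal NNReal

namespace Peridynamics

variable {d : ℕ} {D : Set (E d)}

/-! ### The chain rule for weak derivatives, tested with smooth functions -/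

/-- The identity holds for mollifications, whose derivatives near the support of φ are the mollified
weak derivatives. In the limit the left side converges since f is Lipschitz. On the right, the
mollified derivative is exchanged for P by L¹ convergence and the bound on f', and dominated
convergence handles f' along the a.e. convergent mollifications. -/
theorem WeakD.integral_comp {O : Set (E d)} (hO : IsOpen O) {j : Fin d} {p P : E d → ℝ}
    (hp : Integrable p) (hP : Integrable P) (h : WeakD O j p P) {f f' : ℝ → ℝ} {K : ℝ}
    (hf : ∀ s, HasDerivAt f (f' s) s) (hf' : Continuous f') (hK : ∀ s, |f' s| ≤ K)
    {φ : E d → ℝ} (hφ : IsTest O φ) :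
    ∫ x, f (p x) * partialDeriv j φ x = -∫ x, f' (p x) * P x * φ x := by
  have hK0 : 0 ≤ K := (abs_nonneg _).trans (hK 0)
  have hfc : Continuous f := continuous_iff_continuousAt.2 fun s => (hf s).continuousAt
  have hf1 : ContDiff ℝ 1 f := by
    rw [contDiff_one_iff_deriv]
    exact ⟨fun s => (hf s).differentiableAt, by rwa [funext fun s => (hf s).deriv]⟩
  have hlip : ∀ s t, |f s - f t| ≤ K * |s - t| := fun s t =>
    Convex.norm_image_sub_le_of_norm_hasDerivWithin_le (s := univ)
      (fun y _ => (hf y).hasDerivWithinAt) (fun y _ => hK y) convex_univ (mem_univ t) (mem_univ s)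
  set m := fun n => mollify (shrinkingBump d n) p with hm
  set M := fun n => mollify (shrinkingBump d n) P with hM
  have hms : ∀ n, ContDiff ℝ ((⊤ : ℕ∞) : WithTop ℕ∞) (m n) := fun n =>
    contDiff_mollify _ hp.locallyIntegrable
  have hMs : ∀ n, ContDiff ℝ ((⊤ : ℕ∞) : WithTop ℕ∞) (M n) := fun n =>
    contDiff_mollify _ hP.locallyIntegrable
  have lp : ∀ {u : E d → ℝ}, Integrable u → ∀ n, Integrable (mollify (shrinkingBump d n) u) := by
    intro u hu n
    exact memLp_one_iff_integrable.1 (lpBd_mollify _ le_rfl ENNReal.one_ne_top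
      (MemLp.lpBd (memLp_one_iff_integrable.2 hu))).memLp
  have hmi : ∀ n, Integrable (m n) := lp hp
  have hMi : ∀ n, Integrable (M n) := lp hP
  obtain ⟨r, hr, hrO⟩ := (HasCompactSupport.isCompact hφ.2.1).exists_cthickening_subset_open
    hO hφ.2.2
  have hder : ∀ᶠ n in atTop, ∀ x ∈ tsupport φ, partialDeriv j (m n) x = M n x := by
    filter_upwards [(tendsto_shrinkingBump (d := d)).eventually_le_const hr] with n hn x hx
    refine partialDeriv_mollify_eq _ hp.locallyIntegrable h
      ((Metric.closedBall_subset_closedBall hn).trans (subset_trans ?_ hrO))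
    exact Metric.closedBall_subset_cthickening hx r
  obtain ⟨c, hc⟩ := hφ.1.continuous.bounded_above_of_compact_support hφ.2.1
  obtain ⟨c', hc'⟩ := (hφ.continuous_partialDeriv j).bounded_above_of_compact_support
    (hφ.hasCompactSupport_partialDeriv j)
  have hc0 : 0 ≤ c := (norm_nonneg _).trans (hc 0)
  have hc0' : 0 ≤ c' := (norm_nonneg _).trans (hc' 0)
  have hφm := hφ.1.continuous.aestronglyMeasurable (μ := (volume : Measure (E d)))
  have hφm' := (hφ.continuous_partialDeriv j).aestronglyMeasurable (μ := (volume : Measure (E d)))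
  -- integration by parts for the mollified functions
  have e : ∀ᶠ n in atTop, ∫ x, f (m n x) * partialDeriv j φ x =
      -∫ x, f' (m n x) * M n x * φ x := by
    filter_upwards [hder] with n hn
    have h1 := integral_mul_partialDeriv (F := fun x => f (m n x))
      (hf1.comp ((hms n).of_le (by exact_mod_cast le_top))) hφ.isC1Test j
    rw [h1]
    congr 1
    refine integral_congr_ae (.of_forall fun x => ?_)
    by_cases hx : x ∈ tsupport φ
    · have := ((hf (m n x)).comp_hasFDerivAt x
        ((hms n).differentiable (by simp) x).hasFDerivAt).fderiv
      simp only
      rw [← hn x hx, partialDeriv]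
      change fderiv ℝ (f ∘ m n) x _ * _ = _
      rw [this]
      rfl
    · simp [image_eq_zero_of_notMem_tsupport hx]
  have t1 : Tendsto (fun n => ∫ x, f (m n x) * partialDeriv j φ x) atTop
      (𝓝 (∫ x, f (p x) * partialDeriv j φ x)) := by
    have hi : ∀ {u : E d → ℝ}, Integrable u → Integrable fun x => f (u x) * partialDeriv j φ x := by
      intro u hu
      have : Integrable fun x => f 0 * partialDeriv j φ x :=
        ((hφ.continuous_partialDeriv j).integrable_of_hasCompactSupport
          (hφ.hasCompactSupport_partialDeriv j)).const_mul _
      have h2 : Integrable fun x => (f (u x) - f 0) * partialDeriv j φ x := by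
        refine (hu.abs.const_mul (K * c')).mono' (((hfc.comp_aestronglyMeasurable hu.1).sub
          aestronglyMeasurable_const).mul hφm') (.of_forall fun x => ?_)
        rw [norm_mul, mul_right_comm]
        refine mul_le_mul ?_ (hc' x) (norm_nonneg _) (by positivity)
        simpa using hlip (u x) 0
      refine (h2.add this).congr (.of_forall fun x => ?_)
      simp only [Pi.add_apply]
      ring
    rw [tendsto_iff_norm_sub_tendsto_zero]
    refine squeeze_zero (fun _ => norm_nonneg _) (g := fun n => K * c' * ∫ x, |m n x - p x|)
      (fun n => ?_) (by simpa using (tendsto_mollify_L1 hp).const_mul (K * c'))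
    rw [← integral_sub (hi (hmi n)) (hi hp), ← integral_const_mul]
    refine norm_integral_le_of_norm_le (((hmi n).sub hp).abs.const_mul _) (.of_forall fun x => ?_)
    rw [← sub_mul, norm_mul, mul_right_comm]
    exact mul_le_mul (hlip _ _) (hc' x) (norm_nonneg _) (by positivity)
  have t2 : Tendsto (fun n => ∫ x, f' (m n x) * M n x * φ x) atTop
      (𝓝 (∫ x, f' (p x) * P x * φ x)) := by
    have hi : ∀ {u v : E d → ℝ}, AEStronglyMeasurable u volume → Integrable v →
        Integrable fun x => f' (u x) * v x * φ x := by
      intro u v hu hv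
      refine (hv.abs.const_mul (K * c)).mono' (((hf'.comp_aestronglyMeasurable hu).mul hv.1).mul
        hφm) (.of_forall fun x => ?_)
      rw [norm_mul, norm_mul, mul_right_comm]
      exact mul_le_mul_of_nonneg_right (mul_le_mul (hK _) (hc x) (norm_nonneg _) hK0) (norm_nonneg _)
    have a : Tendsto (fun n => ∫ x, f' (m n x) * P x * φ x) atTop
        (𝓝 (∫ x, f' (p x) * P x * φ x)) := by
      refine tendsto_integral_of_dominated_convergence (fun x => K * c * |P x|)
        (fun n => (hi (hmi n).1 hP).1) (hP.abs.const_mul _) (fun n => .of_forall fun x => ?_) ?_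
      · rw [norm_mul, norm_mul, mul_right_comm]
        exact mul_le_mul_of_nonneg_right (mul_le_mul (hK _) (hc x) (norm_nonneg _) hK0)
          (norm_nonneg _)
      · filter_upwards [ae_tendsto_mollify hp.locallyIntegrable] with x hx
        exact (((hf'.tendsto _).comp hx).mul_const _).mul_const _
    have b : Tendsto (fun n => (∫ x, f' (m n x) * M n x * φ x) - ∫ x, f' (m n x) * P x * φ x) atTop
        (𝓝 0) := by
      rw [tendsto_zero_iff_norm_tendsto_zero]
      refine squeeze_zero (fun _ => norm_nonneg _) (g := fun n => K * c * ∫ x, |M n x - P x|)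
        (fun n => ?_) (by simpa using (tendsto_mollify_L1 hP).const_mul (K * c))
      rw [← integral_sub (hi (hmi n).1 (hMi n)) (hi (hmi n).1 hP), ← integral_const_mul]
      refine norm_integral_le_of_norm_le (((hMi n).sub hP).abs.const_mul _)
        (.of_forall fun x => ?_)
      rw [← sub_mul, ← mul_sub, norm_mul, norm_mul, mul_right_comm]
      exact mul_le_mul_of_nonneg_right (mul_le_mul (hK _) (hc x) (norm_nonneg _) hK0)
        (norm_nonneg _)
    simpa using b.add a
  exact tendsto_nhds_unique (t1.congr' e) t2.neg

/-! ### First derivatives are in `L⁴` -/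

/-- Fatou's lemma as κ → 0. The regularized quotient is at most f²/κ, so it can be integrated before
anything is known about the fourth power. -/
theorem lpBd_four_of_regularized {α : Type*} [MeasurableSpace α] {μ : Measure α} {f : α → ℝ} {B : ℝ}
    (hB : 0 ≤ B) (hf : AEStronglyMeasurable f μ)
    (h : ∀ κ > 0, Integrable (fun x => f x ^ 4 / (1 + κ * f x ^ 2)) μ ∧
      ∫ x, f x ^ 4 / (1 + κ * f x ^ 2) ∂μ ≤ B ^ 4) : LpBd μ 4 f B := by
  refine ⟨hf, ?_⟩
  have h1 : ∫⁻ x, ENNReal.ofReal (f x ^ 4) ∂μ ≤ ENNReal.ofReal (B ^ 4) := by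
    let κ : ℕ → ℝ := fun n => 1 / (n + 1)
    have hκ : ∀ n, 0 < κ n := fun n => by positivity
    have hlim : ∀ x, Tendsto (fun n => ENNReal.ofReal (f x ^ 4 / (1 + κ n * f x ^ 2))) atTop
        (𝓝 (ENNReal.ofReal (f x ^ 4))) := fun x => by
      refine (ENNReal.continuous_ofReal.tendsto _).comp ?_
      have : Tendsto (fun n => 1 + κ n * f x ^ 2) atTop (𝓝 (1 + 0 * f x ^ 2)) :=
        (tendsto_one_div_add_atTop_nhds_zero_nat.mul_const _).const_add _
      have h2 := (tendsto_const_nhds (x := f x ^ 4)).div this (by simp)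
      rw [zero_mul, add_zero, div_one] at h2
      exact h2
    calc ∫⁻ x, ENNReal.ofReal (f x ^ 4) ∂μ
        = ∫⁻ x, liminf (fun n => ENNReal.ofReal (f x ^ 4 / (1 + κ n * f x ^ 2))) atTop ∂μ :=
          lintegral_congr fun x => (hlim x).liminf_eq.symm
      _ ≤ liminf (fun n => ∫⁻ x, ENNReal.ofReal (f x ^ 4 / (1 + κ n * f x ^ 2)) ∂μ) atTop :=
          lintegral_liminf_le' fun n => (h _ (hκ n)).1.1.aemeasurable.ennreal_ofReal
      _ ≤ ENNReal.ofReal (B ^ 4) := by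
          refine liminf_le_of_le (by isBoundedDefault) fun b hb => ?_
          obtain ⟨n, hn⟩ := hb.exists
          refine hn.trans ?_
          rw [← ofReal_integral_eq_lintegral_ofReal (h _ (hκ n)).1 (.of_forall fun x => by
            have := (hκ n).le
            simp only [Pi.zero_apply]
            positivity)]
          exact ENNReal.ofReal_le_ofReal (h _ (hκ n)).2
  rw [eLpNorm_eq_lintegral_rpow_enorm_toReal (by norm_num) (by norm_num)]
  have e : ∀ x, ‖f x‖ₑ ^ (4 : ℝ≥0∞).toReal = ENNReal.ofReal (f x ^ 4) := fun x => by
    rw [Real.enorm_eq_ofReal_abs, show (4 : ℝ≥0∞).toReal = ((4 : ℕ) : ℝ) by norm_num,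
      ENNReal.rpow_natCast, ← ENNReal.ofReal_pow (abs_nonneg _)]
    congr 1
    exact Even.pow_abs (by decide) _
  simp only [e]
  refine (ENNReal.rpow_le_rpow h1 (by positivity)).trans (le_of_eq ?_)
  rw [show (1 / (4 : ℝ≥0∞).toReal) = (1 / 4 : ℝ) by norm_num, ENNReal.ofReal_pow hB,
    ← ENNReal.rpow_natCast, ← ENNReal.rpow_mul]
  norm_num

theorem integrable_of_lpBd_two (hDb : Bornology.IsBounded D) (hD : IsOpen D) {f : E d → ℝ} {c : ℝ}
    (hf : LpBd volume 2 (D.indicator f) c) : Integrable (D.indicator f) := by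
  have : IsFiniteMeasure ((volume : Measure (E d)).restrict D) :=
    ⟨by simpa using hDb.measure_lt_top⟩
  rw [integrable_indicator_iff hD.measurableSet]
  have h := (hf.restrict D).memLp.integrable (by norm_num)
  exact h.congr (indicator_ae_eq_restrict hD.measurableSet)

/-- Formally ∫ p⁴ = ∫ ∂ⱼU p³ = −3 ∫ U p² ∂ⱼp ≤ 3 ‖U‖_∞ ‖p‖₄² ‖∂ⱼp‖₂ with p = ∂ⱼU, and one factor
‖p‖₄² cancels. There is no boundary term because U vanishes on ∂D. The bound is linear in ‖w‖ for a
given sup bound, which is what the growth estimate for the force needs. -/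
theorem W.lpBd_four_c1 (hDb : Bornology.IsBounded D) (hD : IsOpen D) (w : W D) (i j : Fin d)
    {M : ℝ} (hM0 : 0 ≤ M) (hM : ∀ᵐ x, |comp0 w i x| ≤ M) :
    LpBd volume 4 (comp1 w i j) (√(3 * M * ‖w‖)) := by
  set U := comp0 w i with hU
  set p := comp1 w i j with hp
  set P := comp2 w i j j with hP
  have bU := W.lpBd_c0 hD w i
  have bp := W.lpBd_c1 hD w i j
  have bP := W.lpBd_c2 hD w i j j
  have ip : Integrable p := integrable_of_lpBd_two hDb hD bp
  have iP : Integrable P := integrable_of_lpBd_two hDb hD bP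
  refine lpBd_four_of_regularized (Real.sqrt_nonneg _) bp.1 fun κ hκ => ?_
  have hden : ∀ s : ℝ, 0 < 1 + κ * s ^ 2 := fun s => by positivity
  -- A replacement for the cube with linear growth and bounded derivative, so that f(p) is in L² and
  -- the chain rule applies.
  let f : ℝ → ℝ := fun s => s ^ 3 / (1 + κ * s ^ 2)
  let f' : ℝ → ℝ := fun s => s ^ 2 * (3 + κ * s ^ 2) / (1 + κ * s ^ 2) ^ 2
  have hf : ∀ s, HasDerivAt f (f' s) s := fun s => by
    have h2 : HasDerivAt (fun s : ℝ => 1 + κ * s ^ 2) (κ * (2 * s)) s := by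
      simpa using ((hasDerivAt_pow 2 s).const_mul κ).const_add 1
    have h3 : HasDerivAt (fun s : ℝ => s ^ 3) (3 * s ^ 2) s := by simpa using hasDerivAt_pow 3 s
    refine (h3.div h2 (hden s).ne').congr_deriv ?_
    simp only [f']
    congr 1
    ring
  have hfc : Continuous f := continuous_iff_continuousAt.2 fun s => (hf s).continuousAt
  have hf'c : Continuous f' := by
    refine Continuous.div (by fun_prop) (by fun_prop) fun s => (pow_pos (hden s) 2).ne'
  have hf'n : ∀ s, 0 ≤ f' s := fun s => by
    have := hden s
    simp only [f']
    positivity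
  have hf'3 : ∀ s, f' s * (1 + κ * s ^ 2) ≤ 3 * s ^ 2 := fun s => by
    have := hden s
    simp only [f']
    rw [div_mul_eq_mul_div, div_le_iff₀ (by positivity)]
    have : 0 ≤ κ * s ^ 2 := by positivity
    have h4 : 0 ≤ s ^ 2 * (1 + κ * s ^ 2) := by positivity
    nlinarith [mul_nonneg h4 this]
  have hf'b : ∀ s, |f' s| ≤ 3 / κ := fun s => by
    rw [abs_of_nonneg (hf'n s), le_div_iff₀ hκ]
    by_contra! hcon
    have := hf'3 s
    nlinarith [sq_nonneg s, hf'n s, mul_nonneg (sq_nonneg s) (sub_nonneg.2 hcon.le)]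
  have hfb : ∀ s, |f s| ≤ |1 / κ * s| := fun s => by
    simp only [f]
    rw [abs_div, abs_of_pos (hden s), div_le_iff₀ (hden s), abs_mul,
      abs_of_pos (show 0 < 1 / κ by positivity), abs_pow, ← sq_abs s]
    field_simp
    nlinarith [abs_nonneg s]
  have bf : LpBd volume 2 (fun x => f (p x)) (|1 / κ| * ‖w‖) :=
    LpBd.of_abs_le (hfc.comp_aestronglyMeasurable bp.1) (bp.const_mul (1 / κ))
      (.of_forall fun x => hfb _)
  have bf' : LpBd volume ⊤ (fun x => f' (p x)) (3 / κ) :=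
    LpBd.of_ae_bound (hf'c.comp_aestronglyMeasurable bp.1) (.of_forall fun x => hf'b _)
  have bf'P : LpBd volume 2 (fun x => f' (p x) * P x) (3 / κ * ‖w‖) :=
    bf'.mul (hpqr := inferInstance) (by positivity) bP
  set Y := ∫ x, p x * f (p x) with hY
  have hYi : Integrable (fun x => p x * f (p x)) :=
    (bp.pairing (norm_nonneg _) (by positivity) bf).1
  -- integration by parts
  have key : Y = -∫ x, f' (p x) * P x * U x := by
    rw [← sub_eq_zero, sub_neg_eq_add, ← abs_eq_zero]
    refine le_antisymm (le_of_forall_pos_le_add fun c hc => ?_) (abs_nonneg _)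
    set A := |1 / κ| * ‖w‖ + 3 / κ * ‖w‖
    have hA : 0 ≤ A := by positivity
    obtain ⟨Φ, hΦ, hΦ0, hΦ1⟩ := W.exists_test_near hD w (η := c / (A + 1)) (by positivity)
    -- The chain rule is applied to the exact p = ∂ⱼU; only the factor U and the single factor p
    -- outside f are replaced by a test function and its derivative.
    have e := (W.weakD_c1 hD w i j j).integral_comp hD ip iP hf hf'c hf'b (hΦ i)
    have bΦ0 := (hΦ i).1.continuous.memLp_of_hasCompactSupport (p := 2)
      (μ := (volume : Measure (E d))) (hΦ i).2.1
    have bΦ1 := ((hΦ i).continuous_partialDeriv j).memLp_of_hasCompactSupport (p := 2)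
      (μ := (volume : Measure (E d))) ((hΦ i).hasCompactSupport_partialDeriv j)
    have a1 := (hΦ1 i j).pairing (by positivity) (by positivity) bf
    have a2 := bf'P.pairing (by positivity) (by positivity) (hΦ0 i)
    have i1 : Integrable fun x => partialDeriv j (Φ i) x * f (p x) :=
      (MemLp.lpBd bΦ1).pairing (by positivity) (by positivity) bf |>.1
    have i2 : Integrable fun x => f' (p x) * P x * Φ i x :=
      bf'P.pairing (by positivity) (by positivity) (MemLp.lpBd bΦ0) |>.1
    have i3 : Integrable fun x => f' (p x) * P x * U x :=
      bf'P.pairing (by positivity) (by positivity) bU |>.1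
    have a1' := a1.2.2
    have a2' := a2.2.2
    simp only [sub_mul, mul_sub] at a1' a2'
    rw [integral_sub hYi i1] at a1'
    rw [integral_sub i3 i2] at a2'
    simp only [mul_comm (f _)] at e
    rw [← hY] at a1'
    have : |Y + ∫ x, f' (p x) * P x * U x| ≤ c / (A + 1) * A := by
      rw [show c / (A + 1) * A = c / (A + 1) * (|1 / κ| * ‖w‖) + 3 / κ * ‖w‖ * (c / (A + 1)) by
        simp only [A]; ring]
      rw [abs_le] at a1' a2' ⊢
      constructor <;> linarith [a1'.1, a1'.2, a2'.1, a2'.2]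
    refine this.trans ?_
    rw [zero_add, div_mul_eq_mul_div, div_le_iff₀ (by positivity)]
    nlinarith
  have hpf : ∀ s, s * f s = s ^ 4 / (1 + κ * s ^ 2) := fun s => by simp only [f]; ring
  -- This closes the argument: it gives ‖f'(p)‖₂ ≤ 3√Y, hence Y ≤ 3√Y ‖w‖ M by Cauchy–Schwarz, and
  -- √Y can be divided out.
  have hsq : ∀ s, f' s ^ 2 ≤ 9 * (s * f s) := fun s => by
    have h1 := hf'3 s
    have h2 := hden s
    rw [hpf, ← mul_div_assoc, le_div_iff₀ h2]
    have h4 : f' s ^ 2 * (1 + κ * s ^ 2) ≤ f' s ^ 2 * (1 + κ * s ^ 2) ^ 2 := by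
      have : 0 ≤ κ * s ^ 2 := by positivity
      exact mul_le_mul_of_nonneg_left (by nlinarith) (sq_nonneg _)
    have h5 : (f' s * (1 + κ * s ^ 2)) ^ 2 ≤ (3 * s ^ 2) ^ 2 :=
      pow_le_pow_left₀ (mul_nonneg (hf'n s) h2.le) h1 2
    nlinarith
  have hY0 : 0 ≤ Y := integral_nonneg fun x => by
    have := hden (p x)
    simp only [hpf, Pi.zero_apply]
    positivity
  have bsq : LpBd volume 2 (fun x => f' (p x)) (3 * √Y) := by
    rw [lpBd_two_iff (by positivity) (hf'c.comp_aestronglyMeasurable bp.1)]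
    have hi : Integrable fun x => f' (p x) ^ 2 :=
      (hYi.const_mul 9).mono' ((hf'c.comp_aestronglyMeasurable bp.1).pow 2)
        (.of_forall fun x => by
          rw [Real.norm_of_nonneg (sq_nonneg _)]
          exact hsq _)
    refine ⟨hi, (integral_mono hi (hYi.const_mul 9) fun x => hsq _).trans ?_⟩
    rw [integral_const_mul, mul_pow, Real.sq_sqrt hY0]
    norm_num
    rfl
  have bPU : LpBd volume 2 (fun x => P x * U x) (‖w‖ * M) :=
    ((LpBd.of_ae_bound bU.1 hM).mul (hpqr := inferInstance) (r := 2) hM0 bP).congr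
      (.of_forall fun x => mul_comm _ _) |>.mono (by rw [mul_comm])
  have hle : Y ≤ 3 * √Y * (‖w‖ * M) := by
    have := (bsq.pairing (by positivity) (by positivity) bPU).2.2
    rw [key]
    refine (neg_le_abs _).trans ?_
    rw [← key]
    simpa only [mul_assoc] using this
  have hfin : Y ≤ (3 * M * ‖w‖) ^ 2 := by
    have h1 : √Y ≤ 3 * M * ‖w‖ := by
      by_contra! hcon
      have h2 : 0 < √Y := lt_of_le_of_lt (by positivity) hcon
      have h3 := Real.mul_self_sqrt hY0
      nlinarith
    calc Y = √Y ^ 2 := (Real.sq_sqrt hY0).symm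
      _ ≤ _ := pow_le_pow_left₀ (Real.sqrt_nonneg _) h1 2
  simp only [← hpf]
  refine ⟨hYi, hfin.trans (le_of_eq ?_)⟩
  rw [show (√(3 * M * ‖w‖)) ^ 4 = ((√(3 * M * ‖w‖)) ^ 2) ^ 2 by ring,
    Real.sq_sqrt (by positivity)]

end Peridynamics

end

/-! ### Potential theory for the sup bound -/

noncomputable section

open scoped ENNReal NNReal

namespace Peridynamics

variable {d : ℕ} {D : Set (E d)}

/-! ### A regularized fundamental solution of the Laplacian -/

/-- A positive multiple of the regularized fundamental solution, with pole `x₀`, up to a constant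
that makes it nonnegative in the ball of radius `R`. -/
def barrier (R δ : ℝ) (x₀ x : E d) : ℝ :=
  1 / 2 * ∫ τ in (‖x - x₀‖ ^ 2)..(R ^ 2), (|τ| + δ) ^ (-(d : ℝ) / 2)

/-- The partial derivatives of `barrier`. -/
def barrierGrad (δ : ℝ) (x₀ : E d) (j : Fin d) (x : E d) : ℝ :=
  -(‖x - x₀‖ ^ 2 + δ) ^ (-(d : ℝ) / 2) * (x - x₀) j

/-- The negative of the Laplacian of `barrier`. -/
def barrierDens (δ : ℝ) (x₀ x : E d) : ℝ :=
  d * δ * (‖x - x₀‖ ^ 2 + δ) ^ (-(d : ℝ) / 2 - 1)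

theorem partialDeriv_of_hasFDerivAt {f : E d → ℝ} {f' : E d →L[ℝ] ℝ} {x : E d}
    (h : HasFDerivAt f f' x) (j : Fin d) : partialDeriv j f x = f' (EuclideanSpace.single j 1) := by
  rw [partialDeriv, h.fderiv]

theorem hasFDerivAt_norm_sub_sq (x₀ x : E d) :
    HasFDerivAt (fun x => ‖x - x₀‖ ^ 2) ((2 : ℝ) • innerSL ℝ (x - x₀)) x := by
  refine ((hasFDerivAt_id x).sub_const x₀).norm_sq.congr_fderiv ?_
  ext v
  simp

theorem continuous_barrier_integrand {δ : ℝ} (hδ : 0 < δ) :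
    Continuous fun τ : ℝ => (|τ| + δ) ^ (-(d : ℝ) / 2) := by
  refine Continuous.rpow_const (by fun_prop) fun τ => Or.inl ?_
  positivity

theorem hasFDerivAt_barrier (R : ℝ) {δ : ℝ} (hδ : 0 < δ) (x₀ x : E d) :
    HasFDerivAt (barrier R δ x₀)
      ((-(‖x - x₀‖ ^ 2 + δ) ^ (-(d : ℝ) / 2)) • innerSL ℝ (x - x₀)) x := by
  have hc := continuous_barrier_integrand (d := d) hδ
  have h1 : HasDerivAt (fun u => ∫ τ in u..(R ^ 2), (|τ| + δ) ^ (-(d : ℝ) / 2))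
      (-(|‖x - x₀‖ ^ 2| + δ) ^ (-(d : ℝ) / 2)) (‖x - x₀‖ ^ 2) :=
    intervalIntegral.integral_hasDerivAt_left (hc.intervalIntegrable _ _)
      (hc.stronglyMeasurableAtFilter _ _) hc.continuousAt
  have h2 := (h1.comp_hasFDerivAt x (hasFDerivAt_norm_sub_sq x₀ x)).const_mul (1 / 2)
  rw [abs_of_nonneg (by positivity)] at h2
  refine h2.congr_fderiv ?_
  rw [smul_smul, smul_smul]
  congr 1
  ring

theorem contDiff_barrier_factor {δ : ℝ} (hδ : 0 < δ) (x₀ : E d) (r : ℝ) :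
    ContDiff ℝ 1 fun x : E d => (‖x - x₀‖ ^ 2 + δ) ^ r := by
  refine ContDiff.rpow_const_of_ne ?_ fun x => by positivity
  exact ((contDiff_id.sub contDiff_const).norm_sq ℝ).add contDiff_const

theorem contDiff_barrier (R : ℝ) {δ : ℝ} (hδ : 0 < δ) (x₀ : E d) :
    ContDiff ℝ 1 (barrier R δ x₀) := by
  rw [contDiff_one_iff_fderiv]
  refine ⟨fun x => (hasFDerivAt_barrier R hδ x₀ x).differentiableAt, ?_⟩
  rw [funext fun x => (hasFDerivAt_barrier R hδ x₀ x).fderiv]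
  exact ((contDiff_barrier_factor hδ x₀ _).continuous.neg).smul
    ((innerSL ℝ).continuous.comp (continuous_id.sub continuous_const))

theorem partialDeriv_barrier (R : ℝ) {δ : ℝ} (hδ : 0 < δ) (x₀ x : E d) (j : Fin d) :
    partialDeriv j (barrier R δ x₀) x = barrierGrad δ x₀ j x := by
  rw [partialDeriv_of_hasFDerivAt (hasFDerivAt_barrier R hδ x₀ x), barrierGrad]
  simp [EuclideanSpace.inner_single_right]

theorem contDiff_barrierGrad {δ : ℝ} (hδ : 0 < δ) (x₀ : E d) (j : Fin d) :
    ContDiff ℝ 1 (barrierGrad δ x₀ j) := by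
  refine ((contDiff_barrier_factor hδ x₀ _).neg).mul ?_
  exact (EuclideanSpace.proj (𝕜 := ℝ) j).contDiff.comp (contDiff_id.sub contDiff_const)

/-- With s = |x − x₀|² the sum is d s (s+δ)^{-d/2-1} − d (s+δ)^{-d/2}, in which only the part
carrying δ survives. Its negative is positive and concentrates at x₀ on the scale √δ. -/
theorem sum_partialDeriv_barrierGrad {δ : ℝ} (hδ : 0 < δ) (x₀ x : E d) :
    ∑ j, partialDeriv j (barrierGrad δ x₀ j) x = -barrierDens δ x₀ x := by
  set s := ‖x - x₀‖ ^ 2 with hs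
  have hs0 : 0 < s + δ := by positivity
  have h : ∀ j, partialDeriv j (barrierGrad δ x₀ j) x =
      (d : ℝ) * (s + δ) ^ (-(d : ℝ) / 2 - 1) * (x - x₀) j ^ 2 - (s + δ) ^ (-(d : ℝ) / 2) := by
    intro j
    have h1 := ((hasFDerivAt_norm_sub_sq x₀ x).add_const δ)
    have h2 : HasDerivAt (fun y : ℝ => -y ^ (-(d : ℝ) / 2))
        (-(-(d : ℝ) / 2 * (s + δ) ^ (-(d : ℝ) / 2 - 1))) (s + δ) :=
      (Real.hasDerivAt_rpow_const (Or.inl hs0.ne')).neg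
    have h3 := h2.comp_hasFDerivAt x h1
    have h4 := h3.mul ((EuclideanSpace.proj (𝕜 := ℝ) j).hasFDerivAt.comp x
      ((hasFDerivAt_id x).sub_const x₀))
    have h5 := partialDeriv_of_hasFDerivAt h4 j
    change partialDeriv j (barrierGrad δ x₀ j) x = _ at h5
    rw [h5]
    simp [EuclideanSpace.inner_single_right]
    ring
  simp only [h]
  rw [Finset.sum_sub_distrib, ← Finset.mul_sum, barrierDens, ← hs]
  have e : ∑ j, (x - x₀) j ^ 2 = s := by rw [hs, EuclideanSpace.real_norm_sq_eq]
  have e2 : (s + δ) ^ (-(d : ℝ) / 2) = (s + δ) ^ (-(d : ℝ) / 2 - 1) * (s + δ) := by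
    rw [← Real.rpow_add_one hs0.ne']
    congr 1
    ring
  rw [e, Finset.sum_const, Finset.card_univ, Fintype.card_fin, nsmul_eq_mul, e2]
  ring

theorem barrier_nonneg {R δ : ℝ} (hδ : 0 < δ) {x₀ x : E d} (hx : ‖x - x₀‖ ≤ R) :
    0 ≤ barrier R δ x₀ x := by
  refine mul_nonneg (by norm_num) (intervalIntegral.integral_nonneg ?_ fun τ _ => by positivity)
  exact pow_le_pow_left₀ (norm_nonneg _) hx 2

/-- Writing τ^{-d/2} = τ^{(3-d)/4} τ^{-β} and bounding the first factor by its value at R², where d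
≤ 3 is used, treats both dimensions at once: for d = 3 this is the Newtonian potential, for d = 2
the logarithm is replaced by a power. The square of the resulting power is |x − x₀|^{-(d-1)}, which
is locally integrable. -/
theorem barrier_le (hd : d = 2 ∨ d = 3) {R δ : ℝ} (hδ : 0 < δ) {x₀ x : E d}
    (hx : ‖x - x₀‖ ≤ R) (hx0 : x ≠ x₀) :
    barrier R δ x₀ x ≤
      2 / ((d : ℝ) - 1) * R ^ ((3 - (d : ℝ)) / 2) * ‖x - x₀‖ ^ (-((d : ℝ) - 1) / 2) := by
  have hd1 : 2 ≤ (d : ℝ) := by rcases hd with rfl | rfl <;> norm_num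
  have hd3 : (d : ℝ) ≤ 3 := by rcases hd with rfl | rfl <;> norm_num
  set r := ‖x - x₀‖ with hr
  have hr0 : 0 < r := norm_pos_iff.2 (sub_ne_zero.2 hx0)
  have hR0 : 0 < R := hr0.trans_le hx
  have hrR : r ^ 2 ≤ R ^ 2 := pow_le_pow_left₀ hr0.le hx 2
  set β : ℝ := ((d : ℝ) + 3) / 4 with hβ
  have h0 : (0 : ℝ) ∉ uIcc (r ^ 2) (R ^ 2) := by
    rw [uIcc_of_le hrR]
    exact fun h => (lt_of_lt_of_le (by positivity) h.1).false
  have hint : IntervalIntegrable (fun τ : ℝ => (R ^ 2) ^ ((3 - (d : ℝ)) / 4) * τ ^ (-β))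
      volume (r ^ 2) (R ^ 2) :=
    (intervalIntegral.intervalIntegrable_rpow (Or.inr h0)).const_mul _
  have h1 : ∫ τ in (r ^ 2)..(R ^ 2), (|τ| + δ) ^ (-(d : ℝ) / 2) ≤
      ∫ τ in (r ^ 2)..(R ^ 2), (R ^ 2) ^ ((3 - (d : ℝ)) / 4) * τ ^ (-β) := by
    refine intervalIntegral.integral_mono_on hrR
      ((continuous_barrier_integrand hδ).intervalIntegrable _ _) hint fun τ hτ => ?_
    have hτ0 : 0 < τ := lt_of_lt_of_le (by positivity) hτ.1
    rw [abs_of_pos hτ0]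
    calc (τ + δ) ^ (-(d : ℝ) / 2) ≤ τ ^ (-(d : ℝ) / 2) :=
          Real.rpow_le_rpow_of_nonpos hτ0 (by linarith) (by linarith)
      _ = τ ^ ((3 - (d : ℝ)) / 4) * τ ^ (-β) := by
          rw [← Real.rpow_add hτ0]
          congr 1
          rw [hβ]; ring
      _ ≤ _ := mul_le_mul_of_nonneg_right (Real.rpow_le_rpow hτ0.le hτ.2 (by linarith))
          (by positivity)
  have h2 : ∫ τ in (r ^ 2)..(R ^ 2), τ ^ (-β) ≤ 4 / ((d : ℝ) - 1) * (r ^ 2) ^ (-β + 1) := by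
    rw [integral_rpow (Or.inr ⟨by rw [hβ]; intro h; linarith, h0⟩)]
    have : -β + 1 = -((d : ℝ) - 1) / 4 := by rw [hβ]; ring
    rw [this]
    have hR : 0 ≤ (R ^ 2) ^ (-((d : ℝ) - 1) / 4) := by positivity
    have hd' : 0 < (d : ℝ) - 1 := by linarith
    rw [show ∀ a b : ℝ, (a - b) / (-((d : ℝ) - 1) / 4) = 4 / ((d : ℝ) - 1) * (b - a) by
      intro a b; field_simp; ring]
    exact mul_le_mul_of_nonneg_left (by linarith) (by positivity)
  rw [intervalIntegral.integral_const_mul] at h1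
  have e1 : (R ^ 2) ^ ((3 - (d : ℝ)) / 4) = R ^ ((3 - (d : ℝ)) / 2) := by
    rw [← Real.rpow_natCast, ← Real.rpow_mul hR0.le]
    congr 1
    push_cast
    ring
  have e2 : (r ^ 2) ^ (-β + 1) = r ^ (-((d : ℝ) - 1) / 2) := by
    rw [← Real.rpow_natCast, ← Real.rpow_mul hr0.le]
    congr 1
    rw [hβ]
    push_cast
    ring
  rw [e1] at h1
  rw [e2] at h2
  rw [barrier, ← hr]
  have h3 := h1.trans (mul_le_mul_of_nonneg_left h2 (by positivity))
  calc _ ≤ 1 / 2 * (R ^ ((3 - (d : ℝ)) / 2) *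
      (4 / ((d : ℝ) - 1) * r ^ (-((d : ℝ) - 1) / 2))) :=
        mul_le_mul_of_nonneg_left h3 (by norm_num)
    _ = _ := by ring

/-- Powers of the norm that are integrable near the origin. -/
theorem integrableOn_norm_rpow (hd : 1 ≤ d) {β : ℝ} (hβ : β < d) {R : ℝ} :
    IntegrableOn (fun x : E d => ‖x‖ ^ (-β)) (Metric.ball 0 R) := by
  rcases le_or_gt R 0 with hR | hR
  · rw [Metric.ball_eq_empty.2 hR]
    exact integrableOn_empty
  have : Nontrivial (E d) := by
    have : Nonempty (Fin d) := ⟨⟨0, hd⟩⟩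
    infer_instance
  rw [integrableOn_fun_norm_addHaar volume (f := fun r => r ^ (-β))]
  have : IntegrableOn (fun x : ℝ => x ^ ((d : ℝ) - 1 - β)) (Ioo 0 R) :=
    (intervalIntegral.integrableOn_Ioo_rpow_iff hR).2 (by linarith)
  refine this.congr_fun (fun y hy => ?_) measurableSet_Ioo
  simp only [smul_eq_mul, finrank_euclideanSpace, Fintype.card_fin]
  rw [← Real.rpow_natCast, ← Real.rpow_add hy.1, Nat.cast_sub hd]
  congr 1
  push_cast
  ring

/-- The point is uniformity in the pole and in δ: the majorant is a translate of a fixed integrable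
function, cut off at a radius R that exceeds all distances in D. -/
theorem exists_lpBd_barrier (hd : d = 2 ∨ d = 3) (hD : IsOpen D) {R : ℝ}
    (hR : ∀ x ∈ D, ∀ y ∈ D, ‖x - y‖ < R) :
    ∃ B, 0 ≤ B ∧ ∀ x₀ ∈ D, ∀ δ > 0, LpBd volume 2 (D.indicator (barrier R δ x₀)) B := by
  have hd1 : 1 ≤ d := by omega
  set C := 2 / ((d : ℝ) - 1) * R ^ ((3 - (d : ℝ)) / 2)
  have hβ : (d : ℝ) - 1 < d := by linarith
  have hint := integrableOn_norm_rpow hd1 hβ (R := R)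
  set I := ∫ x in Metric.ball (0 : E d) R, ‖x‖ ^ (-((d : ℝ) - 1)) with hI
  have hI0 : 0 ≤ I := integral_nonneg fun x => by positivity
  refine ⟨√(C ^ 2 * I), Real.sqrt_nonneg _, fun x₀ hx₀ δ hδ => ?_⟩
  have hm : AEStronglyMeasurable (D.indicator (barrier R δ x₀)) volume :=
    (contDiff_barrier R hδ x₀).continuous.aestronglyMeasurable.indicator hD.measurableSet
  rw [lpBd_two_iff (Real.sqrt_nonneg _) hm, Real.sq_sqrt (by positivity)]
  let g : E d → ℝ := (Metric.ball (0 : E d) R).indicator fun x => ‖x‖ ^ (-((d : ℝ) - 1))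
  have hg : Integrable g := (integrable_indicator_iff measurableSet_ball).2 hint
  have hg' : Integrable fun x => C ^ 2 * g (x - x₀) := (hg.comp_sub_right x₀).const_mul _
  have hle : ∀ᵐ x, D.indicator (barrier R δ x₀) x ^ 2 ≤ C ^ 2 * g (x - x₀) := by
    have : Nontrivial (E d) := by
      have : Nonempty (Fin d) := ⟨⟨0, hd1⟩⟩
      infer_instance
    have hne : ∀ᵐ x : E d, x ≠ x₀ := by
      simp [ae_iff]
    filter_upwards [hne] with x hx
    have hg0 : 0 ≤ g (x - x₀) := indicator_nonneg (fun _ _ => by positivity) _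
    by_cases hxD : x ∈ D
    · have hlt := hR x hxD x₀ hx₀
      rw [indicator_of_mem hxD]
      simp only [g]
      rw [indicator_of_mem (by simpa using hlt)]
      have h1 := barrier_le hd hδ hlt.le hx
      have h2 := pow_le_pow_left₀ (barrier_nonneg hδ hlt.le) h1 2
      refine h2.trans (le_of_eq ?_)
      rw [mul_pow]
      congr 1
      rw [← Real.rpow_natCast (‖x - x₀‖ ^ _), ← Real.rpow_mul (norm_nonneg _)]
      congr 1
      push_cast
      ring
    · rw [indicator_of_notMem hxD]
      simpa using mul_nonneg (sq_nonneg C) hg0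
  have hi : Integrable fun x => D.indicator (barrier R δ x₀) x ^ 2 :=
    hg'.mono' (hm.pow 2) (hle.mono fun x hx => by rwa [Real.norm_of_nonneg (sq_nonneg _)])
  refine ⟨hi, (integral_mono_ae hi hg' hle).trans (le_of_eq ?_)⟩
  rw [integral_const_mul, integral_sub_right_eq_self g x₀, integral_indicator measurableSet_ball]

end Peridynamics

end

/-! ### The embedding of W into L∞ -/

noncomputable section

open scoped ENNReal NNReal

namespace Peridynamics

variable {d : ℕ} {D : Set (E d)}

/-! ### Elements of `W` are bounded -/

theorem hasDerivAt_sqrt_one_add_sq (s : ℝ) :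
    HasDerivAt (fun s : ℝ => √(1 + s ^ 2) - 1) (s / √(1 + s ^ 2)) s := by
  have h : HasDerivAt (fun s : ℝ => 1 + s ^ 2) (2 * s) s := by
    simpa using (hasDerivAt_pow 2 s).const_add 1
  refine ((h.sqrt (by positivity)).sub_const 1).congr_deriv ?_
  field_simp

theorem contDiff_sqrt_one_add_sq : ContDiff ℝ ((⊤ : ℕ∞) : WithTop ℕ∞)
    fun s : ℝ => √(1 + s ^ 2) :=
  ContDiff.sqrt (contDiff_const.add (contDiff_id.pow 2)) fun s => by positivity

theorem hasDerivAt_div_sqrt_one_add_sq (s : ℝ) :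
    HasDerivAt (fun s : ℝ => s / √(1 + s ^ 2)) (1 / (√(1 + s ^ 2) * (1 + s ^ 2))) s := by
  have h0 : 0 < √(1 + s ^ 2) := by positivity
  have h := ((hasDerivAt_id s).div ((hasDerivAt_sqrt_one_add_sq s).add_const 1)
    (by simpa using h0.ne'))
  simp only [sub_add_cancel] at h
  refine h.congr_deriv ?_
  have h2 := Real.sq_sqrt (show (0 : ℝ) ≤ 1 + s ^ 2 by positivity)
  set q := √(1 + s ^ 2)
  rw [← h2]
  field_simp
  simp only [id]
  nlinarith

theorem partialDeriv_comp {f : ℝ → ℝ} {f' : ℝ} {φ : E d → ℝ} {x : E d} (hf : HasDerivAt f f' (φ x))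
    (hφ : DifferentiableAt ℝ φ x) (j : Fin d) :
    partialDeriv j (fun x => f (φ x)) x = f' * partialDeriv j φ x :=
  partialDeriv_of_hasFDerivAt (hf.comp_hasFDerivAt x hφ.hasFDerivAt) j

theorem partialDeriv_mul {f g : E d → ℝ} {x : E d} (hf : DifferentiableAt ℝ f x)
    (hg : DifferentiableAt ℝ g x) (j : Fin d) :
    partialDeriv j (fun x => f x * g x) x =
      partialDeriv j f x * g x + f x * partialDeriv j g x := by
  rw [partialDeriv_of_hasFDerivAt (f := fun x => f x * g x)
    (hf.hasFDerivAt.mul hg.hasFDerivAt) j]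
  simp [partialDeriv]
  ring

theorem IsC1Test.comp_mul {O : Set (E d)} {φ g : E d → ℝ} {f : ℝ → ℝ} (hφ : IsC1Test O φ)
    (hf : ContDiff ℝ 1 f) (hf0 : f 0 = 0) (hg : ContDiff ℝ 1 g) :
    IsC1Test O fun x => f (φ x) * g x := by
  refine ⟨(hf.comp hφ.1).mul hg, (hφ.2.1.comp_left hf0).mul_right, ?_⟩
  exact (tsupport_mul_subset_left (f := fun x => f (φ x)) (g := g)).trans
    ((tsupport_comp_subset hf0 φ).trans hφ.2.2)

theorem memLp_indicator_continuous (hD : IsOpen D) (hDb : Bornology.IsBounded D) {f : E d → ℝ}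
    (hf : Continuous f) : MemLp (D.indicator f) 2 volume := by
  rw [memLp_indicator_iff_restrict hD.measurableSet]
  obtain ⟨C, hC⟩ := hDb.isCompact_closure.exists_bound_of_continuousOn hf.continuousOn
  have : IsFiniteMeasure ((volume : Measure (E d)).restrict D) :=
    ⟨by simpa using hDb.measure_lt_top⟩
  refine MemLp.of_bound hf.aestronglyMeasurable C ?_
  filter_upwards [ae_restrict_mem hD.measurableSet] with x hx
  exact hC x (subset_closure hx)

theorem comp0_eq_zero {w : W D} {i : Fin d} {x : E d} (hx : x ∉ D) : comp0 w i x = 0 :=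
  indicator_of_notMem hx _

theorem IsTest.eq_zero {O : Set (E d)} {φ : E d → ℝ} (hφ : IsTest O φ) {x : E d} (hx : x ∉ O) :
    φ x = 0 := image_eq_zero_of_notMem_tsupport fun h => hx (hφ.2.2 h)

set_option maxHeartbeats 1000000 in
/-- A regularized form of Kato's inequality, tested with `barrier`. -/
theorem integral_barrierDens_le (hDb : Bornology.IsBounded D) (hD : IsOpen D) {R : ℝ}
    (hR : ∀ x ∈ D, ∀ y ∈ D, ‖x - y‖ < R) {B δ : ℝ} (hB : 0 ≤ B) (hδ : 0 < δ) {x₀ : E d}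
    (hx₀ : x₀ ∈ D) (hb : LpBd volume 2 (D.indicator (barrier R δ x₀)) B) (w : W D) (i : Fin d) :
    ∫ x, (√(1 + comp0 w i x ^ 2) - 1) * barrierDens δ x₀ x ≤ d * (‖w‖ * B) := by
  let T : ℝ → ℝ := fun s => s / √(1 + s ^ 2)
  let T' : ℝ → ℝ := fun s => 1 / (√(1 + s ^ 2) * (1 + s ^ 2))
  let τ : ℝ → ℝ := fun s => √(1 + s ^ 2) - 1
  have hτ : ∀ s, HasDerivAt τ (T s) s := hasDerivAt_sqrt_one_add_sq
  have hT : ∀ s, HasDerivAt T (T' s) s := hasDerivAt_div_sqrt_one_add_sq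
  have hT'0 : ∀ s, 0 ≤ T' s := fun s => by simp only [T']; positivity
  have hT'1 : ∀ s, |T' s| ≤ 1 := fun s => by
    rw [abs_of_nonneg (hT'0 s)]
    have h1 : 1 ≤ √(1 + s ^ 2) := Real.one_le_sqrt.2 (by nlinarith)
    simp only [T']
    rw [div_le_one (by positivity)]
    nlinarith [sq_nonneg s]
  have hT1 : ∀ s, |T s| ≤ 1 := fun s => by
    simp only [T]
    rw [abs_div, abs_of_pos (show 0 < √(1 + s ^ 2) by positivity), div_le_one (by positivity)]
    exact Real.abs_le_sqrt (by linarith)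
  have hTs : ContDiff ℝ 1 T := by
    have : ContDiff ℝ 1 fun s : ℝ => √(1 + s ^ 2) :=
      contDiff_sqrt_one_add_sq.of_le (by exact_mod_cast le_top)
    exact contDiff_id.div this fun s => by positivity
  have hτs : ContDiff ℝ 1 τ :=
    (contDiff_sqrt_one_add_sq.of_le (by exact_mod_cast le_top)).sub contDiff_const
  have hT0 : T 0 = 0 := by simp [T]
  have hτ0 : τ 0 = 0 := by simp [τ]
  have hT'c : Continuous T' := by
    simp only [T']
    refine continuous_const.div (by fun_prop) fun s => by positivity
  have hτlip : ∀ s t, |τ s - τ t| ≤ |s - t| := fun s t => by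
    have := Convex.norm_image_sub_le_of_norm_hasDerivWithin_le (s := univ)
      (fun y _ => (hτ y).hasDerivWithinAt) (fun y _ => hT1 y) convex_univ (mem_univ t) (mem_univ s)
    simpa using this
  have hτU : ∀ s, √(1 + s ^ 2) - 1 = τ s := fun _ => rfl
  simp only [hτU]
  have hΓX : ∀ x j, partialDeriv j (barrier R δ x₀) x = barrierGrad δ x₀ j x :=
    fun x j => partialDeriv_barrier R hδ x₀ x j
  have hsum := sum_partialDeriv_barrierGrad hδ x₀
  have hΓnn : ∀ x ∈ D, 0 ≤ barrier R δ x₀ x := fun x hx =>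
    barrier_nonneg hδ (hR x hx x₀ hx₀).le
  clear hτU
  clear_value τ T T'
  have hΓs : ContDiff ℝ 1 (barrier R δ x₀) := contDiff_barrier R hδ x₀
  have hXs : ∀ j, ContDiff ℝ 1 (barrierGrad δ x₀ j) := contDiff_barrierGrad hδ x₀
  have hks : Continuous (barrierDens δ x₀) := continuous_const.mul (contDiff_barrier_factor hδ x₀ _).continuous
  generalize barrier R δ x₀ = Γ at *
  generalize barrierGrad δ x₀ = X at *
  generalize barrierDens δ x₀ = k at *
  have bU := W.lpBd_c0 hD w i
  have lpX := fun j => MemLp.lpBd (memLp_indicator_continuous hD hDb (hXs j).continuous)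
  have lpk := MemLp.lpBd (memLp_indicator_continuous hD hDb hks)
  obtain ⟨G, hG⟩ := hDb.isCompact_closure.exists_bound_of_continuousOn hΓs.continuous.continuousOn
  have hGD : ∀ x ∈ D, |Γ x| ≤ G := fun x hx => hG x (subset_closure hx)
  have hG0 : 0 ≤ G := (abs_nonneg _).trans (hGD x₀ hx₀)
  obtain ⟨A, hA0, lpX⟩ : ∃ A : Fin d → ℝ, (∀ j, 0 ≤ A j) ∧
      ∀ j, LpBd volume 2 (D.indicator (X j)) (A j) :=
    ⟨_, fun j => ENNReal.toReal_nonneg, lpX⟩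
  obtain ⟨Ak, hAk0, lpk⟩ : ∃ Ak : ℝ, 0 ≤ Ak ∧ LpBd volume 2 (D.indicator k) Ak :=
    ⟨_, ENNReal.toReal_nonneg, lpk⟩
  -- the estimate up to an error that is linear in the distance of the approximation
  obtain ⟨C, hC⟩ : ∃ C, C = Ak + ∑ j, (A j + G * (‖w‖ + 1)) := ⟨_, rfl⟩
  have hC0 : 0 ≤ C := by
    rw [hC]
    have : 0 ≤ ∑ j, (A j + G * (‖w‖ + 1)) :=
      Finset.sum_nonneg fun j _ => add_nonneg (hA0 j) (by positivity)
    positivity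
  -- Each replacement of U by an H¹ approximation φ costs a multiple of η. The constant C may depend
  -- on δ and w, since η tends to 0 while these are fixed; only B has to be uniform.
  have main : ∀ η, 0 < η → η ≤ 1 → ∫ x, τ (comp0 w i x) * k x ≤ d * (‖w‖ * B) + C * η := by
    intro η hη hη1
    obtain ⟨φ, φt, φ0, φ1⟩ : ∃ φ, IsTest D φ ∧ LpBd volume 2 (fun x => comp0 w i x - φ x) η ∧
        ∀ j, LpBd volume 2 (fun x => comp1 w i j x - partialDeriv j φ x) η := by
      obtain ⟨Φ, hΦ, hΦ0, hΦ1⟩ := W.exists_test_near hD w hη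
      exact ⟨Φ i, hΦ i, hΦ0 i, hΦ1 i⟩
    have φd : Differentiable ℝ φ := φt.1.differentiable (by simp)
    have φz : ∀ x ∉ D, φ x = 0 := fun x hx => φt.eq_zero hx
    have φ'z : ∀ j, ∀ x ∉ D, partialDeriv j φ x = 0 := fun j x hx => (φt.partialDeriv j).eq_zero hx
    have mT : AEStronglyMeasurable (fun x => T (φ x)) (volume : Measure (E d)) :=
      (hTs.continuous.comp φt.1.continuous).aestronglyMeasurable
    have mT' : AEStronglyMeasurable (fun x => T' (φ x)) (volume : Measure (E d)) :=
      (hT'c.comp φt.1.continuous).aestronglyMeasurable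
    have bT : LpBd volume ⊤ (fun x => T (φ x)) 1 := LpBd.of_ae_bound mT (.of_forall fun x => hT1 _)
    have bT' : LpBd volume ⊤ (fun x => T' (φ x)) 1 :=
      LpBd.of_ae_bound mT' (.of_forall fun x => hT'1 _)
    have bTX : ∀ j, LpBd volume 2 (fun x => T (φ x) * X j x) (A j) := fun j =>
      ((bT.mul (hpqr := inferInstance) zero_le_one (lpX j)).congr (.of_forall fun x => by
        by_cases hx : x ∈ D
        · simp [hx]
        · simp [hx, φz x hx, hT0])).mono (by simp)
    have bTΓ : LpBd volume 2 (fun x => T (φ x) * Γ x) B :=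
      ((bT.mul (hpqr := inferInstance) zero_le_one hb).congr (.of_forall fun x => by
        by_cases hx : x ∈ D
        · simp [hx]
        · simp [hx, φz x hx, hT0])).mono (by simp)
    have bφ' : ∀ j, LpBd volume 2 (partialDeriv j φ) (‖w‖ + 1) := fun j =>
      (((W.lpBd_c1 hD w i j).sub (by norm_num) (norm_nonneg _) hη.le (φ1 j)).congr
        (.of_forall fun x => by ring)).mono (by linarith)
    have bΓind : LpBd volume ⊤ (D.indicator Γ) G := by
      refine LpBd.of_ae_bound (hΓs.continuous.aestronglyMeasurable.indicator hD.measurableSet)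
        (.of_forall fun x => ?_)
      by_cases hx : x ∈ D
      · simpa [hx] using hGD x hx
      · simpa [hx] using hG0
    have bG : ∀ j, LpBd volume 2 (fun x => T' (φ x) * partialDeriv j φ x * Γ x) (G * (‖w‖ + 1)) :=
      fun j => (bΓind.mul (hpqr := inferInstance) (r := 2) hG0
        (bT'.mul (hpqr := inferInstance) (r := 2) zero_le_one (bφ' j))).congr
        (.of_forall fun x => by
          by_cases hx : x ∈ D
          · simp only [indicator_of_mem hx]
            ring
          · simp [hx, φ'z j x hx]) |>.mono (by rw [one_mul])
    -- replacing `U` by its approximation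
    have s1 : |∫ x, (τ (comp0 w i x) - τ (φ x)) * k x| ≤ η * Ak := by
      have h1 : LpBd volume 2 (fun x => τ (comp0 w i x) - τ (φ x)) η :=
        LpBd.of_abs_le ((hτs.continuous.comp_aestronglyMeasurable bU.1).sub
          (hτs.continuous.comp φt.1.continuous).aestronglyMeasurable) φ0
          (.of_forall fun x => hτlip _ _)
      have h2 := (h1.pairing hη.le hAk0 lpk).2.2
      convert h2 using 2
      refine integral_congr_ae (.of_forall fun x => ?_)
      by_cases hx : x ∈ D
      · simp [hx]
      · simp [hx, comp0_eq_zero hx, φz x hx]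
    have iφk : Integrable fun x => τ (φ x) * k x :=
      ((hτs.continuous.comp φt.1.continuous).mul hks).integrable_of_hasCompactSupport
        ((φt.2.1.comp_left hτ0).mul_right)
    have iUk : Integrable fun x => τ (comp0 w i x) * k x := by
      have h1 : LpBd volume 2 (fun x => τ (comp0 w i x)) ‖w‖ :=
        LpBd.of_abs_le (hτs.continuous.comp_aestronglyMeasurable bU.1) bU
          (.of_forall fun x => by simpa [hτ0] using hτlip (comp0 w i x) 0)
      refine ((h1.pairing (norm_nonneg _) hAk0 lpk).1).congr (.of_forall fun x => ?_)
      by_cases hx : x ∈ D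
      · simp [hx]
      · simp [hx, comp0_eq_zero hx, hτ0]
    -- the integrations by parts
    have τt : IsC1Test D fun x => τ (φ x) := by
      simpa using φt.isC1Test.comp_mul hτs hτ0 (contDiff_const (c := (1 : ℝ)))
    have s2 : ∫ x, τ (φ x) * k x = ∑ j, ∫ x, T (φ x) * X j x * partialDeriv j φ x := by
      have h1 : ∀ j, ∫ x, T (φ x) * X j x * partialDeriv j φ x =
          ∫ x, -(partialDeriv j (X j) x * τ (φ x)) := fun j => by
        rw [integral_neg, ← integral_mul_partialDeriv (hXs j) τt j]
        refine integral_congr_ae (.of_forall fun x => ?_)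
        simp only [partialDeriv_comp (hτ (φ x)) (φd x)]
        ring
      simp only [h1]
      rw [← integral_finsetSum]
      · refine integral_congr_ae (.of_forall fun x => ?_)
        have := hsum x
        simp only [Finset.sum_neg_distrib, ← Finset.sum_mul]
        rw [this]
        ring
      · intro j _
        have : Continuous (partialDeriv j (X j)) :=
          ((hXs j).continuous_fderiv (by simp)).clm_apply continuous_const
        exact ((this.mul τt.1.continuous).integrable_of_hasCompactSupport
          τt.2.1.mul_left).neg
    -- The factor ∂ⱼφ is exchanged for ∂ⱼU, which has the weak derivative ∂ⱼ²U in L². The function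
    -- T(φ)Γ is an admissible C¹ test function because φ has compact support in D, so Γ need not
    -- vanish on ∂D.
    have s3 : ∀ j, ∫ x, T (φ x) * X j x * partialDeriv j φ x ≤
        ‖w‖ * B + (A j + G * (‖w‖ + 1)) * η := fun j => by
      have bp := W.lpBd_c1 hD w i j
      have bP := W.lpBd_c2 hD w i j j
      have lip : Integrable (comp1 w i j) := integrable_of_lpBd_two hDb hD bp
      have liP : Integrable (comp2 w i j j) := integrable_of_lpBd_two hDb hD bP
      have tt := φt.isC1Test.comp_mul hTs hT0 hΓs
      have ibp : ∫ x, comp1 w i j x * partialDeriv j (fun x => T (φ x) * Γ x) x =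
          -∫ x, comp2 w i j j x * (T (φ x) * Γ x) :=
        (W.weakD_c1 hD w i j j).apply_c1 hD lip.locallyIntegrable liP.locallyIntegrable tt
      have hpd : ∀ x, partialDeriv j (fun x => T (φ x) * Γ x) x =
          T' (φ x) * partialDeriv j φ x * Γ x + T (φ x) * X j x := fun x => by
        rw [partialDeriv_mul (f := fun x => T (φ x))
            ((hTs.differentiable (by simp) _).comp x (φd x))
          (hΓs.differentiable (by simp) x), partialDeriv_comp (hT (φ x)) (φd x),
          hΓX]
      simp only [hpd, mul_add] at ibp
      have q1 := bp.pairing (norm_nonneg _) (by positivity) (bG j)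
      have q2 := bp.pairing (norm_nonneg _) (hA0 j) (bTX j)
      rw [integral_add q1.1 q2.1] at ibp
      have e1 := ((φ1 j).pairing hη.le (hA0 j) (bTX j))
      have e2 := ((φ1 j).pairing hη.le (by positivity) (bG j))
      have e3 := bP.pairing (norm_nonneg _) hB bTΓ
      have i1 := (bTX j).pairing (hA0 j) (by positivity) (bφ' j)
      have i2 := (bφ' j).pairing (by positivity) (by positivity) (bG j)
      have e1' := e1.2.2
      have e2' := e2.2.2
      simp only [sub_mul] at e1' e2'
      rw [integral_sub q2.1 (i1.1.congr (.of_forall fun x => by ring))] at e1'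
      rw [integral_sub q1.1 i2.1] at e2'
      -- The term with T' produced by the product rule has a favourable sign, since √(1+s²) is
      -- convex and Γ ≥ 0 in D; it is dropped.
      have pos : 0 ≤ ∫ x, partialDeriv j φ x * (T' (φ x) * partialDeriv j φ x * Γ x) := by
        refine integral_nonneg fun x => ?_
        by_cases hx : x ∈ D
        · have := mul_nonneg (mul_nonneg (sq_nonneg (partialDeriv j φ x)) (hT'0 (φ x)))
            (hΓnn x hx)
          simp only [Pi.zero_apply]
          nlinarith
        · simp [φ'z j x hx]
      have comm : ∫ x, partialDeriv j φ x * (T (φ x) * X j x) =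
          ∫ x, T (φ x) * X j x * partialDeriv j φ x := by simp only [mul_comm]
      rw [comm] at e1'
      rw [abs_le] at e1' e2'
      have e3' := (abs_le.1 e3.2.2).1
      nlinarith [e1'.1, e1'.2, e2'.1, e2'.2]
    have s4 : ∫ x, τ (φ x) * k x ≤ d * (‖w‖ * B) + (∑ j, (A j + G * (‖w‖ + 1))) * η := by
      rw [s2]
      refine (Finset.sum_le_sum fun j _ => s3 j).trans (le_of_eq ?_)
      rw [Finset.sum_add_distrib, Finset.sum_mul]
      simp
    simp only [sub_mul] at s1
    rw [integral_sub iUk iφk] at s1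
    have := (abs_le.1 s1).2
    rw [hC]
    nlinarith
  refine le_of_forall_pos_le_add fun c hc => ?_
  have h := main (min 1 (c / (C + 1))) (by positivity) (min_le_left _ _)
  refine h.trans (add_le_add le_rfl ?_)
  calc C * min 1 (c / (C + 1)) ≤ C * (c / (C + 1)) :=
        mul_le_mul_of_nonneg_left (min_le_right _ _) hC0
    _ ≤ c := by
        rw [mul_div_assoc', div_le_iff₀ (by positivity)]
        nlinarith

/-- The Sobolev embedding of `W` into bounded functions. -/
theorem W.exists_sup_bound (hd : d = 2 ∨ d = 3) (hDb : Bornology.IsBounded D) (hD : IsOpen D) :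
    ∃ C, 0 ≤ C ∧ ∀ (w : W D) (i : Fin d), ∀ᵐ x, |comp0 w i x| ≤ C * ‖w‖ := by
  obtain ⟨R, hR⟩ : ∃ R, ∀ x ∈ D, ∀ y ∈ D, ‖x - y‖ < R := by
    obtain ⟨R, hR⟩ := Metric.isBounded_iff.1 hDb
    exact ⟨R + 1, fun x hx y hy => by
      have := hR hx hy
      rw [dist_eq_norm] at this
      linarith⟩
  obtain ⟨B, hB, hbar⟩ := exists_lpBd_barrier hd hD hR
  have hd0 : 0 < (d : ℝ) := by rcases hd with rfl | rfl <;> norm_num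
  set ωd := volume.real (Metric.ball (0 : E d) 1) with hωd
  have hω : 0 < ωd := by
    rw [hωd, measureReal_def]
    exact ENNReal.toReal_pos (Metric.measure_ball_pos _ _ one_pos).ne' measure_ball_lt_top.ne
  set q : ℝ := (2 : ℝ) ^ (-(d : ℝ) / 2 - 1) with hq
  have hq0 : 0 < q := by positivity
  set C₁ := B / (ωd * q) with hC₁
  have hC₁0 : 0 ≤ C₁ := by positivity
  -- At a Lebesgue point x₀ the value is the limit of averages over balls, and the average over the
  -- ball of radius r is dominated by the integral against `barrierDens` with δ = r².
  have step : ∀ (w : W D) (i : Fin d), ∀ᵐ x, √(1 + comp0 w i x ^ 2) - 1 ≤ C₁ * ‖w‖ := by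
    intro w i
    set U := comp0 w i with hU
    have bU := W.lpBd_c0 hD w i
    have iU : Integrable U := integrable_of_lpBd_two hDb hD bU
    have hn : ∀ x, 0 ≤ √(1 + U x ^ 2) - 1 := fun x => by
      have : 1 ≤ √(1 + U x ^ 2) := Real.one_le_sqrt.2 (by nlinarith [sq_nonneg (U x)])
      linarith
    have hle : ∀ x, √(1 + U x ^ 2) - 1 ≤ |U x| := fun x => by
      have : √(1 + U x ^ 2) ≤ 1 + |U x| := by
        rw [Real.sqrt_le_left (by positivity)]
        nlinarith [abs_nonneg (U x), sq_abs (U x)]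
      linarith
    have hm : AEStronglyMeasurable (fun x => √(1 + U x ^ 2) - 1) volume :=
      (show Continuous fun s : ℝ => √(1 + s ^ 2) - 1 by fun_prop).comp_aestronglyMeasurable iU.1
    have iτ : Integrable fun x => √(1 + U x ^ 2) - 1 :=
      iU.abs.mono' hm (.of_forall fun x => by
        rw [Real.norm_of_nonneg (hn x)]
        exact hle x)
    filter_upwards [(Besicovitch.vitaliFamily (volume : Measure (E d))).ae_tendsto_average
      iτ.locallyIntegrable] with x₀ hx₀
    by_cases hxD : x₀ ∈ D
    swap
    · rw [hU, comp0_eq_zero hxD]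
      simpa using mul_nonneg hC₁0 (norm_nonneg _)
    refine le_of_tendsto (hx₀.comp (Besicovitch.tendsto_filterAt volume x₀)) ?_
    filter_upwards [self_mem_nhdsWithin] with r hr
    have hr0 : 0 < r := hr
    -- With δ = r² the density is at least d q r^{-d} on the ball of radius r, matching the
    -- normalization of the average.
    have hδ : 0 < r ^ 2 := by positivity
    have h := integral_barrierDens_le hDb hD hR hB hδ hxD (hbar x₀ hxD _ hδ) w i
    have hk0 : ∀ x, 0 ≤ barrierDens (r ^ 2) x₀ x := fun x => by
      rw [barrierDens]; positivity
    have hkb : ∀ x, barrierDens (r ^ 2) x₀ x ≤ d * r ^ 2 * (r ^ 2) ^ (-(d : ℝ) / 2 - 1) := fun x => by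
      rw [barrierDens]
      refine mul_le_mul_of_nonneg_left (Real.rpow_le_rpow_of_nonpos hδ ?_ ?_) (by positivity)
      · nlinarith [sq_nonneg ‖x - x₀‖]
      · linarith
    have hkl : ∀ x ∈ Metric.closedBall x₀ r, d * q * (r ^ d)⁻¹ ≤ barrierDens (r ^ 2) x₀ x := by
      intro x hx
      rw [mem_closedBall_iff_norm] at hx
      have h2 : ‖x - x₀‖ ^ 2 + r ^ 2 ≤ 2 * r ^ 2 := by
        have := pow_le_pow_left₀ (norm_nonneg _) hx 2
        linarith
      have h3 : (2 * r ^ 2) ^ (-(d : ℝ) / 2 - 1) ≤ (‖x - x₀‖ ^ 2 + r ^ 2) ^ (-(d : ℝ) / 2 - 1) :=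
        Real.rpow_le_rpow_of_nonpos (by positivity) h2 (by linarith)
      have h4 : (2 * r ^ 2) ^ (-(d : ℝ) / 2 - 1) = q * ((r ^ d)⁻¹ * (r ^ 2)⁻¹) := by
        rw [Real.mul_rpow (by norm_num) hδ.le, ← hq]
        congr 1
        rw [← Real.rpow_natCast r 2, ← Real.rpow_mul hr0.le, ← Real.rpow_natCast r d,
          ← Real.rpow_neg hr0.le, ← Real.rpow_neg hr0.le, ← Real.rpow_add hr0]
        congr 1
        push_cast
        ring
      rw [barrierDens]
      rw [h4] at h3
      calc d * q * (r ^ d)⁻¹ = d * r ^ 2 * (q * ((r ^ d)⁻¹ * (r ^ 2)⁻¹)) := by field_simp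
        _ ≤ _ := mul_le_mul_of_nonneg_left h3 (by positivity)
    have iτk : Integrable fun x => (√(1 + U x ^ 2) - 1) * barrierDens (r ^ 2) x₀ x := by
      refine (iτ.const_mul (d * r ^ 2 * (r ^ 2) ^ (-(d : ℝ) / 2 - 1))).mono'
        (hm.mul (continuous_const.mul
          (contDiff_barrier_factor hδ x₀ _).continuous).aestronglyMeasurable)
        (.of_forall fun x => ?_)
      rw [Real.norm_of_nonneg (mul_nonneg (hn x) (hk0 x)), mul_comm]
      exact mul_le_mul_of_nonneg_right (hkb x) (hn x)
    have h1 : d * q * (r ^ d)⁻¹ * ∫ x in Metric.closedBall x₀ r, (√(1 + U x ^ 2) - 1) ≤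
        d * (‖w‖ * B) := by
      refine le_trans ?_ h
      rw [← integral_const_mul]
      refine le_trans ?_ (setIntegral_le_integral iτk (s := Metric.closedBall x₀ r)
        (.of_forall fun x => mul_nonneg (hn x) (hk0 x)))
      refine setIntegral_mono_on (iτ.integrableOn.const_mul _) iτk.integrableOn
        measurableSet_closedBall fun x hx => ?_
      rw [mul_comm]
      exact mul_le_mul_of_nonneg_left (hkl x hx) (hn x)
    simp only [Function.comp]
    rw [setAverage_eq, smul_eq_mul, Measure.addHaar_real_closedBall _ _ hr0.le,
      finrank_euclideanSpace, Fintype.card_fin, ← hωd]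
    set I := ∫ x in Metric.closedBall x₀ r, (√(1 + U x ^ 2) - 1)
    have hrd : 0 < r ^ d := by positivity
    rw [hC₁, inv_mul_le_iff₀ (by positivity)]
    have h2 : d * q * (r ^ d)⁻¹ * I = d * (q * I / r ^ d) := by field_simp
    rw [h2, mul_le_mul_iff_right₀ hd0, div_le_iff₀ hrd] at h1
    rw [show r ^ d * ωd * (B / (ωd * q) * ‖w‖) = ‖w‖ * B * r ^ d / q by field_simp,
      le_div_iff₀ hq0]
    linarith
  -- The function √(1+s²) − 1 is not homogeneous; a linear bound results from applying `step` to
  -- w/‖w‖ and using |s| ≤ √(1+s²).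
  refine ⟨1 + C₁, by positivity, fun w i => ?_⟩
  rcases eq_or_ne w 0 with rfl | hw
  · have h0 := W.lpBd_c0 hD (0 : W D) i
    rw [norm_zero] at h0
    have h1 := h0.2
    rw [ENNReal.ofReal_zero, nonpos_iff_eq_zero, eLpNorm_eq_zero_iff h0.1 (by norm_num)] at h1
    filter_upwards [h1] with x hx
    simp [hx]
  · have hw0 : 0 < ‖w‖ := norm_pos_iff.2 hw
    filter_upwards [step (‖w‖⁻¹ • w) i, W.c0_smul hD ‖w‖⁻¹ w i] with x hx hx'
    rw [norm_smul, norm_inv, norm_norm, inv_mul_cancel₀ hw0.ne', mul_one, hx'] at hx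
    have h2 : |‖w‖⁻¹ * comp0 w i x| ≤ √(1 + (‖w‖⁻¹ * comp0 w i x) ^ 2) :=
      Real.abs_le_sqrt (by linarith)
    rw [abs_mul, abs_of_pos (inv_pos.2 hw0)] at h2
    have h3 : ‖w‖⁻¹ * |comp0 w i x| ≤ 1 + C₁ := by linarith
    rw [inv_mul_le_iff₀ hw0] at h3
    linarith

end Peridynamics

end

/-! ### L⁴ gradients and Morrey's inequality on W -/

noncomputable section

open scoped ENNReal NNReal

namespace Peridynamics

variable {d : ℕ} {D : Set (E d)}

/-! ### Hölder continuity of elements of `W` -/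

theorem W.exists_four_bound (hd : d = 2 ∨ d = 3) (hDb : Bornology.IsBounded D) (hD : IsOpen D) :
    ∃ C, 0 ≤ C ∧ ∀ (w : W D) (i j : Fin d), LpBd volume 4 (comp1 w i j) (C * ‖w‖) := by
  obtain ⟨C, hC, h⟩ := W.exists_sup_bound hd hDb hD
  refine ⟨√(3 * C), Real.sqrt_nonneg _, fun w i j => ?_⟩
  refine (W.lpBd_four_c1 hDb hD w i j (by positivity) (h w i)).mono (le_of_eq ?_)
  rw [show 3 * (C * ‖w‖) * ‖w‖ = 3 * C * (‖w‖ * ‖w‖) by ring,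
    Real.sqrt_mul (by positivity), Real.sqrt_mul_self (norm_nonneg _)]

theorem LpBd.comp_add_left {p : ℝ≥0∞} {g : E d → ℝ} {c : ℝ} (h : LpBd volume p g c) (x : E d) :
    LpBd volume p (fun y => g (x + y)) c :=
  ⟨h.1.comp_measurePreserving (measurePreserving_add_left volume x),
    (eLpNorm_comp_measurePreserving h.1 (measurePreserving_add_left volume x)).trans_le h.2⟩

theorem LpBd.comp_add_right {p : ℝ≥0∞} {g : E d → ℝ} {c : ℝ} (h : LpBd volume p g c) (x : E d) :
    LpBd volume p (fun y => g (y + x)) c := by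
  simpa only [add_comm] using h.comp_add_left x

theorem unitBall_volume_pos : 0 < volume.real (Metric.ball (0 : E d) 1) := by
  rw [measureReal_def]
  exact ENNReal.toReal_pos (Metric.measure_ball_pos _ _ one_pos).ne' measure_ball_lt_top.ne

theorem setIntegral_abs_le_of_lpBd_four {g : E d → ℝ} {A : ℝ} (hA : 0 ≤ A)
    (hg : LpBd volume 4 g A) {s : Set (E d)} (hs : volume s ≠ ⊤) :
    ∫ x in s, |g x| ≤ A * volume.real s ^ (3 / 4 : ℝ) := by
  have hg' := hg.restrict s
  have h1 := eLpNorm_le_eLpNorm_mul_rpow_measure_univ (μ := volume.restrict s) (f := g)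
    (p := 1) (q := 4) (by norm_num) hg'.1
  have h2 : ∫ x in s, |g x| = (eLpNorm g 1 (volume.restrict s)).toReal := by
    rw [eLpNorm_one_eq_lintegral_enorm, ← integral_norm_eq_lintegral_enorm hg'.1]
    rfl
  rw [h2]
  refine ENNReal.toReal_le_of_le_ofReal (by positivity) (h1.trans ?_)
  rw [ENNReal.ofReal_mul hA, ← ENNReal.ofReal_rpow_of_nonneg measureReal_nonneg (by norm_num),
    measureReal_def, ENNReal.ofReal_toReal hs, Measure.restrict_apply_univ]
  refine mul_le_mul' hg'.2 (le_of_eq ?_)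
  congr 1
  norm_num

/-- Hölder's inequality and scaling give s^{-d/4}, which is at most s^{-3/4} for d ≤ 3. This
singularity is integrable in s, and its primitive 4 s^{1/4} is the source of the Hölder exponent. -/
theorem setIntegral_ball_abs_le {g : E d → ℝ} {A : ℝ} (hA : 0 ≤ A) (hg : LpBd volume 4 g A)
    (hd : d ≤ 3) (x : E d) {s : ℝ} (hs : 0 < s) (hs1 : s ≤ 1) :
    ∫ η in Metric.ball (0 : E d) 1, |g (x + s • η)| ≤
      volume.real (Metric.ball (0 : E d) 1) ^ (3 / 4 : ℝ) * A * s ^ (-(3 / 4) : ℝ) := by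
  have hω := unitBall_volume_pos (d := d)
  rw [Measure.setIntegral_comp_smul_of_pos volume (fun y => |g (x + y)|) _ hs,
    smul_unitBall_of_pos hs, finrank_euclideanSpace, Fintype.card_fin, smul_eq_mul]
  have h := setIntegral_abs_le_of_lpBd_four hA (hg.comp_add_left x)
    (s := Metric.ball (0 : E d) s) measure_ball_lt_top.ne
  have hb : volume.real (Metric.ball (0 : E d) s) = s ^ d * volume.real (Metric.ball (0 : E d) 1) := by
    rw [measureReal_def, Measure.addHaar_ball_of_pos _ _ hs, finrank_euclideanSpace, Fintype.card_fin,
      ENNReal.toReal_mul, ENNReal.toReal_ofReal (by positivity), measureReal_def]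
  rw [hb, Real.mul_rpow (by positivity) hω.le] at h
  set q := volume.real (Metric.ball (0 : E d) 1) ^ (3 / 4 : ℝ) with hq
  have hq0 : 0 ≤ q := by positivity
  have e1 : (s ^ d)⁻¹ * (s ^ d) ^ (3 / 4 : ℝ) = s ^ (-(d / 4) : ℝ) := by
    rw [← Real.rpow_natCast, ← Real.rpow_neg hs.le, ← Real.rpow_mul hs.le, ← Real.rpow_add hs]
    congr 1
    ring
  have e2 : s ^ (-(d / 4) : ℝ) ≤ s ^ (-(3 / 4) : ℝ) := by
    refine Real.rpow_le_rpow_of_exponent_ge hs hs1 ?_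
    have : (d : ℝ) ≤ 3 := by exact_mod_cast hd
    linarith
  calc _ ≤ (s ^ d)⁻¹ * (A * ((s ^ d) ^ (3 / 4 : ℝ) * q)) :=
        mul_le_mul_of_nonneg_left h (by positivity)
    _ = q * A * ((s ^ d)⁻¹ * (s ^ d) ^ (3 / 4 : ℝ)) := by ring
    _ ≤ _ := by
        rw [e1]
        exact mul_le_mul_of_nonneg_left e2 (by positivity)

theorem clm_apply_eq_sum (L : E d →L[ℝ] ℝ) (v : E d) :
    L v = ∑ j, v j * L (EuclideanSpace.single j 1) := by
  have h := (EuclideanSpace.basisFun (Fin d) ℝ).sum_repr v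
  conv_lhs => rw [← h]
  simp

theorem abs_fderiv_apply_le (V : E d → ℝ) (x v : E d) :
    |fderiv ℝ V x v| ≤ ‖v‖ * ∑ j, |partialDeriv j V x| := by
  rw [clm_apply_eq_sum, Finset.mul_sum]
  refine (Finset.abs_sum_le_sum_abs _ _).trans (Finset.sum_le_sum fun j _ => ?_)
  rw [abs_mul]
  exact mul_le_mul_of_nonneg_right (PiLp.norm_apply_le v j) (abs_nonneg _)

/-- Morrey's inequality for the exponent `4` and smooth functions. -/
theorem morrey_of_smooth (hd : d ≤ 3) {V : E d → ℝ}
    (hV : ContDiff ℝ ((⊤ : ℕ∞) : WithTop ℕ∞) V) (hc : HasCompactSupport V) {A : ℝ} (hA : 0 ≤ A)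
    (h : ∀ j, LpBd volume 4 (partialDeriv j V) A) (x y : E d) (hxy : ‖y‖ ≤ 1) :
    |V (x + y) - V x| ≤
      9 * d * volume.real (Metric.ball (0 : E d) 1) ^ (-(1 / 4) : ℝ) * A * ‖y‖ ^ (1 / 4 : ℝ) := by
  rcases eq_or_ne y 0 with rfl | hy
  · simp
  have hr : 0 < ‖y‖ := norm_pos_iff.2 hy
  have hω := unitBall_volume_pos (d := d)
  set r := ‖y‖ with hrdef
  set ω := volume.real (Metric.ball (0 : E d) 1) with hωdef
  set K := d * (ω ^ (3 / 4 : ℝ) * A) with hK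
  have hK0 : 0 ≤ K := by positivity
  have : IsFiniteMeasure ((volume : Measure (E d)).restrict (Metric.ball 0 1)) :=
    ⟨by simpa using measure_ball_lt_top⟩
  have hVd : Differentiable ℝ V := hV.differentiable (by simp)
  have hV'c : Continuous (fderiv ℝ V) := hV.continuous_fderiv (by simp)
  have hpc : ∀ j, Continuous (partialDeriv j V) := fun j => hV'c.clm_apply continuous_const
  obtain ⟨B, hB⟩ := (hc.fderiv (𝕜 := ℝ)).exists_bound_of_continuous hV'c
  obtain ⟨B', hB'⟩ := hc.exists_bound_of_continuous hV.continuous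
  have ii : ∀ {f : E d → ℝ}, Continuous f →
      IntegrableOn f (Metric.ball (0 : E d) 1) := fun hf =>
    (hf.continuousOn.integrableOn_compact (isCompact_closedBall 0 1)).mono_set
      Metric.ball_subset_closedBall
  -- the basic gradient bound
  have grad : ∀ (p : E d) (s : ℝ), 0 < s → s ≤ 1 →
      ∫ η in Metric.ball (0 : E d) 1, ∑ j, |partialDeriv j V (p + s • η)| ≤
        K * s ^ (-(3 / 4) : ℝ) := fun p s hs hs1 => by
    rw [integral_finsetSum _ fun j _ => ii (by fun_prop)]
    refine (Finset.sum_le_sum fun j _ => setIntegral_ball_abs_le hA (h j) hd p hs hs1).trans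
      (le_of_eq ?_)
    simp [hK]
    ring
  -- derivative of averages along lines
  have der : ∀ (P Q : E d → E d), Continuous P → Continuous Q →
      (∀ η ∈ Metric.ball (0 : E d) 1, ‖Q η‖ ≤ 1) → ∀ s : ℝ,
      HasDerivAt (fun s : ℝ => ∫ η in Metric.ball (0 : E d) 1, V (P η + s • Q η))
        (∫ η in Metric.ball (0 : E d) 1, fderiv ℝ V (P η + s • Q η) (Q η)) s := by
    intro P Q hP hQ hQ1 s
    refine (hasDerivAt_integral_of_dominated_loc_of_deriv_le (s := univ) univ_mem
      (F := fun s η => V (P η + s • Q η)) (F' := fun s η => fderiv ℝ V (P η + s • Q η) (Q η))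
      (bound := fun _ => B)
      (.of_forall fun s => (ii (hV.continuous.comp (by fun_prop))).1)
      (ii (hV.continuous.comp (by fun_prop)))
      (ii ((hV'c.comp (by fun_prop)).clm_apply hQ)).1 ?_ (integrable_const _) ?_).2
    · filter_upwards [ae_restrict_mem measurableSet_ball] with η hη t _
      refine ((fderiv ℝ V _).le_opNorm _).trans ?_
      have h1 := hB (P η + t • Q η)
      have h2 := hQ1 η hη
      have h3 := norm_nonneg (fderiv ℝ V (P η + t • Q η))
      nlinarith [norm_nonneg (Q η)]
    · refine .of_forall fun η t _ => ?_
      have h1 : HasDerivAt (fun t : ℝ => P η + t • Q η) (Q η) t := by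
        simpa using ((hasDerivAt_id t).smul_const (Q η)).const_add (P η)
      exact (hVd _).hasFDerivAt.comp_hasDerivAt t h1
  have derb : ∀ (p : E d) (s : ℝ) (Q : E d → E d), Continuous Q →
      (∀ η ∈ Metric.ball (0 : E d) 1, ‖Q η‖ ≤ 1) → 0 < s → s ≤ 1 →
      |∫ η in Metric.ball (0 : E d) 1, fderiv ℝ V (p + s • η) (Q η)| ≤
        K * s ^ (-(3 / 4) : ℝ) := by
    intro p s Q hQ hQ1 hs hs1
    refine (abs_integral_le_integral_abs).trans (le_trans ?_ (grad p s hs hs1))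
    refine setIntegral_mono_on (ii ?_) (ii ?_) measurableSet_ball fun η hη => ?_
    · exact ((hV'c.comp (by fun_prop)).clm_apply hQ).abs
    · exact continuous_finsetSum _ fun j _ => ((hpc j).comp (by fun_prop)).abs
    · refine (abs_fderiv_apply_le V _ _).trans ?_
      refine mul_le_of_le_one_left (Finset.sum_nonneg fun j _ => abs_nonneg _) (hQ1 η hη)
  -- the average over a ball of radius `r`
  have avg : ∀ p : E d, |(∫ η in Metric.ball (0 : E d) 1, V (p + r • η)) - ω * V p| ≤
      4 * K * r ^ (1 / 4 : ℝ) := by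
    intro p
    set g : ℝ → ℝ := fun s => ∫ η in Metric.ball (0 : E d) 1, V (p + s • η) with hg
    have hgd : ∀ s, HasDerivAt g _ s := fun s =>
      der (fun _ => p) (fun η => η) continuous_const continuous_id
        (fun η hη => (mem_ball_zero_iff.1 hη).le) s
    have hgc : Continuous g := continuous_iff_continuousAt.2 fun s => (hgd s).continuousAt
    have hg0 : g 0 = ω * V p := by simp [hg, hωdef]
    -- The derivative of g is at most K s^{-3/4}, the derivative of 4K s^{1/4}. The comparison
    -- starts at a > 0 because the bound is singular at 0; then a → 0.
    have key : ∀ a, 0 < a → a < r → |g r - g a| ≤ 4 * K * r ^ (1 / 4 : ℝ) - 4 * K * a ^ (1 / 4 : ℝ) := by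
      intro a ha har
      refine image_norm_le_of_norm_deriv_right_le_deriv_boundary' (a := a) (b := r)
        (f := fun s => g s - g a) (B := fun s => 4 * K * s ^ (1 / 4 : ℝ) - 4 * K * a ^ (1 / 4 : ℝ))
        (B' := fun s => K * s ^ (-(3 / 4) : ℝ)) (hgc.sub continuous_const).continuousOn
        (fun s _ => ((hgd s).sub_const _).hasDerivWithinAt) (by simp) ?_ ?_ ?_
        (right_mem_Icc.2 har.le)
      · exact ((continuous_const.mul (Real.continuous_rpow_const (by norm_num))).sub
          continuous_const).continuousOn
      · intro s hs
        have hs0 : 0 < s := ha.trans_le hs.1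
        have := ((Real.hasDerivAt_rpow_const (p := (1 / 4 : ℝ)) (Or.inl hs0.ne')).const_mul
          (4 * K)).sub_const (4 * K * a ^ (1 / 4 : ℝ))
        refine (this.congr_deriv ?_).hasDerivWithinAt
        norm_num
        ring
      · intro s hs
        exact derb p s _ continuous_id (fun η hη => (mem_ball_zero_iff.1 hη).le)
          (ha.trans_le hs.1) (hs.2.le.trans hxy)
    rw [← hg0]
    have t1 : Tendsto (fun a => |g r - g a|) (𝓝[>] 0) (𝓝 |g r - g 0|) :=
      ((hgc.tendsto 0).const_sub _).abs.mono_left nhdsWithin_le_nhds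
    refine le_of_tendsto t1 ?_
    filter_upwards [Ioo_mem_nhdsGT hr] with a ha
    have := key a ha.1 ha.2
    have : 0 ≤ 4 * K * a ^ (1 / 4 : ℝ) := by
      have := ha.1.le
      positivity
    linarith
  -- The centre moves from x to x + y along a unit direction with the radius r fixed: a path of
  -- length r on which the derivative is at most K r^{-3/4}.
  have shift : |(∫ η in Metric.ball (0 : E d) 1, V (x + y + r • η)) -
      ∫ η in Metric.ball (0 : E d) 1, V (x + r • η)| ≤ K * r ^ (1 / 4 : ℝ) := by
    set g : ℝ → ℝ := fun s => ∫ η in Metric.ball (0 : E d) 1, V (x + r • η + s • r⁻¹ • y) with hg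
    have hy1 : ‖r⁻¹ • y‖ ≤ 1 := by
      rw [norm_smul, norm_inv, Real.norm_of_nonneg hr.le, ← hrdef, inv_mul_cancel₀ hr.ne']
    have := Convex.norm_image_sub_le_of_norm_hasDerivWithin_le (s := univ)
      (C := K * r ^ (-(3 / 4) : ℝ)) (f := g)
      (fun s _ => (der (fun η => x + r • η) (fun η => r⁻¹ • y) (by fun_prop) continuous_const
        (fun η _ => hy1) s).hasDerivWithinAt) (fun s _ => ?_) convex_univ (mem_univ 0) (mem_univ r)
    · have e1 : g r = ∫ η in Metric.ball (0 : E d) 1, V (x + y + r • η) := by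
        simp only [hg, smul_smul, mul_inv_cancel₀ hr.ne', one_smul]
        simp only [add_right_comm]
      have e0 : g 0 = ∫ η in Metric.ball (0 : E d) 1, V (x + r • η) := by simp [hg]
      rw [e1, e0, sub_zero, Real.norm_eq_abs, Real.norm_of_nonneg hr.le] at this
      refine this.trans (le_of_eq ?_)
      rw [mul_assoc]
      congr 1
      nth_rw 2 [← Real.rpow_one r]
      rw [← Real.rpow_add hr]
      norm_num
    · rw [Real.norm_eq_abs]
      have := derb (x + s • r⁻¹ • y) r (fun _ => r⁻¹ • y) continuous_const (fun _ _ => hy1) hr hxy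
      simpa only [add_right_comm] using this
  have a1 := avg x
  have a2 := avg (x + y)
  -- The constant 9 consists of 4 for each of the two averages and 1 for the shift.
  have tot : ω * |V (x + y) - V x| ≤ 9 * K * r ^ (1 / 4 : ℝ) := by
    rw [show ω * |V (x + y) - V x| = |ω * (V (x + y) - V x)| by rw [abs_mul, abs_of_pos hω]]
    rw [abs_le] at *
    constructor <;> nlinarith [a1.1, a1.2, a2.1, a2.2, shift.1, shift.2]
  have e3 : ω ^ (3 / 4 : ℝ) = ω * ω ^ (-(1 / 4) : ℝ) := by
    nth_rw 2 [← Real.rpow_one ω]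
    rw [← Real.rpow_add hω]
    norm_num
  rw [hK, e3] at tot
  refine le_of_mul_le_mul_left (tot.trans (le_of_eq ?_)) hω
  ring

/-- Extension by zero creates no jump for elements of H¹₀: the identity holds for the approximating
test functions against an arbitrary test function on the whole space and passes to the limit. -/
theorem W.weakD_univ (hDb : Bornology.IsBounded D) (hD : IsOpen D) (w : W D) (i j : Fin d) :
    WeakD univ j (comp0 w i) (comp1 w i j) := by
  intro φ hφ
  have i0 : Integrable (comp0 w i) := integrable_of_lpBd_two hDb hD (W.lpBd_c0 hD w i)
  have i1 : Integrable (comp1 w i j) := integrable_of_lpBd_two hDb hD (W.lpBd_c1 hD w i j)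
  have m0 := MemLp.lpBd ((hφ.partialDeriv j).1.continuous.memLp_of_hasCompactSupport
    (hφ.partialDeriv j).2.1 (p := 2) (μ := volume))
  have m1 := MemLp.lpBd (hφ.1.continuous.memLp_of_hasCompactSupport hφ.2.1 (p := 2) (μ := volume))
  set P := (eLpNorm (partialDeriv j φ) 2 volume).toReal
  set Q := (eLpNorm φ 2 volume).toReal
  have hP : 0 ≤ P := ENNReal.toReal_nonneg
  have hQ : 0 ≤ Q := ENNReal.toReal_nonneg
  have key : ∀ η > 0, |(∫ x, comp0 w i x * partialDeriv j φ x) + ∫ x, comp1 w i j x * φ x| ≤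
      η * (P + Q) := by
    intro η hη
    obtain ⟨Φ, hΦ, h0, h1⟩ := W.exists_test_near hD w hη
    have e := integral_mul_partialDeriv (hΦ i).isC1Test.1 hφ.isC1Test j
    have n0 := (h0 i).pairing hη.le hP m0
    have n1 := (h1 i j).pairing hη.le hQ m1
    have q0 := ((W.lpBd_c0 hD w i).pairing (norm_nonneg _) hP m0).1
    have q1 := ((W.lpBd_c1 hD w i j).pairing (norm_nonneg _) hQ m1).1
    have r0 : Integrable fun x => Φ i x * partialDeriv j φ x :=
      (q0.sub n0.1).congr (.of_forall fun x => by simp; ring)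
    have r1 : Integrable fun x => partialDeriv j (Φ i) x * φ x :=
      (q1.sub n1.1).congr (.of_forall fun x => by simp; ring)
    have s0 := n0.2.2
    have s1 := n1.2.2
    simp only [sub_mul] at s0 s1
    rw [integral_sub q0 r0] at s0
    rw [integral_sub q1 r1] at s1
    rw [abs_le] at *
    constructor <;> linarith [s0.1, s0.2, s1.1, s1.2]
  have : |(∫ x, comp0 w i x * partialDeriv j φ x) + ∫ x, comp1 w i j x * φ x| ≤ 0 := by
    refine le_of_forall_pos_le_add fun c hc => ?_
    refine (key (c / (P + Q + 1)) (by positivity)).trans ?_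
    rw [div_mul_eq_mul_div, div_le_iff₀ (by positivity)]
    nlinarith
  linarith [abs_nonpos_iff.1 this]

/-- The Sobolev embedding of `W` into Hölder continuous functions. -/
theorem W.exists_holder_bound (hd : d = 2 ∨ d = 3) (hDb : Bornology.IsBounded D) (hD : IsOpen D) :
    ∃ C, 0 ≤ C ∧ ∀ (w : W D) (i : Fin d) (h : E d), ‖h‖ ≤ 1 →
      ∀ᵐ x, |comp0 w i (x + h) - comp0 w i x| ≤ C * ‖w‖ * ‖h‖ ^ (1 / 4 : ℝ) := by
  obtain ⟨C, hC, hC4⟩ := W.exists_four_bound hd hDb hD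
  have hd3 : d ≤ 3 := by rcases hd with rfl | rfl <;> norm_num
  refine ⟨9 * d * volume.real (Metric.ball (0 : E d) 1) ^ (-(1 / 4) : ℝ) * C, by positivity,
    fun w i h hh => ?_⟩
  have i0 : Integrable (comp0 w i) := integrable_of_lpBd_two hDb hD (W.lpBd_c0 hD w i)
  have hcs : HasCompactSupport (comp0 w i) :=
    HasCompactSupport.intro hDb.isCompact_closure fun x hx =>
      comp0_eq_zero fun hxD => hx (subset_closure hxD)
  -- Morrey's inequality is applied to mollifications, whose gradients keep the L⁴ bound, and passes
  -- to the limit at almost every x for which x and x + h are both points of convergence.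
  have lim := ae_tendsto_mollify i0.locallyIntegrable
  have lim' := (measurePreserving_add_right (volume : Measure (E d)) h).quasiMeasurePreserving.ae lim
  filter_upwards [lim, lim'] with x hx hx'
  refine le_of_tendsto ((hx'.sub hx).abs) (.of_forall fun n => ?_)
  have hcm : HasCompactSupport (mollify (shrinkingBump d n) (comp0 w i)) :=
    IsCompact.of_isClosed_subset (hcs.cthickening) (isClosed_tsupport _)
      (mollify_support_subset _ _)
  have hpd : ∀ j, LpBd volume 4 (partialDeriv j (mollify (shrinkingBump d n) (comp0 w i)))
      (C * ‖w‖) := fun j => by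
    have : partialDeriv j (mollify (shrinkingBump d n) (comp0 w i)) =
        mollify (shrinkingBump d n) (comp1 w i j) := funext fun x =>
      partialDeriv_mollify_eq _ i0.locallyIntegrable (W.weakD_univ hDb hD w i j) (subset_univ _)
    rw [this]
    exact lpBd_mollify _ (by norm_num) (by norm_num) (hC4 w i j)
  refine (morrey_of_smooth hd3 (contDiff_mollify _ i0.locallyIntegrable) hcm (by positivity)
    hpd x h hh).trans (le_of_eq ?_)
  ring

end Peridynamics

end

/-! ### Product rules in the weak sense, including weights that remove a jump at the boundary -/

noncomputable section

open scoped ENNReal NNReal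

namespace Peridynamics

variable {d : ℕ} {D : Set (E d)}

/-! ### Product and chain rules for weak derivatives -/

/-- `a` is a limit of smooth functions in `H¹`, with gradient `a'`. -/
def SmoothApprox (a : E d → ℝ) (a' : Fin d → E d → ℝ) : Prop :=
  ∀ η > 0, ∃ A : E d → ℝ, ContDiff ℝ ((⊤ : ℕ∞) : WithTop ℕ∞) A ∧
    LpBd volume 2 (fun x => a x - A x) η ∧
    ∀ j, LpBd volume 2 (fun x => a' j x - partialDeriv j A x) η

theorem lipschitz_of_deriv_le {γ γ' : ℝ → ℝ} {K : ℝ} (h : ∀ s, HasDerivAt γ (γ' s) s)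
    (hK : ∀ s, |γ' s| ≤ K) (s t : ℝ) : |γ s - γ t| ≤ K * |s - t| :=
  Convex.norm_image_sub_le_of_norm_hasDerivWithin_le (s := univ)
    (fun y _ => (h y).hasDerivWithinAt) (fun y _ => hK y) convex_univ (mem_univ t) (mem_univ s)

theorem continuous_of_hasDerivAt {γ γ' : ℝ → ℝ} (h : ∀ s, HasDerivAt γ (γ' s) s) :
    Continuous γ := continuous_iff_continuousAt.2 fun s => (h s).continuousAt

theorem LpBd.mul_top {α : Type*} [MeasurableSpace α] {μ : Measure α} {p : ℝ≥0∞} {f g : α → ℝ}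
    {B K : ℝ} (hf : LpBd μ p f B) (hg : AEStronglyMeasurable g μ) (hK0 : 0 ≤ K)
    (hK : ∀ᵐ x ∂μ, |g x| ≤ K) : LpBd μ p (fun x => g x * f x) (K * B) :=
  (LpBd.of_ae_bound hg hK).mul (hpqr := inferInstance) hK0 hf

theorem LpBd.abs_integral_le {α : Type*} [MeasurableSpace α] {μ : Measure α} {f : α → ℝ} {B : ℝ}
    (hB : 0 ≤ B) (h : LpBd μ 1 f B) : Integrable f μ ∧ |∫ x, f x ∂μ| ≤ B := by
  have hi : Integrable f μ := memLp_one_iff_integrable.1 h.memLp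
  refine ⟨hi, (abs_integral_le_integral_abs).trans ?_⟩
  have h2 := h.2
  rw [eLpNorm_one_eq_lintegral_enorm] at h2
  have := integral_norm_eq_lintegral_enorm hi.1
  simp only [Real.norm_eq_abs] at this
  rw [this]
  exact ENNReal.toReal_le_of_le_ofReal hB h2

/-- The weak derivative of c is tested with γ(A)φ, where A is a smooth approximation of a in H¹. The
L⁴ bounds on a' and c put a' c in L², and every error is then a product of two L² functions one of
which is of order η. Approximating a alone suffices, so c needs no approximation up to the boundary
of O. -/
theorem weakD_comp_mul {O : Set (E d)} (hO : IsOpen O) {a c c' : E d → ℝ} {a' : Fin d → E d → ℝ}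
    {k : Fin d} {Ba Bc : ℝ} (hBa : 0 ≤ Ba) (hBc : 0 ≤ Bc) (ham : AEStronglyMeasurable a volume)
    (ha : SmoothApprox a a') (ha4 : LpBd volume 4 (a' k) Ba) (hc2 : LpBd volume 2 c Bc)
    (hc4 : LpBd volume 4 c Bc) (hc' : LpBd volume 2 c' Bc) (h : WeakD O k c c')
    {γ γ' γ'' : ℝ → ℝ} {K : ℝ} (hγ : ∀ s, HasDerivAt γ (γ' s) s)
    (hγ' : ∀ s, HasDerivAt γ' (γ'' s) s) (hK : ∀ s, |γ s| ≤ K) (hK' : ∀ s, |γ' s| ≤ K)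
    (hK'' : ∀ s, |γ'' s| ≤ K) :
    WeakD O k (fun x => γ (a x) * c x) (fun x => γ' (a x) * a' k x * c x + γ (a x) * c' x) := by
  intro φ hφ
  have hK0 : 0 ≤ K := (abs_nonneg _).trans (hK 0)
  have cγ := continuous_of_hasDerivAt hγ
  have cγ' := continuous_of_hasDerivAt hγ'
  obtain ⟨S, hS, hφS, hφS'⟩ : ∃ S, 0 ≤ S ∧ (∀ x, |φ x| ≤ S) ∧ ∀ x, |partialDeriv k φ x| ≤ S := by
    obtain ⟨s, hs⟩ := hφ.1.continuous.bounded_above_of_compact_support hφ.2.1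
    obtain ⟨s', hs'⟩ := (hφ.continuous_partialDeriv k).bounded_above_of_compact_support
      (hφ.hasCompactSupport_partialDeriv k)
    exact ⟨max s s', ((norm_nonneg _).trans (hs 0)).trans (le_max_left _ _),
      fun x => (hs x).trans (le_max_left _ _), fun x => (hs' x).trans (le_max_right _ _)⟩
  have mφ := hφ.1.continuous.aestronglyMeasurable (μ := (volume : Measure (E d)))
  have mφ' := (hφ.continuous_partialDeriv k).aestronglyMeasurable (μ := (volume : Measure (E d)))
  have lφ := MemLp.lpBd (hφ.1.continuous.memLp_of_hasCompactSupport hφ.2.1 (p := 2)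
    (μ := (volume : Measure (E d))))
  have lφ' := MemLp.lpBd ((hφ.continuous_partialDeriv k).memLp_of_hasCompactSupport
    (hφ.hasCompactSupport_partialDeriv k) (p := 2) (μ := (volume : Measure (E d))))
  have mγa : AEStronglyMeasurable (fun x => γ (a x)) volume := cγ.comp_aestronglyMeasurable ham
  have mγa' : AEStronglyMeasurable (fun x => γ' (a x)) volume := cγ'.comp_aestronglyMeasurable ham
  have hac : LpBd volume 2 (fun x => a' k x * c x) (Ba * Bc) :=
    ha4.mul (hpqr := inferInstance) hBa hc4
  -- the three terms
  have i1 : Integrable fun x => γ (a x) * c x * partialDeriv k φ x :=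
    ((hc2.mul_top mγa hK0 (.of_forall fun x => hK _)).pairing (by positivity)
      ENNReal.toReal_nonneg lφ').1
  have i2 : Integrable fun x => γ' (a x) * a' k x * c x * φ x :=
    (((hac.mul_top mγa' hK0 (.of_forall fun x => hK' _)).pairing (by positivity)
      ENNReal.toReal_nonneg lφ).1).congr (.of_forall fun x => by ring)
  have i3 : Integrable fun x => γ (a x) * c' x * φ x :=
    ((hc'.mul_top mγa hK0 (.of_forall fun x => hK _)).pairing (by positivity)
      ENNReal.toReal_nonneg lφ).1
  -- The four errors come from γ(a) − γ(A) against c ∂ₖφ, γ'(a) − γ'(A) against a' c φ, a' − ∂ₖA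
  -- against c φ, and γ(a) − γ(A) against c' φ.
  have key : ∀ η > 0, |(∫ x, (γ (a x) * c x * partialDeriv k φ x +
      (γ' (a x) * a' k x * c x * φ x + γ (a x) * c' x * φ x)))| ≤
      η * (K * S * (3 * Bc + Ba * Bc)) := by
    intro η hη
    obtain ⟨A, hA, hA0, hA1⟩ := ha η hη
    have Ad : Differentiable ℝ A := hA.differentiable (by simp)
    have mA := hA.continuous.aestronglyMeasurable (μ := (volume : Measure (E d)))
    have hψ : IsC1Test O fun x => γ (A x) * φ x := by
      refine ⟨ContDiff.mul ?_ hφ.isC1Test.1, hφ.2.1.mul_left,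
        (tsupport_mul_subset_right (f := fun x => γ (A x)) (g := φ)).trans hφ.2.2⟩
      refine ContDiff.comp (g := γ) ?_ (hA.of_le (by exact_mod_cast le_top))
      rw [contDiff_one_iff_deriv]
      exact ⟨fun s => (hγ s).differentiableAt, by rwa [funext fun s => (hγ s).deriv]⟩
    have id := h.apply_c1 hO (hc2.memLp.locallyIntegrable (by norm_num))
      (hc'.memLp.locallyIntegrable (by norm_num)) hψ
    have pd : ∀ x, partialDeriv k (fun x => γ (A x) * φ x) x =
        γ' (A x) * partialDeriv k A x * φ x + γ (A x) * partialDeriv k φ x := fun x => by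
      rw [partialDeriv_mul (f := fun x => γ (A x)) ((hγ _).differentiableAt.comp x (Ad x))
        (hφ.1.differentiable (by simp) x), partialDeriv_comp (hγ (A x)) (Ad x)]
    simp only [pd] at id
    have dγ : LpBd volume 2 (fun x => γ (a x) - γ (A x)) (K * η) :=
      LpBd.of_abs_le (mγa.sub (cγ.comp_aestronglyMeasurable mA)) (hA0.const_mul K)
        (.of_forall fun x => by
          rw [abs_mul, abs_of_nonneg hK0]; exact lipschitz_of_deriv_le hγ hK' _ _) |>.mono
        (by rw [abs_of_nonneg hK0])
    have dγ' : LpBd volume 2 (fun x => γ' (a x) - γ' (A x)) (K * η) :=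
      LpBd.of_abs_le (mγa'.sub (cγ'.comp_aestronglyMeasurable mA)) (hA0.const_mul K)
        (.of_forall fun x => by
          rw [abs_mul, abs_of_nonneg hK0]; exact lipschitz_of_deriv_le hγ' hK'' _ _) |>.mono
        (by rw [abs_of_nonneg hK0])
    have hKη : 0 ≤ K * η := by positivity
    have t1 := (dγ.mul (hpqr := inferInstance) (r := 1) hKη
      (hc2.mul_top mφ' hS (.of_forall hφS')))
    have t2 := (dγ'.mul (hpqr := inferInstance) (r := 1) hKη
      (hac.mul_top mφ hS (.of_forall hφS)))
    have t3 := ((hA1 k).mul_top (cγ'.comp_aestronglyMeasurable mA) hK0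
      (.of_forall fun x => hK' (A x))).mul (hpqr := inferInstance) (r := 1) hKη
      (hc2.mul_top mφ hS (.of_forall hφS))
    have t4 := (dγ.mul (hpqr := inferInstance) (r := 1) hKη
      (hc'.mul_top mφ hS (.of_forall hφS)))
    have T := (((t1.add le_rfl (by positivity) (by positivity) t2).add le_rfl (by positivity)
      (by positivity) t3).add le_rfl (by positivity) (by positivity) t4).abs_integral_le
      (by positivity)
    have iT : Integrable fun x => γ (a x) * c x * partialDeriv k φ x +
        (γ' (a x) * a' k x * c x * φ x + γ (a x) * c' x * φ x) := i1.add (i2.add i3)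
    have iz : Integrable fun x => c x * (γ' (A x) * partialDeriv k A x * φ x +
        γ (A x) * partialDeriv k φ x) + c' x * (γ (A x) * φ x) :=
      (iT.sub T.1).congr (.of_forall fun x => by simp only [Pi.sub_apply]; ring)
    have ic : Integrable fun x => c' x * (γ (A x) * φ x) :=
      (((hc'.mul_top (cγ.comp_aestronglyMeasurable mA) hK0
        (.of_forall fun x => hK (A x))).pairing (by positivity)
      ENNReal.toReal_nonneg lφ).1).congr (.of_forall fun x => by ring)
    have z : ∫ x, (c x * (γ' (A x) * partialDeriv k A x * φ x +
        γ (A x) * partialDeriv k φ x) + c' x * (γ (A x) * φ x)) = 0 := by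
      rw [integral_add ((iz.sub ic).congr (.of_forall fun x => by simp only [Pi.sub_apply]; ring)) ic,
        id]
      ring
    have e : ∫ x, (γ (a x) * c x * partialDeriv k φ x +
        (γ' (a x) * a' k x * c x * φ x + γ (a x) * c' x * φ x)) =
        ∫ x, ((γ (a x) - γ (A x)) * (partialDeriv k φ x * c x) +
          (γ' (a x) - γ' (A x)) * (φ x * (a' k x * c x)) +
          γ' (A x) * (a' k x - partialDeriv k A x) * (φ x * c x) +
          (γ (a x) - γ (A x)) * (φ x * c' x)) := by
      rw [← sub_zero (∫ x, (γ (a x) * c x * partialDeriv k φ x + _)), ← z, ← integral_sub iT iz]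
      exact integral_congr_ae (.of_forall fun x => by ring)
    rw [e]
    refine T.2.trans (le_of_eq (by ring))
  have zero : ∫ x, (γ (a x) * c x * partialDeriv k φ x +
      (γ' (a x) * a' k x * c x * φ x + γ (a x) * c' x * φ x)) = 0 := by
    refine abs_nonpos_iff.1 (le_of_forall_pos_le_add fun ε hε => ?_)
    have hQ : 0 ≤ K * S * (3 * Bc + Ba * Bc) := by positivity
    refine (key (ε / (K * S * (3 * Bc + Ba * Bc) + 1)) (by positivity)).trans ?_
    rw [div_mul_eq_mul_div, div_le_iff₀ (by positivity)]
    nlinarith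
  have i23 := i2.add i3
  have s := integral_add i1 i23
  simp only [Pi.add_apply] at s
  rw [zero] at s
  have e2 : ∫ x, (γ' (a x) * a' k x * c x + γ (a x) * c' x) * φ x =
      ∫ x, (γ' (a x) * a' k x * c x * φ x + γ (a x) * c' x * φ x) := by simp only [add_mul]
  rw [e2]
  linarith

/-! ### Multiplication by weights -/

theorem IsC1Test.weight_mul {β φ : E d → ℝ} (hD : IsOpen D) (hβ : ContDiffOn ℝ 1 β D)
    (hφ : IsTest D φ) : IsC1Test D fun x => β x * φ x := by
  have hsub := tsupport_mul_subset_right (f := β) (g := φ)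
  refine ⟨contDiff_iff_contDiffAt.2 fun x => ?_, hφ.2.1.mul_left, hsub.trans hφ.2.2⟩
  by_cases hx : x ∈ tsupport φ
  · exact (hβ.contDiffAt (hD.mem_nhds (hφ.2.2 hx))).mul hφ.isC1Test.1.contDiffAt
  · refine contDiffAt_const (c := (0 : ℝ)) |>.congr_of_eventuallyEq ?_
    filter_upwards [notMem_tsupport_iff_eventuallyEq.1 hx] with y hy
    rw [hy, Pi.zero_apply, mul_zero]

theorem continuous_indicator_mul {β φ : E d → ℝ} (hD : IsOpen D) (hβ : ContinuousOn β D)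
    (hφ : IsTest D φ) : Continuous fun x => D.indicator β x * φ x := by
  refine continuous_iff_continuousAt.2 fun x => ?_
  by_cases hx : x ∈ tsupport φ
  · have hxD := hD.mem_nhds (hφ.2.2 hx)
    refine ((hβ.continuousAt hxD).mul hφ.1.continuous.continuousAt).congr ?_
    filter_upwards [hxD] with y hy
    rw [indicator_of_mem hy, Pi.mul_apply]
  · refine (continuousAt_const (y := (0 : ℝ))).congr ?_
    filter_upwards [notMem_tsupport_iff_eventuallyEq.1 hx] with y hy
    rw [hy, Pi.zero_apply, mul_zero]

theorem continuousOn_partialDeriv {β : E d → ℝ} (hD : IsOpen D) (hβ : ContDiffOn ℝ 1 β D)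
    (j : Fin d) : ContinuousOn (partialDeriv j β) D :=
  (hβ.continuousOn_fderiv_of_isOpen hD le_rfl).clm_apply continuousOn_const

theorem integrable_mul_of_locallyIntegrable {p ψ : E d → ℝ}
    (hp : LocallyIntegrable p volume) (hψ : Continuous ψ) (hc : HasCompactSupport ψ) :
    Integrable fun x => p x * ψ x := by
  simpa only [smul_eq_mul, mul_comm] using hp.integrable_smul_left_of_hasCompactSupport hψ hc

theorem WeakD.weight_mul (hD : IsOpen D) {β p P : E d → ℝ} {j : Fin d} (hβ : ContDiffOn ℝ 1 β D)
    (hp : LocallyIntegrable p volume) (hP : LocallyIntegrable P volume) (h : WeakD D j p P) :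
    WeakD D j (fun x => D.indicator β x * p x)
      (fun x => D.indicator (partialDeriv j β) x * p x + D.indicator β x * P x) := by
  intro φ hφ
  have hψ := IsC1Test.weight_mul hD hβ hφ
  have id := h.apply_c1 hD hp hP hψ
  have hβd : ∀ x ∈ D, DifferentiableAt ℝ β x := fun x hx =>
    (hβ.contDiffAt (hD.mem_nhds hx)).differentiableAt (by simp)
  have φd : Differentiable ℝ φ := hφ.1.differentiable (by simp)
  have pd : ∀ x, partialDeriv j (fun x => β x * φ x) x =
      D.indicator (partialDeriv j β) x * φ x + D.indicator β x * partialDeriv j φ x := fun x => by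
    by_cases hx : x ∈ D
    · rw [partialDeriv_mul (hβd x hx) (φd x), indicator_of_mem hx, indicator_of_mem hx]
    · rw [indicator_of_notMem hx, indicator_of_notMem hx]
      simp only [zero_mul, add_zero]
      exact image_eq_zero_of_notMem_tsupport fun hx' =>
        hx (hψ.2.2 (tsupport_partialDeriv_subset _ _ hx'))
  have i1 : Integrable fun x => p x * (D.indicator (partialDeriv j β) x * φ x) := by
    exact integrable_mul_of_locallyIntegrable hp
      (continuous_indicator_mul hD (continuousOn_partialDeriv hD hβ j) hφ) hφ.2.1.mul_left
  have i2 : Integrable fun x => p x * (D.indicator β x * partialDeriv j φ x) := by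
    have := (integrable_mul_of_locallyIntegrable hp (hψ.continuous_partialDeriv j)
      (hψ.hasCompactSupport_partialDeriv j)).sub i1
    refine this.congr (.of_forall fun x => ?_)
    simp only [pd, Pi.sub_apply]
    ring
  have i3 : Integrable fun x => D.indicator β x * P x * φ x := by
    refine (integrable_mul_of_locallyIntegrable hP hψ.1.continuous hψ.2.1).congr
      (.of_forall fun x => ?_)
    by_cases hx : x ∈ D
    · simp only [indicator_of_mem hx]
      ring
    · simp [hφ.eq_zero hx]
  simp only [pd, mul_add] at id
  rw [integral_add i1 i2] at id
  have e1 : ∫ x, (D.indicator (partialDeriv j β) x * p x + D.indicator β x * P x) * φ x =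
      (∫ x, p x * (D.indicator (partialDeriv j β) x * φ x)) + ∫ x, P x * (β x * φ x) := by
    simp only [add_mul]
    rw [integral_add (i1.congr (.of_forall fun x => by ring)) i3]
    congr 1
    · exact integral_congr_ae (.of_forall fun x => by ring)
    · refine integral_congr_ae (.of_forall fun x => ?_)
      by_cases hx : x ∈ D
      · simp only [indicator_of_mem hx]
        ring
      · simp [hφ.eq_zero hx]
  have e2 : ∫ x, D.indicator β x * p x * partialDeriv j φ x =
      ∫ x, p x * (D.indicator β x * partialDeriv j φ x) :=
    integral_congr_ae (.of_forall fun x => by ring)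
  rw [e1, e2]
  linarith

/-- A smooth approximation of the identity of `[0, ∞)` that vanishes near zero. -/
def softThreshold (n : ℕ) (s : ℝ) : ℝ := s * Real.smoothTransition (n * s - 1)

theorem contDiff_softThreshold (n : ℕ) : ContDiff ℝ 1 (softThreshold n) :=
  contDiff_id.mul (Real.smoothTransition.contDiff.comp
    ((contDiff_const.mul contDiff_id).sub contDiff_const))

theorem softThreshold_eq_zero {n : ℕ} {s : ℝ} (h : n * s ≤ 1) : softThreshold n s = 0 := by
  rw [softThreshold, Real.smoothTransition.zero_of_nonpos (by linarith), mul_zero]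

theorem abs_softThreshold_le (n : ℕ) (s : ℝ) : |softThreshold n s| ≤ |s| := by
  rw [softThreshold, abs_mul, abs_of_nonneg (Real.smoothTransition.nonneg _)]
  exact mul_le_of_le_one_right (abs_nonneg _) (Real.smoothTransition.le_one _)

theorem softThreshold_eventuallyEq {s : ℝ} (hs : 0 < s) :
    ∀ᶠ n : ℕ in atTop, softThreshold n =ᶠ[𝓝 s] id := by
  obtain ⟨N, hN⟩ := exists_nat_gt (4 / s)
  filter_upwards [eventually_ge_atTop N] with n hn
  filter_upwards [lt_mem_nhds (half_lt_self hs)] with t ht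
  have h1 : 4 / s < n := hN.trans_le (by exact_mod_cast hn)
  rw [div_lt_iff₀ hs] at h1
  have h2 : (2 : ℝ) ≤ n * t := by nlinarith [Nat.cast_nonneg (α := ℝ) n]
  rw [softThreshold, Real.smoothTransition.one_of_one_le (by linarith), mul_one, id]

/-- By scaling, the derivative is σ(t) + (t+1) σ'(t) at t = ns − 1, with σ the smooth transition. It
depends on n through t only, and σ' has compact support. -/
theorem exists_deriv_softThreshold_le : ∃ C, ∀ n s, |deriv (softThreshold n) s| ≤ C := by
  have hσ : ContDiff ℝ 1 Real.smoothTransition := Real.smoothTransition.contDiff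
  have hc : Continuous fun t => (t + 1) * deriv Real.smoothTransition t :=
    (continuous_id.add continuous_const).mul (hσ.continuous_deriv le_rfl)
  have hs : HasCompactSupport fun t => (t + 1) * deriv Real.smoothTransition t := by
    refine HasCompactSupport.intro (isCompact_Icc (a := (0 : ℝ)) (b := 1)) fun t ht => ?_
    have : deriv Real.smoothTransition t = 0 := by
      rcases lt_or_ge t 0 with h | h
      · have e : Real.smoothTransition =ᶠ[𝓝 t] fun _ => (0 : ℝ) := by
          filter_upwards [gt_mem_nhds h] with s hs
          exact Real.smoothTransition.zero_of_nonpos hs.le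
        rw [e.deriv_eq, deriv_const]
      · have h1 : 1 < t := not_le.1 fun h' => ht ⟨h, h'⟩
        have e : Real.smoothTransition =ᶠ[𝓝 t] fun _ => (1 : ℝ) := by
          filter_upwards [lt_mem_nhds h1] with s hs
          exact Real.smoothTransition.one_of_one_le hs.le
        rw [e.deriv_eq, deriv_const]
    rw [this, mul_zero]
  obtain ⟨C, hC⟩ := hs.exists_bound_of_continuous hc
  refine ⟨1 + C, fun n s => ?_⟩
  have hd : HasDerivAt (softThreshold n) (1 * Real.smoothTransition (n * s - 1) +
      s * (deriv Real.smoothTransition (n * s - 1) * n)) s := by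
    have h1 : HasDerivAt (fun s : ℝ => n * s - 1) n s := by
      simpa using ((hasDerivAt_id s).const_mul (n : ℝ)).sub_const 1
    exact (hasDerivAt_id s).mul
      (((hσ.differentiable (by simp) _).hasDerivAt).comp s h1)
  rw [hd.deriv, one_mul]
  have h2 := hC (n * s - 1)
  rw [sub_add_cancel, Real.norm_eq_abs] at h2
  refine (abs_add_le _ _).trans (add_le_add ?_ ?_)
  · rw [abs_of_nonneg (Real.smoothTransition.nonneg _)]
    exact Real.smoothTransition.le_one _
  · rwa [show s * (deriv Real.smoothTransition (n * s - 1) * n) =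
      n * s * deriv Real.smoothTransition (n * s - 1) by ring]

/-- A weight that vanishes on the boundary of the set where a weak derivative is known. -/
theorem WeakD.weight_mul_of_frontier (hD : IsOpen D) {O : Set (E d)} (hO : IsOpen O)
    {β p P : E d → ℝ} {j : Fin d} (hβ : ContDiffOn ℝ 1 β D) (hβ0 : ∀ x ∈ D, 0 ≤ β x)
    (hβO : ∀ x ∈ D, x ∈ frontier O → β x = 0)
    (hp : LocallyIntegrable p volume) (hP : LocallyIntegrable P volume)
    (hp0 : ∀ x ∉ O, p x = 0) (hP0 : ∀ x ∉ O, P x = 0) (h : WeakD O j p P) :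
    WeakD D j (fun x => D.indicator β x * p x)
      (fun x => D.indicator (partialDeriv j β) x * p x + D.indicator β x * P x) := by
  intro φ hφ
  have hβd : ∀ x ∈ D, DifferentiableAt ℝ β x := fun x hx =>
    (hβ.contDiffAt (hD.mem_nhds hx)).differentiableAt (by simp)
  have φd : Differentiable ℝ φ := hφ.1.differentiable (by simp)
  have hθβ : ∀ n, ContDiffOn ℝ 1 (fun x => softThreshold n (β x)) D := fun n =>
    (contDiff_softThreshold n).comp_contDiffOn hβ
  have hψ := fun n => IsC1Test.weight_mul hD (hθβ n) hφ
  -- Thresholding makes the weight vanish in a neighbourhood of ∂O within the support of φ, so its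
  -- restriction to O times φ is a C¹ test function on O.
  set χ : ℕ → E d → ℝ := fun n => O.indicator fun x => softThreshold n (β x) * φ x with hχ
  have hχ0 : ∀ n, ∀ x ∉ O, χ n =ᶠ[𝓝 x] 0 := by
    intro n x hx
    by_cases hxc : x ∈ closure O
    · by_cases hxφ : x ∈ tsupport φ
      · have hxD := hφ.2.2 hxφ
        have hb := hβO x hxD ⟨hxc, by rwa [hO.interior_eq]⟩
        have : Tendsto (fun y => n * β y) (𝓝 x) (𝓝 (n * β x)) :=
          ((hβd x hxD).continuousAt.tendsto).const_mul _
        rw [hb, mul_zero] at this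
        filter_upwards [this.eventually_lt_const one_pos] with y hy
        simp only [hχ]
        by_cases hyO : y ∈ O
        · rw [indicator_of_mem hyO, softThreshold_eq_zero hy.le, zero_mul, Pi.zero_apply]
        · rw [indicator_of_notMem hyO, Pi.zero_apply]
      · filter_upwards [notMem_tsupport_iff_eventuallyEq.1 hxφ] with y hy
        simp only [hχ]
        by_cases hyO : y ∈ O
        · rw [indicator_of_mem hyO, hy, Pi.zero_apply, mul_zero]
        · rw [indicator_of_notMem hyO, Pi.zero_apply]
    · filter_upwards [isClosed_closure.isOpen_compl.mem_nhds hxc] with y hy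
      simp only [hχ]
      rw [indicator_of_notMem fun h => hy (subset_closure h), Pi.zero_apply]
  have hχ1 : ∀ n, ∀ x ∈ O, χ n =ᶠ[𝓝 x] fun x => softThreshold n (β x) * φ x := fun n x hx => by
    filter_upwards [hO.mem_nhds hx] with y hy
    simp only [hχ]
    rw [indicator_of_mem hy]
  have hχt : ∀ n, IsC1Test O (χ n) := by
    intro n
    refine ⟨contDiff_iff_contDiffAt.2 fun x => ?_, ?_, fun x hx => ?_⟩
    · by_cases hx : x ∈ O
      · exact (hψ n).1.contDiffAt.congr_of_eventuallyEq (hχ1 n x hx)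
      · exact contDiffAt_const.congr_of_eventuallyEq (hχ0 n x hx)
    · refine HasCompactSupport.intro (K := tsupport φ) hφ.2.1 fun x hx => ?_
      have := image_eq_zero_of_notMem_tsupport hx
      simp only [hχ]
      by_cases hxO : x ∈ O
      · rw [indicator_of_mem hxO, this, mul_zero]
      · rw [indicator_of_notMem hxO]
    · by_contra hxO
      exact notMem_tsupport_iff_eventuallyEq.2 (hχ0 n x hxO) hx
  have pd : ∀ n, ∀ x ∈ O, partialDeriv j (χ n) x =
      deriv (softThreshold n) (D.indicator β x) * (D.indicator (partialDeriv j β) x * φ x) +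
      softThreshold n (D.indicator β x) * partialDeriv j φ x := fun n x hx => by
    have e : partialDeriv j (χ n) x = partialDeriv j (fun x => softThreshold n (β x) * φ x) x := by
      rw [partialDeriv, (hχ1 n x hx).fderiv_eq]; rfl
    rw [e]
    by_cases hxD : x ∈ D
    · have hd : HasDerivAt (softThreshold n) _ (β x) :=
        ((contDiff_softThreshold n).differentiable (by simp) (β x)).hasDerivAt
      rw [partialDeriv_mul (f := fun x => softThreshold n (β x))
        (hd.differentiableAt.comp x (hβd x hxD)) (φd x), partialDeriv_comp hd (hβd x hxD),
        indicator_of_mem hxD, indicator_of_mem hxD]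
      ring
    · rw [hφ.eq_zero hxD, (hφ.partialDeriv j).eq_zero hxD, mul_zero, mul_zero, mul_zero, add_zero]
      exact image_eq_zero_of_notMem_tsupport fun hx' =>
        hxD ((hψ n).2.2 (tsupport_partialDeriv_subset _ _ hx'))
  have id : ∀ n, ∫ x, p x * (deriv (softThreshold n) (D.indicator β x) *
      (D.indicator (partialDeriv j β) x * φ x) +
      softThreshold n (D.indicator β x) * partialDeriv j φ x) =
      -∫ x, P x * (softThreshold n (D.indicator β x) * φ x) := by
    intro n
    have h1 := h.apply_c1 hO hp hP (hχt n)
    rw [show ∫ x, p x * partialDeriv j (χ n) x = ∫ x, p x * (deriv (softThreshold n)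
        (D.indicator β x) * (D.indicator (partialDeriv j β) x * φ x) +
        softThreshold n (D.indicator β x) * partialDeriv j φ x) from
      integral_congr_ae (.of_forall fun x => ?_)] at h1
    · rw [h1]
      congr 1
      refine integral_congr_ae (.of_forall fun x => ?_)
      by_cases hxO : x ∈ O
      · simp only [hχ, indicator_of_mem hxO]
        by_cases hxD : x ∈ D
        · rw [indicator_of_mem hxD]
        · simp [hφ.eq_zero hxD]
      · simp [hP0 x hxO]
    · by_cases hxO : x ∈ O
      · simp only [pd n x hxO]
      · simp [hp0 x hxO]
  -- the dominating functions
  have cψ' := continuous_indicator_mul hD hβ.continuousOn (hφ.partialDeriv j)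
  have cψ := continuous_indicator_mul hD hβ.continuousOn hφ
  have cβ' := continuous_indicator_mul hD (continuousOn_partialDeriv hD hβ j) hφ
  have i1 := integrable_mul_of_locallyIntegrable hp cβ' hφ.2.1.mul_left
  have i2 := integrable_mul_of_locallyIntegrable hp cψ' (hφ.partialDeriv j).2.1.mul_left
  have i3 := integrable_mul_of_locallyIntegrable hP cψ hφ.2.1.mul_left
  obtain ⟨C, hC⟩ := exists_deriv_softThreshold_le
  have mβ : AEStronglyMeasurable (D.indicator β) volume :=
    (aestronglyMeasurable_indicator_iff hD.measurableSet).2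
      (hβ.continuousOn.aestronglyMeasurable hD.measurableSet)
  -- at a zero of the weight its gradient vanishes
  have grad0 : ∀ x ∈ D, β x = 0 → partialDeriv j β x = 0 := fun x hx h0 => by
    have : IsLocalMin β x := by
      filter_upwards [hD.mem_nhds hx] with y hy
      rw [h0]
      exact hβ0 y hy
    rw [partialDeriv, this.fderiv_eq_zero, zero_apply]
  have lim0 : ∀ x, Tendsto (fun n => softThreshold n (D.indicator β x)) atTop
      (𝓝 (D.indicator β x)) := fun x => by
    have hn : 0 ≤ D.indicator β x := indicator_nonneg hβ0 x
    rcases hn.eq_or_lt with h0 | h0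
    · rw [← h0]
      simp [softThreshold]
    · refine tendsto_const_nhds.congr' ?_
      filter_upwards [softThreshold_eventuallyEq h0] with n hn
      exact hn.eq_of_nhds.symm
  -- Where β > 0 the derivative of the threshold is eventually 1. Where β = 0 it is not, but there
  -- ∂ⱼβ vanishes as well, since β attains a minimum.
  have lim1 : ∀ x, Tendsto (fun n => deriv (softThreshold n) (D.indicator β x) *
      (D.indicator (partialDeriv j β) x * φ x)) atTop
      (𝓝 (D.indicator (partialDeriv j β) x * φ x)) := fun x => by
    have hn : 0 ≤ D.indicator β x := indicator_nonneg hβ0 x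
    rcases hn.eq_or_lt with h0 | h0
    · by_cases hx : x ∈ D
      · rw [indicator_of_mem hx] at h0
        rw [show D.indicator (partialDeriv j β) x = 0 by
          rw [indicator_of_mem hx, grad0 x hx h0.symm]]
        simp
      · rw [hφ.eq_zero hx]
        simp
    · refine tendsto_const_nhds.congr' ?_
      filter_upwards [softThreshold_eventuallyEq h0] with n hn
      rw [hn.deriv_eq, deriv_id, one_mul]
  have L1 : Tendsto (fun n => ∫ x, p x * (deriv (softThreshold n) (D.indicator β x) *
      (D.indicator (partialDeriv j β) x * φ x) +
      softThreshold n (D.indicator β x) * partialDeriv j φ x)) atTop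
      (𝓝 (∫ x, p x * (D.indicator (partialDeriv j β) x * φ x +
        D.indicator β x * partialDeriv j φ x))) := by
    refine tendsto_integral_of_dominated_convergence
      (fun x => C * |p x * (D.indicator (partialDeriv j β) x * φ x)| +
        |p x * (D.indicator β x * partialDeriv j φ x)|) (fun n => ?_)
      ((i1.abs.const_mul C).add i2.abs) (fun n => .of_forall fun x => ?_)
      (.of_forall fun x => ((lim1 x).add ((lim0 x).mul_const _)).const_mul _)
    · refine hp.aestronglyMeasurable.mul (AEStronglyMeasurable.add ?_ ?_)
      · exact (((contDiff_softThreshold n).continuous_deriv le_rfl).comp_aestronglyMeasurable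
          mβ).mul cβ'.aestronglyMeasurable
      · exact ((contDiff_softThreshold n).continuous.comp_aestronglyMeasurable mβ).mul
          (hφ.continuous_partialDeriv j).aestronglyMeasurable
    · rw [Real.norm_eq_abs, mul_add]
      refine (abs_add_le _ _).trans (add_le_add ?_ ?_)
      · rw [show p x * (deriv (softThreshold n) (D.indicator β x) *
          (D.indicator (partialDeriv j β) x * φ x)) = deriv (softThreshold n) (D.indicator β x) *
          (p x * (D.indicator (partialDeriv j β) x * φ x)) by ring, abs_mul]
        exact mul_le_mul_of_nonneg_right (hC n _) (abs_nonneg _)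
      · rw [abs_mul, abs_mul, abs_mul, abs_mul]
        exact mul_le_mul_of_nonneg_left (mul_le_mul_of_nonneg_right (abs_softThreshold_le n _)
          (abs_nonneg _)) (abs_nonneg _)
  have L2 : Tendsto (fun n => -∫ x, P x * (softThreshold n (D.indicator β x) * φ x)) atTop
      (𝓝 (-∫ x, P x * (D.indicator β x * φ x))) := by
    refine (tendsto_integral_of_dominated_convergence (fun x => |P x * (D.indicator β x * φ x)|)
      (fun n => ?_) i3.abs (fun n => .of_forall fun x => ?_)
      (.of_forall fun x => ((lim0 x).mul_const _).const_mul _)).neg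
    · exact hP.aestronglyMeasurable.mul
        (((contDiff_softThreshold n).continuous.comp_aestronglyMeasurable mβ).mul
          hφ.1.continuous.aestronglyMeasurable)
    · rw [Real.norm_eq_abs, abs_mul, abs_mul, abs_mul, abs_mul]
      exact mul_le_mul_of_nonneg_left (mul_le_mul_of_nonneg_right (abs_softThreshold_le n _)
        (abs_nonneg _)) (abs_nonneg _)
  simp only [id] at L1
  have fin := tendsto_nhds_unique L1 L2
  simp only [mul_add] at fin
  rw [integral_add i1 i2] at fin
  have e1 : ∫ x, (D.indicator (partialDeriv j β) x * p x + D.indicator β x * P x) * φ x =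
      (∫ x, p x * (D.indicator (partialDeriv j β) x * φ x)) +
        ∫ x, P x * (D.indicator β x * φ x) := by
    rw [← integral_add i1 i3]
    exact integral_congr_ae (.of_forall fun x => by ring)
  have e2 : ∫ x, D.indicator β x * p x * partialDeriv j φ x =
      ∫ x, p x * (D.indicator β x * partialDeriv j φ x) :=
    integral_congr_ae (.of_forall fun x => by ring)
  rw [e1, e2]
  linarith

end Peridynamics

end

/-! ### Increments of elements of W and the first two derivatives of β γ(a) -/

noncomputable section

open scoped ENNReal NNReal

namespace Peridynamics

variable {d : ℕ} {D : Set (E d)}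

/-! ### Linear operations on weak derivatives -/

theorem LpBd.locallyIntegrable {p : ℝ≥0∞} {f : E d → ℝ} {c : ℝ} (h : LpBd volume p f c)
    (hp : 1 ≤ p) : LocallyIntegrable f volume := h.memLp.locallyIntegrable hp

theorem WeakD.congr_fun {O : Set (E d)} {j : Fin d} {p P q Q : E d → ℝ} (h : WeakD O j p P)
    (hp : ∀ x, p x = q x) (hP : ∀ x, P x = Q x) : WeakD O j q Q := by
  obtain rfl : p = q := funext hp
  obtain rfl : P = Q := funext hP
  exact h

theorem WeakD.add {O : Set (E d)} {j : Fin d} {p P q Q : E d → ℝ} (h : WeakD O j p P)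
    (h' : WeakD O j q Q) (hp : LocallyIntegrable p volume) (hP : LocallyIntegrable P volume)
    (hq : LocallyIntegrable q volume) (hQ : LocallyIntegrable Q volume) :
    WeakD O j (fun x => p x + q x) (fun x => P x + Q x) := by
  intro φ hφ
  have c := hφ.continuous_partialDeriv j
  have s := hφ.hasCompactSupport_partialDeriv j
  simp only [add_mul]
  rw [integral_add (integrable_mul_of_locallyIntegrable hp c s)
      (integrable_mul_of_locallyIntegrable hq c s),
    integral_add (integrable_mul_of_locallyIntegrable hP hφ.1.continuous hφ.2.1)
      (integrable_mul_of_locallyIntegrable hQ hφ.1.continuous hφ.2.1), h φ hφ, h' φ hφ]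
  ring

theorem WeakD.const_mul {O : Set (E d)} {j : Fin d} {p P : E d → ℝ} (h : WeakD O j p P) (c : ℝ) :
    WeakD O j (fun x => c * p x) (fun x => c * P x) := by
  intro φ hφ
  simp only [mul_assoc]
  rw [integral_const_mul, integral_const_mul, h φ hφ]
  ring

theorem WeakD.finset_sum {ι : Type*} (s : Finset ι) {O : Set (E d)} {j : Fin d}
    {p P : ι → E d → ℝ} (h : ∀ i, WeakD O j (p i) (P i))
    (hp : ∀ i, LocallyIntegrable (p i) volume) (hP : ∀ i, LocallyIntegrable (P i) volume) :
    WeakD O j (fun x => ∑ i ∈ s, p i x) (fun x => ∑ i ∈ s, P i x) := by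
  intro φ hφ
  have c := hφ.continuous_partialDeriv j
  have t := hφ.hasCompactSupport_partialDeriv j
  simp only [Finset.sum_mul]
  rw [integral_finsetSum _ fun i _ => integrable_mul_of_locallyIntegrable (hp i) c t,
    integral_finsetSum _ fun i _ => integrable_mul_of_locallyIntegrable (hP i) hφ.1.continuous
      hφ.2.1,
    ← Finset.sum_neg_distrib]
  exact Finset.sum_congr rfl fun i _ => h i φ hφ

theorem partialDeriv_comp_add_right (φ : E d → ℝ) (h : E d) (j : Fin d) (x : E d) :
    partialDeriv j (fun y => φ (y + h)) x = partialDeriv j φ (x + h) := by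
  rw [partialDeriv, fderiv_comp_add_right]; rfl

theorem IsTest.comp_add_right {O : Set (E d)} {φ : E d → ℝ} (hφ : IsTest O φ) (h : E d) :
    IsTest {x | x + h ∈ O} fun x => φ (x + h) := by
  refine ⟨hφ.1.comp (contDiff_id.add contDiff_const),
    hφ.2.1.comp_homeomorph (Homeomorph.addRight h), fun x hx => ?_⟩
  exact hφ.2.2 ((tsupport_comp_eq_preimage φ (Homeomorph.addRight h)).subset hx)

theorem WeakD.comp_add_right {O : Set (E d)} {j : Fin d} {p P : E d → ℝ} (h : WeakD O j p P)
    (s : E d) : WeakD {x | x + s ∈ O} j (fun x => p (x + s)) (fun x => P (x + s)) := by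
  intro φ hφ
  have ht : IsTest O fun x => φ (x + -s) := by
    have := hφ.comp_add_right (-s)
    simpa using this
  have e := h _ ht
  simp only [partialDeriv_comp_add_right] at e
  rw [← integral_add_right_eq_self (fun x => p x * partialDeriv j φ (x + -s)) s,
    ← integral_add_right_eq_self (fun x => P x * φ (x + -s)) s] at e
  simpa using e

theorem comp1_eq_zero {w : W D} {i j : Fin d} {x : E d} (hx : x ∉ D) : comp1 w i j x = 0 :=
  indicator_of_notMem hx _

theorem comp2_eq_zero {w : W D} {i j k : Fin d} {x : E d} (hx : x ∉ D) : comp2 w i j k x = 0 :=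
  indicator_of_notMem hx _

/-! ### Increments -/

/-- The increment over `h` of a vector field, in the direction `e`. -/
def incr (F : Fin d → E d → ℝ) (h e : E d) (x : E d) : ℝ := ∑ i, e i * (F i (x + h) - F i x)

theorem abs_apply_le_one {e : E d} (he : ‖e‖ ≤ 1) (i : Fin d) : |e i| ≤ 1 :=
  (PiLp.norm_apply_le e i).trans he

theorem LpBd.incr {p : ℝ≥0∞} (hp : 1 ≤ p) {F : Fin d → E d → ℝ} {B : ℝ} (hB : 0 ≤ B) {e : E d}
    (he : ‖e‖ ≤ 1) (h : E d) (hF : ∀ i, LpBd volume p (F i) B) :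
    LpBd volume p (incr F h e) (2 * d * B) := by
  have h1 : ∀ i, LpBd volume p (fun x => e i * (F i (x + h) - F i x)) (2 * B) := fun i =>
    ((((hF i).comp_add_right h).sub hp hB hB (hF i)).const_mul (e i)).mono (by
      have := abs_apply_le_one he i
      nlinarith [abs_nonneg (e i)])
  refine (LpBd.nonneg_sum Finset.univ hp (fun _ => by positivity) h1).mono (le_of_eq ?_)
  simp
  ring

theorem incr_ae_eq {F G : Fin d → E d → ℝ} (h e : E d) (hFG : ∀ i, F i =ᵐ[volume] G i) :
    incr F h e =ᵐ[volume] incr G h e := by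
  have h1 := ae_all_iff.2 hFG
  have h2 := (measurePreserving_add_right (volume : Measure (E d)) h).quasiMeasurePreserving.ae h1
  filter_upwards [h1, h2] with x hx hx'
  simp only [incr, hx, hx']

theorem incr_sub (F G : Fin d → E d → ℝ) (h e x : E d) :
    incr (fun i x => F i x - G i x) h e x = incr F h e x - incr G h e x := by
  simp only [incr, ← Finset.sum_sub_distrib]
  exact Finset.sum_congr rfl fun i _ => by ring

theorem incr_const_mul (c : ℝ) (F : Fin d → E d → ℝ) (h e x : E d) :
    incr (fun i x => c * F i x) h e x = c * incr F h e x := by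
  simp only [incr, Finset.mul_sum]
  exact Finset.sum_congr rfl fun i _ => by ring

theorem partialDeriv_incr {F : Fin d → E d → ℝ} (hF : ∀ i, Differentiable ℝ (F i)) (h e : E d)
    (j : Fin d) (x : E d) :
    partialDeriv j (incr F h e) x = incr (fun i => partialDeriv j (F i)) h e x := by
  have h1 : ∀ i, HasFDerivAt (fun x => e i * (F i (x + h) - F i x))
      (e i • (fderiv ℝ (F i) (x + h) - fderiv ℝ (F i) x)) x := fun i =>
    ((((hF i (x + h)).hasFDerivAt.comp x ((hasFDerivAt_id x).add_const h)).sub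
      (hF i x).hasFDerivAt).const_mul (e i))
  have h2 := HasFDerivAt.fun_sum (u := Finset.univ) fun i _ => h1 i
  rw [show incr F h e = fun x => ∑ i, e i * (F i (x + h) - F i x) from rfl,
    partialDeriv_of_hasFDerivAt h2]
  simp [incr, partialDeriv]

theorem integrable_incr {F : Fin d → E d → ℝ} (hF : ∀ i, Integrable (F i)) (h e : E d) :
    Integrable (incr F h e) :=
  integrable_finsetSum Finset.univ (f := fun i x => e i * (F i (x + h) - F i x)) fun i _ =>
    (((hF i).comp_add_right h).sub (hF i)).const_mul (e i)

/-- The component of the increment of `w` in the direction `e`, and its weak derivatives. -/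
def incr0 (w : W D) (h e : E d) : E d → ℝ := incr (comp0 w) h e

def incr1 (w : W D) (h e : E d) (j : Fin d) : E d → ℝ := incr (fun i => comp1 w i j) h e

def incr2 (w : W D) (h e : E d) (j k : Fin d) : E d → ℝ := incr (fun i => comp2 w i j k) h e

theorem smoothApprox_incr (hD : IsOpen D) (w : W D) (h : E d) {e : E d} (he : ‖e‖ ≤ 1) :
    SmoothApprox (incr0 w h e) (incr1 w h e) := by
  intro η hη
  set η' := η / (2 * d + 1) with hη'
  have hη'0 : 0 < η' := by positivity
  have hle : 2 * d * η' ≤ η := by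
    rw [hη', mul_div_assoc', div_le_iff₀ (by positivity)]
    nlinarith
  obtain ⟨Φ, hΦ, h0, h1⟩ := W.exists_test_near hD w hη'0
  refine ⟨incr Φ h e, ?_, ?_, fun j => ?_⟩
  · refine ContDiff.sum fun i _ => contDiff_const.mul (ContDiff.sub ?_ (hΦ i).1)
    exact (hΦ i).1.comp (contDiff_id.add contDiff_const)
  · refine ((LpBd.incr (by norm_num) hη'0.le he h h0).mono hle).congr (.of_forall fun x => ?_)
    exact incr_sub (comp0 w) Φ h e x
  · refine ((LpBd.incr (by norm_num) hη'0.le he h fun i => h1 i j).mono hle).congr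
      (.of_forall fun x => ?_)
    simp only [partialDeriv_incr fun i => (hΦ i).1.differentiable (by simp)]
    exact incr_sub (fun i => comp1 w i j) _ h e x

theorem weakD_incr (hDb : Bornology.IsBounded D) (hD : IsOpen D) (w : W D) (h e : E d)
    (j : Fin d) : WeakD univ j (incr0 w h e) (incr1 w h e j) := by
  have l0 := fun i => W.lpBd_c0 hD w i
  have l1 := fun i => W.lpBd_c1 hD w i j
  have l0' := fun i => (l0 i).comp_add_right h
  have l1' := fun i => (l1 i).comp_add_right h
  have h12 : (1 : ℝ≥0∞) ≤ 2 := by norm_num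
  have hw := fun i => W.weakD_univ hDb hD w i j
  have hw' : ∀ i, WeakD univ j (fun x => comp0 w i (x + h)) (fun x => comp1 w i j (x + h)) :=
    fun i => by simpa using (hw i).comp_add_right h
  have key : ∀ i, WeakD univ j (fun x => e i * (comp0 w i (x + h) + -1 * comp0 w i x))
      (fun x => e i * (comp1 w i j (x + h) + -1 * comp1 w i j x)) := fun i =>
    ((hw' i).add ((hw i).const_mul (-1)) ((l0' i).locallyIntegrable h12)
      ((l1' i).locallyIntegrable h12) (((l0 i).const_mul (-1)).locallyIntegrable h12)
      (((l1 i).const_mul (-1)).locallyIntegrable h12)).const_mul (e i)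
  refine (WeakD.finset_sum Finset.univ key (fun i => ?_) fun i => ?_).congr_fun
    (fun x => ?_) fun x => ?_
  · exact (((l0' i).add h12 (norm_nonneg _) (by positivity) ((l0 i).const_mul (-1))).const_mul
      (e i)).locallyIntegrable h12
  · exact (((l1' i).add h12 (norm_nonneg _) (by positivity) ((l1 i).const_mul (-1))).const_mul
      (e i)).locallyIntegrable h12
  · simp only [incr0, incr]
    exact Finset.sum_congr rfl fun i _ => by ring
  · simp only [incr1, incr]
    exact Finset.sum_congr rfl fun i _ => by ring

/-! ### Weights, profiles and jets -/

/-- A weight on `D` adapted to increments over `h`. -/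
structure IsWeight (D : Set (E d)) (h : E d) (B : ℝ) (β : E d → ℝ) : Prop where
  contDiffOn : ContDiffOn ℝ 2 β D
  nonneg : ∀ x ∈ D, 0 ≤ β x
  eq_zero : ∀ x ∈ D, x + h ∈ frontier D → β x = 0
  bound : ∀ x ∈ D, β x ≤ B
  bound_one : ∀ j, ∀ x ∈ D, |partialDeriv j β x| ≤ B
  bound_two : ∀ j k, ∀ x ∈ D, |partialDeriv k (partialDeriv j β) x| ≤ B

/-- A function with its derivatives, those of order at most three being bounded. -/
structure IsProfile (γ : ℕ → ℝ → ℝ) (K : ℝ) : Prop where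
  deriv : ∀ m s, HasDerivAt (γ m) (γ (m + 1) s) s
  bound : ∀ m ≤ 3, ∀ s, |γ m s| ≤ K

/-- The function `β γ(a)` on `D`. -/
def jet0 (D : Set (E d)) (β : E d → ℝ) (γ : ℕ → ℝ → ℝ) (a : E d → ℝ) (x : E d) : ℝ :=
  D.indicator β x * γ 0 (a x)

/-- The partial derivatives of `jet0`, where `a1` is the gradient of `a`. -/
def jet1 (D : Set (E d)) (β : E d → ℝ) (γ : ℕ → ℝ → ℝ) (a : E d → ℝ) (a1 : Fin d → E d → ℝ)
    (j : Fin d) (x : E d) : ℝ :=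
  D.indicator (partialDeriv j β) x * γ 0 (a x) + D.indicator β x * (γ 1 (a x) * a1 j x)

/-- The second partial derivatives of `jet0`. -/
def jet2 (D : Set (E d)) (β : E d → ℝ) (γ : ℕ → ℝ → ℝ) (a : E d → ℝ) (a1 : Fin d → E d → ℝ)
    (a2 : Fin d → Fin d → E d → ℝ) (j k : Fin d) (x : E d) : ℝ :=
  (D.indicator (partialDeriv k (partialDeriv j β)) x * γ 0 (a x) +
      D.indicator (partialDeriv j β) x * (γ 1 (a x) * a1 k x)) +
    (D.indicator (partialDeriv k β) x * (γ 1 (a x) * a1 j x) +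
      D.indicator β x * (γ 2 (a x) * (a1 k x * a1 j x) + γ 1 (a x) * a2 j k x))

theorem IsProfile.nonneg {γ : ℕ → ℝ → ℝ} {K : ℝ} (hγ : IsProfile γ K) : 0 ≤ K :=
  (abs_nonneg _).trans (hγ.bound 0 (by norm_num) 0)

theorem IsProfile.continuous {γ : ℕ → ℝ → ℝ} {K : ℝ} (hγ : IsProfile γ K) (m : ℕ) :
    Continuous (γ m) := continuous_of_hasDerivAt (hγ.deriv m)

theorem contDiffOn_partialDeriv (hD : IsOpen D) {β : E d → ℝ} (hβ : ContDiffOn ℝ 2 β D)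
    (j : Fin d) : ContDiffOn ℝ 1 (partialDeriv j β) D :=
  (hβ.fderiv_of_isOpen hD (m := 1) (by norm_num)).clm_apply contDiffOn_const

theorem aestronglyMeasurable_indicator_of_continuousOn (hD : IsOpen D) {β : E d → ℝ}
    (hβ : ContinuousOn β D) : AEStronglyMeasurable (D.indicator β) volume :=
  (aestronglyMeasurable_indicator_iff hD.measurableSet).2
    (hβ.aestronglyMeasurable hD.measurableSet)

theorem abs_indicator_le {β : E d → ℝ} {B : ℝ} (hB : 0 ≤ B) (h : ∀ x ∈ D, |β x| ≤ B) (x : E d) :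
    |D.indicator β x| ≤ B := by
  by_cases hx : x ∈ D
  · rw [indicator_of_mem hx]; exact h x hx
  · rw [indicator_of_notMem hx, abs_zero]; exact hB

theorem IsWeight.one {h : E d} {B : ℝ} {β : E d → ℝ} (hβ : IsWeight D h B β) :
    ContDiffOn ℝ 1 β D := hβ.contDiffOn.of_le (by norm_num)

theorem IsWeight.abs_le {h : E d} {B : ℝ} {β : E d → ℝ} (hβ : IsWeight D h B β) :
    ∀ x ∈ D, |β x| ≤ B := fun x hx => by
  rw [abs_of_nonneg (hβ.nonneg x hx)]; exact hβ.bound x hx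

/-- For first derivatives the zeros of the weight play no role: the increment is weakly
differentiable on the whole space, across all boundaries. -/
theorem weakD_jet0 (hDb : Bornology.IsBounded D) (hD : IsOpen D) {w : W D} {h e : E d}
    (he : ‖e‖ ≤ 1) {B : ℝ} {β : E d → ℝ} (hβ : IsWeight D h B β) {γ : ℕ → ℝ → ℝ} {K : ℝ}
    (hγ : IsProfile γ K) (j : Fin d) :
    WeakD D j (jet0 D β γ (incr0 w h e)) (jet1 D β γ (incr0 w h e) (incr1 w h e) j) := by
  have b0 : LpBd volume 2 (incr0 w h e) _ :=
    LpBd.incr (by norm_num) (norm_nonneg w) he h fun i => W.lpBd_c0 hD w i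
  have b1 : LpBd volume 2 (incr1 w h e j) _ :=
    LpBd.incr (by norm_num) (norm_nonneg w) he h fun i => W.lpBd_c1 hD w i j
  have i0 : Integrable (incr0 w h e) := 
    integrable_incr (fun i => integrable_of_lpBd_two hDb hD (W.lpBd_c0 hD w i)) h e
  have i1 : Integrable (incr1 w h e j) := 
    integrable_incr (fun i => integrable_of_lpBd_two hDb hD (W.lpBd_c1 hD w i j)) h e
  have hw : WeakD D j (fun x => γ 0 (incr0 w h e x))
      (fun x => γ 1 (incr0 w h e x) * incr1 w h e j x) := fun φ hφ =>
    (weakD_incr hDb hD w h e j).integral_comp isOpen_univ i0 i1 (hγ.deriv 0) (hγ.continuous 1)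
      (hγ.bound 1 (by norm_num)) ⟨hφ.1, hφ.2.1, subset_univ _⟩
  have m0 := (hγ.continuous 0).comp_aestronglyMeasurable b0.1
  have m1 := (hγ.continuous 1).comp_aestronglyMeasurable b0.1
  exact hw.weight_mul hD (hβ.one)
    ((LpBd.of_ae_bound m0 (.of_forall fun x => hγ.bound 0 (by norm_num) _)).locallyIntegrable
      le_top)
    ((b1.mul_top m1 hγ.nonneg (.of_forall fun x => hγ.bound 1 (by norm_num) _)).locallyIntegrable
      (by norm_num))

/-- This is where the zeros of the weight are needed. The derivative ∂ⱼu, extended by zero, has a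
weak derivative in D but not across ∂D, so the two parts of the increment of ∂ⱼu are treated
separately, each on the set where its argument lies in D. The weight vanishes where x + h meets ∂D
and makes the product weakly differentiable in all of D. -/
theorem weakD_jet1 (hd : d = 2 ∨ d = 3) (hDb : Bornology.IsBounded D) (hD : IsOpen D) {w : W D}
    {h e : E d} (he : ‖e‖ ≤ 1) {B : ℝ} (hB : 0 ≤ B) {β : E d → ℝ} (hβ : IsWeight D h B β)
    {γ : ℕ → ℝ → ℝ} {K : ℝ} (hγ : IsProfile γ K) (j k : Fin d) :
    WeakD D k (jet1 D β γ (incr0 w h e) (incr1 w h e) j)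
      (jet2 D β γ (incr0 w h e) (incr1 w h e) (incr2 w h e) j k) := by
  have hK := hγ.nonneg
  obtain ⟨Q, hQ, h4⟩ := W.exists_four_bound hd hDb hD
  set R := (Q + 1) * ‖w‖ with hR
  have hR0 : 0 ≤ R := by positivity
  have c2 : ∀ i j, LpBd volume 2 (comp1 w i j) R := fun i j =>
    (W.lpBd_c1 hD w i j).mono (by nlinarith [norm_nonneg w])
  have c4 : ∀ i j, LpBd volume 4 (comp1 w i j) R := fun i j =>
    (h4 w i j).mono (by nlinarith [norm_nonneg w])
  have cc : ∀ i j k, LpBd volume 2 (comp2 w i j k) R := fun i j k =>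
    (W.lpBd_c2 hD w i j k).mono (by nlinarith [norm_nonneg w])
  have b0 : LpBd volume 2 (incr0 w h e) _ :=
    LpBd.incr (by norm_num) (norm_nonneg w) he h fun i => W.lpBd_c0 hD w i
  have b1 : ∀ j, LpBd volume 2 (incr1 w h e j) _ := fun j =>
    LpBd.incr (by norm_num) hR0 he h fun i => c2 i j
  have b4 : ∀ j, LpBd volume 4 (incr1 w h e j) _ := fun j =>
    LpBd.incr (by norm_num) hR0 he h fun i => c4 i j
  have m : ∀ n, AEStronglyMeasurable (fun x => γ n (incr0 w h e x)) volume := fun n =>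
    (hγ.continuous n).comp_aestronglyMeasurable b0.1
  -- the summand containing the derivative of the weight
  have i0 : Integrable (incr0 w h e) := 
    integrable_incr (fun i => integrable_of_lpBd_two hDb hD (W.lpBd_c0 hD w i)) h e
  have i1 : Integrable (incr1 w h e k) := 
    integrable_incr (fun i => integrable_of_lpBd_two hDb hD (W.lpBd_c1 hD w i k)) h e
  have hw : WeakD D k (fun x => γ 0 (incr0 w h e x))
      (fun x => γ 1 (incr0 w h e x) * incr1 w h e k x) := fun φ hφ =>
    (weakD_incr hDb hD w h e k).integral_comp isOpen_univ i0 i1 (hγ.deriv 0) (hγ.continuous 1)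
      (hγ.bound 1 (by norm_num)) ⟨hφ.1, hφ.2.1, subset_univ _⟩
  have lγ : LpBd volume ⊤ (fun x => γ 0 (incr0 w h e x)) K :=
    LpBd.of_ae_bound (m 0) (.of_forall fun x => hγ.bound 0 (by norm_num) _)
  have l1 : ∀ j, LpBd volume 2 (fun x => γ 1 (incr0 w h e x) * incr1 w h e j x)
      (K * (2 * d * R)) := fun j =>
    (b1 j).mul_top (m 1) hK (.of_forall fun x => hγ.bound 1 (by norm_num) _)
  have first := hw.weight_mul hD (contDiffOn_partialDeriv hD hβ.contDiffOn j)
    (lγ.locallyIntegrable le_top) ((l1 k).locallyIntegrable (by norm_num))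
  -- the summand containing the derivative of the increment
  have mβ := aestronglyMeasurable_indicator_of_continuousOn hD hβ.contDiffOn.continuousOn
  have mβ1 : ∀ k, AEStronglyMeasurable (D.indicator (partialDeriv k β)) volume := fun k =>
    aestronglyMeasurable_indicator_of_continuousOn hD (continuousOn_partialDeriv hD (hβ.one) k)
  have mβ2 : AEStronglyMeasurable (D.indicator (partialDeriv k (partialDeriv j β))) volume :=
    aestronglyMeasurable_indicator_of_continuousOn hD
      (continuousOn_partialDeriv hD (contDiffOn_partialDeriv hD hβ.contDiffOn j) k)
  have wβ := fun {p f c} (hf : LpBd volume p f c) =>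
    hf.mul_top mβ hB (.of_forall (abs_indicator_le hB hβ.abs_le))
  have wβ1 := fun k {p f c} (hf : LpBd volume p f c) =>
    hf.mul_top (mβ1 k) hB (.of_forall (abs_indicator_le hB (hβ.bound_one k)))
  have wβ2 := fun {p f c} (hf : LpBd volume p f c) =>
    hf.mul_top mβ2 hB (.of_forall (abs_indicator_le hB (hβ.bound_two j k)))
  -- One statement for both ends of the bond: s = h for the far end and s = 0 for the near end.
  have piece : ∀ s : E d, (∀ x ∈ D, x + s ∈ frontier D → β x = 0) → ∀ i,
      WeakD D k (fun x => D.indicator β x * (γ 1 (incr0 w h e x) * comp1 w i j (x + s)))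
        (fun x => D.indicator (partialDeriv k β) x * (γ 1 (incr0 w h e x) * comp1 w i j (x + s)) +
          D.indicator β x * (γ 2 (incr0 w h e x) * incr1 w h e k x * comp1 w i j (x + s) +
            γ 1 (incr0 w h e x) * comp2 w i j k (x + s))) ∧
      LpBd volume 2 (fun x => D.indicator β x * (γ 1 (incr0 w h e x) * comp1 w i j (x + s)))
        (B * (K * R)) ∧
      LpBd volume 2 (fun x => D.indicator (partialDeriv k β) x *
          (γ 1 (incr0 w h e x) * comp1 w i j (x + s)) +
          D.indicator β x * (γ 2 (incr0 w h e x) * incr1 w h e k x * comp1 w i j (x + s) +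
            γ 1 (incr0 w h e x) * comp2 w i j k (x + s)))
        (B * (K * R) + B * (K * (2 * d * R * R) + K * R)) := by
    intro s hs i
    set O : Set (E d) := {x | x + s ∈ D} with hOdef
    have hO : IsOpen O := hD.preimage (continuous_add_const s)
    have hfr : ∀ x ∈ frontier O, x + s ∈ frontier D := fun x hx =>
      (((Homeomorph.addRight s).preimage_frontier D).symm.subset hx)
    have s2 := (c2 i j).comp_add_right s
    have s4 := (c4 i j).comp_add_right s
    have ss := (cc i j k).comp_add_right s
    have hw := weakD_comp_mul hO (by positivity) hR0 b0.1 (smoothApprox_incr hD w h he) (b4 k)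
      s2 s4 ss ((W.weakD_c1 hD w i j k).comp_add_right s) (hγ.deriv 1) (hγ.deriv 2)
      (hγ.bound 1 (by norm_num)) (hγ.bound 2 (by norm_num)) (hγ.bound 3 (by norm_num))
    have p1 : LpBd volume 2 (fun x => γ 1 (incr0 w h e x) * comp1 w i j (x + s)) (K * R) :=
      s2.mul_top (m 1) hK (.of_forall fun x => hγ.bound 1 (by norm_num) _)
    have p2 : LpBd volume 2 (fun x => γ 2 (incr0 w h e x) * incr1 w h e k x * comp1 w i j (x + s) +
        γ 1 (incr0 w h e x) * comp2 w i j k (x + s)) (K * (2 * d * R * R) + K * R) := by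
      have q1 : LpBd volume 2 (fun x => incr1 w h e k x * comp1 w i j (x + s)) (2 * d * R * R) :=
        (b4 k).mul (hpqr := inferInstance) (by positivity) s4
      have q2 := q1.mul_top (m 2) hK (.of_forall fun x => hγ.bound 2 (by norm_num) _)
      have q3 := ss.mul_top (m 1) hK (.of_forall fun x => hγ.bound 1 (by norm_num) _)
      exact (q2.add (by norm_num) (by positivity) (by positivity) q3).congr
        (.of_forall fun x => by ring)
    refine ⟨?_, wβ p1, (wβ1 k p1).add (by norm_num) (by positivity) (by positivity) (wβ p2)⟩
    refine hw.weight_mul_of_frontier hD hO (hβ.one) hβ.nonneg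
      (fun x hx hxO => hs x hx (hfr x hxO)) (p1.locallyIntegrable (by norm_num))
      (p2.locallyIntegrable (by norm_num)) (fun x hx => ?_) fun x hx => ?_
    · have hx' : x + s ∉ D := hx
      rw [comp1_eq_zero hx', mul_zero]
    · have hx' : x + s ∉ D := hx
      rw [comp1_eq_zero hx', comp2_eq_zero hx', mul_zero, mul_zero, add_zero]
  have P1 := piece h hβ.eq_zero
  -- For s = 0 the condition on the weight is vacuous, as the open set D does not meet its frontier.
  have P0 := piece 0 fun x hx hx' => by
    rw [add_zero, hD.frontier_eq] at hx'
    exact absurd hx hx'.2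
  have sec := WeakD.finset_sum Finset.univ (fun i =>
      (((P1 i).1.add ((P0 i).1.const_mul (-1)) ((P1 i).2.1.locallyIntegrable (by norm_num))
        ((P1 i).2.2.locallyIntegrable (by norm_num))
        (((P0 i).2.1.const_mul (-1)).locallyIntegrable (by norm_num))
        (((P0 i).2.2.const_mul (-1)).locallyIntegrable (by norm_num))).const_mul (e i)))
    (fun i => (((P1 i).2.1.add (by norm_num) (by positivity) (by positivity)
      ((P0 i).2.1.const_mul (-1))).const_mul (e i)).locallyIntegrable (by norm_num))
    (fun i => (((P1 i).2.2.add (by norm_num) (by positivity) (by positivity)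
      ((P0 i).2.2.const_mul (-1))).const_mul (e i)).locallyIntegrable (by norm_num))
  have sec' : WeakD D k (fun x => D.indicator β x * (γ 1 (incr0 w h e x) * incr1 w h e j x))
      (fun x => D.indicator (partialDeriv k β) x * (γ 1 (incr0 w h e x) * incr1 w h e j x) +
        D.indicator β x * (γ 2 (incr0 w h e x) * (incr1 w h e k x * incr1 w h e j x) +
          γ 1 (incr0 w h e x) * incr2 w h e j k x)) := by
    refine sec.congr_fun (fun x => ?_) fun x => ?_
    · simp only [add_zero]
      rw [incr1, incr, Finset.mul_sum, Finset.mul_sum]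
      exact Finset.sum_congr rfl fun i _ => by ring
    · simp only [add_zero]
      generalize incr1 w h e k x = A
      simp only [incr1, incr2, incr, Finset.mul_sum, ← Finset.sum_add_distrib]
      exact Finset.sum_congr rfl fun i _ => by ring
  have q2 : LpBd volume 2 (fun x => incr1 w h e k x * incr1 w h e j x)
      (2 * d * R * (2 * d * R)) := (b4 k).mul (hpqr := inferInstance) (by positivity) (b4 j)
  have b2 : LpBd volume 2 (incr2 w h e j k) (2 * d * R) :=
    LpBd.incr (by norm_num) hR0 he h fun i => cc i j k
  refine (first.add sec' ?_ ?_ ?_ ?_).congr_fun (fun x => rfl) fun x => rfl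
  · exact (wβ1 j lγ).locallyIntegrable le_top
  · exact ((wβ2 lγ).locallyIntegrable le_top).add
      ((wβ1 j (l1 k)).locallyIntegrable (by norm_num))
  · exact (wβ (l1 j)).locallyIntegrable (by norm_num)
  · refine ((wβ1 k (l1 j)).locallyIntegrable (by norm_num)).add
      ((wβ (LpBd.add (p := 2) (by norm_num) ?_ ?_
        (q2.mul_top (m 2) hK (.of_forall fun x => hγ.bound 2 (by norm_num) _))
        (b2.mul_top (m 1) hK (.of_forall fun x => hγ.bound 1 (by norm_num) _)))).locallyIntegrable
        (by norm_num))
    · positivity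
    · positivity

end Peridynamics

end

/-! ### Estimates for a single bond -/

noncomputable section

open scoped ENNReal NNReal

namespace Peridynamics

variable {d : ℕ} {D : Set (E d)}

/-! ### Slices of the force and their estimates -/

/-- Indices for a function and its first and second partial derivatives. -/
abbrev JetIndex (d : ℕ) : Type := Unit ⊕ (Fin d ⊕ Fin d × Fin d)

/-- The components of an element of `W` and of its derivatives. -/
def compJet (w : W D) (i : Fin d) : JetIndex d → E d → ℝ
  | .inl _ => comp0 w i
  | .inr (.inl j) => comp1 w i j
  | .inr (.inr (j, k)) => comp2 w i j k

/-- The profile `s ↦ G(λ s)`, `λ = r^{-1/2}`. -/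
def scaleProfile (G : ℕ → ℝ → ℝ) (r : ℝ) (m : ℕ) (s : ℝ) : ℝ :=
  (r ^ (-(1 / 2) : ℝ)) ^ m * G m (r ^ (-(1 / 2) : ℝ) * s)

theorem IsProfile.scale {G : ℕ → ℝ → ℝ} {K : ℝ} (hG : IsProfile G K) {r : ℝ} (hr : 0 < r)
    (hr1 : r ≤ 1) : IsProfile (scaleProfile G r) ((r ^ (-(1 / 2) : ℝ)) ^ 3 * K) := by
  have h1 : 1 ≤ r ^ (-(1 / 2) : ℝ) := Real.one_le_rpow_of_pos_of_le_one_of_nonpos hr hr1 (by norm_num)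
  refine ⟨fun m s => ?_, fun m hm s => ?_⟩
  · have h := ((hG.deriv m (r ^ (-(1 / 2) : ℝ) * s)).comp s
      ((hasDerivAt_id s).const_mul (r ^ (-(1 / 2) : ℝ)))).const_mul ((r ^ (-(1 / 2) : ℝ)) ^ m)
    refine h.congr_deriv ?_
    rw [scaleProfile]
    ring
  · rw [scaleProfile, abs_mul, abs_of_nonneg (by positivity)]
    exact mul_le_mul (pow_le_pow_right₀ h1 hm) (hG.bound m hm _) (abs_nonneg _) (by positivity)

/-- The jets of the integrand of the force, for a bond `h` in direction `e`. -/
def slice (G : ℕ → ℝ → ℝ) (β : E d → ℝ) (h e : E d) (w : W D) : JetIndex d → E d → ℝ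
  | .inl _ => jet0 D β (scaleProfile G ‖h‖) (incr0 w h e)
  | .inr (.inl j) => jet1 D β (scaleProfile G ‖h‖) (incr0 w h e) (incr1 w h e) j
  | .inr (.inr (j, k)) =>
      jet2 D β (scaleProfile G ‖h‖) (incr0 w h e) (incr1 w h e) (incr2 w h e) j k

theorem IsWeight.lpBd_top (hD : IsOpen D) {h : E d} {B : ℝ} (hB : 0 ≤ B) {β : E d → ℝ}
    (hβ : IsWeight D h B β) : LpBd volume ⊤ (D.indicator β) B ∧
      (∀ j, LpBd volume ⊤ (D.indicator (partialDeriv j β)) B) ∧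
      ∀ j k, LpBd volume ⊤ (D.indicator (partialDeriv k (partialDeriv j β))) B :=
  ⟨.of_ae_bound (aestronglyMeasurable_indicator_of_continuousOn hD hβ.contDiffOn.continuousOn)
      (.of_forall (abs_indicator_le hB hβ.abs_le)),
    fun j => .of_ae_bound (aestronglyMeasurable_indicator_of_continuousOn hD
      (continuousOn_partialDeriv hD hβ.one j)) (.of_forall (abs_indicator_le hB (hβ.bound_one j))),
    fun j k => .of_ae_bound (aestronglyMeasurable_indicator_of_continuousOn hD
      (continuousOn_partialDeriv hD (contDiffOn_partialDeriv hD hβ.contDiffOn j) k))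
      (.of_forall (abs_indicator_le hB (hβ.bound_two j k)))⟩

theorem lpBd_two_indicator {f : E d → ℝ} {B v : ℝ} (hB : 0 ≤ B)
    (hv : LpBd volume 2 (D.indicator fun _ => (1 : ℝ)) v) (hf : LpBd volume ⊤ (D.indicator f) B) :
    LpBd volume 2 (D.indicator f) (B * v) :=
  (hf.mul (hpqr := inferInstance) hB hv).congr (.of_forall fun x => by
    by_cases hx : x ∈ D <;> simp [hx])

theorem exists_lpBd_indicator_one (hDb : Bornology.IsBounded D) (hD : IsOpen D) :
    ∃ v, 0 ≤ v ∧ LpBd volume 2 (D.indicator fun _ => (1 : ℝ)) v :=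
  ⟨_, ENNReal.toReal_nonneg, MemLp.lpBd (memLp_indicator_continuous hD hDb continuous_const)⟩

/-- The second-order jet has one term without derivatives of a (size vκ), three linear ones (κR
each) and one quadratic (κS). The same bound is used for the lower orders so that all jets can be
treated alike. -/
theorem pairBd_jets (hD : IsOpen D) {h : E d} {B v : ℝ} (hB : 0 ≤ B) (hv0 : 0 ≤ v)
    (hv : LpBd volume 2 (D.indicator fun _ => (1 : ℝ)) v) {β : E d → ℝ} (hβ : IsWeight D h B β)
    {γ : ℕ → ℝ → ℝ} {a b : E d → ℝ} {a1 b1 : Fin d → E d → ℝ} {a2 b2 : Fin d → Fin d → E d → ℝ}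
    {κ κ' R A S A' : ℝ}
    (hγ : ∀ m ≤ 2, PairBd volume ⊤ (fun x => γ m (a x)) (fun x => γ m (b x)) κ κ')
    (h1 : ∀ j, PairBd volume 2 (a1 j) (b1 j) R A)
    (h11 : ∀ j k, PairBd volume 2 (fun x => a1 k x * a1 j x) (fun x => b1 k x * b1 j x) S A')
    (h2 : ∀ j k, PairBd volume 2 (a2 j k) (b2 j k) R A) (j k : Fin d) :
    PairBd volume 2 (jet0 D β γ a) (jet0 D β γ b) (B * (v * κ + 3 * κ * R + κ * S))
        (B * (v * κ' + 3 * (κ' * R + κ * A) + (κ' * S + κ * A'))) ∧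
      PairBd volume 2 (jet1 D β γ a a1 j) (jet1 D β γ b b1 j) (B * (v * κ + 3 * κ * R + κ * S))
        (B * (v * κ' + 3 * (κ' * R + κ * A) + (κ' * S + κ * A'))) ∧
      PairBd volume 2 (jet2 D β γ a a1 a2 j k) (jet2 D β γ b b1 b2 j k)
        (B * (v * κ + 3 * κ * R + κ * S))
        (B * (v * κ' + 3 * (κ' * R + κ * A) + (κ' * S + κ * A'))) := by
  obtain ⟨w0, w1, w2⟩ := hβ.lpBd_top hD hB
  have h12 : (1 : ℝ≥0∞) ≤ 2 := by norm_num
  have hκ := (hγ 0 (by norm_num)).size_nonneg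
  have hκ' := (hγ 0 (by norm_num)).diff_nonneg
  have hR := (h1 j).size_nonneg
  have hA := (h1 j).diff_nonneg
  have hS := (h11 j k).size_nonneg
  have hA' := (h11 j k).diff_nonneg
  have T0 : ∀ {f}, LpBd volume ⊤ (D.indicator f) B →
      PairBd volume 2 (fun x => D.indicator f x * γ 0 (a x)) (fun x => D.indicator f x * γ 0 (b x))
        (B * (v * κ)) (B * (v * κ')) := fun {f} hf =>
    ((PairBd.const (lpBd_two_indicator hB hv hf) (by positivity)).mul (hpqr := inferInstance) h12
      (hγ 0 (by norm_num))).mono (by rw [mul_assoc]) (by rw [zero_mul, zero_add, mul_assoc])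
  have T1 : ∀ {f}, LpBd volume ⊤ (D.indicator f) B → ∀ {p q : E d → ℝ} {s t : ℝ},
      PairBd volume 2 p q s t →
      PairBd volume 2 (fun x => D.indicator f x * p x) (fun x => D.indicator f x * q x)
        (B * s) (B * t) := fun {f} hf {p q s t} hp =>
    ((PairBd.const hf hB).mul (hpqr := inferInstance) h12 hp).mono le_rfl
      (by rw [zero_mul, zero_add])
  have g1 := fun j => (hγ 1 (by norm_num)).mul (hpqr := inferInstance) h12 (h1 j)
  have g11 := (hγ 2 (by norm_num)).mul (hpqr := inferInstance) h12 (h11 j k)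
  have g2 := (hγ 1 (by norm_num)).mul (hpqr := inferInstance) h12 (h2 j k)
  have e1 : 0 ≤ κ' * R := by positivity
  have e2 : 0 ≤ κ * A := by positivity
  have e3 : 0 ≤ κ' * S := by positivity
  have e4 : 0 ≤ κ * A' := by positivity
  have e5 : 0 ≤ κ * R := by positivity
  have e6 : 0 ≤ κ * S := by positivity
  refine ⟨(T0 w0).mono ?_ ?_, ((T0 (w1 j)).add h12 (T1 w0 (g1 j))).mono ?_ ?_,
    (((T0 (w2 j k)).add h12 (T1 (w1 j) (g1 k))).add h12
      ((T1 (w1 k) (g1 j)).add h12 (T1 w0 (g11.add h12 g2)))).mono ?_ ?_⟩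
  all_goals linarith [mul_nonneg hB e1, mul_nonneg hB e2, mul_nonneg hB e3, mul_nonneg hB e4,
    mul_nonneg hB e5, mul_nonneg hB e6]

theorem pairBd_incr {p : ℝ≥0∞} (hp : 1 ≤ p) {F F' : Fin d → E d → ℝ} {B A : ℝ} {e : E d}
    (hB : 0 ≤ B) (hA : 0 ≤ A) (he : ‖e‖ ≤ 1) (h : E d)
    (hF : ∀ i, PairBd volume p (F i) (F' i) B A) :
    PairBd volume p (incr F h e) (incr F' h e) (2 * d * B) (2 * d * A) :=
  ⟨by positivity, by positivity, LpBd.incr hp hB he h fun i => (hF i).left,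
    LpBd.incr hp hB he h fun i => (hF i).right,
    (LpBd.incr hp hA he h fun i => (hF i).diff).congr
      (.of_forall fun x => incr_sub F F' h e x)⟩

theorem W.lpBd_incr0_top {C : ℝ} {w : W D} {h e : E d} (hD : IsOpen D) (he : ‖e‖ ≤ 1)
    (hC : ∀ i, ∀ᵐ x, |comp0 w i (x + h) - comp0 w i x| ≤ C) :
    LpBd volume ⊤ (incr0 w h e) (d * C) := by
  refine LpBd.of_ae_bound (LpBd.incr (by norm_num) (norm_nonneg w) he h
    fun i => W.lpBd_c0 hD w i).1 ?_
  filter_upwards [ae_all_iff.2 hC] with x hx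
  rw [incr0, incr]
  refine (Finset.abs_sum_le_sum_abs _ _).trans ?_
  refine (Finset.sum_le_sum (g := fun _ => C) fun i _ => ?_).trans (by simp)
  rw [abs_mul]
  have h0 := (abs_nonneg _).trans (hx i)
  exact (mul_le_mul (abs_apply_le_one he i) (hx i) (abs_nonneg _) zero_le_one).trans
    (by rw [one_mul])

theorem incr0_sub (hD : IsOpen D) (w w' : W D) (h e : E d) :
    incr0 (w - w') h e =ᵐ[volume] fun x => incr0 w h e x - incr0 w' h e x :=
  (incr_ae_eq h e fun i => W.c0_sub hD w w' i).trans (.of_forall fun x => incr_sub _ _ h e x)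

theorem incr1_sub (hD : IsOpen D) (w w' : W D) (h e : E d) (j : Fin d) :
    incr1 (w - w') h e j =ᵐ[volume] fun x => incr1 w h e j x - incr1 w' h e j x :=
  (incr_ae_eq h e fun i => W.c1_sub hD w w' i j).trans
    (.of_forall fun x => incr_sub _ _ h e x)

theorem incr2_sub (hD : IsOpen D) (w w' : W D) (h e : E d) (j k : Fin d) :
    incr2 (w - w') h e j k =ᵐ[volume] fun x => incr2 w h e j k x - incr2 w' h e j k x :=
  (incr_ae_eq h e fun i => W.c2_sub hD w w' i j k).trans
    (.of_forall fun x => incr_sub _ _ h e x)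

theorem incr0_smul (hD : IsOpen D) (c : ℝ) (w : W D) (h e : E d) :
    incr0 (c • w) h e =ᵐ[volume] fun x => c * incr0 w h e x :=
  (incr_ae_eq h e fun i => W.c0_smul hD c w i).trans (.of_forall fun x => incr_const_mul c _ h e x)

theorem incr1_smul (hD : IsOpen D) (c : ℝ) (w : W D) (h e : E d) (j : Fin d) :
    incr1 (c • w) h e j =ᵐ[volume] fun x => c * incr1 w h e j x :=
  (incr_ae_eq h e fun i => W.c1_smul hD c w i j).trans
    (.of_forall fun x => incr_const_mul c _ h e x)

theorem incr2_smul (hD : IsOpen D) (c : ℝ) (w : W D) (h e : E d) (j k : Fin d) :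
    incr2 (c • w) h e j k =ᵐ[volume] fun x => c * incr2 w h e j k x :=
  (incr_ae_eq h e fun i => W.c2_smul hD c w i j k).trans
    (.of_forall fun x => incr_const_mul c _ h e x)

/-- Powers of `q = r^{-1/4}`. -/
theorem rpow_quarter {r : ℝ} (hr : 0 < r) (hr1 : r ≤ 1) :
    1 ≤ r ^ (-(1 / 4) : ℝ) ∧ r ^ (-(1 / 2) : ℝ) = (r ^ (-(1 / 4) : ℝ)) ^ 2 ∧
      r ^ (1 / 4 : ℝ) = (r ^ (-(1 / 4) : ℝ))⁻¹ ∧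
      r ^ (-(5 / 4) : ℝ) = (r ^ (-(1 / 4) : ℝ)) ^ 5 := by
  refine ⟨Real.one_le_rpow_of_pos_of_le_one_of_nonpos hr hr1 (by norm_num), ?_, ?_, ?_⟩
  · rw [← Real.rpow_natCast, ← Real.rpow_mul hr.le]; norm_num
  · rw [← Real.rpow_neg hr.le]; norm_num
  · rw [← Real.rpow_natCast, ← Real.rpow_mul hr.le]; norm_num

/-- This fixes the exponent 5/4. Each derivative of the profile costs r^{-1/2}: at most r^{-1} for
sizes with m ≤ 2, and r^{-3/2} for Lipschitz constants, from which a Hölder increment of order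
r^{1/4} is regained. -/
theorem abs_scaleProfile_le {G : ℕ → ℝ → ℝ} {K : ℝ} (hG : IsProfile G K) {r : ℝ} (hr : 0 < r)
    (hr1 : r ≤ 1) {m : ℕ} (hm : m ≤ 2) (s : ℝ) :
    |scaleProfile G r m s| ≤ K * r ^ (-(5 / 4) : ℝ) ∧
      |scaleProfile G r (m + 1) s| * r ^ (1 / 4 : ℝ) ≤ K * r ^ (-(5 / 4) : ℝ) := by
  obtain ⟨h1, h2, h3, h5⟩ := rpow_quarter hr hr1
  set q := r ^ (-(1 / 4) : ℝ)
  have hq : 0 < q := by linarith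
  have hK := hG.nonneg
  have e : ∀ n, |scaleProfile G r n s| = q ^ (2 * n) * |G n (q ^ 2 * s)| := fun n => by
    rw [scaleProfile, h2, abs_mul, ← pow_mul, abs_of_nonneg (by positivity)]
  rw [e, e, h3, h5, mul_comm K]
  constructor
  · exact mul_le_mul (pow_le_pow_right₀ h1 (by omega)) (hG.bound m (by omega) _) (abs_nonneg _)
      (by positivity)
  · rw [mul_right_comm]
    refine mul_le_mul ?_ (hG.bound (m + 1) (by omega) _) (abs_nonneg _) (by positivity)
    rw [show 2 * (m + 1) = 2 * m + 1 + 1 by ring, pow_succ, mul_assoc, mul_inv_cancel₀ hq.ne',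
      mul_one]
    exact pow_le_pow_right₀ h1 (by omega)

/-- The profiles differ by their Lipschitz constant times the sup norm of the increment of w − w',
where the Hölder bound supplies r^{1/4}. The power M² arises when the difference of the profiles
meets the quadratic gradient term, the other products being of lower degree in M. -/
theorem exists_slice_lipschitz (hd : d = 2 ∨ d = 3) (hDb : Bornology.IsBounded D)
    (hD : IsOpen D) {K B : ℝ} (hB : 0 ≤ B) (hK : 0 ≤ K) :
    ∃ C, 0 ≤ C ∧ ∀ {G : ℕ → ℝ → ℝ}, IsProfile G K → ∀ {h e : E d}, h ≠ 0 → ‖h‖ ≤ 1 → ‖e‖ ≤ 1 →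
      ∀ {β : E d → ℝ}, IsWeight D h B β → ∀ {w w' : W D} {M : ℝ}, ‖w‖ ≤ M → ‖w'‖ ≤ M →
      ∀ α, LpBd volume 2 (fun x => slice G β h e w α x - slice G β h e w' α x)
        (C * (1 + M + M ^ 2) * ‖w - w'‖ * ‖h‖ ^ (-(5 / 4) : ℝ)) := by
  obtain ⟨v, hv0, hv⟩ := exists_lpBd_indicator_one hDb hD
  obtain ⟨Q, hQ, h4⟩ := W.exists_four_bound hd hDb hD
  obtain ⟨H, hH, hh⟩ := W.exists_holder_bound hd hDb hD
  set N : ℝ := 2 * d * (Q + 1) with hN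
  have hN0 : 0 ≤ N := by positivity
  refine ⟨B * K * (10 * (v + 1) * (d * H + 1) * (N + 1) ^ 2), by positivity, ?_⟩
  intro G hG h e hh0 hh1 he β hβ w w' M hw hw' α
  have hr : 0 < ‖h‖ := norm_pos_iff.2 hh0
  set Δ := ‖w - w'‖ with hΔ
  have hΔ0 : 0 ≤ Δ := norm_nonneg _
  have hM : 0 ≤ M := (norm_nonneg _).trans hw
  set p := ‖h‖ ^ (-(5 / 4) : ℝ) with hp
  have hp0 : 0 ≤ p := by positivity
  have h12 : (1 : ℝ≥0∞) ≤ 2 := by norm_num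
  have h14 : (1 : ℝ≥0∞) ≤ 4 := by norm_num
  -- sizes and differences of the ingredients
  have P0 : ∃ S, PairBd volume ⊤ (incr0 w h e) (incr0 w' h e) S
      (d * (H * Δ * ‖h‖ ^ (1 / 4 : ℝ))) := by
    refine ⟨d * (H * M * ‖h‖ ^ (1 / 4 : ℝ)), by positivity, by positivity,
      (W.lpBd_incr0_top hD he fun i => hh w i h hh1).mono (by gcongr),
      (W.lpBd_incr0_top hD he fun i => hh w' i h hh1).mono (by gcongr), ?_⟩
    exact (W.lpBd_incr0_top hD he fun i => hh (w - w') i h hh1).congr (incr0_sub hD w w' h e)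
  have Pγ : ∀ m ≤ 2, PairBd volume ⊤ (fun x => scaleProfile G ‖h‖ m (incr0 w h e x))
      (fun x => scaleProfile G ‖h‖ m (incr0 w' h e x)) (K * p) (K * p * (d * H * Δ)) := by
    intro m hm
    obtain ⟨S, hS⟩ := P0
    have hpos : 0 < ‖h‖ ^ (1 / 4 : ℝ) := by positivity
    have hs := (hG.scale hr hh1)
    have lip : ∀ s s', |scaleProfile G ‖h‖ m s - scaleProfile G ‖h‖ m s'| ≤
        K * p / ‖h‖ ^ (1 / 4 : ℝ) * |s - s'| :=
      lipschitz_of_deriv_le (hs.deriv m) fun s => by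
        rw [le_div_iff₀ hpos]
        exact (abs_scaleProfile_le hG hr hh1 hm s).2
    refine (hS.comp (hs.continuous m) (fun s => (abs_scaleProfile_le hG hr hh1 hm s).1)
      (by positivity) lip).mono le_rfl (le_of_eq ?_)
    field_simp
  have c1 : ∀ i j, PairBd volume 2 (comp1 w i j) (comp1 w' i j) ((Q + 1) * M) ((Q + 1) * Δ) :=
    fun i j => ⟨by positivity, by positivity,
      (W.lpBd_c1 hD w i j).mono (by nlinarith [norm_nonneg w]),
      (W.lpBd_c1 hD w' i j).mono (by nlinarith [norm_nonneg w']),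
      ((W.lpBd_c1 hD (w - w') i j).mono (by nlinarith)).congr (W.c1_sub hD w w' i j)⟩
  have c4 : ∀ i j, PairBd volume 4 (comp1 w i j) (comp1 w' i j) ((Q + 1) * M) ((Q + 1) * Δ) :=
    fun i j => ⟨by positivity, by positivity,
      (h4 w i j).mono (by nlinarith [norm_nonneg w]),
      (h4 w' i j).mono (by nlinarith [norm_nonneg w']),
      ((h4 (w - w') i j).mono (by nlinarith)).congr (W.c1_sub hD w w' i j)⟩
  have c2 : ∀ i j k, PairBd volume 2 (comp2 w i j k) (comp2 w' i j k) ((Q + 1) * M)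
      ((Q + 1) * Δ) :=
    fun i j k => ⟨by positivity, by positivity,
      (W.lpBd_c2 hD w i j k).mono (by nlinarith [norm_nonneg w]),
      (W.lpBd_c2 hD w' i j k).mono (by nlinarith [norm_nonneg w']),
      ((W.lpBd_c2 hD (w - w') i j k).mono (by nlinarith)).congr (W.c2_sub hD w w' i j k)⟩
  have hQM : 0 ≤ (Q + 1) * M := by positivity
  have hQΔ : 0 ≤ (Q + 1) * Δ := by positivity
  have P1 : ∀ j, PairBd volume 2 (incr1 w h e j) (incr1 w' h e j) (N * M) (N * Δ) := fun j =>
    (pairBd_incr h12 hQM hQΔ he h fun i => c1 i j).mono (by rw [hN]; linarith)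
      (by rw [hN]; linarith)
  have P4 : ∀ j, PairBd volume 4 (incr1 w h e j) (incr1 w' h e j) (N * M) (N * Δ) := fun j =>
    (pairBd_incr h14 hQM hQΔ he h fun i => c4 i j).mono (by rw [hN]; linarith)
      (by rw [hN]; linarith)
  have P2 : ∀ j k, PairBd volume 2 (incr2 w h e j k) (incr2 w' h e j k) (N * M) (N * Δ) :=
    fun j k => (pairBd_incr h12 hQM hQΔ he h fun i => c2 i j k).mono (by rw [hN]; linarith)
      (by rw [hN]; linarith)
  have fin : B * (v * (K * p * (d * H * Δ)) +
      3 * (K * p * (d * H * Δ) * (N * M) + K * p * (N * Δ)) +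
      (K * p * (d * H * Δ) * (N * M * (N * M)) + K * p * (N * Δ * (N * M) + N * M * (N * Δ)))) ≤
      B * K * (10 * (v + 1) * (d * H + 1) * (N + 1) ^ 2) * (1 + M + M ^ 2) * Δ * p := by
    have hdH : 0 ≤ d * H := by positivity
    generalize d * H = X at hdH ⊢
    have : v * X + 3 * (X * (N * M) + N) + (X * (N * M * (N * M)) + (N * (N * M) + N * M * N)) ≤
        10 * (v + 1) * (X + 1) * (N + 1) ^ 2 * (1 + M + M ^ 2) := by
      rw [← sub_nonneg]
      ring_nf
      positivity
    calc _ = B * K * Δ * p * (v * X + 3 * (X * (N * M) + N) +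
          (X * (N * M * (N * M)) + (N * (N * M) + N * M * N))) := by ring
      _ ≤ B * K * Δ * p * (10 * (v + 1) * (X + 1) * (N + 1) ^ 2 * (1 + M + M ^ 2)) :=
          mul_le_mul_of_nonneg_left this (by positivity)
      _ = _ := by ring
  have jets := fun j k => pairBd_jets hD hB hv0 hv hβ Pγ P1
    (fun j k => (P4 k).mul (hpqr := inferInstance) h12 (P4 j)) P2 j k
  have j0 : Fin d := ⟨0, by rcases hd with rfl | rfl <;> norm_num⟩
  match α with
  | .inl _ => exact (jets j0 j0).1.diff.mono fin
  | .inr (.inl j) => exact (jets j j0).2.1.diff.mono fin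
  | .inr (.inr (j, k)) => exact (jets j k).2.2.diff.mono fin

/-- Under a sup bound on w the interpolation inequality bounds the quadratic gradient term by M₀ ‖w‖
instead of ‖w‖², so the estimate is linear in ‖w‖. The profile itself is bounded, hence no Hölder
bound is needed. -/
theorem exists_slice_growth (hd : d = 2 ∨ d = 3) (hDb : Bornology.IsBounded D)
    (hD : IsOpen D) {K B M₀ : ℝ} (hB : 0 ≤ B) (hK : 0 ≤ K) (hM₀ : 0 ≤ M₀) :
    ∃ C, 0 ≤ C ∧ ∀ {G : ℕ → ℝ → ℝ}, IsProfile G K → ∀ {h e : E d}, h ≠ 0 → ‖h‖ ≤ 1 → ‖e‖ ≤ 1 →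
      ∀ {β : E d → ℝ}, IsWeight D h B β → ∀ {w : W D}, (∀ i, ∀ᵐ x, |comp0 w i x| ≤ M₀) →
      ∀ α, LpBd volume 2 (slice G β h e w α) (C * (1 + ‖w‖) * ‖h‖ ^ (-(5 / 4) : ℝ)) := by
  obtain ⟨v, hv0, hv⟩ := exists_lpBd_indicator_one hDb hD
  refine ⟨B * K * (10 * (v + 1) * (d + 1) ^ 2 * (M₀ + 1)) * 4, by positivity, ?_⟩
  intro G hG h e hh0 hh1 he β hβ w hw α
  have hr : 0 < ‖h‖ := norm_pos_iff.2 hh0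
  set p := ‖h‖ ^ (-(5 / 4) : ℝ) with hp
  have hp0 : 0 ≤ p := by positivity
  have h12 : (1 : ℝ≥0∞) ≤ 2 := by norm_num
  have h14 : (1 : ℝ≥0∞) ≤ 4 := by norm_num
  have b0 : LpBd volume 2 (incr0 w h e) _ :=
    LpBd.incr h12 (norm_nonneg w) he h fun i => W.lpBd_c0 hD w i
  have hs := hG.scale hr hh1
  have Pγ : ∀ m ≤ 2, PairBd volume ⊤ (fun x => scaleProfile G ‖h‖ m (incr0 w h e x))
      (fun x => scaleProfile G ‖h‖ m (incr0 w h e x)) (K * p) 0 := fun m hm =>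
    PairBd.const (LpBd.of_ae_bound ((hs.continuous m).comp_aestronglyMeasurable b0.1)
      (.of_forall fun x => (abs_scaleProfile_le hG hr hh1 hm _).1)) (by positivity)
  have P1 : ∀ j, PairBd volume 2 (incr1 w h e j) (incr1 w h e j) (2 * d * ‖w‖) 0 := fun j =>
    PairBd.const (LpBd.incr h12 (norm_nonneg w) he h fun i => W.lpBd_c1 hD w i j) (by positivity)
  have P2 : ∀ j k, PairBd volume 2 (incr2 w h e j k) (incr2 w h e j k) (2 * d * ‖w‖) 0 :=
    fun j k => PairBd.const (LpBd.incr h12 (norm_nonneg w) he h fun i => W.lpBd_c2 hD w i j k)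
      (by positivity)
  have P4 : ∀ j, LpBd volume 4 (incr1 w h e j) (2 * d * √(3 * M₀ * ‖w‖)) := fun j =>
    LpBd.incr h14 (Real.sqrt_nonneg _) he h fun i => W.lpBd_four_c1 hDb hD w i j hM₀ (hw i)
  have P11 : ∀ j k, PairBd volume 2 (fun x => incr1 w h e k x * incr1 w h e j x)
      (fun x => incr1 w h e k x * incr1 w h e j x) (12 * d ^ 2 * M₀ * ‖w‖) 0 := fun j k =>
    PairBd.const (((P4 k).mul (hpqr := inferInstance) (by positivity) (P4 j)).mono (le_of_eq (by
      rw [show 2 * d * √(3 * M₀ * ‖w‖) * (2 * d * √(3 * M₀ * ‖w‖)) =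
        4 * d ^ 2 * (√(3 * M₀ * ‖w‖) * √(3 * M₀ * ‖w‖)) by ring, Real.mul_self_sqrt (by positivity)]
      ring))) (by positivity)
  have fin : B * (v * (K * p) + 3 * (K * p) * (2 * d * ‖w‖) + K * p * (12 * d ^ 2 * M₀ * ‖w‖)) ≤
      B * K * (10 * (v + 1) * (d + 1) ^ 2 * (M₀ + 1)) * 4 * (1 + ‖w‖) * p := by
    have hw0 := norm_nonneg w
    generalize ‖w‖ = X at hw0 ⊢
    have : v + 3 * (2 * d * X) + 12 * d ^ 2 * M₀ * X ≤
        10 * (v + 1) * (d + 1) ^ 2 * (M₀ + 1) * 4 * (1 + X) := by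
      rw [← sub_nonneg]
      ring_nf
      positivity
    calc _ = B * K * p * (v + 3 * (2 * d * X) + 12 * d ^ 2 * M₀ * X) := by ring
      _ ≤ B * K * p * (10 * (v + 1) * (d + 1) ^ 2 * (M₀ + 1) * 4 * (1 + X)) :=
          mul_le_mul_of_nonneg_left this (by positivity)
      _ = _ := by ring
  have jets := fun j k => pairBd_jets hD hB hv0 hv hβ Pγ P1 P11 P2 j k
  have j0 : Fin d := ⟨0, by rcases hd with rfl | rfl <;> norm_num⟩
  match α with
  | .inl _ => exact (jets j0 j0).1.left.mono fin
  | .inr (.inl j) => exact (jets j j0).2.1.left.mono fin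
  | .inr (.inr (j, k)) => exact (jets j k).2.2.left.mono fin

/-! ### Strict differentiability of slices -/

theorem exists_norm_le_of_hasStrictDerivAt {F : Type*} [NormedAddCommGroup F] [NormedSpace ℝ F]
    {u : ℝ → F} {u' : F} {t₀ : ℝ} (hu : HasStrictDerivAt u u' t₀) {η : ℝ} (hη : 0 < η) :
    ∃ δ > 0, ∀ t t', |t - t₀| < δ → |t' - t₀| < δ →
      ‖u t - u t' - (t - t') • u'‖ ≤ η * |t - t'| := by
  have h1 := hu.hasStrictFDerivAt.isLittleO.def hη
  obtain ⟨δ, hδ, H⟩ := Metric.eventually_nhds_iff.1 h1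
  refine ⟨δ, hδ, fun t t' ht ht' => ?_⟩
  have := H (y := (t, t')) (by
    rw [Prod.dist_eq, Real.dist_eq, Real.dist_eq]
    exact max_lt ht ht')
  simpa using this

/-- Linearity is required only almost everywhere, since the components of a sum in W are sums of
components only up to null sets. -/
theorem unifStrictDeriv_of_linear {F ι α : Type*} [NormedAddCommGroup F] [NormedSpace ℝ F]
    [MeasurableSpace α] {μ : Measure α} {p : ℝ≥0∞} {T : ι → F → α → ℝ} {C : ℝ} (hC : 0 ≤ C)
    (hT : ∀ i w, LpBd μ p (T i w) (C * ‖w‖))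
    (hsub : ∀ i w w', T i (w - w') =ᵐ[μ] fun x => T i w x - T i w' x)
    (hsmul : ∀ i (c : ℝ) w, T i (c • w) =ᵐ[μ] fun x => c * T i w x) {u : ℝ → F} {u' : F} {t₀ : ℝ}
    (hu : HasStrictDerivAt u u' t₀) :
    UnifStrictDeriv μ p (fun t i => T i (u t)) (fun i => T i u') t₀ := by
  refine ⟨⟨max (C * ‖u t₀‖) (C * ‖u'‖), le_max_of_le_left (by positivity), fun i =>
    ⟨(hT i _).mono (le_max_left _ _), (hT i _).mono (le_max_right _ _)⟩⟩, fun η hη => ?_⟩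
  obtain ⟨δ, hδ, H⟩ := exists_norm_le_of_hasStrictDerivAt hu (show 0 < η / (C + 1) by positivity)
  refine ⟨δ, hδ, fun t t' ht ht' i => ?_⟩
  have h2 : LpBd μ p (T i (u t - u t' - (t - t') • u')) (η * |t - t'|) := by
    refine (hT i _).mono ?_
    calc C * ‖u t - u t' - (t - t') • u'‖ ≤ C * (η / (C + 1) * |t - t'|) :=
          mul_le_mul_of_nonneg_left (H t t' ht ht') hC
      _ = C / (C + 1) * (η * |t - t'|) := by field_simp
      _ ≤ η * |t - t'| := mul_le_of_le_one_left (by positivity)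
          (by rw [div_le_one (by positivity)]; linarith)
  refine h2.congr ?_
  filter_upwards [hsub i (u t - u t') ((t - t') • u'), hsub i (u t) (u t'),
    hsmul i (t - t') u'] with x h3 h4 h5
  rw [h3, h4, h5]

/-- Bonds of length at least `ρ`, with a direction and a weight. -/
abbrev LongBond (D : Set (E d)) (B ρ : ℝ) : Type :=
  {b : E d × E d × (E d → ℝ) // ρ ≤ ‖b.1‖ ∧ ‖b.1‖ ≤ 1 ∧ ‖b.2.1‖ ≤ 1 ∧ IsWeight D b.1 B b.2.2}

/-- A lower bound on the bond length bounds the scaling r^{-1/2}, so all profiles have uniform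
bounds and the product and chain rules apply uniformly in the bond. Only the existence of a common
derivative matters, because the difference quotients will be compared with each other. -/
theorem unifStrictDeriv_slice (hd : d = 2 ∨ d = 3) (hDb : Bornology.IsBounded D)
    (hD : IsOpen D) {K B ρ : ℝ} (hB : 0 ≤ B) (hρ : 0 < ρ) {G : ℕ → ℝ → ℝ} (hG : IsProfile G K)
    {u : ℝ → W D} {u' : W D} {t₀ : ℝ} (hu : HasStrictDerivAt u u' t₀) (α : JetIndex d) :
    ∃ f' : LongBond D B ρ → E d → ℝ, UnifStrictDeriv volume 2
      (fun t (b : LongBond D B ρ) => slice G b.1.2.2 b.1.1 b.1.2.1 (u t) α) f' t₀ := by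
  obtain ⟨v, hv0, hv⟩ := exists_lpBd_indicator_one hDb hD
  obtain ⟨Q, hQ, h4⟩ := W.exists_four_bound hd hDb hD
  obtain ⟨H, hH, hh⟩ := W.exists_holder_bound hd hDb hD
  have h12 : (1 : ℝ≥0∞) ≤ 2 := by norm_num
  have h14 : (1 : ℝ≥0∞) ≤ 4 := by norm_num
  have h1t : (1 : ℝ≥0∞) ≤ ⊤ := le_top
  have hpos : ∀ b : LongBond D B ρ, 0 < ‖b.1.1‖ := fun b => hρ.trans_le b.2.1
  have u0 : UnifStrictDeriv volume ⊤
      (fun t (b : LongBond D B ρ) => incr0 (u t) b.1.1 b.1.2.1) _ t₀ :=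
    unifStrictDeriv_of_linear (T := fun (b : LongBond D B ρ) w => incr0 w b.1.1 b.1.2.1)
      (C := d * H) (by positivity)
      (fun b w => (W.lpBd_incr0_top hD b.2.2.2.1 fun i => hh w i b.1.1 b.2.2.1).mono (by
        have := Real.rpow_le_one (hpos b).le b.2.2.1 (show (0 : ℝ) ≤ 1 / 4 by norm_num)
        calc d * (H * ‖w‖ * ‖b.1.1‖ ^ (1 / 4 : ℝ)) ≤ d * (H * ‖w‖ * 1) := by gcongr
          _ = _ := by ring))
      (fun b w w' => incr0_sub hD w w' _ _) (fun b c w => incr0_smul hD c w _ _) hu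
  have u1 : ∀ j, UnifStrictDeriv volume 2
      (fun t (b : LongBond D B ρ) => incr1 (u t) b.1.1 b.1.2.1 j) _ t₀ := fun j =>
    unifStrictDeriv_of_linear (T := fun (b : LongBond D B ρ) w => incr1 w b.1.1 b.1.2.1 j)
      (C := 2 * d) (by positivity)
      (fun b w => LpBd.incr h12 (norm_nonneg w) b.2.2.2.1 _ fun i => W.lpBd_c1 hD w i j)
      (fun b w w' => incr1_sub hD w w' _ _ j) (fun b c w => incr1_smul hD c w _ _ j) hu
  have u4 : ∀ j, UnifStrictDeriv volume 4
      (fun t (b : LongBond D B ρ) => incr1 (u t) b.1.1 b.1.2.1 j) _ t₀ := fun j =>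
    unifStrictDeriv_of_linear (T := fun (b : LongBond D B ρ) w => incr1 w b.1.1 b.1.2.1 j)
      (C := 2 * d * Q) (by positivity)
      (fun b w => (LpBd.incr h14 (by positivity) b.2.2.2.1 _ fun i => h4 w i j).mono
        (le_of_eq (by ring)))
      (fun b w w' => incr1_sub hD w w' _ _ j) (fun b c w => incr1_smul hD c w _ _ j) hu
  have u2 : ∀ j k, UnifStrictDeriv volume 2
      (fun t (b : LongBond D B ρ) => incr2 (u t) b.1.1 b.1.2.1 j k) _ t₀ := fun j k =>
    unifStrictDeriv_of_linear (T := fun (b : LongBond D B ρ) w => incr2 w b.1.1 b.1.2.1 j k)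
      (C := 2 * d) (by positivity)
      (fun b w => LpBd.incr h12 (norm_nonneg w) b.2.2.2.1 _ fun i => W.lpBd_c2 hD w i j k)
      (fun b w w' => incr2_sub hD w w' _ _ j k) (fun b c w => incr2_smul hD c w _ _ j k) hu
  set L := ρ ^ (-(1 / 2) : ℝ) with hL
  have hL0 : 0 ≤ L := by positivity
  have hle : ∀ b : LongBond D B ρ, ‖b.1.1‖ ^ (-(1 / 2) : ℝ) ≤ L := fun b =>
    Real.rpow_le_rpow_of_nonpos hρ b.2.1 (by norm_num)
  have hK := hG.nonneg
  have hbd : ∀ m ≤ 3, ∀ (b : LongBond D B ρ) s, |scaleProfile G ‖b.1.1‖ m s| ≤ (L + 1) ^ 3 * K := by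
    intro m hm b s
    refine ((hG.scale (hpos b) b.2.2.1).bound m hm s).trans ?_
    have := hle b
    gcongr
    linarith
  have gm : ∀ m ≤ 2, ∃ f', UnifStrictDeriv volume ⊤
      (fun t (b : LongBond D B ρ) x => scaleProfile G ‖b.1.1‖ m (incr0 (u t) b.1.1 b.1.2.1 x))
      f' t₀ := by
    intro m hm
    refine ⟨_, u0.comp (φ := fun b => scaleProfile G ‖b.1.1‖ m)
      (φ' := fun b => scaleProfile G ‖b.1.1‖ (m + 1))
      (φ'' := fun b => scaleProfile G ‖b.1.1‖ (m + 1 + 1)) (K := (L + 1) ^ 3 * K)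
      (fun b s => (hG.scale (hpos b) b.2.2.1).deriv m s)
      (fun b s => (hG.scale (hpos b) b.2.2.1).deriv (m + 1) s)
      (fun b s => hbd m (by omega) b s) (fun b s => hbd (m + 1) (by omega) b s) fun R => ?_⟩
    -- For m = 2 this is the profile of order four, which is continuous but not assumed bounded; the
    -- arguments stay in [−LR, LR].
    obtain ⟨P, hP⟩ := (isCompact_Icc (a := -(L * R)) (b := L * R)).exists_bound_of_continuousOn
      (hG.continuous (m + 1 + 1)).continuousOn
    refine ⟨L ^ (m + 1 + 1) * P, fun b s hs => ?_⟩
    have hb0 : 0 ≤ ‖b.1.1‖ ^ (-(1 / 2) : ℝ) := by positivity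
    rw [scaleProfile, abs_mul, abs_of_nonneg (by positivity)]
    refine mul_le_mul (pow_le_pow_left₀ hb0 (hle b) _) (hP _ ?_) (abs_nonneg _) (by positivity)
    rw [mem_Icc, ← abs_le, abs_mul, abs_of_nonneg hb0]
    exact mul_le_mul (hle b) hs (abs_nonneg _) hL0
  obtain ⟨_, γ0⟩ := gm 0 (by norm_num)
  obtain ⟨_, γ1⟩ := gm 1 (by norm_num)
  obtain ⟨_, γ2⟩ := gm 2 (by norm_num)
  have wt := fun b : LongBond D B ρ => b.2.2.2.2.lpBd_top hD hB
  have w0 := UnifStrictDeriv.const (t₀ := t₀) hB fun b => (wt b).1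
  have w1 := fun j => UnifStrictDeriv.const (t₀ := t₀) hB fun b => (wt b).2.1 j
  have hBv : 0 ≤ B * v := by positivity
  have v0 := UnifStrictDeriv.const (t₀ := t₀) hBv fun b => lpBd_two_indicator hB hv (wt b).1
  have v1 := fun j => UnifStrictDeriv.const (t₀ := t₀) hBv fun b =>
    lpBd_two_indicator hB hv ((wt b).2.1 j)
  have v2 := fun j k => UnifStrictDeriv.const (t₀ := t₀) hBv fun b =>
    lpBd_two_indicator hB hv ((wt b).2.2 j k)
  have g1 := fun j => γ1.mul (hpqr := inferInstance) h1t h12 h12 (u1 j)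
  match α with
  | .inl _ => exact ⟨_, v0.mul (hpqr := inferInstance) h12 h1t h12 γ0⟩
  | .inr (.inl j) =>
    exact ⟨_, ((v1 j).mul (hpqr := inferInstance) h12 h1t h12 γ0).add h12
      (w0.mul (hpqr := inferInstance) h1t h12 h12 (g1 j))⟩
  | .inr (.inr (j, k)) =>
    have g11 := γ2.mul (hpqr := inferInstance) (r := 2) h1t h12 h12
      ((u4 k).mul (hpqr := inferInstance) (r := 2) h14 h14 h12 (u4 j))
    have g2 := γ1.mul (hpqr := inferInstance) (r := 2) h1t h12 h12 (u2 j k)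
    exact ⟨_, (((v2 j k).mul (hpqr := inferInstance) (r := 2) h12 h1t h12 γ0).add h12
      ((w1 j).mul (hpqr := inferInstance) (r := 2) h1t h12 h12 (g1 k))).add h12
      (((w1 k).mul (hpqr := inferInstance) (r := 2) h1t h12 h12 (g1 j)).add h12
        (w0.mul (hpqr := inferInstance) (r := 2) h1t h12 h12 (g11.add h12 g2)))⟩

end Peridynamics

end

/-! ### L² duality and the force in bond variables -/

noncomputable section

open scoped ENNReal NNReal

namespace Peridynamics

variable {d : ℕ} {D : Set (E d)}

/-! ### Duality with test functions -/

/-- The classes of test functions in `L²(D)`. -/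
def testSubmodule (D : Set (E d)) : Submodule ℝ (Lp ℝ 2 ((volume : Measure (E d)).restrict D)) where
  carrier := {g | ∃ φ, IsTest D φ ∧ g =ᵐ[volume.restrict D] φ}
  zero_mem' := ⟨0, ⟨contDiff_const, HasCompactSupport.zero, by simp [tsupport]⟩, Lp.coeFn_zero _ _ _⟩
  add_mem' := by
    rintro g g' ⟨φ, hφ, e⟩ ⟨φ', hφ', e'⟩
    exact ⟨φ + φ', ⟨hφ.1.add hφ'.1, hφ.2.1.add hφ'.2.1, (tsupport_add φ φ').trans
      (union_subset hφ.2.2 hφ'.2.2)⟩, (Lp.coeFn_add g g').trans (e.add e')⟩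
  smul_mem' := by
    rintro c g ⟨φ, hφ, e⟩
    exact ⟨fun x => c * φ x, ⟨contDiff_const.mul hφ.1, hφ.2.1.mul_left,
      (tsupport_mul_subset_right (f := fun _ => c) (g := φ)).trans hφ.2.2⟩,
      (Lp.coeFn_smul c g).trans (e.const_smul c)⟩

/-- An element orthogonal to all test functions vanishes almost everywhere, by the fundamental lemma
of the calculus of variations. -/
theorem testSubmodule_dense (hD : IsOpen D) : (testSubmodule D).topologicalClosure = ⊤ := by
  rw [Submodule.topologicalClosure_eq_top_iff, Submodule.eq_bot_iff]
  intro g hg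
  have hloc : LocallyIntegrableOn g D volume := by
    have h2 : MemLp g 2 (volume.restrict D) := Lp.memLp g
    exact locallyIntegrableOn_of_locallyIntegrable_restrict (h2.locallyIntegrable (by norm_num))
  have h0 := hD.ae_eq_zero_of_integral_contDiff_smul_eq_zero hloc fun φ h1 h2 h3 => by
    have hm : MemLp φ 2 (volume.restrict D) := h1.continuous.memLp_of_hasCompactSupport h2
    have := (Submodule.mem_orthogonal _ _).1 hg hm.toLp ⟨φ, ⟨h1, h2, h3⟩, hm.coeFn_toLp⟩
    rw [L2.inner_def] at this
    rw [← setIntegral_eq_integral_of_forall_compl_eq_zero (s := D), ← this]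
    · refine integral_congr_ae ?_
      filter_upwards [hm.coeFn_toLp] with x hx
      rw [hx]
      simp [mul_comm]
    · intro x hx
      rw [image_eq_zero_of_notMem_tsupport fun h => hx (h3 h), zero_smul]
  refine (Lp.eq_zero_iff_ae_eq_zero).2 ?_
  exact (ae_restrict_iff' hD.measurableSet).2 h0

/-- By density the bound extends from test functions to all of L²(D), in particular to f itself. -/
theorem lpBd_of_test (hD : IsOpen D) {f : E d → ℝ} {c B : ℝ} (hf : LpBd volume 2 f c)
    (hf0 : ∀ x ∉ D, f x = 0) (hB : 0 ≤ B)
    (h : ∀ φ, IsTest D φ → ∀ c, 0 ≤ c → LpBd volume 2 φ c → |∫ x, f x * φ x| ≤ B * c) :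
    LpBd volume 2 f B := by
  have hm : MemLp f 2 (volume.restrict D) := hf.memLp.restrict D
  set F := hm.toLp with hF
  have key : ∀ g : Lp ℝ 2 ((volume : Measure (E d)).restrict D), |inner ℝ F g| ≤ B * ‖g‖ := by
    intro g
    have hg : g ∈ closure (testSubmodule D : Set (Lp ℝ 2 ((volume : Measure (E d)).restrict D))) := by
      rw [← Submodule.topologicalClosure_coe, testSubmodule_dense hD]; trivial
    have hcl : IsClosed {g : Lp ℝ 2 ((volume : Measure (E d)).restrict D) |
        |inner ℝ F g| ≤ B * ‖g‖} :=
      isClosed_le (continuous_const.inner continuous_id).abs (continuous_const.mul continuous_norm)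
    refine closure_minimal ?_ hcl hg
    rintro g ⟨φ, hφ, e⟩
    have lφ : LpBd volume 2 φ ‖g‖ := by
      refine ⟨hφ.1.continuous.aestronglyMeasurable, ?_⟩
      rw [Lp.norm_def, ENNReal.ofReal_toReal (Lp.eLpNorm_ne_top g), eLpNorm_congr_ae e,
        eLpNorm_restrict_eq_of_support_subset]
      intro x hx
      by_contra hxD
      exact hx (hφ.eq_zero hxD)
    have := h φ hφ ‖g‖ (norm_nonneg _) lφ
    rw [← setIntegral_eq_integral_of_forall_compl_eq_zero (s := D)
      fun x hx => by rw [hf0 x hx, zero_mul]] at this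
    rw [mem_ofPred_eq, L2.inner_def]
    convert this using 2
    refine integral_congr_ae ?_
    filter_upwards [hm.coeFn_toLp, e] with x hx hx'
    rw [hF, hx, hx']
    simp [mul_comm]
  have h1 := key F
  rw [real_inner_self_eq_norm_sq, abs_of_nonneg (by positivity)] at h1
  have h2 : ‖F‖ ≤ B := by
    rcases (norm_nonneg F).eq_or_lt with h0 | h0
    · rw [← h0]; exact hB
    · nlinarith
  refine ⟨hf.1, ?_⟩
  rw [← eLpNorm_restrict_eq_of_support_subset (s := D) fun x hx => by
    by_contra hxD
    exact hx (hf0 x hxD)]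
  rw [hF, Lp.norm_toLp] at h2
  exact (ENNReal.le_ofReal_iff_toReal_le hm.2.ne hB).2 h2

/-! ### The force as an integral of slices -/

/-- The derivatives of `s ↦ f(s²)`, starting with the first. -/
def bondProfile (f : ℝ → ℝ) (m : ℕ) : ℝ → ℝ := iteratedDeriv (m + 1) fun s => f (s ^ 2)

theorem IsBondFunction.contDiff_sq {f : ℝ → ℝ} (hf : IsBondFunction f) :
    ContDiff ℝ ((⊤ : ℕ∞) : WithTop ℕ∞) fun s => f (s ^ 2) := by
  rw [← contDiffOn_univ]
  exact hf.smooth.comp (contDiff_id.pow 2).contDiffOn fun s _ => sq_nonneg s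

theorem exists_isProfile_bondProfile {f : ℝ → ℝ} (hf : IsBondFunction f) :
    ∃ K, IsProfile (bondProfile f) K := by
  choose K hK using hf.bounded_derivs
  have hK' : ∀ m, m ≤ 3 → ∃ K, ∀ s, |bondProfile f m s| ≤ K := fun m hm =>
    ⟨K (m + 1) (by omega) (by omega), hK (m + 1) (by omega) (by omega)⟩
  choose L hL using hK'
  refine ⟨max (max (L 0 (by norm_num)) (L 1 (by norm_num)))
    (max (L 2 (by norm_num)) (L 3 (by norm_num))), fun m s => ?_, fun m hm s => ?_⟩
  · rw [bondProfile, bondProfile, iteratedDeriv_succ (n := m + 1)]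
    exact ((hf.contDiff_sq.differentiable_iteratedDeriv (m + 1)
      (by exact_mod_cast ENat.natCast_lt_top _)) s).hasDerivAt
  · refine (hL m hm s).trans ?_
    interval_cases m <;> simp

/-- The direction of a bond. -/
def bondDir (ξ : E d) : E d := ‖ξ‖⁻¹ • ξ

theorem norm_bondDir_le (ξ : E d) : ‖bondDir ξ‖ ≤ 1 := by
  rw [bondDir, norm_smul, norm_inv, norm_norm]
  exact inv_mul_le_one

/-- The coefficient of a bond in the force. -/
def bondKernel (ε : ℝ) (J : ℝ → ℝ) (ξ : E d) : ℝ :=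
  J ‖ξ‖ * (ε * ‖ξ‖) ^ (-(1 / 2) : ℝ) / ε

/-- The weight of a bond in the force. -/
def bondWeight (ε : ℝ) (ω : E d → ℝ) (ξ x : E d) : ℝ := ω x * ω (x + ε • ξ)

/-- The bound does not depend on ε, ω or ξ, which is what makes the final constant uniform in these.
-/
theorem IsBoundaryFunction.isWeight (hD : IsOpen D) {ε C₁ C₂ : ℝ} {ω : E d → ℝ}
    (hω : IsBoundaryFunction D ε C₁ C₂ ω) {ξ : E d} (hξ : ‖ξ‖ < 1) :
    IsWeight D (ε • ξ) (1 + |C₁| + |C₂|) (bondWeight ε ω ξ) := by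
  have h2 := hω.contDiffOn ξ hξ
  refine ⟨h2, fun x _ => mul_nonneg (hω.nonneg _) (hω.nonneg _), fun x _ hx => ?_,
    fun x _ => ?_, fun j x hx => ?_, fun j k x hx => ?_⟩
  · rw [bondWeight, hω.eq_zero _ hx, mul_zero]
  · have := mul_le_one₀ (hω.le_one x) (hω.nonneg (x + ε • ξ)) (hω.le_one (x + ε • ξ))
    rw [bondWeight]
    linarith [abs_nonneg C₁, abs_nonneg C₂]
  · have h1 := hω.bound_one ξ hξ x hx
    have h3 := (fderiv ℝ (fun x => ω x * ω (x + ε • ξ)) x).le_opNorm (EuclideanSpace.single j 1)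
    rw [PiLp.norm_single, norm_one, mul_one] at h3
    refine h3.trans (h1.trans ?_)
    linarith [abs_nonneg C₂, le_abs_self C₁]
  · have h1 := hω.bound_two ξ hξ x hx
    have h3 := (iteratedFDeriv ℝ 2 (fun x => ω x * ω (x + ε • ξ)) x).le_opNorm
      ![EuclideanSpace.single k 1, EuclideanSpace.single j 1]
    rw [iteratedFDeriv_two_apply] at h3
    simp only [Fin.prod_univ_two, Matrix.cons_val_zero, Matrix.cons_val_one,
      PiLp.norm_single, norm_one, mul_one] at h3
    have hdd : DifferentiableAt ℝ (fderiv ℝ (fun x => ω x * ω (x + ε • ξ))) x :=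
      ((h2.fderiv_of_isOpen hD (m := 1) (by norm_num)).contDiffAt
        (hD.mem_nhds hx)).differentiableAt (by simp)
    have e : partialDeriv k (partialDeriv j (bondWeight ε ω ξ)) x =
        fderiv ℝ (fderiv ℝ (fun x => ω x * ω (x + ε • ξ))) x (EuclideanSpace.single k 1)
          (EuclideanSpace.single j 1) := by
      have := hdd.hasFDerivAt.clm_apply (hasFDerivAt_const (EuclideanSpace.single j (1 : ℝ)) x)
      refine (partialDeriv_of_hasFDerivAt this k).trans ?_
      simp
    rw [e]
    refine h3.trans (h1.trans ?_)
    linarith [abs_nonneg C₁, le_abs_self C₂]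

/-- Since |y − x| S² is the square of √|y − x| S, the potential is a function of the form f(s²), and
only derivatives of s ↦ f(s²) occur. -/
theorem hasDerivAt_pairPotential {ε : ℝ} {J f : ℝ → ℝ} (hf : IsBondFunction f) (ω : E d → ℝ)
    (x y : E d) (S : ℝ) :
    HasDerivAt (pairPotential ε J f ω x y)
      (ω x * ω y * (J (‖y - x‖ / ε) / (ε * ‖y - x‖)) *
        (bondProfile f 0 (√‖y - x‖ * S) * √‖y - x‖)) S := by
  have h1 : (pairPotential ε J f ω x y) = fun S => ω x * ω y * (J (‖y - x‖ / ε) / (ε * ‖y - x‖)) *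
      (fun s => f (s ^ 2)) (√‖y - x‖ * S) := by
    funext S
    simp only [pairPotential]
    rw [mul_pow, Real.sq_sqrt (norm_nonneg _)]
  rw [h1]
  refine HasDerivAt.const_mul _ ?_
  have h2 : HasDerivAt (fun s => f (s ^ 2)) (bondProfile f 0 (√‖y - x‖ * S)) (√‖y - x‖ * S) := by
    rw [bondProfile, zero_add, iteratedDeriv_one]
    exact (hf.contDiff_sq.differentiable (by simp) _).hasDerivAt
  have h3 : HasDerivAt (fun S => √‖y - x‖ * S) √‖y - x‖ S := by
    simpa using (hasDerivAt_id S).const_mul √‖y - x‖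
  exact h2.comp S h3

/-- The integrand of the force in the variable `ξ`. -/
def forceDens (ε : ℝ) (J f : ℝ → ℝ) (ω : E d → ℝ) (w : W D) (x ξ : E d) : ℝ :=
  bondKernel ε J ξ * (bondWeight ε ω ξ x *
    scaleProfile (bondProfile f) ‖ε • ξ‖ 0 (incr0 w (ε • ξ) (bondDir ξ) x))

/-- With r = |εξ| the strain is the increment divided by r, so the argument of the profile is √r ·
r^{-1} = r^{-1/2} times the increment. The same power remains in front, as √r from the chain rule
meets the factor 1/r of the potential. -/
theorem deriv_pairPotential_strain {ε : ℝ} (hε : 0 < ε) {J f : ℝ → ℝ} (hf : IsBondFunction f)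
    (ω : E d → ℝ) (w : W D) (x ξ : E d) :
    deriv (pairPotential ε J f ω x (x + ε • ξ)) (strain (W.toFun w) (x + ε • ξ) x) •
      (‖x + ε • ξ - x‖⁻¹ • (x + ε • ξ - x)) = forceDens ε J f ω w x ξ • bondDir ξ := by
  rcases eq_or_ne ξ 0 with rfl | hξ
  · simp [bondDir]
  have hξ0 : 0 < ‖ξ‖ := norm_pos_iff.2 hξ
  have hdir : ‖ε • ξ‖⁻¹ • (ε • ξ) = bondDir ξ := by
    rw [bondDir, norm_smul, smul_smul, Real.norm_of_nonneg hε.le]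
    congr 1
    field_simp
  have hn : ‖ε • ξ‖ = ε * ‖ξ‖ := by rw [norm_smul, Real.norm_of_nonneg hε.le]
  have hr : 0 < ε * ‖ξ‖ := by positivity
  have hs : strain (W.toFun w) (x + ε • ξ) x = (ε * ‖ξ‖)⁻¹ * incr0 w (ε • ξ) (bondDir ξ) x := by
    rw [strain, add_sub_cancel_left, hdir, hn, real_inner_smul_left, PiLp.inner_apply, incr0, incr]
    congr 1
    refine Finset.sum_congr rfl fun i _ => ?_
    simp [W.toFun_apply]
  rw [(hasDerivAt_pairPotential hf ω x _ _).deriv, add_sub_cancel_left, hdir, hs, hn, forceDens,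
    scaleProfile, pow_zero, one_mul, bondKernel, bondWeight, hn]
  congr 1
  have e1 : √(ε * ‖ξ‖) * (ε * ‖ξ‖)⁻¹ = (ε * ‖ξ‖) ^ (-(1 / 2) : ℝ) := by
    rw [Real.sqrt_eq_rpow, ← Real.rpow_neg_one, ← Real.rpow_add hr]
    norm_num
  rw [← mul_assoc (√(ε * ‖ξ‖)), e1, mul_div_cancel_left₀ _ hε.ne', ← e1]
  field_simp

theorem setIntegral_ball_eq {F : Type*} [NormedAddCommGroup F] [NormedSpace ℝ F] {ε : ℝ}
    (hε : 0 < ε) (x : E d) (g : E d → F) :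
    ∫ y in Metric.ball x ε, g y = ε ^ d • ∫ ξ in Metric.ball (0 : E d) 1, g (x + ε • ξ) := by
  rw [Measure.setIntegral_comp_smul_of_pos volume (fun z => g (x + z)) _ hε,
    smul_unitBall_of_pos hε, finrank_euclideanSpace, Fintype.card_fin, smul_smul,
    mul_inv_cancel₀ (by positivity), one_smul,
    ← integral_indicator measurableSet_ball, ← integral_indicator measurableSet_ball,
    ← integral_add_left_eq_self _ x]
  congr 1
  funext z
  simp only [indicator]
  congr 1
  simp [Metric.mem_ball, dist_eq_norm]

theorem measurable_forceDens (hD : IsOpen D) {ε : ℝ} {J f : ℝ → ℝ} (hJ : IsInfluenceFunction J)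
    (hf : IsBondFunction f) {ω : E d → ℝ} (hω : Continuous ω) (w : W D) :
    Measurable fun p : E d × E d => forceDens ε J f ω w p.1 p.2 := by
  obtain ⟨K, hK⟩ := exists_isProfile_bondProfile hf
  have hG := (hK.continuous 0).measurable
  have hJm := hJ.measurable
  have hc := fun i => (W.stronglyMeasurable_c0 hD w i).measurable
  have hωm := hω.measurable
  have hdir : Measurable (bondDir : E d → E d) :=
    measurable_norm.inv.smul measurable_id
  have hi : Measurable fun p : E d × E d => incr0 w (ε • p.2) (bondDir p.2) p.1 := by
    unfold incr0 incr
    refine Finset.measurable_sum _ fun i _ => Measurable.mul ?_ (Measurable.sub ?_ ?_)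
    · exact (EuclideanSpace.proj (𝕜 := ℝ) i).continuous.measurable.comp (hdir.comp measurable_snd)
    · exact (hc i).comp (measurable_fst.add (measurable_snd.const_smul ε))
    · exact (hc i).comp measurable_fst
  have hn : Measurable fun p : E d × E d => ‖p.2‖ := measurable_snd.norm
  have hn' : Measurable fun p : E d × E d => ‖ε • p.2‖ := (measurable_snd.const_smul ε).norm
  unfold forceDens bondKernel bondWeight scaleProfile
  refine Measurable.mul ?_ (Measurable.mul ?_ ?_)
  · exact ((hJm.comp hn).mul ((hn.const_mul ε).pow_const _)).div_const _
  · exact (hωm.comp measurable_fst).mul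
      (hωm.comp (measurable_fst.add (measurable_snd.const_smul ε)))
  · exact ((hn'.pow_const _).pow_const _).mul (hG.comp ((hn'.pow_const _).mul hi))

theorem measurable_forceDens_right (hD : IsOpen D) {ε : ℝ} {J f : ℝ → ℝ}
    (hJ : IsInfluenceFunction J) (hf : IsBondFunction f) {ω : E d → ℝ} (hω : Continuous ω)
    (w : W D) (x : E d) : Measurable (forceDens ε J f ω w x) := by
  have h : Measurable (Function.uncurry (forceDens ε J f ω w)) :=
    measurable_forceDens hD hJ hf hω w (ε := ε)
  exact h.of_uncurry_left

theorem abs_bondKernel_le {ε : ℝ} (hε : 0 < ε) {J : ℝ → ℝ} {M : ℝ}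
    (hM : ∀ r, 0 ≤ r → r < 1 → 0 ≤ J r ∧ J r ≤ M) {ξ : E d} (hξ : ‖ξ‖ < 1) :
    |bondKernel ε J ξ| ≤ M * ‖ε • ξ‖ ^ (-(1 / 2) : ℝ) / ε := by
  have h := hM ‖ξ‖ (norm_nonneg _) hξ
  rw [bondKernel, norm_smul, Real.norm_of_nonneg hε.le,
    abs_of_nonneg (div_nonneg (mul_nonneg h.1 (by positivity)) hε.le)]
  gcongr
  exact h.2

theorem abs_forceDens_le {ε : ℝ} (hε : 0 < ε) {J f : ℝ → ℝ} {M K : ℝ}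
    (hM : ∀ r, 0 ≤ r → r < 1 → 0 ≤ J r ∧ J r ≤ M) (hK : IsProfile (bondProfile f) K)
    {ω : E d → ℝ} (hω0 : ∀ x, 0 ≤ ω x) (hω1 : ∀ x, ω x ≤ 1) (w : W D) (x : E d) {ξ : E d}
    (hξ : ‖ξ‖ < 1) :
    |forceDens ε J f ω w x ξ| ≤ M * ε ^ (-(1 / 2) : ℝ) / ε * K * ‖ξ‖ ^ (-(1 / 2) : ℝ) := by
  have h1 := abs_bondKernel_le hε hM hξ
  have hb : |bondWeight ε ω ξ x| ≤ 1 := by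
    rw [bondWeight, abs_of_nonneg (mul_nonneg (hω0 _) (hω0 _))]
    exact mul_le_one₀ (hω1 x) (hω0 _) (hω1 _)
  have hs : ∀ s, |scaleProfile (bondProfile f) ‖ε • ξ‖ 0 s| ≤ K := fun s => by
    rw [scaleProfile, pow_zero, one_mul]
    exact hK.bound 0 (by norm_num) _
  rw [norm_smul, Real.norm_of_nonneg hε.le, Real.mul_rpow hε.le (norm_nonneg _)] at h1
  have hK0 := hK.nonneg
  rw [forceDens, abs_mul, abs_mul]
  calc _ ≤ M * (ε ^ (-(1 / 2) : ℝ) * ‖ξ‖ ^ (-(1 / 2) : ℝ)) / ε * (1 * K) :=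
        mul_le_mul h1 (mul_le_mul hb (hs _) (abs_nonneg _) zero_le_one) (by positivity)
          ((abs_nonneg _).trans h1)
    _ = _ := by ring

/-- Substituting y = x + εξ cancels ε^d. The integrand is dominated by a multiple of |ξ|^{-1/2}, so
components may be taken inside the integral. -/
theorem force_apply (hd : 1 ≤ d) (hD : IsOpen D) {ε : ℝ} (hε : 0 < ε) {J f : ℝ → ℝ}
    (hJ : IsInfluenceFunction J) (hf : IsBondFunction f) {ω : E d → ℝ} (hω : Continuous ω)
    (hω0 : ∀ x, 0 ≤ ω x) (hω1 : ∀ x, ω x ≤ 1) (w : W D) (x : E d) (i : Fin d) :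
    force ε J f ω (W.toFun w) x i = 2 / volume.real (Metric.ball (0 : E d) 1) *
      ∫ ξ in Metric.ball (0 : E d) 1, forceDens ε J f ω w x ξ * bondDir ξ i := by
  obtain ⟨K, hK⟩ := exists_isProfile_bondProfile hf
  obtain ⟨M, hM⟩ := hJ.bounded
  have hd' : (1 / 2 : ℝ) < d := by
    have : (1 : ℝ) ≤ d := by exact_mod_cast hd
    linarith
  rw [force, setIntegral_ball_eq hε]
  simp only [deriv_pairPotential_strain hε hf]
  have hdir : Measurable (bondDir : E d → E d) := measurable_norm.inv.smul measurable_id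
  have hint : Integrable (fun ξ => forceDens ε J f ω w x ξ • bondDir ξ)
      (volume.restrict (Metric.ball (0 : E d) 1)) := by
    refine Integrable.mono' ((integrableOn_norm_rpow hd hd' (R := 1)).const_mul
      (M * ε ^ (-(1 / 2) : ℝ) / ε * K)) ?_ ?_
    · have h1 := measurable_forceDens_right hD hJ hf hω w x (ε := ε)
      have h2 : Measurable fun ξ => forceDens ε J f ω w x ξ • bondDir ξ := h1.smul hdir
      exact h2.aestronglyMeasurable
    · filter_upwards [ae_restrict_mem measurableSet_ball] with ξ hξ
      rw [norm_smul, Real.norm_eq_abs]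
      have h1 := abs_forceDens_le hε hM hK hω0 hω1 w x (mem_ball_zero_iff.1 hξ)
      exact (mul_le_of_le_one_right (abs_nonneg _) (norm_bondDir_le ξ)).trans h1
  have e : (∫ ξ in Metric.ball (0 : E d) 1, forceDens ε J f ω w x ξ • bondDir ξ) i =
      ∫ ξ in Metric.ball (0 : E d) 1, forceDens ε J f ω w x ξ * bondDir ξ i := by
    have := (EuclideanSpace.proj (𝕜 := ℝ) i).integral_comp_comm hint
    simpa using this.symm
  rw [smul_smul, PiLp.smul_apply, e, smul_eq_mul]
  congr 1
  field_simp

end Peridynamics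

end

/-! ### The force and its weak derivatives as superpositions over bonds -/

noncomputable section

open scoped ENNReal NNReal

namespace Peridynamics

variable {d : ℕ} {D : Set (E d)}

/-! ### Superpositions over bonds -/

/-- Tested with functions supported in `D`, `p` is the integral over the bonds `ξ` of the functions
`s ξ` with coefficients `κ ξ`. -/
structure IsBondIntegral (D : Set (E d)) (κ : E d → ℝ) (p : E d → ℝ) (s : E d → E d → ℝ) :
    Prop where
  memLp : ∀ ξ ∈ Metric.ball (0 : E d) 1, κ ξ ≠ 0 → MemLp (s ξ) 2 volume
  memLp_left : MemLp p 2 volume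
  integrableOn : ∀ φ, IsTest D φ →
    IntegrableOn (fun ξ => κ ξ * ∫ x, s ξ x * φ x) (Metric.ball (0 : E d) 1)
  integral_eq : ∀ φ, IsTest D φ →
    ∫ x, p x * φ x = ∫ ξ in Metric.ball (0 : E d) 1, κ ξ * ∫ x, s ξ x * φ x

theorem IsTest.memLp {φ : E d → ℝ} (hφ : IsTest D φ) : MemLp φ 2 volume :=
  hφ.1.continuous.memLp_of_hasCompactSupport hφ.2.1

theorem integral_sub_mul_test {f g φ : E d → ℝ} (hf : MemLp f 2 volume) (hg : MemLp g 2 volume)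
    (hφ : IsTest D φ) :
    ∫ x, (f x - g x) * φ x = (∫ x, f x * φ x) - ∫ x, g x * φ x := by
  have h1 : Integrable (fun x => f x * φ x) := hf.integrable_mul hφ.memLp
  have h2 : Integrable (fun x => g x * φ x) := hg.integrable_mul hφ.memLp
  rw [← integral_sub h1 h2]
  simp only [sub_mul]

theorem IsBondIntegral.sub {κ p p' : E d → ℝ} {s s' : E d → E d → ℝ}
    (h : IsBondIntegral D κ p s) (h' : IsBondIntegral D κ p' s') :
    IsBondIntegral D κ (fun x => p x - p' x) (fun ξ x => s ξ x - s' ξ x) := by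
  have e : ∀ φ, IsTest D φ → ∀ ξ ∈ Metric.ball (0 : E d) 1,
      κ ξ * ∫ x, (s ξ x - s' ξ x) * φ x =
        κ ξ * (∫ x, s ξ x * φ x) - κ ξ * ∫ x, s' ξ x * φ x := fun φ hφ ξ hξ => by
    rcases eq_or_ne (κ ξ) 0 with h0 | h0
    · simp [h0]
    · rw [integral_sub_mul_test (h.memLp ξ hξ h0) (h'.memLp ξ hξ h0) hφ, mul_sub]
  refine ⟨fun ξ hξ h0 => (h.memLp ξ hξ h0).sub (h'.memLp ξ hξ h0), h.memLp_left.sub h'.memLp_left,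
    fun φ hφ => ?_, fun φ hφ => ?_⟩
  · exact ((h.integrableOn φ hφ).sub (h'.integrableOn φ hφ)).congr_fun
      (fun ξ hξ => (e φ hφ ξ hξ).symm) measurableSet_ball
  · rw [setIntegral_congr_fun measurableSet_ball (e φ hφ),
      integral_sub (h.integrableOn φ hφ) (h'.integrableOn φ hφ), ← h.integral_eq φ hφ,
      ← h'.integral_eq φ hφ, integral_sub_mul_test h.memLp_left h'.memLp_left hφ]

theorem IsBondIntegral.const_mul {κ p : E d → ℝ} {s : E d → E d → ℝ}
    (h : IsBondIntegral D κ p s) (c : ℝ) :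
    IsBondIntegral D κ (fun x => c * p x) (fun ξ x => c * s ξ x) := by
  have e : ∀ φ : E d → ℝ, ∀ ξ, κ ξ * ∫ x, (c * s ξ x) * φ x = c * (κ ξ * ∫ x, s ξ x * φ x) :=
    fun φ ξ => by
      simp only [mul_assoc c]
      rw [integral_const_mul]
      ring
  refine ⟨fun ξ hξ h0 => (h.memLp ξ hξ h0).const_mul c, h.memLp_left.const_mul c,
    fun φ hφ => ?_, fun φ hφ => ?_⟩
  · simp only [e]
    exact (h.integrableOn φ hφ).const_mul c
  · simp only [e]
    rw [integral_const_mul, ← h.integral_eq φ hφ, ← integral_const_mul]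
    simp only [mul_assoc]

theorem IsBondIntegral.congr {κ p q : E d → ℝ} {s : E d → E d → ℝ} (h : IsBondIntegral D κ p s)
    (e : p =ᵐ[volume] q) : IsBondIntegral D κ q s :=
  ⟨h.memLp, (memLp_congr_ae e).1 h.memLp_left, h.integrableOn, fun φ hφ => by
    rw [← h.integral_eq φ hφ]
    refine integral_congr_ae ?_
    filter_upwards [e] with x hx
    rw [hx]⟩

/-- The derivative is moved to the test function in p and in each bond separately. Neither
differentiation under the integral nor joint measurability of the differentiated jets is needed. -/
theorem IsBondIntegral.weakD {κ p P : E d → ℝ} {s S : E d → E d → ℝ}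
    (h : IsBondIntegral D κ p s) {j : Fin d} (hp : WeakD D j p P) (hP : MemLp P 2 volume)
    (hS : ∀ ξ ∈ Metric.ball (0 : E d) 1, κ ξ ≠ 0 → MemLp (S ξ) 2 volume)
    (hs : ∀ ξ ∈ Metric.ball (0 : E d) 1, κ ξ ≠ 0 → WeakD D j (s ξ) (S ξ)) :
    IsBondIntegral D κ P S := by
  have e : ∀ φ, IsTest D φ → ∀ ξ ∈ Metric.ball (0 : E d) 1,
      κ ξ * ∫ x, S ξ x * φ x = -(κ ξ * ∫ x, s ξ x * partialDeriv j φ x) := fun φ hφ ξ hξ => by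
    rcases eq_or_ne (κ ξ) 0 with h0 | h0
    · simp [h0]
    · rw [hs ξ hξ h0 φ hφ, mul_neg, neg_neg]
  refine ⟨hS, hP, fun φ hφ => ?_, fun φ hφ => ?_⟩
  · exact (h.integrableOn _ (hφ.partialDeriv j)).neg.congr_fun
      (fun ξ hξ => (e φ hφ ξ hξ).symm) measurableSet_ball
  · rw [setIntegral_congr_fun measurableSet_ball (e φ hφ), integral_neg,
      ← h.integral_eq _ (hφ.partialDeriv j), hp φ hφ, neg_neg]

/-- Minkowski's integral inequality, obtained by duality because the superposition is known only
after testing. -/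
theorem IsBondIntegral.lpBd (hD : IsOpen D) {κ p : E d → ℝ} {s : E d → E d → ℝ}
    (h : IsBondIntegral D κ p s) (hp : ∀ x ∉ D, p x = 0) {b b' : E d → ℝ}
    (hb' : ∀ ξ ∈ Metric.ball (0 : E d) 1, κ ξ ≠ 0 → 0 ≤ b' ξ ∧ LpBd volume 2 (s ξ) (b' ξ) ∧
      |κ ξ| * b' ξ ≤ b ξ)
    (hb0 : ∀ ξ, 0 ≤ b ξ) (hb : IntegrableOn b (Metric.ball (0 : E d) 1)) :
    LpBd volume 2 p (∫ ξ in Metric.ball (0 : E d) 1, b ξ) := by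
  refine lpBd_of_test hD (MemLp.lpBd h.memLp_left) hp (integral_nonneg hb0)
    fun φ hφ c hc lφ => ?_
  rw [h.integral_eq φ hφ, ← integral_mul_const, ← Real.norm_eq_abs]
  refine norm_integral_le_of_norm_le (hb.mul_const c) ?_
  filter_upwards [ae_restrict_mem measurableSet_ball] with ξ hξ
  rw [norm_mul, Real.norm_eq_abs, Real.norm_eq_abs]
  rcases eq_or_ne (κ ξ) 0 with h0 | h0
  · rw [h0, abs_zero, zero_mul]
    exact mul_nonneg (hb0 ξ) hc
  · obtain ⟨h1, h2, h3⟩ := hb' ξ hξ h0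
    calc |κ ξ| * |∫ x, s ξ x * φ x| ≤ |κ ξ| * (b' ξ * c) :=
          mul_le_mul_of_nonneg_left (h2.pairing h1 hc lφ).2.2 (abs_nonneg _)
      _ ≤ b ξ * c := by rw [← mul_assoc]; exact mul_le_mul_of_nonneg_right h3 hc

/-! ### The jets of the force -/

/-- `n` is the peridynamic force of `w`. -/
def IsForce (ε : ℝ) (J f : ℝ → ℝ) (ω : E d → ℝ) (w n : W D) : Prop :=
  ∀ᵐ x ∂(volume.restrict D), W.toFun n x = force ε J f ω (W.toFun w) x

/-- The coefficient of a bond in a component of the force. -/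
def bondCoeff (ε : ℝ) (J : ℝ → ℝ) (i : Fin d) (ξ : E d) : ℝ :=
  2 / volume.real (Metric.ball (0 : E d) 1) * (bondKernel ε J ξ * bondDir ξ i)

/-- The jets of the contribution of a bond to the force. -/
def bondJet (ε : ℝ) (f : ℝ → ℝ) (ω : E d → ℝ) (w : W D) (α : JetIndex d) (ξ : E d) : E d → ℝ :=
  slice (bondProfile f) (bondWeight ε ω ξ) (ε • ξ) (bondDir ξ) w α

theorem ne_zero_of_bondCoeff_ne_zero {ε : ℝ} {J : ℝ → ℝ} {i : Fin d} {ξ : E d}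
    (h : bondCoeff ε J i ξ ≠ 0) : ξ ≠ 0 := by
  rintro rfl
  simp [bondCoeff, bondDir] at h

theorem norm_smul_le_one {ε : ℝ} (hε : 0 < ε) (hε1 : ε < 1) {ξ : E d}
    (hξ : ξ ∈ Metric.ball (0 : E d) 1) : ‖ε • ξ‖ ≤ 1 := by
  rw [norm_smul, Real.norm_of_nonneg hε.le]
  have := mem_ball_zero_iff.1 hξ
  nlinarith [norm_nonneg ξ]

theorem compJet_eq_zero {w : W D} {i : Fin d} (α : JetIndex d) {x : E d} (hx : x ∉ D) :
    compJet w i α x = 0 := by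
  rcases α with _ | j | ⟨j, k⟩
  exacts [comp0_eq_zero hx, comp1_eq_zero hx, comp2_eq_zero hx]

theorem memLp_compJet (hD : IsOpen D) (w : W D) (i : Fin d) (α : JetIndex d) :
    MemLp (compJet w i α) 2 volume := by
  rcases α with _ | j | ⟨j, k⟩
  exacts [(W.lpBd_c0 hD w i).memLp, (W.lpBd_c1 hD w i j).memLp, (W.lpBd_c2 hD w i j k).memLp]

theorem memLp_bondJet (hd : d = 2 ∨ d = 3) (hDb : Bornology.IsBounded D) (hD : IsOpen D)
    {ε C₁ C₂ : ℝ} (hε : 0 < ε) (hε1 : ε < 1) {f : ℝ → ℝ} (hf : IsBondFunction f) {ω : E d → ℝ}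
    (hω : IsBoundaryFunction D ε C₁ C₂ ω) (w : W D) (α : JetIndex d) {ξ : E d}
    (hξ : ξ ∈ Metric.ball (0 : E d) 1) (h0 : ξ ≠ 0) : MemLp (bondJet ε f ω w α ξ) 2 volume := by
  obtain ⟨K, hK⟩ := exists_isProfile_bondProfile hf
  obtain ⟨M, hM, h⟩ := W.exists_sup_bound hd hDb hD
  obtain ⟨C, hC, H⟩ := exists_slice_growth hd hDb hD (B := 1 + |C₁| + |C₂|) (by positivity)
    hK.nonneg (M₀ := M * ‖w‖) (by positivity)
  exact (H hK (smul_ne_zero hε.ne' h0) (norm_smul_le_one hε hε1 hξ) (norm_bondDir_le ξ)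
    (hω.isWeight hD (mem_ball_zero_iff.1 hξ)) (h w) α).memLp

/-- Fubini's theorem, with a multiple of |φ(x)| |ξ|^{-1/2} as integrable majorant. This is the only
level at which joint measurability is used. -/
theorem isBondIntegral_comp0 (hd : d = 2 ∨ d = 3) (hDb : Bornology.IsBounded D) (hD : IsOpen D)
    {ε C₁ C₂ : ℝ} (hε : 0 < ε) (hε1 : ε < 1) {J f : ℝ → ℝ} (hJ : IsInfluenceFunction J)
    (hf : IsBondFunction f) {ω : E d → ℝ} (hω : IsBoundaryFunction D ε C₁ C₂ ω) {w n : W D}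
    (hn : IsForce ε J f ω w n) (i : Fin d) :
    IsBondIntegral D (bondCoeff ε J i) (comp0 n i) (bondJet ε f ω w (.inl ())) := by
  obtain ⟨K, hK⟩ := exists_isProfile_bondProfile hf
  obtain ⟨M, hM⟩ := hJ.bounded
  have hd1 : 1 ≤ d := by omega
  have hd' : (1 / 2 : ℝ) < d := by
    have : (1 : ℝ) ≤ d := by exact_mod_cast hd1
    linarith
  have hdirm : Measurable (bondDir : E d → E d) := measurable_norm.inv.smul measurable_id
  have hdi : Measurable fun ξ : E d => bondDir ξ i :=
    (EuclideanSpace.proj (𝕜 := ℝ) i).continuous.measurable.comp hdirm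
  have hm := measurable_forceDens hD hJ hf hω.continuous w (ε := ε)
  have key : ∀ φ, IsTest D φ → Integrable (Function.uncurry fun x ξ : E d =>
      2 / volume.real (Metric.ball (0 : E d) 1) *
        (forceDens ε J f ω w x ξ * bondDir ξ i) * φ x)
      (volume.prod (volume.restrict (Metric.ball (0 : E d) 1))) := fun φ hφ => by
    have hφi : Integrable φ volume := hφ.1.continuous.integrable_of_hasCompactSupport hφ.2.1
    refine Integrable.mono' (hφi.norm.mul_prod ((integrableOn_norm_rpow hd1 hd' (R := 1)).const_mul
      (2 / volume.real (Metric.ball (0 : E d) 1) * (M * ε ^ (-(1 / 2) : ℝ) / ε * K)))) ?_ ?_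
    · exact (((hm.mul (hdi.comp measurable_snd)).const_mul _).mul
        (hφ.1.continuous.measurable.comp measurable_fst)).aestronglyMeasurable
    · have h2 : ∀ᵐ p : E d × E d ∂(volume.prod (volume.restrict (Metric.ball (0 : E d) 1))),
          p.2 ∈ Metric.ball (0 : E d) 1 :=
        Measure.quasiMeasurePreserving_snd.ae (ae_restrict_mem measurableSet_ball)
      filter_upwards [h2] with p hp
      have h1 := abs_forceDens_le hε hM hK hω.nonneg hω.le_one w p.1 (mem_ball_zero_iff.1 hp)
      have h3 := abs_apply_le_one (norm_bondDir_le p.2) i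
      have h4 : |forceDens ε J f ω w p.1 p.2| * |bondDir p.2 i| ≤ _ :=
        (mul_le_of_le_one_right (abs_nonneg _) h3).trans h1
      simp only [Function.uncurry, norm_mul, Real.norm_eq_abs]
      rw [abs_of_nonneg (show (0 : ℝ) ≤ 2 / volume.real (Metric.ball (0 : E d) 1) by positivity)]
      calc _ ≤ 2 / volume.real (Metric.ball (0 : E d) 1) *
            (M * ε ^ (-(1 / 2) : ℝ) / ε * K * ‖p.2‖ ^ (-(1 / 2) : ℝ)) * |φ p.1| := by gcongr
        _ = _ := by ring
  have e1 : ∀ φ, IsTest D φ → ∀ ξ,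
      ∫ x, 2 / volume.real (Metric.ball (0 : E d) 1) *
        (forceDens ε J f ω w x ξ * bondDir ξ i) * φ x =
      bondCoeff ε J i ξ * ∫ x, bondJet ε f ω w (.inl ()) ξ x * φ x := fun φ hφ ξ => by
    rw [← integral_const_mul]
    congr 1
    funext x
    by_cases hx : x ∈ D
    · simp only [bondCoeff, bondJet, slice, jet0, forceDens, indicator_of_mem hx]
      ring
    · rw [hφ.eq_zero hx]
      simp
  refine ⟨fun ξ hξ h0 => memLp_bondJet hd hDb hD hε hε1 hf hω w _ hξ
    (ne_zero_of_bondCoeff_ne_zero h0), (W.lpBd_c0 hD n i).memLp, fun φ hφ => ?_, fun φ hφ => ?_⟩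
  · have := (key φ hφ).integral_prod_right
    simp only [Function.uncurry, e1 φ hφ] at this
    exact this
  · have h1 := integral_integral_swap (key φ hφ)
    simp only [e1 φ hφ] at h1
    rw [← h1]
    refine integral_congr_ae ?_
    have hn' := (ae_restrict_iff' hD.measurableSet).1 hn
    filter_upwards [hn'] with x hx
    by_cases hxD : x ∈ D
    · rw [integral_mul_const, integral_const_mul, ← force_apply hd1 hD hε hJ hf hω.continuous
        hω.nonneg hω.le_one, ← hx hxD, W.toFun_apply]
    · simp [hφ.eq_zero hxD]

/-- Since n is an element of W it has weak derivatives of both orders, and these are identified from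
order zero by two applications of `IsBondIntegral.weakD`. That the force belongs to W is an
assumption here, not a conclusion. -/
theorem isBondIntegral_compJet (hd : d = 2 ∨ d = 3) (hDb : Bornology.IsBounded D) (hD : IsOpen D)
    {ε C₁ C₂ : ℝ} (hε : 0 < ε) (hε1 : ε < 1) {J f : ℝ → ℝ} (hJ : IsInfluenceFunction J)
    (hf : IsBondFunction f) {ω : E d → ℝ} (hω : IsBoundaryFunction D ε C₁ C₂ ω) {w n : W D}
    (hn : IsForce ε J f ω w n) (i : Fin d) (α : JetIndex d) :
    IsBondIntegral D (bondCoeff ε J i) (compJet n i α) (bondJet ε f ω w α) := by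
  obtain ⟨K, hK⟩ := exists_isProfile_bondProfile hf
  have hm := fun (α : JetIndex d) (ξ : E d) (hξ : ξ ∈ Metric.ball (0 : E d) 1)
    (h0 : bondCoeff ε J i ξ ≠ 0) => memLp_bondJet hd hDb hD hε hε1 hf hω w α hξ
      (ne_zero_of_bondCoeff_ne_zero h0)
  have hs : ∀ ξ ∈ Metric.ball (0 : E d) 1, bondCoeff ε J i ξ ≠ 0 →
      IsProfile (scaleProfile (bondProfile f) ‖ε • ξ‖) _ := fun ξ hξ h0 =>
    hK.scale (norm_pos_iff.2 (smul_ne_zero hε.ne' (ne_zero_of_bondCoeff_ne_zero h0)))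
      (norm_smul_le_one hε hε1 hξ)
  have hw := fun (ξ : E d) (hξ : ξ ∈ Metric.ball (0 : E d) 1) =>
    hω.isWeight hD (mem_ball_zero_iff.1 hξ)
  have h0 := isBondIntegral_comp0 hd hDb hD hε hε1 hJ hf hω hn i
  have h1 : ∀ j, IsBondIntegral D (bondCoeff ε J i) (comp1 n i j)
      (bondJet ε f ω w (.inr (.inl j))) := fun j =>
    h0.weakD (W.weakD_c0 hD n i j) (memLp_compJet hD n i (.inr (.inl j))) (hm _) fun ξ hξ h =>
      weakD_jet0 hDb hD (norm_bondDir_le ξ) (hw ξ hξ) (hs ξ hξ h) j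
  rcases α with _ | j | ⟨j, k⟩
  · exact h0
  · exact h1 j
  · exact (h1 j).weakD (W.weakD_c1 hD n i j k) (memLp_compJet hD n i (.inr (.inr (j, k)))) (hm _)
      fun ξ hξ h => weakD_jet1 hd hDb hD (norm_bondDir_le ξ) (by positivity) (hw ξ hξ)
        (hs ξ hξ h) j k

end Peridynamics

end

/-! ### Lipschitz and growth estimates for the force in W -/

noncomputable section

open scoped ENNReal NNReal

namespace Peridynamics

variable {d : ℕ} {D : Set (E d)}

/-! ### Estimates for the force -/

theorem compJet_sub (hD : IsOpen D) (w w' : W D) (i : Fin d) (α : JetIndex d) :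
    compJet (w - w') i α =ᵐ[volume] fun x => compJet w i α x - compJet w' i α x := by
  rcases α with _ | j | ⟨j, k⟩
  exacts [W.c0_sub hD w w' i, W.c1_sub hD w w' i j, W.c2_sub hD w w' i j k]

theorem compJet_smul (hD : IsOpen D) (c : ℝ) (w : W D) (i : Fin d) (α : JetIndex d) :
    compJet (c • w) i α =ᵐ[volume] fun x => c * compJet w i α x := by
  rcases α with _ | j | ⟨j, k⟩
  exacts [W.c0_smul hD c w i, W.c1_smul hD c w i j, W.c2_smul hD c w i j k]

theorem abs_bondCoeff_le {ε : ℝ} (hε : 0 < ε) {J : ℝ → ℝ} {M : ℝ}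
    (hM : ∀ r, 0 ≤ r → r < 1 → 0 ≤ J r ∧ J r ≤ M) (i : Fin d) {ξ : E d}
    (hξ : ξ ∈ Metric.ball (0 : E d) 1) :
    |bondCoeff ε J i ξ| ≤ 2 / volume.real (Metric.ball (0 : E d) 1) * M *
      (‖ε • ξ‖ ^ (-(1 / 2) : ℝ) / ε) := by
  have h1 := abs_bondKernel_le hε hM (mem_ball_zero_iff.1 hξ)
  have h2 := abs_apply_le_one (norm_bondDir_le ξ) i
  rw [bondCoeff, abs_mul, abs_mul,
    abs_of_nonneg (show (0 : ℝ) ≤ 2 / volume.real (Metric.ball (0 : E d) 1) by positivity)]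
  have h0 := (abs_nonneg _).trans h1
  calc _ ≤ 2 / volume.real (Metric.ball (0 : E d) 1) *
        (M * ‖ε • ξ‖ ^ (-(1 / 2) : ℝ) / ε * 1) := by gcongr
    _ = _ := by ring

/-- The integral of the singularity of the bonds over a ball. -/
def singularMass (d : ℕ) (ρ : ℝ) : ℝ := ∫ ξ in Metric.ball (0 : E d) ρ, ‖ξ‖ ^ (-(7 / 4) : ℝ)

theorem singularMass_nonneg (d : ℕ) (ρ : ℝ) : 0 ≤ singularMass d ρ :=
  integral_nonneg fun ξ => by positivity

theorem integrableOn_singular (hd : 2 ≤ d) (ρ : ℝ) :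
    IntegrableOn (fun ξ : E d => ‖ξ‖ ^ (-(7 / 4) : ℝ)) (Metric.ball 0 ρ) := by
  have hd' : (2 : ℝ) ≤ d := by exact_mod_cast hd
  exact integrableOn_norm_rpow (by omega) (by linarith)

/-- Scaling gives the factor (q⁴)^d q^{-7} = q^{4d-7}, at most q for d ≥ 2. The radius q⁴ keeps the
exponents integral. -/
theorem singularMass_le (hd : 2 ≤ d) {q : ℝ} (hq : 0 < q) (hq1 : q ≤ 1) :
    singularMass d (q ^ 4) ≤ q * singularMass d 1 := by
  have h1 : singularMass d (q ^ 4) = (q ^ 4) ^ d * ((q ^ 4) ^ (-(7 / 4) : ℝ) * singularMass d 1) := by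
    rw [singularMass, setIntegral_ball_eq (by positivity), singularMass, ← integral_const_mul,
      smul_eq_mul]
    congr 1
    refine integral_congr_ae (.of_forall fun ξ => ?_)
    simp only [zero_add]
    rw [norm_smul, Real.norm_of_nonneg (by positivity), Real.mul_rpow (by positivity) (norm_nonneg _)]
  have h2 : (q ^ 4) ^ (-(7 / 4) : ℝ) = (q ^ 7)⁻¹ := by
    rw [← Real.rpow_natCast q 4, ← Real.rpow_mul hq.le, ← Real.rpow_natCast q 7, ← Real.rpow_neg hq.le]
    norm_num
  rw [h1, h2, ← mul_assoc]
  refine mul_le_mul_of_nonneg_right ?_ (singularMass_nonneg d 1)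
  rw [← div_eq_mul_inv, div_le_iff₀ (by positivity), ← pow_mul, ← pow_succ']
  exact pow_le_pow_of_le_one hq.le hq1 (by omega)

/-- The coefficient r^{-1/2}/ε times r^{-5/4} is ε^{-11/4} |ξ|^{-7/4}. Splitting at |ξ| = ρ lets
short bonds use a singular bound over a small mass and long bonds a uniformly small one; in the
latter η is enlarged to η r^{-5/4}, as r ≤ 1. -/
theorem norm_le_of_isBondIntegral (hd : 2 ≤ d) (hD : IsOpen D) {ε : ℝ} (hε : 0 < ε) (hε1 : ε < 1)
    {J : ℝ → ℝ} {M : ℝ} (hM : ∀ r, 0 ≤ r → r < 1 → 0 ≤ J r ∧ J r ≤ M) {m : W D}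
    {s : JetIndex d → E d → E d → ℝ}
    (hm : ∀ i α, IsBondIntegral D (bondCoeff ε J i) (compJet m i α) (s α)) {ρ L η : ℝ}
    (hρ : ρ ≤ 1) (hL : 0 ≤ L) (hη : 0 ≤ η)
    (hs : ∀ α, ∀ ξ ∈ Metric.ball (0 : E d) 1, ξ ≠ 0 → ‖ξ‖ < ρ →
      LpBd volume 2 (s α ξ) (L * ‖ε • ξ‖ ^ (-(5 / 4) : ℝ)))
    (hs' : ∀ α, ∀ ξ ∈ Metric.ball (0 : E d) 1, ξ ≠ 0 → ρ ≤ ‖ξ‖ → LpBd volume 2 (s α ξ) η) :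
    ‖m‖ ≤ ((d : ℝ) + d ^ 2 + d ^ 3) * (2 / volume.real (Metric.ball (0 : E d) 1) * M / ε ^ 3 *
      (L * singularMass d ρ + η * singularMass d 1)) := by
  have hM0 : 0 ≤ M := (hM 0 le_rfl one_pos).1.trans (hM 0 le_rfl one_pos).2
  set A := 2 / volume.real (Metric.ball (0 : E d) 1) * M with hA
  have hA0 : 0 ≤ A := by positivity
  have hint := integrableOn_singular hd 1
  set b : E d → ℝ := fun ξ => A / ε ^ 3 * ((Metric.ball (0 : E d) ρ).indicator
    (fun ξ => L * ‖ξ‖ ^ (-(7 / 4) : ℝ)) ξ + η * ‖ξ‖ ^ (-(7 / 4) : ℝ)) with hb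
  have hi1 : IntegrableOn ((Metric.ball (0 : E d) ρ).indicator
      fun ξ => L * ‖ξ‖ ^ (-(7 / 4) : ℝ)) (Metric.ball (0 : E d) 1) :=
    (hint.const_mul L).indicator measurableSet_ball
  have hi2 : IntegrableOn (fun ξ : E d => η * ‖ξ‖ ^ (-(7 / 4) : ℝ)) (Metric.ball (0 : E d) 1) :=
    hint.const_mul η
  have hbi : IntegrableOn b (Metric.ball (0 : E d) 1) := (hi1.add hi2).const_mul _
  have hbI : ∫ ξ in Metric.ball (0 : E d) 1, b ξ =
      A / ε ^ 3 * (L * singularMass d ρ + η * singularMass d 1) := by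
    rw [hb, integral_const_mul, integral_add hi1 hi2, integral_const_mul,
      setIntegral_indicator measurableSet_ball,
      inter_eq_right.2 (Metric.ball_subset_ball hρ), integral_const_mul, singularMass, singularMass]
  have hb0 : ∀ ξ, 0 ≤ b ξ := fun ξ => mul_nonneg (by positivity) (add_nonneg
    (indicator_nonneg (fun ξ _ => by positivity) ξ) (by positivity))
  have hκ : ∀ i, ∀ ξ ∈ Metric.ball (0 : E d) 1, ξ ≠ 0 → 1 ≤ ‖ε • ξ‖ ^ (-(5 / 4) : ℝ) ∧
      |bondCoeff ε J i ξ| * ‖ε • ξ‖ ^ (-(5 / 4) : ℝ) ≤ A / ε ^ 3 * ‖ξ‖ ^ (-(7 / 4) : ℝ) := by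
    intro i ξ hξ h0
    have hp : 0 < ‖ε • ξ‖ := norm_pos_iff.2 (smul_ne_zero hε.ne' h0)
    refine ⟨Real.one_le_rpow_of_pos_of_le_one_of_nonpos hp (norm_smul_le_one hε hε1 hξ)
      (by norm_num), ?_⟩
    refine (mul_le_mul_of_nonneg_right (abs_bondCoeff_le hε hM i hξ) (by positivity)).trans ?_
    rw [← hA]
    have e1 : ‖ε • ξ‖ ^ (-(1 / 2) : ℝ) * ‖ε • ξ‖ ^ (-(5 / 4) : ℝ) =
        ε ^ (-(7 / 4) : ℝ) * ‖ξ‖ ^ (-(7 / 4) : ℝ) := by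
      rw [← Real.rpow_add hp, norm_smul, Real.norm_of_nonneg hε.le,
        ← Real.mul_rpow hε.le (norm_nonneg _)]
      norm_num
    -- Here ε^{-11/4} is rounded up to ε^{-3}.
    have e2 : ε ^ (-(7 / 4) : ℝ) ≤ (ε ^ 2)⁻¹ := by
      rw [← Real.rpow_natCast, ← Real.rpow_neg hε.le]
      exact Real.rpow_le_rpow_of_exponent_ge hε hε1.le (by norm_num)
    calc A * (‖ε • ξ‖ ^ (-(1 / 2) : ℝ) / ε) * ‖ε • ξ‖ ^ (-(5 / 4) : ℝ)
        = A / ε * (‖ε • ξ‖ ^ (-(1 / 2) : ℝ) * ‖ε • ξ‖ ^ (-(5 / 4) : ℝ)) := by ring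
      _ = A / ε * ‖ξ‖ ^ (-(7 / 4) : ℝ) * ε ^ (-(7 / 4) : ℝ) := by rw [e1]; ring
      _ ≤ A / ε * ‖ξ‖ ^ (-(7 / 4) : ℝ) * (ε ^ 2)⁻¹ := by gcongr
      _ = _ := by field_simp
  have key : ∀ i α, LpBd volume 2 (compJet m i α) (∫ ξ in Metric.ball (0 : E d) 1, b ξ) := by
    intro i α
    refine (hm i α).lpBd hD (fun x hx => compJet_eq_zero α hx)
      (b' := fun ξ => if ‖ξ‖ < ρ then L * ‖ε • ξ‖ ^ (-(5 / 4) : ℝ) else η)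
      (fun ξ hξ h0 => ?_) hb0 hbi
    have hξ0 := ne_zero_of_bondCoeff_ne_zero h0
    obtain ⟨k1, k2⟩ := hκ i ξ hξ hξ0
    by_cases hr : ‖ξ‖ < ρ
    · simp only [if_pos hr]
      refine ⟨by positivity, hs α ξ hξ hξ0 hr, ?_⟩
      rw [hb]
      simp only [indicator_of_mem (mem_ball_zero_iff.2 hr)]
      calc _ = L * (|bondCoeff ε J i ξ| * ‖ε • ξ‖ ^ (-(5 / 4) : ℝ)) := by ring
        _ ≤ L * (A / ε ^ 3 * ‖ξ‖ ^ (-(7 / 4) : ℝ)) := by gcongr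
        _ ≤ L * (A / ε ^ 3 * ‖ξ‖ ^ (-(7 / 4) : ℝ)) + A / ε ^ 3 * (η * ‖ξ‖ ^ (-(7 / 4) : ℝ)) :=
            le_add_of_nonneg_right (by positivity)
        _ = _ := by ring
    · simp only [if_neg hr]
      refine ⟨hη, hs' α ξ hξ hξ0 (not_lt.1 hr), ?_⟩
      rw [hb]
      simp only [indicator_of_notMem (fun h => hr (mem_ball_zero_iff.1 h))]
      calc |bondCoeff ε J i ξ| * η = |bondCoeff ε J i ξ| * 1 * η := by ring
        _ ≤ |bondCoeff ε J i ξ| * ‖ε • ξ‖ ^ (-(5 / 4) : ℝ) * η := by gcongr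
        _ ≤ A / ε ^ 3 * ‖ξ‖ ^ (-(7 / 4) : ℝ) * η := by gcongr
        _ = _ := by ring
  rw [← hbI]
  exact W.norm_le hD m (integral_nonneg hb0) (fun i => key i (.inl ()))
    (fun i j => key i (.inr (.inl j))) fun i j k => key i (.inr (.inr (j, k)))

/-- Integration of the estimate for single bonds, with ρ = 1 so that every bond counts as short. The
constant is chosen before ε, ω and M. -/
theorem exists_force_lipschitz (hd : d = 2 ∨ d = 3) (hDb : Bornology.IsBounded D) (hD : IsOpen D)
    {J f : ℝ → ℝ} (hJ : IsInfluenceFunction J) (hf : IsBondFunction f) (C₁ C₂ : ℝ) :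
    ∃ C, 0 ≤ C ∧ ∀ {ε : ℝ}, 0 < ε → ε < 1 → ∀ {ω : E d → ℝ}, IsBoundaryFunction D ε C₁ C₂ ω →
      ∀ {w w' n n' : W D} {M : ℝ}, ‖w‖ ≤ M → ‖w'‖ ≤ M → IsForce ε J f ω w n →
      IsForce ε J f ω w' n' → ‖n - n'‖ ≤ C * (1 + M + M ^ 2) / ε ^ 3 * ‖w - w'‖ := by
  obtain ⟨K, hK⟩ := exists_isProfile_bondProfile hf
  obtain ⟨MJ, hMJ⟩ := hJ.bounded
  have hMJ0 : 0 ≤ MJ := (hMJ 0 le_rfl one_pos).1.trans (hMJ 0 le_rfl one_pos).2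
  obtain ⟨C, hC, H⟩ := exists_slice_lipschitz hd hDb hD (B := 1 + |C₁| + |C₂|) (by positivity)
    hK.nonneg
  have hI := singularMass_nonneg d 1
  refine ⟨((d : ℝ) + d ^ 2 + d ^ 3) * (2 / volume.real (Metric.ball (0 : E d) 1) * MJ) *
    singularMass d 1 * C, by positivity, ?_⟩
  intro ε hε hε1 ω hω w w' n n' M hw hw' hn hn'
  have hM := (norm_nonneg w).trans hw
  have hm : ∀ i α, IsBondIntegral D (bondCoeff ε J i) (compJet (n - n') i α)
      (fun ξ x => bondJet ε f ω w α ξ x - bondJet ε f ω w' α ξ x) := fun i α =>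
    ((isBondIntegral_compJet hd hDb hD hε hε1 hJ hf hω hn i α).sub
      (isBondIntegral_compJet hd hDb hD hε hε1 hJ hf hω hn' i α)).congr
      (compJet_sub hD n n' i α).symm
  have := norm_le_of_isBondIntegral (by omega) hD hε hε1 hMJ hm (ρ := 1)
    (L := C * (1 + M + M ^ 2) * ‖w - w'‖) (η := 0) le_rfl (by positivity) le_rfl
    (fun α ξ hξ h0 _ => H hK (smul_ne_zero hε.ne' h0) (norm_smul_le_one hε hε1 hξ)
      (norm_bondDir_le ξ) (hω.isWeight hD (mem_ball_zero_iff.1 hξ)) hw hw' α)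
    (fun α ξ hξ _ h1 => absurd (mem_ball_zero_iff.1 hξ) (not_lt.2 h1))
  refine this.trans (le_of_eq ?_)
  ring

/-- Used only to show that solutions stay bounded, so the constant may depend on ε and on the sup
bound. -/
theorem exists_force_growth (hd : d = 2 ∨ d = 3) (hDb : Bornology.IsBounded D) (hD : IsOpen D)
    {J f : ℝ → ℝ} (hJ : IsInfluenceFunction J) (hf : IsBondFunction f) {C₁ C₂ ε : ℝ}
    (hε : 0 < ε) (hε1 : ε < 1) {ω : E d → ℝ} (hω : IsBoundaryFunction D ε C₁ C₂ ω) {M₀ : ℝ}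
    (hM₀ : 0 ≤ M₀) :
    ∃ C, 0 ≤ C ∧ ∀ {w n : W D}, (∀ i, ∀ᵐ x, |comp0 w i x| ≤ M₀) → IsForce ε J f ω w n →
      ‖n‖ ≤ C * (1 + ‖w‖) := by
  obtain ⟨K, hK⟩ := exists_isProfile_bondProfile hf
  obtain ⟨MJ, hMJ⟩ := hJ.bounded
  have hMJ0 : 0 ≤ MJ := (hMJ 0 le_rfl one_pos).1.trans (hMJ 0 le_rfl one_pos).2
  obtain ⟨C, hC, H⟩ := exists_slice_growth hd hDb hD (B := 1 + |C₁| + |C₂|) (by positivity)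
    hK.nonneg hM₀
  have hI := singularMass_nonneg d 1
  refine ⟨((d : ℝ) + d ^ 2 + d ^ 3) * (2 / volume.real (Metric.ball (0 : E d) 1) * MJ / ε ^ 3) *
    singularMass d 1 * C, by positivity, fun {w n} hw hn => ?_⟩
  have := norm_le_of_isBondIntegral (by omega) hD hε hε1 hMJ
    (isBondIntegral_compJet hd hDb hD hε hε1 hJ hf hω hn) (ρ := 1)
    (L := C * (1 + ‖w‖)) (η := 0) le_rfl (by positivity) le_rfl
    (fun α ξ hξ h0 _ => H hK (smul_ne_zero hε.ne' h0) (norm_smul_le_one hε hε1 hξ)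
      (norm_bondDir_le ξ) (hω.isWeight hD (mem_ball_zero_iff.1 hξ)) hw α)
    (fun α ξ hξ _ h1 => absurd (mem_ball_zero_iff.1 hξ) (not_lt.2 h1))
  refine this.trans (le_of_eq ?_)
  ring

end Peridynamics

end

/-! ### Differentiability in time of the force -/

noncomputable section

open scoped ENNReal NNReal

namespace Peridynamics

variable {d : ℕ} {D : Set (E d)}

/-! ### Strict differentiability of the force along curves -/

section StrictDeriv

variable {F : Type*} [NormedAddCommGroup F] [NormedSpace ℝ F]

/-- The slopes based at t₀ converge by completeness. Comparing an arbitrary difference quotient near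
t₀ with them and passing to the limit gives strict differentiability, with no candidate for the
derivative. -/
theorem exists_hasStrictDerivAt_of_cauchy [CompleteSpace F] {n : ℝ → F} {t₀ : ℝ}
    (h : ∀ η > 0, ∃ δ > 0, ∀ t t' s s', |t - t₀| < δ → |t' - t₀| < δ → |s - t₀| < δ →
      |s' - t₀| < δ → t ≠ t' → s ≠ s' →
      ‖(t - t')⁻¹ • (n t - n t') - (s - s')⁻¹ • (n s - n s')‖ ≤ η) :
    ∃ n', HasStrictDerivAt n n' t₀ := by
  have hC : Cauchy (map (slope n t₀) (𝓝[≠] t₀)) := by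
    rw [Metric.cauchy_iff]
    refine ⟨inferInstance, fun η hη => ?_⟩
    obtain ⟨δ, hδ, H⟩ := h (η / 2) (by positivity)
    refine ⟨slope n t₀ '' (Metric.ball t₀ δ ∩ {t₀}ᶜ), image_mem_map
      (inter_mem (mem_nhdsWithin_of_mem_nhds (Metric.ball_mem_nhds t₀ hδ)) self_mem_nhdsWithin), ?_⟩
    rintro _ ⟨s, ⟨hs, hs'⟩, rfl⟩ _ ⟨t, ⟨ht, ht'⟩, rfl⟩
    have := H s t₀ t t₀ hs (by simpa using hδ) ht (by simpa using hδ) hs' ht'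
    rw [dist_eq_norm, slope_def_module, slope_def_module]
    linarith
  obtain ⟨n', hn'⟩ := CompleteSpace.complete hC
  refine ⟨n', ?_⟩
  rw [hasStrictDerivAt_iff_hasStrictFDerivAt, hasStrictFDerivAt_iff_isLittleO,
    Asymptotics.isLittleO_iff]
  intro η hη
  obtain ⟨δ, hδ, H⟩ := h η hη
  refine Metric.eventually_nhds_iff.2 ⟨δ, hδ, fun {p} hp => ?_⟩
  rw [Prod.dist_eq, max_lt_iff, Real.dist_eq, Real.dist_eq] at hp
  rcases eq_or_ne p.1 p.2 with he | he
  · simp [he]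
  have h1 : ‖(p.1 - p.2)⁻¹ • (n p.1 - n p.2) - n'‖ ≤ η := by
    refine le_of_tendsto ((tendsto_const_nhds.sub hn').norm) ?_
    filter_upwards [inter_mem (mem_nhdsWithin_of_mem_nhds (Metric.ball_mem_nhds t₀ hδ)) self_mem_nhdsWithin] with s hs
    rw [slope_def_module]
    exact H _ _ _ _ hp.1 hp.2 hs.1 (by simpa using hδ) he hs.2
  have h2 : p.1 - p.2 ≠ 0 := sub_ne_zero.2 he
  have h3 : n p.1 - n p.2 - (p.1 - p.2) • n' =
      (p.1 - p.2) • ((p.1 - p.2)⁻¹ • (n p.1 - n p.2) - n') := by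
    rw [smul_sub, smul_smul, mul_inv_cancel₀ h2, one_smul]
  simp only [ContinuousLinearMap.toSpanSingleton_apply]
  rw [h3, norm_smul, mul_comm]
  exact mul_le_mul_of_nonneg_right h1 (norm_nonneg _)

/-- The Lipschitz inequality divided by |t − t₀|, in the limit. It bounds the derivative of the
force without a formula for it. -/
theorem norm_deriv_le_of_lipschitz {G : Type*} [NormedAddCommGroup G] [NormedSpace ℝ G]
    {u : ℝ → F} {n : ℝ → G} {u' : F} {n' : G} {t₀ L : ℝ} (hu : HasDerivAt u u' t₀)
    (hn : HasDerivAt n n' t₀) (h : ∀ᶠ t in 𝓝 t₀, ‖n t - n t₀‖ ≤ L * ‖u t - u t₀‖) :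
    ‖n'‖ ≤ L * ‖u'‖ := by
  refine le_of_tendsto_of_tendsto (hasDerivAt_iff_tendsto_slope.1 hn).norm
    ((hasDerivAt_iff_tendsto_slope.1 hu).norm.const_mul L) ?_
  filter_upwards [nhdsWithin_le_nhds h] with t ht
  rw [slope_def_module, slope_def_module, norm_smul, norm_smul, mul_left_comm]
  exact mul_le_mul_of_nonneg_left ht (norm_nonneg _)

/-- In the strict estimate at t₀, letting s → t gives ‖n'(t) − n'(t₀)‖ ≤ η/2. -/
theorem continuousAt_of_hasStrictDerivAt {n n' : ℝ → F} {t₀ : ℝ}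
    (h : ∀ᶠ t in 𝓝 t₀, HasDerivAt n (n' t) t) (h0 : HasStrictDerivAt n (n' t₀) t₀) :
    ContinuousAt n' t₀ := by
  rw [Metric.continuousAt_iff']
  intro η hη
  obtain ⟨δ, hδ, H⟩ := exists_norm_le_of_hasStrictDerivAt h0 (half_pos hη)
  filter_upwards [h, Metric.ball_mem_nhds t₀ hδ] with t ht htδ
  rw [dist_eq_norm]
  have h1 : ‖n' t - n' t₀‖ ≤ η / 2 := by
    refine le_of_tendsto (((hasDerivAt_iff_tendsto_slope.1 ht).sub_const (n' t₀)).norm) ?_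
    filter_upwards [nhdsWithin_le_nhds (Metric.isOpen_ball.mem_nhds htδ), self_mem_nhdsWithin]
      with s hs hst
    have h2 : 0 < |s - t| := abs_pos.2 (sub_ne_zero.2 hst)
    have h3 := H s t hs htδ
    have h4 : slope n t s - n' t₀ = (s - t)⁻¹ • (n s - n t - (s - t) • n' t₀) := by
      rw [slope_def_module, smul_sub (s - t)⁻¹ (n s - n t), smul_smul (s - t)⁻¹, inv_mul_cancel₀ (sub_ne_zero.2 hst),
        one_smul]
    rw [h4, norm_smul, norm_inv, Real.norm_eq_abs, inv_mul_le_iff₀ h2, mul_comm |s - t|]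
    exact h3
  linarith

end StrictDeriv

theorem LpBd.inv_mul_sub {α : Type*} [MeasurableSpace α] {μ : Measure α} {p : ℝ≥0∞}
    {f : α → ℝ} {τ L : ℝ} (hτ : τ ≠ 0) (h : LpBd μ p f (L * |τ|)) :
    LpBd μ p (fun x => τ⁻¹ * f x) L :=
  (h.const_mul τ⁻¹).mono (le_of_eq (by
    rw [abs_inv]
    have := abs_pos.2 hτ
    field_simp))

theorem exists_forall_jetIndex {P : JetIndex d → ℝ → Prop}
    (hP : ∀ α δ δ', δ' ≤ δ → P α δ → P α δ') (h : ∀ α, ∃ δ > 0, P α δ) : ∃ δ > 0, ∀ α, P α δ := by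
  choose δ hδ hδP using h
  have : ∀ᶠ r in 𝓝[>] (0 : ℝ), ∀ α, P α r := eventually_all.2 fun α => by
    filter_upwards [Ioo_mem_nhdsGT (hδ α)] with r hr
    exact hP α _ _ hr.2.le (hδP α)
  obtain ⟨r, hr, hr0⟩ := (this.and self_mem_nhdsWithin).exists
  exact ⟨r, hr0, hr⟩

theorem exists_bondJet_slope (hd : d = 2 ∨ d = 3) (hDb : Bornology.IsBounded D) (hD : IsOpen D)
    {f : ℝ → ℝ} (hf : IsBondFunction f) {C₁ C₂ ε : ℝ} (hε : 0 < ε) (hε1 : ε < 1) {ω : E d → ℝ}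
    (hω : IsBoundaryFunction D ε C₁ C₂ ω) {u : ℝ → W D} {u' : W D} {t₀ : ℝ}
    (hu : HasStrictDerivAt u u' t₀) {ρ η : ℝ} (hρ : 0 < ρ) (hη : 0 < η) :
    ∃ δ > 0, ∀ α, ∀ ξ ∈ Metric.ball (0 : E d) 1, ρ ≤ ‖ξ‖ → ∀ t t' s s', |t - t₀| < δ →
      |t' - t₀| < δ → |s - t₀| < δ → |s' - t₀| < δ → t ≠ t' → s ≠ s' →
      LpBd volume 2 (fun x => (t - t')⁻¹ * (bondJet ε f ω (u t) α ξ x - bondJet ε f ω (u t') α ξ x) -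
        (s - s')⁻¹ * (bondJet ε f ω (u s) α ξ x - bondJet ε f ω (u s') α ξ x)) η := by
  obtain ⟨K, hK⟩ := exists_isProfile_bondProfile hf
  refine exists_forall_jetIndex (fun α δ δ' hδ h ξ hξ hr t t' s s' h1 h2 h3 h4 =>
    h ξ hξ hr t t' s s' (h1.trans_le hδ) (h2.trans_le hδ) (h3.trans_le hδ) (h4.trans_le hδ))
    fun α => ?_
  obtain ⟨f', hf'⟩ := unifStrictDeriv_slice hd hDb hD (B := 1 + |C₁| + |C₂|) (by positivity)
    (mul_pos hε hρ) hK hu α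
  obtain ⟨δ, hδ, H⟩ := hf'.strict (η / 2) (by positivity)
  refine ⟨δ, hδ, fun ξ hξ hr t t' s s' h1 h2 h3 h4 htt hss => ?_⟩
  have hb : ε * ρ ≤ ‖ε • ξ‖ := by
    rw [norm_smul, Real.norm_of_nonneg hε.le]
    gcongr
  let b : LongBond D (1 + |C₁| + |C₂|) (ε * ρ) := ⟨(ε • ξ, bondDir ξ, bondWeight ε ω ξ), hb,
    norm_smul_le_one hε hε1 hξ, norm_bondDir_le ξ, hω.isWeight hD (mem_ball_zero_iff.1 hξ)⟩
  have k1 := (H t t' h1 h2 b).inv_mul_sub (sub_ne_zero.2 htt)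
  have k2 := (H s s' h3 h4 b).inv_mul_sub (sub_ne_zero.2 hss)
  refine ((k1.sub (by norm_num) (by positivity) (by positivity) k2).congr
    (.of_forall fun x => ?_)).mono (by linarith)
  have e1 : (t - t')⁻¹ * ((t - t') * f' b x) = f' b x := inv_mul_cancel_left₀ (sub_ne_zero.2 htt) _
  have e2 : (s - s')⁻¹ * ((s - s') * f' b x) = f' b x := inv_mul_cancel_left₀ (sub_ne_zero.2 hss) _
  change (t - t')⁻¹ * (bondJet ε f ω (u t) α ξ x - bondJet ε f ω (u t') α ξ x -
      (t - t') * f' b x) - (s - s')⁻¹ * (bondJet ε f ω (u s) α ξ x - bondJet ε f ω (u s') α ξ x -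
      (s - s') * f' b x) = _
  rw [mul_sub (t - t')⁻¹ _ ((t - t') * f' b x), e1, mul_sub (s - s')⁻¹ _ ((s - s') * f' b x), e2]
  ring

theorem isBondIntegral_slope (hd : d = 2 ∨ d = 3) (hDb : Bornology.IsBounded D)
    (hD : IsOpen D) {J f : ℝ → ℝ} (hJ : IsInfluenceFunction J) (hf : IsBondFunction f)
    {C₁ C₂ ε : ℝ} (hε : 0 < ε) (hε1 : ε < 1) {ω : E d → ℝ} (hω : IsBoundaryFunction D ε C₁ C₂ ω)
    {w w' n n' : W D} (hn : IsForce ε J f ω w n) (hn' : IsForce ε J f ω w' n') (c : ℝ) (i : Fin d)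
    (α : JetIndex d) :
    IsBondIntegral D (bondCoeff ε J i) (compJet (c • (n - n')) i α)
      (fun ξ x => c * (bondJet ε f ω w α ξ x - bondJet ε f ω w' α ξ x)) := by
  have h1 := (isBondIntegral_compJet hd hDb hD hε hε1 hJ hf hω hn i α).sub
    (isBondIntegral_compJet hd hDb hD hε hε1 hJ hf hω hn' i α)
  refine (h1.const_mul c).congr ?_
  filter_upwards [compJet_smul hD c (n - n') i α, compJet_sub hD n n' i α] with x hx hx'
  rw [hx, hx']

/-- Two difference quotients are compared. On short bonds both obey the Lipschitz bound, with
constant L after division by the time step, and the singular mass is small; on long bonds they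
differ little by uniform strict differentiability. The short bonds have to be split off because the
scaling r^{-1/2} is unbounded there. -/
theorem exists_hasStrictDerivAt_force (hd : d = 2 ∨ d = 3) (hDb : Bornology.IsBounded D)
    (hD : IsOpen D) {J f : ℝ → ℝ} (hJ : IsInfluenceFunction J) (hf : IsBondFunction f)
    {C₁ C₂ ε : ℝ} (hε : 0 < ε) (hε1 : ε < 1) {ω : E d → ℝ} (hω : IsBoundaryFunction D ε C₁ C₂ ω)
    {u n : ℝ → W D} {u' : W D} {t₀ : ℝ} (hu : HasStrictDerivAt u u' t₀)
    (hn : ∀ᶠ t in 𝓝 t₀, IsForce ε J f ω (u t) (n t)) : ∃ n', HasStrictDerivAt n n' t₀ := by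
  obtain ⟨K, hK⟩ := exists_isProfile_bondProfile hf
  obtain ⟨MJ, hMJ⟩ := hJ.bounded
  have hMJ0 : 0 ≤ MJ := (hMJ 0 le_rfl one_pos).1.trans (hMJ 0 le_rfl one_pos).2
  have hd2 : 2 ≤ d := by omega
  obtain ⟨C, hC, H⟩ := exists_slice_lipschitz hd hDb hD (B := 1 + |C₁| + |C₂|) (by positivity)
    hK.nonneg
  obtain ⟨δ₀, hδ₀, H₀⟩ := Metric.eventually_nhds_iff.1 hn
  obtain ⟨δ₁, hδ₁, H₁⟩ := exists_norm_le_of_hasStrictDerivAt hu one_pos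
  obtain ⟨Λ, hΛ⟩ : ∃ Λ, Λ = 1 + ‖u'‖ := ⟨_, rfl⟩
  have hΛ0 : 0 ≤ Λ := by rw [hΛ]; positivity
  have hlip : ∀ t t', |t - t₀| < δ₁ → |t' - t₀| < δ₁ → ‖u t - u t'‖ ≤ Λ * |t - t'| := by
    intro t t' ht ht'
    have h1 := norm_add_le (u t - u t' - (t - t') • u') ((t - t') • u')
    rw [sub_add_cancel, norm_smul, Real.norm_eq_abs] at h1
    have h2 := H₁ t t' ht ht'
    rw [hΛ]
    linarith
  obtain ⟨M, hM⟩ : ∃ M, ∀ t, |t - t₀| < δ₁ → ‖u t‖ ≤ M := by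
    refine ⟨Λ * δ₁ + ‖u t₀‖, fun t ht => ?_⟩
    have h1 := hlip t t₀ ht (by simpa using hδ₁)
    have h2 := norm_add_le (u t - u t₀) (u t₀)
    rw [sub_add_cancel] at h2
    have h3 : Λ * |t - t₀| ≤ Λ * δ₁ := mul_le_mul_of_nonneg_left ht.le (by positivity)
    linarith
  have hM0 : 0 ≤ M := (norm_nonneg _).trans (hM t₀ (by simpa using hδ₁))
  have hI := singularMass_nonneg d 1
  obtain ⟨A, hA⟩ : ∃ A, A = ((d : ℝ) + d ^ 2 + d ^ 3) *
    (2 / volume.real (Metric.ball (0 : E d) 1) * MJ / ε ^ 3) := ⟨_, rfl⟩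
  have hA0 : 0 ≤ A := by rw [hA]; positivity
  obtain ⟨L, hL⟩ : ∃ L, L = C * (1 + M + M ^ 2) * Λ := ⟨_, rfl⟩
  have hL0 : 0 ≤ L := by rw [hL]; positivity
  refine exists_hasStrictDerivAt_of_cauchy fun η hη => ?_
  obtain ⟨I, hIdef⟩ : ∃ I, I = singularMass d 1 := ⟨_, rfl⟩
  rw [← hIdef] at hI
  -- Bonds with |ξ| < q⁴ have mass at most q I, and the difference of two quotients costs 2L; q
  -- makes their share at most η/2.
  obtain ⟨q, hq0, hq1, hqη⟩ : ∃ q : ℝ, 0 < q ∧ q ≤ 1 ∧ A * (2 * L * (q * I)) ≤ η / 2 := by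
    refine ⟨min 1 (η / (4 * (A * L * I + 1))), by positivity, min_le_left _ _, ?_⟩
    have h1 : min 1 (η / (4 * (A * L * I + 1))) * (4 * (A * L * I + 1)) ≤ η := by
      rw [← le_div_iff₀ (by positivity)]
      exact min_le_right _ _
    have h2 : 0 < min 1 (η / (4 * (A * L * I + 1))) := by positivity
    linarith
  obtain ⟨δ₂, hδ₂, H₂⟩ := exists_bondJet_slope hd hDb hD hf hε hε1 hω hu
    (pow_pos hq0 4) (show 0 < η / (2 * (A * I + 1)) by positivity)
  have hshort : ∀ t t', |t - t₀| < δ₁ → |t' - t₀| < δ₁ → t ≠ t' → ∀ α,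
      ∀ ξ ∈ Metric.ball (0 : E d) 1, ξ ≠ 0 →
      LpBd volume 2 (fun x => (t - t')⁻¹ * (bondJet ε f ω (u t) α ξ x - bondJet ε f ω (u t') α ξ x))
        (L * ‖ε • ξ‖ ^ (-(5 / 4) : ℝ)) := by
    intro t t' ht ht' htt α ξ hξ h0
    have h1 := H hK (smul_ne_zero hε.ne' h0) (norm_smul_le_one hε hε1 hξ)
      (norm_bondDir_le ξ) (hω.isWeight hD (mem_ball_zero_iff.1 hξ)) (hM t ht) (hM t' ht') α
    refine LpBd.inv_mul_sub (sub_ne_zero.2 htt) (h1.mono ?_)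
    calc _ ≤ C * (1 + M + M ^ 2) * (Λ * |t - t'|) * ‖ε • ξ‖ ^ (-(5 / 4) : ℝ) := by
          gcongr
          exact hlip t t' ht ht'
      _ = _ := by rw [hL]; ring
  refine ⟨min δ₀ (min δ₁ δ₂), by positivity, fun t t' s s' ht ht' hs hs' htt hss => ?_⟩
  simp only [lt_min_iff] at ht ht' hs hs'
  have hbond : ∀ i α, IsBondIntegral D (bondCoeff ε J i)
      (compJet ((t - t')⁻¹ • (n t - n t') - (s - s')⁻¹ • (n s - n s')) i α) _ := fun i α =>
    ((isBondIntegral_slope hd hDb hD hJ hf hε hε1 hω (H₀ ht.1) (H₀ ht'.1) (t - t')⁻¹ i α).sub (isBondIntegral_slope hd hDb hD hJ hf hε hε1 hω (H₀ hs.1)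
        (H₀ hs'.1) (s - s')⁻¹ i α)).congr
      (compJet_sub hD _ _ i α).symm
  have key := norm_le_of_isBondIntegral hd2 hD hε hε1 hMJ hbond
    (ρ := q ^ 4) (L := 2 * L) (η := η / (2 * (A * I + 1))) (pow_le_one₀ hq0.le hq1)
    (by positivity) (by positivity)
    (fun α ξ hξ h0 _ => ((hshort t t' ht.2.1 ht'.2.1 htt α ξ hξ h0).sub (by norm_num)
      (by positivity) (by positivity) (hshort s s' hs.2.1 hs'.2.1 hss α ξ hξ h0)).mono
      (le_of_eq (by ring)))
    (fun α ξ hξ _ hr => H₂ α ξ hξ hr t t' s s' ht.2.2 ht'.2.2 hs.2.2 hs'.2.2 htt hss)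
  refine key.trans ?_
  have h1 := singularMass_le hd2 hq0 hq1
  rw [← hIdef] at h1 ⊢
  have h2 : A * (η / (2 * (A * I + 1)) * I) ≤ η / 2 := by
    rw [div_mul_eq_mul_div, mul_div_assoc', div_le_div_iff₀ (by positivity) (by positivity)]
    linarith
  calc _ = A * (2 * L * singularMass d (q ^ 4)) + A * (η / (2 * (A * I + 1)) * I) := by
        rw [hA]; ring
    _ ≤ A * (2 * L * (q * I)) + η / 2 := by gcongr
    _ ≤ η := by linarith

end Peridynamics

end

/-! ### A priori bounds on the whole time interval -/

noncomputable section

open scoped ENNReal NNReal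

namespace Peridynamics

variable {d : ℕ} {D : Set (E d)}

/-! ### Boundedness of solutions -/

/-- The bound is independent of w, because the profile is bounded and the coefficient r^{-1/2} is
integrable over bonds. -/
theorem exists_force_sup_bound (hd : 1 ≤ d) (hD : IsOpen D) {J f : ℝ → ℝ}
    (hJ : IsInfluenceFunction J) (hf : IsBondFunction f) {C₁ C₂ ε : ℝ} (hε : 0 < ε)
    {ω : E d → ℝ} (hω : IsBoundaryFunction D ε C₁ C₂ ω) :
    ∃ C, 0 ≤ C ∧ ∀ (w : W D) x i, |force ε J f ω (W.toFun w) x i| ≤ C := by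
  obtain ⟨K, hK⟩ := exists_isProfile_bondProfile hf
  obtain ⟨M, hM⟩ := hJ.bounded
  have hd' : (1 / 2 : ℝ) < d := by
    have : (1 : ℝ) ≤ d := by exact_mod_cast hd
    linarith
  have key : ∀ (w : W D) x i, |force ε J f ω (W.toFun w) x i| ≤
      2 / volume.real (Metric.ball (0 : E d) 1) * ∫ ξ in Metric.ball (0 : E d) 1,
        M * ε ^ (-(1 / 2) : ℝ) / ε * K * ‖ξ‖ ^ (-(1 / 2) : ℝ) := by
    intro w x i
    rw [force_apply hd hD hε hJ hf hω.continuous hω.nonneg hω.le_one, abs_mul,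
      abs_of_nonneg (show (0 : ℝ) ≤ 2 / volume.real (Metric.ball (0 : E d) 1) by positivity)]
    refine mul_le_mul_of_nonneg_left ?_ (by positivity)
    rw [← Real.norm_eq_abs]
    refine norm_integral_le_of_norm_le ((integrableOn_norm_rpow hd hd' (R := 1)).const_mul _) ?_
    filter_upwards [ae_restrict_mem measurableSet_ball] with ξ hξ
    rw [Real.norm_eq_abs, abs_mul]
    exact (mul_le_of_le_one_right (abs_nonneg _) (abs_apply_le_one (norm_bondDir_le ξ) i)).trans
      (abs_forceDens_le hε hM hK hω.nonneg hω.le_one w x (mem_ball_zero_iff.1 hξ))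
  exact ⟨_, (abs_nonneg _).trans (key 0 0 ⟨0, hd⟩), key⟩

theorem W.c0_add (hD : IsOpen D) (w w' : W D) (i : Fin d) :
    comp0 (w + w') i =ᵐ[volume] fun x => comp0 w i x + comp0 w' i x := by
  have h : w + w' = w - (-1 : ℝ) • w' := by rw [neg_one_smul, sub_neg_eq_add]
  rw [h]
  filter_upwards [W.c0_sub hD w ((-1 : ℝ) • w') i, W.c0_smul hD (-1) w' i] with x h1 h2
  rw [h1, h2]
  ring

/-- Sup norm bounds are preserved in the mean value theorem. -/
theorem W.sup_bound_of_hasDerivAt (hd : d = 2 ∨ d = 3) (hDb : Bornology.IsBounded D)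
    (hD : IsOpen D) {y y' : ℝ → W D} {T A B : ℝ} (hA : 0 ≤ A) (hB : 0 ≤ B) (hT : 0 < T)
    (hy : ∀ t ∈ Ioo (-T) T, HasDerivAt y (y' t) t)
    (hA' : ∀ t ∈ Ioo (-T) T, ∀ i, ∀ᵐ x, |comp0 (y' t) i x| ≤ A)
    (hB' : ∀ i, ∀ᵐ x, |comp0 (y 0) i x| ≤ B) :
    ∀ t ∈ Ioo (-T) T, ∀ i, ∀ᵐ x, |comp0 (y t) i x| ≤ B + A * T := by
  obtain ⟨C, hC, h⟩ := W.exists_sup_bound hd hDb hD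
  have hm : ∀ (w : W D) i {B : ℝ}, (∀ᵐ x, |comp0 w i x| ≤ B) → LpBd volume ⊤ (comp0 w i) B :=
    fun w i B hw => LpBd.of_ae_bound (W.stronglyMeasurable_c0 hD w i).aestronglyMeasurable hw
  intro t ht i
  have hmem : ∀ w : W D, MemLp (comp0 w i) ⊤ volume := fun w => (hm w i (h w i)).memLp
  have hnorm : ∀ (w : W D) {B : ℝ}, 0 ≤ B → (∀ᵐ x, |comp0 w i x| ≤ B) →
      ‖(hmem w).toLp‖ ≤ B := fun w B hB hw => by
    rw [Lp.norm_toLp]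
    exact ENNReal.toReal_le_of_le_ofReal hB (hm w i hw).2
  -- The embedding into L∞ is a continuous linear map, so it carries derivatives in W to derivatives
  -- in L∞, where the mean value inequality is applied.
  let Λ : W D →L[ℝ] Lp ℝ ⊤ (volume : Measure (E d)) := LinearMap.mkContinuous
    { toFun := fun w => (hmem w).toLp
      map_add' := fun w w' => by
        rw [← MemLp.toLp_add]
        exact MemLp.toLp_congr _ _ (W.c0_add hD w w' i)
      map_smul' := fun c w => by
        rw [RingHom.id_apply, ← MemLp.toLp_const_smul]
        exact MemLp.toLp_congr _ _ (W.c0_smul hD c w i) } C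
    fun w => hnorm w (by positivity) (h w i)
  have h0 : (0 : ℝ) ∈ Ioo (-T) T := ⟨by linarith, hT⟩
  have h1 : ‖Λ (y t) - Λ (y 0)‖ ≤ A * ‖t - 0‖ :=
    (convex_Ioo (-T) T).norm_image_sub_le_of_norm_hasDerivWithin_le
      (f := fun t => Λ (y t)) (f' := fun t => Λ (y' t))
      (fun s hs => (Λ.hasFDerivAt.comp_hasDerivAt s (hy s hs)).hasDerivWithinAt)
      (fun s hs => hnorm _ hA (hA' s hs i)) h0 ht
  have h2 : ‖Λ (y 0)‖ ≤ B := hnorm _ hB (hB' i)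
  have h3 : ‖Λ (y t)‖ ≤ B + A * T := by
    have h4 := norm_add_le (Λ (y t) - Λ (y 0)) (Λ (y 0))
    rw [sub_add_cancel] at h4
    rw [sub_zero, Real.norm_eq_abs] at h1
    have h5 : A * |t| ≤ A * T := mul_le_mul_of_nonneg_left (abs_le.2 ⟨ht.1.le, ht.2.le⟩) hA
    linarith
  have h6 : LpBd volume ⊤ (comp0 (y t) i) (B + A * T) := by
    refine ⟨(hmem _).1, ?_⟩
    have h7 : (eLpNorm (comp0 (y t) i) ⊤ volume).toReal ≤ B + A * T := by
      rw [← Lp.norm_toLp _ (hmem (y t))]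
      exact h3
    exact (ENNReal.le_ofReal_iff_toReal_le (hmem _).2.ne (by positivity)).2 h7
  exact h6.ae_le (by positivity)

/-- Gronwall's inequality forwards from 0 and, after reversing time, backwards. The bound at time T
serves for all times, so it is uniform up to the ends of the open interval. -/
theorem exists_norm_le_of_norm_deriv_le {F : Type*} [NormedAddCommGroup F] [NormedSpace ℝ F]
    {y y' : ℝ → F} {T K c : ℝ} (hK : 0 ≤ K) (hc : 0 ≤ c)
    (hy : ∀ t ∈ Ioo (-T) T, HasDerivAt y (y' t) t)
    (h : ∀ t ∈ Ioo (-T) T, ‖y' t‖ ≤ K * ‖y t‖ + c) :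
    ∃ M, ∀ t ∈ Ioo (-T) T, ‖y t‖ ≤ M := by
  have hf : ∀ {y y' : ℝ → F}, (∀ t ∈ Ioo (-T) T, HasDerivAt y (y' t) t) →
      (∀ t ∈ Ioo (-T) T, ‖y' t‖ ≤ K * ‖y t‖ + c) →
      ∀ t ∈ Ico 0 T, ‖y t‖ ≤ gronwallBound ‖y 0‖ K c T := by
    intro y y' hy h t ht
    have hsub : ∀ s ∈ Icc 0 t, s ∈ Ioo (-T) T := fun s hs =>
      ⟨by linarith [hs.1, ht.1, ht.2], hs.2.trans_lt ht.2⟩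
    have h1 := norm_le_gronwallBound_of_norm_deriv_right_le (f := y) (f' := y') (a := 0) (b := t)
      (fun s hs => (hy s (hsub s hs)).continuousAt.continuousWithinAt)
      (fun s hs => (hy s (hsub s (Ico_subset_Icc_self hs))).hasDerivWithinAt) le_rfl
      (fun s hs => h s (hsub s (Ico_subset_Icc_self hs))) t ⟨ht.1, le_rfl⟩
    rw [sub_zero] at h1
    exact h1.trans (gronwallBound_mono (norm_nonneg _) hc hK ht.2.le)
  refine ⟨gronwallBound ‖y 0‖ K c T, fun t ht => ?_⟩
  rcases le_total 0 t with h0 | h0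
  · exact hf hy h t ⟨h0, ht.2⟩
  · have hn : ∀ s ∈ Ioo (-T) T, -s ∈ Ioo (-T) T := fun s hs =>
      ⟨by linarith [hs.2], by linarith [hs.1]⟩
    have h1 := hf (y := fun s => y (-s)) (y' := fun s => -y' (-s))
      (fun s hs => by
        have := HasDerivAt.scomp s (hy (-s) (hn s hs)) (hasDerivAt_neg s)
        rw [neg_one_smul] at this
        exact this)
      (fun s hs => by rw [norm_neg]; exact h (-s) (hn s hs)) (-t) ⟨by linarith, by linarith [ht.1]⟩
    simpa using h1

/-- The Lipschitz constant of the force is quadratic in the norm, so it does not exclude growth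
directly. Sup bounds come first, since the force is bounded in L∞; with them the growth in W is
linear. -/
theorem exists_norm_le_of_force (hd : d = 2 ∨ d = 3) (hDb : Bornology.IsBounded D)
    (hD : IsOpen D) {J f : ℝ → ℝ} (hJ : IsInfluenceFunction J) (hf : IsBondFunction f)
    {C₁ C₂ ε : ℝ} (hε : 0 < ε) (hε1 : ε < 1) {ω : E d → ℝ} (hω : IsBoundaryFunction D ε C₁ C₂ ω)
    {T B : ℝ} (hT : 0 < T) {b u v v' : ℝ → W D} (hb : ∀ t ∈ Ioo (-T) T, ‖b t‖ ≤ B)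
    (hu : ∀ t ∈ Ioo (-T) T, HasDerivAt u (v t) t) (hv : ∀ t ∈ Ioo (-T) T, HasDerivAt v (v' t) t)
    (hn : ∀ t ∈ Ioo (-T) T, IsForce ε J f ω (u t) (v' t - b t)) :
    ∃ M, ∀ t ∈ Ioo (-T) T, ‖u t‖ ≤ M ∧ ‖v t‖ ≤ M := by
  have h0 : (0 : ℝ) ∈ Ioo (-T) T := ⟨by linarith, hT⟩
  have hB : 0 ≤ B := (norm_nonneg _).trans (hb 0 h0)
  obtain ⟨A, hA, h1⟩ := exists_force_sup_bound (by omega) hD hJ hf hε hω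
  obtain ⟨C, hC, h2⟩ := W.exists_sup_bound hd hDb hD
  have hv' : ∀ t ∈ Ioo (-T) T, ∀ i, ∀ᵐ x, |comp0 (v' t) i x| ≤ A + C * B := by
    intro t ht i
    have hf' := (ae_restrict_iff' hD.measurableSet).1 (hn t ht)
    filter_upwards [hf', W.c0_sub hD (v' t) (b t) i, h2 (b t) i] with x hx hx1 hx2
    by_cases hxD : x ∈ D
    · have h3 := h1 (u t) x i
      rw [← hx hxD, W.toFun_apply, hx1] at h3
      have h4 : C * ‖b t‖ ≤ C * B := mul_le_mul_of_nonneg_left (hb t ht) hC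
      have h5 := abs_add_le (comp0 (v' t) i x - comp0 (b t) i x) (comp0 (b t) i x)
      rw [sub_add_cancel] at h5
      linarith
    · rw [comp0_eq_zero hxD, abs_zero]
      positivity
  -- First v is bounded from v̇, then u from v.
  have sv := W.sup_bound_of_hasDerivAt hd hDb hD (by positivity)
    (show 0 ≤ C * ‖v 0‖ by positivity) hT hv hv' fun i => h2 _ i
  have su := W.sup_bound_of_hasDerivAt hd hDb hD (by positivity)
    (show 0 ≤ C * ‖u 0‖ by positivity) hT hu sv fun i => h2 _ i
  obtain ⟨G, hG, h3⟩ := exists_force_growth hd hDb hD hJ hf hε hε1 hω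
    (M₀ := C * ‖u 0‖ + (C * ‖v 0‖ + (A + C * B) * T) * T) (by positivity)
  obtain ⟨M, hM⟩ := exists_norm_le_of_norm_deriv_le (y := fun t => (u t, v t))
    (y' := fun t => (v t, v' t)) (T := T) (K := 1 + G) (c := G + B) (by positivity) (by positivity)
    (fun t ht => (hu t ht).prodMk (hv t ht)) fun t ht => by
      have h4 := h3 (su t ht) (hn t ht)
      have h5 := norm_add_le (v' t - b t) (b t)
      rw [sub_add_cancel] at h5
      have h6 := hb t ht
      have h7 := norm_fst_le (u t, v t)
      have h8 := norm_snd_le (u t, v t)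
      have h9 : G * ‖u t‖ ≤ G * ‖(u t, v t)‖ := mul_le_mul_of_nonneg_left h7 hG
      have h10 : 0 ≤ G * ‖(u t, v t)‖ := by positivity
      have h11 := norm_nonneg (u t, v t)
      dsimp only at h7 h8
      rw [Prod.norm_mk (v t)]
      refine max_le ?_ ?_ <;> linarith
  exact ⟨M, fun t ht => ⟨(norm_fst_le (u t, v t)).trans (hM t ht),
    (norm_snd_le (u t, v t)).trans (hM t ht)⟩⟩

end Peridynamics

end

/-! ### Conclusion: regularity of order three and the estimate -/

noncomputable section

open scoped ENNReal NNReal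

namespace Peridynamics

variable {d : ℕ} {D : Set (E d)}

/-! ### Regularity in time -/

theorem contDiffOn_three_of_hasDerivAt {F : Type*} [NormedAddCommGroup F] [NormedSpace ℝ F]
    {u v a j : ℝ → F} {s : Set ℝ} (hs : IsOpen s) (hu : ∀ t ∈ s, HasDerivAt u (v t) t)
    (hv : ∀ t ∈ s, HasDerivAt v (a t) t) (ha : ∀ t ∈ s, HasDerivAt a (j t) t)
    (hj : ContinuousOn j s) :
    ContDiffOn ℝ 3 u s ∧ ∀ t ∈ s, iteratedDeriv 3 u t = j t := by
  have key : ∀ {n : ℕ} {f g : ℝ → F}, (∀ t ∈ s, HasDerivAt f (g t) t) → ContDiffOn ℝ n g s →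
      ContDiffOn ℝ (n + 1 : ℕ) f s := fun {n f g} hf hg => by
    rw [Nat.cast_add, Nat.cast_one, contDiffOn_succ_iff_deriv_of_isOpen hs]
    exact ⟨fun t ht => (hf t ht).differentiableAt.differentiableWithinAt,
      fun h => absurd h (by simp), hg.congr fun t ht => (hf t ht).deriv⟩
  have h0 : ContDiffOn ℝ (0 : ℕ) j s := by simpa using hj
  refine ⟨by exact_mod_cast key hu (key hv (key ha h0)), fun t ht => ?_⟩
  have e1 : ∀ t ∈ s, deriv u =ᶠ[𝓝 t] v := fun t ht => by
    filter_upwards [hs.mem_nhds ht] with r hr using (hu r hr).deriv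
  have e2 : deriv (deriv u) =ᶠ[𝓝 t] a := by
    filter_upwards [hs.mem_nhds ht] with r hr
    rw [(e1 r hr).deriv_eq, (hv r hr).deriv]
  rw [iteratedDeriv_succ, iteratedDeriv_succ, iteratedDeriv_one, e2.deriv_eq, (ha t ht).deriv]

theorem isForce_sub (hD : IsOpen D) {ε : ℝ} {J f : ℝ → ℝ} {ω : E d → ℝ} {w a b : W D}
    (h : ∀ᵐ x ∂(volume.restrict D), W.toFun a x = force ε J f ω (W.toFun w) x + W.toFun b x) :
    IsForce ε J f ω w (a - b) := by
  have h1 := ae_restrict_of_ae (s := D) (ae_all_iff.2 fun i => W.c0_sub hD a b i)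
  filter_upwards [h, h1] with x hx hx1
  ext i
  rw [W.toFun_apply, hx1 i, ← W.toFun_apply, hx, PiLp.add_apply, ← W.toFun_apply,
    add_sub_cancel_right]

end Peridynamics

end

theorem mainTheorem4 (d : ℕ) (hd : d = 2 ∨ d = 3)
    (D : Set (Peridynamics.E d)) (hD : IsOpen D) (hDb : Bornology.IsBounded D)
    (hD1 : Peridynamics.HasC1Boundary D)
    (J f : ℝ → ℝ) (hJ : Peridynamics.IsInfluenceFunction J) (hf : Peridynamics.IsBondFunction f)
    (C₁ C₂ : ℝ) :
    ∃ C : ℝ, 0 < C ∧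
      ∀ ε : ℝ, 0 < ε → ε < 1 →
      ∀ ω : Peridynamics.E d → ℝ, Peridynamics.IsBoundaryFunction D ε C₁ C₂ ω →
      ∀ T : ℝ, 0 < T →
      ∀ (u₀ v₀ : Peridynamics.W D) (b : ℝ → Peridynamics.W D),
        ContinuousOn b (Set.Ioo (-T) T) →
        (∃ B : ℝ, ∀ t ∈ Set.Ioo (-T) T, ‖b t‖ ≤ B) →
        DifferentiableOn ℝ b (Set.Ioo (-T) T) →
        ContinuousOn (deriv b) (Set.Ioo (-T) T) →
        (∃ B : ℝ, ∀ t ∈ Set.Ioo (-T) T, ‖deriv b t‖ ≤ B) →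
      ∀ u v : ℝ → Peridynamics.W D, Peridynamics.IsSolution D ε J f ω T b u₀ v₀ u v →
        ContDiffOn ℝ 3 u (Set.Ioo (-T) T) ∧
        BddAbove (Set.range fun s : Set.Ioo (-T) T => ‖u s‖) ∧
        BddAbove (Set.range fun s : Set.Ioo (-T) T => ‖deriv u s‖) ∧
        ∀ t ∈ Set.Ioo (-T) T,
          ‖iteratedDeriv 3 u t‖ ≤
            C * (1 + (⨆ s : Set.Ioo (-T) T, ‖u s‖) + (⨆ s : Set.Ioo (-T) T, ‖u s‖ ^ 2)) / ε ^ 3 *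
              (⨆ s : Set.Ioo (-T) T, ‖deriv u s‖) + ‖deriv b t‖ := by
  obtain ⟨C, hC, hlip⟩ := Peridynamics.exists_force_lipschitz hd hDb hD hJ hf C₁ C₂
  refine ⟨C + 1, by positivity, ?_⟩
  rintro ε hε hε1 ω hω T hT u₀ v₀ b - ⟨B, hB⟩ hb hb' - u v hsol
  have hS : IsOpen (Ioo (-T) T) := isOpen_Ioo
  have huv : ∀ t ∈ Ioo (-T) T, ContDiffAt ℝ 1 u t ∧ ContDiffAt ℝ 1 v t := fun t ht =>
    have h := hsol.contDiffOn.contDiffAt (hS.mem_nhds ht)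
    ⟨h.fst, h.snd⟩
  have hus : ∀ t ∈ Ioo (-T) T, HasStrictDerivAt u (v t) t := fun t ht => by
    rw [← hsol.deriv_u t ht]
    exact (huv t ht).1.hasStrictDerivAt one_ne_zero
  have hu := fun t ht => (hus t ht).hasDerivAt
  have hv : ∀ t ∈ Ioo (-T) T, HasDerivAt v (deriv v t) t := fun t ht =>
    ((huv t ht).2.differentiableAt one_ne_zero).hasDerivAt
  have hn : ∀ t ∈ Ioo (-T) T, Peridynamics.IsForce ε J f ω (u t) (deriv v t - b t) := fun t ht =>
    Peridynamics.isForce_sub hD (hsol.deriv_v t ht)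
  obtain ⟨M, hM⟩ := Peridynamics.exists_norm_le_of_force hd hDb hD hJ hf hε hε1 hω hT hB hu hv hn
  -- The derivative is made total, with value 0 outside the interval, so that it can be chosen as a
  -- function of time.
  have hn' : ∀ t, ∃ n', t ∈ Ioo (-T) T → HasStrictDerivAt (fun t => deriv v t - b t) n' t := by
    intro t
    by_cases ht : t ∈ Ioo (-T) T
    · obtain ⟨n', h⟩ := Peridynamics.exists_hasStrictDerivAt_force hd hDb hD hJ hf hε hε1 hω
        (hus t ht) (by filter_upwards [hS.mem_nhds ht] with s hs using hn s hs)
      exact ⟨n', fun _ => h⟩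
    · exact ⟨0, fun h => absurd h ht⟩
  choose n' hn' using hn'
  have hbd : ∀ t ∈ Ioo (-T) T, HasDerivAt b (deriv b t) t := fun t ht =>
    ((hb t ht).differentiableAt (hS.mem_nhds ht)).hasDerivAt
  have ha : ∀ t ∈ Ioo (-T) T, HasDerivAt (deriv v) (n' t + deriv b t) t := fun t ht => by
    refine ((hn' t ht).hasDerivAt.add (hbd t ht)).congr_of_eventuallyEq (.of_forall fun s => ?_)
    simp
  -- Strict differentiability at every point makes the derivative of the force continuous.
  have hjc : ContinuousOn (fun t => n' t + deriv b t) (Ioo (-T) T) := by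
    refine ContinuousOn.add (fun t ht => ContinuousAt.continuousWithinAt ?_) hb'
    refine Peridynamics.continuousAt_of_hasStrictDerivAt ?_ (hn' t ht)
    filter_upwards [hS.mem_nhds ht] with s hs using (hn' s hs).hasDerivAt
  obtain ⟨h3, h3'⟩ := Peridynamics.contDiffOn_three_of_hasDerivAt hS hu hv ha hjc
  have b1 : BddAbove (range fun s : Ioo (-T) T => ‖u s‖) :=
    ⟨M, by rintro _ ⟨s, rfl⟩; exact (hM s s.2).1⟩
  have b2 : BddAbove (range fun s : Ioo (-T) T => ‖deriv u s‖) :=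
    ⟨M, by rintro _ ⟨s, rfl⟩; simp only [hsol.deriv_u s s.2]; exact (hM s s.2).2⟩
  have b3 : BddAbove (range fun s : Ioo (-T) T => ‖u s‖ ^ 2) :=
    ⟨M ^ 2, by rintro _ ⟨s, rfl⟩; exact pow_le_pow_left₀ (norm_nonneg _) (hM s s.2).1 2⟩
  refine ⟨h3, b1, b2, fun t ht => ?_⟩
  obtain ⟨m, hm⟩ : ∃ m, m = ⨆ s : Ioo (-T) T, ‖u s‖ := ⟨_, rfl⟩
  obtain ⟨q, hq⟩ : ∃ q, q = ⨆ s : Ioo (-T) T, ‖u s‖ ^ 2 := ⟨_, rfl⟩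
  have hne : Nonempty (Ioo (-T) T) := ⟨⟨t, ht⟩⟩
  have hum : ∀ s ∈ Ioo (-T) T, ‖u s‖ ≤ m := fun s hs => hm ▸ le_ciSup b1 ⟨s, hs⟩
  have huq : ∀ s ∈ Ioo (-T) T, ‖u s‖ ^ 2 ≤ q := fun s hs => hq ▸ le_ciSup b3 ⟨s, hs⟩
  have hm0 : 0 ≤ m := (norm_nonneg _).trans (hum t ht)
  have hq0 : 0 ≤ q := (sq_nonneg _).trans (huq t ht)
  -- The Lipschitz estimate on the ball of radius m = sup ‖u‖ produces m², while the claim contains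
  -- the supremum of the squares.
  have hmq : m ^ 2 ≤ q := by
    have h1 : m ≤ √q := by
      rw [hm]
      exact ciSup_le fun s => Real.le_sqrt_of_sq_le (huq s s.2)
    exact (pow_le_pow_left₀ hm0 h1 2).trans_eq (Real.sq_sqrt hq0)
  have hu' : ‖v t‖ ≤ ⨆ s : Ioo (-T) T, ‖deriv u s‖ := by
    rw [← hsol.deriv_u t ht]
    exact le_ciSup b2 ⟨t, ht⟩
  have hN : ‖n' t‖ ≤ C * (1 + m + m ^ 2) / ε ^ 3 * ‖v t‖ := by
    refine Peridynamics.norm_deriv_le_of_lipschitz (hu t ht) (hn' t ht).hasDerivAt ?_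
    filter_upwards [hS.mem_nhds ht] with s hs
    exact hlip hε hε1 hω (hum s hs) (hum t ht) (hn s hs) (hn t ht)
  rw [h3' t ht, ← hm, ← hq]
  refine (norm_add_le _ _).trans (add_le_add_left (hN.trans ?_) _)
  have hsup : 0 ≤ ⨆ s : Ioo (-T) T, ‖deriv u s‖ := (norm_nonneg _).trans hu'
  gcongr
  linarith
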